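/- Let $\mu>0$, $\lambda+2\mu>0$, $\omega>0$, $k_p=\omega/\sqrt{\lambda+2\mu}$, $k_s=\omega/\sqrt{\mu}$. For $\hat x=(\cos\theta_x,\sin\theta_x)\in\mathbb S$ (the unit circle, with arc length $ds$) put $\hat x^\perp=(-\sin\theta_x,\cos\theta_x)$. For $d\in\mathbb S$, $c_p,c_s\in\mathbb C$ let $$u^i(x;d,c_p,c_s)=c_p\,d\,e^{ik_px\cdot d}+c_s\,d^\perp e^{ik_sx\cdot d},\qquad x\in\mathbb R^2.$$ For $z\in\mathbb R^2$, $R>0$ let $B=B_R(z)$ be the open disk of centre $z$ and radius $R$, and $B_R=B_R(0)$. Let $u^s$ be the field scattered by the rigid body $B$: the solution of $\mu\Delta u^s+(\lambda+\mu)\nabla(\nabla\cdot u^s)+\omega^2u^s=0$ in $\mathbb R^2\setminus\overline B$, smooth there and continuous up to $\partial B$, with $u^i+u^s=0$ on $\partial B$, whose parts $u^s_p=-k_p^{-2}\,\mathrm{grad}\,\mathrm{div}\,u^s$ and $u^s_s=u^s-u^s_p$ satisfy the Kupradze radiation condition $\partial_ru^s_\alpha-ik_\alpha u^s_\alpha=o(r^{-1/2})$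 as $r=|x|\to\infty$, uniformly in all directions, $\alpha=p,s$. Its far-field pattern is $u^\infty_B(\hat x;d,c_p,c_s)=u^\infty_p(\hat x)\hat x+u^\infty_s(\hat x)\hat x^\perp$, where, uniformly in $\hat x$, $$u^s_p=\frac{e^{ik_pr}}{\sqrt r}\{u_p^\infty(\hat x)\hat x+O(1/r)\},\qquad u^s_s=\frac{e^{ik_sr}}{\sqrt r}\{u_s^\infty(\hat x)\hat x^\perp+O(1/r)\}.$$ With $g_p(d)=g(d)\cdot d$ and $g_s(d)=g(d)\cdot d^\perp$, the far-field operator $F_B:(L^2(\mathbb S))^2\to(L^2(\mathbb S))^2$ is $$(F_Bg)(\hat x)=e^{-i\pi/4}\int_{\mathbb S}\Big\{\sqrt{\tfrac{k_p}{\omega}}\,u^\infty_B(\hat x;d,1,0)g_p(d)+\sqrt{\tfrac{k_s}{\omega}}\,u^\infty_B(\hat x;d,0,1)g_s(d)\Big\}ds(d),$$ and $F_B^{(\alpha)}=P_\alpha F_BP_\alpha^*:L^2(\mathbb S)\to L^2(\mathbb S)$ with $P_\alpha g=g_\alpha$, $\alpha=p,s$. Let $J_n,Y_n$ be the Bessel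 functions of the first and second kind, $H_n=J_n+iY_n$, $t_p=k_pR$, $t_s=k_sR$. For $n\in\mathbb Z$ put $$\mathcal J_n=\begin{pmatrix}t_pJ_n'(t_p)&-inJ_n(t_s)\\ inJ_n(t_p)&t_sJ_n'(t_s)\end{pmatrix},\quad \mathcal H_n=\begin{pmatrix}t_pH_n'(t_p)&-inH_n(t_s)\\ inH_n(t_p)&t_sH_n'(t_s)\end{pmatrix},\quad \Sigma_n=\mathcal H_n^{-1}\mathcal J_n .$$ For $n\ne0$ let $\sigma^{(n)}_{1},\sigma^{(n)}_2=\frac12\big(-\beta_n\pm\sqrt{\beta_n^2-4}\big)$, where $$\beta_n=\frac{\pi}{2in}\Big[n^2\big(J_n(t_s)Y_n(t_p)-J_n(t_p)Y_n(t_s)\big)+t_pt_s\big(J_n'(t_p)Y_n'(t_s)-J_n'(t_s)Y_n'(t_p)\big)\Big],$$ and for $n\neq 0$, $j=1,2$, let $$\lambda_{B_R,j}^{(n)}=\sqrt{\tfrac{8\pi}{\omega}}\;i\;\frac{t_pJ_n'(t_p)+inJ_n(t_s)\sigma_j^{(n)}}{t_pH_n'(t_p)+inH_n(t_s)\sigma_j^{(n)}},$$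 where, if the denominator vanishes, the fraction is replaced by $\dfrac{inJ_n(t_p)-t_sJ_n'(t_s)\sigma_j^{(n)}}{inH_n(t_p)-t_sH_n'(t_s)\sigma_j^{(n)}}$. For $n=0$ let $\lambda^{(0)}_{B_R,1}=\sqrt{8\pi/\omega}\,i\,J_0'(t_p)/H_0'(t_p)$ and $\lambda^{(0)}_{B_R,2}=\sqrt{8\pi/\omega}\,i\,J_0'(t_s)/H_0'(t_s)$. Let $$X^{(n)}_{B_R(z),j}(\hat x)=\frac{\sqrt{k_p}\,e^{-ik_pz\cdot\hat x}\,\hat x-\sqrt{k_s}\,\sigma_j^{(n)}e^{-ik_sz\cdot\hat x}\,\hat x^\perp}{\sqrt{1+|\sigma_j^{(n)}|^2}}\,e^{in\theta_x}\quad(n\ne0),$$ $$X^{(0)}_{B_R(z),1}=\sqrt{k_p}\,e^{-ik_pz\cdot\hat x}\,\hat x,\qquad X^{(0)}_{B_R(z),2}=\sqrt{k_s}\,e^{-ik_sz\cdot\hat x}\,\hat x^\perp .$$ Call $(\lambda_i,v_i)_i$ a spectral system of a bounded operator $T$ if the $v_i$ are linearly independent, their span is dense, $Tv_i=\lambda_iv_i$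 for all $i$, and every eigenvalue of $T$ is one of the $\lambda_i$. Then the far-field patterns for $B_R(z)$ exist and are unique, $F_{B_R(z)}$ is a well-defined bounded operator, all the matrices $\mathcal H_n$ are invertible, and: (i) $F_{B_R(z)}$ and $F_{B_R}$ have the same eigenvalues, and $\big(\lambda_{B_R,j}^{(n)},X^{(n)}_{B_R(z),j}\big)$, $n\in\mathbb Z$, $j=1,2$, is a spectral system of $F_{B_R(z)}$. In particular the eigenfunctions for $B_R(z)$ are those for $B_R$ with the phase factors $e^{-ik_pz\cdot\hat x}$ on the $\hat x$-component and $e^{-ik_sz\cdot\hat x}$ on the $\hat x^\perp$-component. (ii) $\big(\sqrt{8\pi/\omega}\;i\,\Sigma_n(1,1),\;e^{in\theta_x}e^{-ik_pz\cdot\hat x}\big)$, $n\in\mathbb Z$, is a spectral system of $F^{(p)}_{B_R(z)}$, and $\big(\sqrt{8\pi/\omega}\;i\,\Sigma_n(2,2),\;e^{in\theta_x}e^{-ik_sz\cdot\hat x}\big)$, $n\in\mathbb Z$, is a spectral system of $F^{(s)}_{B_R(z)}$. -/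

import Mathlib

open scoped Laplacian ContDiff

noncomputable section

namespace ElasticDisk

/-! ### Bessel functions of integer order -/

/-- The Bessel function of the first kind of integer order `n` (Bessel's integral). -/
def besselJ (n : ℤ) (t : ℝ) : ℝ :=
  (1 / Real.pi) * ∫ s in (0 : ℝ)..Real.pi, Real.cos (n * s - t * Real.sin s)

/-- The Bessel (Neumann) function of the second kind of integer order `n`, for `t > 0`
(Schläfli's integral). -/
def besselY (n : ℤ) (t : ℝ) : ℝ :=
  (1 / Real.pi) * (∫ s in (0 : ℝ)..Real.pi, Real.sin (t * Real.sin s - n * s)) -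
    (1 / Real.pi) * ∫ s in Set.Ioi (0 : ℝ),
      (Real.exp (n * s) + (-1) ^ n * Real.exp (-(n * s))) * Real.exp (-(t * Real.sinh s))

/-- `J_n` with complex values. -/
def cJ (n : ℤ) (t : ℝ) : ℂ := (besselJ n t : ℂ)

/-- `Y_n` with complex values. -/
def cY (n : ℤ) (t : ℝ) : ℂ := (besselY n t : ℂ)

/-- The Hankel function of the first kind `H_n^{(1)} = J_n + i Y_n`. -/
def hankel (n : ℤ) (t : ℝ) : ℂ := cJ n t + Complex.I * cY n t

/-! ### The plane, the unit circle, and vector calculus -/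

/-- The Euclidean plane `ℝ²`. -/
abbrev Plane := EuclideanSpace ℝ (Fin 2)

/-- The space `ℂ²` of values of the fields. -/
abbrev Vec := EuclideanSpace ℂ (Fin 2)

instance two_pi_fact : Fact (0 < 2 * Real.pi) := ⟨Real.two_pi_pos⟩

/-- The unit circle `𝕊`, parametrised by the polar angle `θ ∈ ℝ / 2πℤ`; its `volume` is the
arc length `ds`, of total mass `2π`. -/
abbrev S := AddCircle (2 * Real.pi)

/-- `cos θ` for an angle `θ`. -/
def cosA (θ : S) : ℝ := Real.Angle.cos θ

/-- `sin θ` for an angle `θ`. -/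
def sinA (θ : S) : ℝ := Real.Angle.sin θ

/-- The unit vector `x̂ = (cos θ, sin θ)` in the plane. -/
def dir (θ : S) : Plane := WithLp.toLp 2 ![cosA θ, sinA θ]

/-- The unit vector `x̂ = (cos θ, sin θ)` as an element of `ℂ²`. -/
def dirC (θ : S) : Vec := WithLp.toLp 2 ![(cosA θ : ℂ), (sinA θ : ℂ)]

/-- The orthogonal unit vector `x̂^⊥ = (-sin θ, cos θ)` as an element of `ℂ²`. -/
def perpC (θ : S) : Vec := WithLp.toLp 2 ![-(sinA θ : ℂ), (cosA θ : ℂ)]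

/-- The partial derivative `∂_j f`. -/
def pd (j : Fin 2) (f : Plane → ℂ) (x : Plane) : ℂ :=
  fderiv ℝ f x (EuclideanSpace.single j 1)

/-- `grad f = (∂₁ f, ∂₂ f)`. -/
def grad (f : Plane → ℂ) (x : Plane) : Vec := WithLp.toLp 2 ![pd 0 f x, pd 1 f x]

/-- `div u = ∂₁ u₁ + ∂₂ u₂`. -/
def divg (u : Plane → Vec) (x : Plane) : ℂ := pd 0 (fun y => u y 0) x + pd 1 (fun y => u y 1) x

/-- The vector curl of a scalar, `curl f = (-∂₂ f, ∂₁ f)`. -/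
def vcurl (f : Plane → ℂ) (x : Plane) : Vec := WithLp.toLp 2 ![-pd 1 f x, pd 0 f x]

/-- The scalar curl of a vector field, `∂₂ u₁ - ∂₁ u₂`. -/
def scurl (u : Plane → Vec) (x : Plane) : ℂ := pd 1 (fun y => u y 0) x - pd 0 (fun y => u y 1) x

/-! ### Elastic scattering by a rigid body -/

/-- A homogeneous isotropic elastic medium of unit density with Lamé constants `lam`, `mu`,
and an angular frequency `om`. -/
structure Medium where
  lam : ℝ
  mu : ℝ
  om : ℝ
  mu_pos : 0 < mu
  lam_pos : 0 < lam + 2 * mu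
  om_pos : 0 < om

/-- The compressional wave number `k_p = ω / √(λ + 2μ)`. -/
def Medium.kp (M : Medium) : ℝ := M.om / Real.sqrt (M.lam + 2 * M.mu)

/-- The shear wave number `k_s = ω / √μ`. -/
def Medium.ks (M : Medium) : ℝ := M.om / Real.sqrt M.mu

/-- The plane wave `u^i(x; d, c_p, c_s) = c_p d e^{i k_p x·d} + c_s d^⊥ e^{i k_s x·d}`. -/
def planeWave (M : Medium) (d : S) (cp cs : ℂ) (x : Plane) : Vec :=
  (cp * Complex.exp (Complex.I * (M.kp * inner ℝ x (dir d) : ℝ))) • dirC d +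
    (cs * Complex.exp (Complex.I * (M.ks * inner ℝ x (dir d) : ℝ))) • perpC d

/-- The compressional part `u_p = -k_p⁻² grad div u`. -/
def pPart (M : Medium) (u : Plane → Vec) (x : Plane) : Vec :=
  (-(1 / (M.kp : ℂ) ^ 2)) • grad (divg u) x

/-- The shear part `u_s = k_s⁻² curl curl u`. -/
def sPart (M : Medium) (u : Plane → Vec) (x : Plane) : Vec :=
  (1 / (M.ks : ℂ) ^ 2) • vcurl (scurl u) x

/-- `∂_r v - i k v = o(r^{-1/2})` as `r = |x| → ∞`, uniformly in all directions. -/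
def Radiating (k : ℝ) (v : Plane → Vec) : Prop :=
  (fun x : Plane => fderiv ℝ v x (‖x‖⁻¹ • x) - (Complex.I * k) • v x)
    =o[Bornology.cobounded Plane] fun x : Plane => ‖x‖ ^ (-(1 / 2) : ℝ)

/-- `us` is the scattered field produced by the rigid body `D` from the incident wave `ui`: a
classical solution of the Navier equation outside `closure D`, continuous up to the boundary,
which cancels the incident wave on the boundary (`ui + us = 0`) and satisfies the Kupradze radiation
condition. (Solutions of the Navier equation are smooth, so `C^∞` excludes nothing.) -/
structure IsScatteredField (M : Medium) (D : Set Plane) (ui us : Plane → Vec) : Prop where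
  smooth : ContDiffOn ℝ ∞ us (closure D)ᶜ
  cont : ContinuousOn us Dᶜ
  navier : ∀ x ∈ (closure D)ᶜ,
    (M.mu : ℂ) • (Δ us) x + ((M.lam + M.mu : ℝ) : ℂ) • grad (divg us) x
      + (M.om : ℂ) ^ 2 • us x = 0
  rigid : ∀ x ∈ frontier D, ui x + us x = 0
  radiating_p : Radiating M.kp (pPart M us)
  radiating_s : Radiating M.ks (sPart M us)

/-- `v(x) = e^{ikr} r^{-1/2} (a(x̂) e(x̂) + O(1/r))` as `r = |x| → ∞`, uniformly in `x̂`. -/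
def HasFarField (k : ℝ) (e : S → Vec) (v : Plane → Vec) (a : S → ℂ) : Prop :=
  (fun q : ℝ × S => v (q.1 • dir q.2) -
      (Complex.exp (Complex.I * (k * q.1 : ℝ)) / (Real.sqrt q.1 : ℂ) * a q.2) • e q.2)
    =O[Filter.atTop ×ˢ (⊤ : Filter S)] fun q : ℝ × S => q.1 ^ (-(3 / 2) : ℝ)

/-- `a = (u_p^∞, u_s^∞)` is the pair of compressional and shear far-field patterns of a field
scattered by the rigid body `D` from the plane wave `u^i(·; d, c_p, c_s)`. -/
def IsFarFieldPattern (M : Medium) (D : Set Plane) (d : S) (cp cs : ℂ)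
    (a : (S → ℂ) × (S → ℂ)) : Prop :=
  ∃ us : Plane → Vec, IsScatteredField M D (planeWave M d cp cs) us ∧
    HasFarField M.kp dirC (pPart M us) a.1 ∧ HasFarField M.ks perpC (sPart M us) a.2

/-- The pair `(u_p^∞, u_s^∞)` for the rigid body `D` and the plane wave `u^i(·; d, c_p, c_s)`. -/
def farFieldParts (M : Medium) (D : Set Plane) (d : S) (cp cs : ℂ) : (S → ℂ) × (S → ℂ) :=
  Classical.epsilon (IsFarFieldPattern M D d cp cs)

/-- The far-field pattern `u^∞_D(x̂; d, c_p, c_s) = u_p^∞(x̂) x̂ + u_s^∞(x̂) x̂^⊥`. -/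
def farField (M : Medium) (D : Set Plane) (d : S) (cp cs : ℂ) (θ : S) : Vec :=
  (farFieldParts M D d cp cs).1 θ • dirC θ + (farFieldParts M D d cp cs).2 θ • perpC θ

/-! ### Far-field operators -/

/-- `(L²(𝕊))²`. -/
abbrev L2Vec := MeasureTheory.Lp Vec 2 (MeasureTheory.volume : MeasureTheory.Measure S)

/-- `L²(𝕊)`; both `L²_p(𝕊)` and `L²_s(𝕊)` are this space. -/
abbrev L2Scal := MeasureTheory.Lp ℂ 2 (MeasureTheory.volume : MeasureTheory.Measure S)

/-- The bilinear product `v · e` on `ℂ²`. -/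
def dotC (v e : Vec) : ℂ := v 0 * e 0 + v 1 * e 1

/-- The integral
`e^{-iπ/4} ∫ {√(k_p/ω) u^∞_D(x̂; d, 1, 0) g_p(d) + √(k_s/ω) u^∞_D(x̂; d, 0, 1) g_s(d)} ds(d)`,
where `g_p = g · d` and `g_s = g · d^⊥`. -/
def farFieldIntegral (M : Medium) (D : Set Plane) (g : S → Vec) (θ : S) : Vec :=
  Complex.exp (-(Complex.I * Real.pi / 4)) •
    ∫ d : S, (((Real.sqrt (M.kp / M.om) : ℂ) * dotC (g d) (dirC d)) • farField M D d 1 0 θ +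
      ((Real.sqrt (M.ks / M.om) : ℂ) * dotC (g d) (perpC d)) • farField M D d 0 1 θ)

/-- `F` is the bounded operator on `(L²(𝕊))²` given by the far-field integral. -/
def IsFarFieldOperator (M : Medium) (D : Set Plane) (F : L2Vec →L[ℂ] L2Vec) : Prop :=
  ∀ g : L2Vec, F g =ᵐ[MeasureTheory.volume] farFieldIntegral M D g

/-- The far-field operator `F_D : (L²(𝕊))² → (L²(𝕊))²`. -/
def farFieldOperator (M : Medium) (D : Set Plane) : L2Vec →L[ℂ] L2Vec :=
  Classical.epsilon (IsFarFieldOperator M D)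

theorem continuous_cosA : Continuous cosA := Real.Angle.continuous_cos

theorem continuous_sinA : Continuous sinA := Real.Angle.continuous_sin

theorem continuous_dir : Continuous dir := by
  refine (PiLp.continuous_toLp 2 _).comp (continuous_pi fun i => ?_)
  fin_cases i
  · exact continuous_cosA
  · exact continuous_sinA

theorem continuous_dirC : Continuous dirC := by
  refine (PiLp.continuous_toLp 2 _).comp (continuous_pi fun i => ?_)
  fin_cases i
  · exact Complex.continuous_ofReal.comp continuous_cosA
  · exact Complex.continuous_ofReal.comp continuous_sinA

theorem continuous_perpC : Continuous perpC := by
  refine (PiLp.continuous_toLp 2 _).comp (continuous_pi fun i => ?_)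
  fin_cases i
  · exact (Complex.continuous_ofReal.comp continuous_sinA).neg
  · exact Complex.continuous_ofReal.comp continuous_cosA

theorem cosA_sq_add_sinA_sq (θ : S) : cosA θ ^ 2 + sinA θ ^ 2 = 1 :=
  Real.Angle.cos_sq_add_sin_sq θ

theorem norm_dirC (θ : S) : ‖dirC θ‖ = 1 := by
  rw [EuclideanSpace.norm_eq]
  simp [dirC, Fin.sum_univ_two, cosA_sq_add_sinA_sq]

theorem norm_perpC (θ : S) : ‖perpC θ‖ = 1 := by
  rw [EuclideanSpace.norm_eq]
  simp [perpC, Fin.sum_univ_two, add_comm, cosA_sq_add_sinA_sq]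

theorem dotC_eq_inner (v e : Vec) (he : ∀ i, (starRingEnd ℂ) (e i) = e i) :
    dotC v e = inner ℂ e v := by
  simp [dotC, PiLp.inner_apply, Fin.sum_univ_two, he]

theorem norm_dotC_le (v e : Vec) (he : ∀ i, (starRingEnd ℂ) (e i) = e i) (h1 : ‖e‖ = 1) :
    ‖dotC v e‖ ≤ ‖v‖ := by
  rw [dotC_eq_inner v e he]
  simpa [h1] using norm_inner_le_norm (𝕜 := ℂ) e v

theorem memLp_dotC (e : S → Vec) (hc : Continuous e) (he : ∀ θ i, (starRingEnd ℂ) (e θ i) = e θ i)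
    (h1 : ∀ θ, ‖e θ‖ = 1) (g : L2Vec) :
    MeasureTheory.MemLp (fun θ => dotC (g θ) (e θ)) 2 MeasureTheory.volume := by
  refine MeasureTheory.MemLp.of_le (MeasureTheory.Lp.memLp g) ?_
    (Filter.Eventually.of_forall fun θ => norm_dotC_le _ _ (he θ) (h1 θ))
  have h : (fun θ => dotC (g θ) (e θ)) = fun θ => inner ℂ (e θ) (g θ) :=
    funext fun θ => dotC_eq_inner _ _ (he θ)
  rw [h]
  exact hc.aestronglyMeasurable.inner (MeasureTheory.Lp.aestronglyMeasurable g)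

/-- The bounded operator `g ↦ g · e` from `(L²(𝕊))²` to `L²(𝕊)`, for a continuous field `e` of
real unit vectors. -/
def component (e : S → Vec) (hc : Continuous e) (he : ∀ θ i, (starRingEnd ℂ) (e θ i) = e θ i)
    (h1 : ∀ θ, ‖e θ‖ = 1) : L2Vec →L[ℂ] L2Scal :=
  LinearMap.mkContinuous
    { toFun := fun g => (memLp_dotC e hc he h1 g).toLp _
      map_add' := fun f g => by
        rw [← MeasureTheory.MemLp.toLp_add]
        refine MeasureTheory.MemLp.toLp_congr _ _ ?_
        filter_upwards [MeasureTheory.Lp.coeFn_add f g] with θ h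
        simp only [h, Pi.add_apply, dotC, PiLp.add_apply]
        ring
      map_smul' := fun c g => by
        rw [RingHom.id_apply, ← MeasureTheory.MemLp.toLp_const_smul]
        refine MeasureTheory.MemLp.toLp_congr _ _ ?_
        filter_upwards [MeasureTheory.Lp.coeFn_smul c g] with θ h
        simp only [h, Pi.smul_apply, dotC, PiLp.smul_apply, smul_eq_mul]
        ring }
    1 fun g => by
      rw [one_mul]
      refine MeasureTheory.Lp.norm_le_norm_of_ae_le ?_
      filter_upwards [MeasureTheory.MemLp.coeFn_toLp (memLp_dotC e hc he h1 g)] with θ h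
      simp only [LinearMap.coe_mk, AddHom.coe_mk, h]
      exact norm_dotC_le _ _ (he θ) (h1 θ)

/-- The operator `P_p g (d) = g(d) · d`. -/
def projP : L2Vec →L[ℂ] L2Scal :=
  component dirC continuous_dirC (fun θ i => by fin_cases i <;> simp [dirC]) norm_dirC

/-- The operator `P_s g (d) = g(d) · d^⊥`. -/
def projS : L2Vec →L[ℂ] L2Scal :=
  component perpC continuous_perpC (fun θ i => by fin_cases i <;> simp [perpC]) norm_perpC

/-- The P-part `F_D^{(p)} = P_p F_D P_p^*` of the far-field operator. -/
def farFieldOperatorP (M : Medium) (D : Set Plane) : L2Scal →L[ℂ] L2Scal :=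
  projP ∘L farFieldOperator M D ∘L ContinuousLinearMap.adjoint projP

/-- The S-part `F_D^{(s)} = P_s F_D P_s^*` of the far-field operator. -/
def farFieldOperatorS (M : Medium) (D : Set Plane) : L2Scal →L[ℂ] L2Scal :=
  projS ∘L farFieldOperator M D ∘L ContinuousLinearMap.adjoint projS

/-- `(ev i, v i)` is a spectral system of `T`: the `v i` are linearly independent eigenvectors with
eigenvalues `ev i` whose span is dense, and `T` has no other eigenvalues. -/
structure IsSpectralSystem {ι E : Type*} [NormedAddCommGroup E] [NormedSpace ℂ E]
    (T : E →L[ℂ] E) (ev : ι → ℂ) (v : ι → E) : Prop where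
  eigenvector : ∀ i, Module.End.HasEigenvector (T : E →ₗ[ℂ] E) (ev i) (v i)
  independent : LinearIndependent ℂ v
  dense_span : (Submodule.span ℂ (Set.range v)).topologicalClosure = ⊤
  eigenvalue : ∀ c : ℂ, Module.End.HasEigenvalue (T : E →ₗ[ℂ] E) c → ∃ i, ev i = c

/-! ### Spectral data of a disk -/

/-- The matrix `𝓙_n`, `𝓨_n` or `𝓗_n` for `f = J`, `Y` or `H^{(1)}`, with `a = t_p`, `b = t_s`. -/
def cylMatrix (f : ℤ → ℝ → ℂ) (n : ℤ) (a b : ℝ) : Matrix (Fin 2) (Fin 2) ℂ :=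
  !![a * deriv (f n) a, -(Complex.I * n * f n b); Complex.I * n * f n a, b * deriv (f n) b]

/-- `Σ_n = 𝓗_n⁻¹ 𝓙_n`. -/
def sigmaMatrix (n : ℤ) (a b : ℝ) : Matrix (Fin 2) (Fin 2) ℂ :=
  (cylMatrix hankel n a b)⁻¹ * cylMatrix cJ n a b

/-- `β_n = π/(2in) [n² (J_n(b) Y_n(a) - J_n(a) Y_n(b)) + a b (J_n'(a) Y_n'(b) - J_n'(b) Y_n'(a))]`,
for `n ≠ 0`. -/
def betaN (n : ℤ) (a b : ℝ) : ℂ :=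
  Real.pi / (2 * Complex.I * n) *
    ((n : ℂ) ^ 2 * (cJ n b * cY n a - cJ n a * cY n b) +
      a * b * (deriv (cJ n) a * deriv (cY n) b - deriv (cJ n) b * deriv (cY n) a))

/-- `σ_1^{(n)}` (`j = 0`) and `σ_2^{(n)}` (`j = 1`), the roots `(-β_n ± √(β_n² - 4)) / 2`
of `σ² + β_n σ + 1 = 0`, for `n ≠ 0`. -/
def sigmaN (n : ℤ) (j : Fin 2) (a b : ℝ) : ℂ :=
  (-betaN n a b + ![1, -1] j * (betaN n a b ^ 2 - 4) ^ (1 / 2 : ℂ)) / 2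

/-- The eigenvalue `λ_{n,j}` of `Σ_n`. For `n ≠ 0` it is
`(a J_n'(a) + i n J_n(b) σ_j) / (a H_n'(a) + i n H_n(b) σ_j)`; where this quotient is `0 / 0`, it is
the quotient obtained in the same way from the second rows of `𝓙_n` and `𝓗_n`.
For `n = 0` the matrix `Σ_0` is diagonal. -/
def lamN (n : ℤ) (j : Fin 2) (a b : ℝ) : ℂ :=
  if n = 0 then
    ![deriv (cJ 0) a / deriv (hankel 0) a, deriv (cJ 0) b / deriv (hankel 0) b] j
  else if a * deriv (hankel n) a + Complex.I * n * hankel n b * sigmaN n j a b ≠ 0 then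
    (a * deriv (cJ n) a + Complex.I * n * cJ n b * sigmaN n j a b) /
      (a * deriv (hankel n) a + Complex.I * n * hankel n b * sigmaN n j a b)
  else
    (Complex.I * n * cJ n a - b * deriv (cJ n) b * sigmaN n j a b) /
      (Complex.I * n * hankel n a - b * deriv (hankel n) b * sigmaN n j a b)

/-- The eigenvector `(X_{n,j}^{(1)}, X_{n,j}^{(2)})` of `Σ_n`, normalised in `ℂ²`: it is
`(1, -σ_j) / √(1 + |σ_j|²)` for `n ≠ 0`, and `(1, 0)`, `(0, 1)` for `n = 0`. -/
def eigVec (n : ℤ) (j : Fin 2) (a b : ℝ) : Fin 2 → ℂ :=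
  if n = 0 then Pi.single j 1
  else (1 / (Real.sqrt (1 + ‖sigmaN n j a b‖ ^ 2) : ℂ)) • ![1, -sigmaN n j a b]

/-- The eigenvalue `√(8π/ω) i λ_{n,j}` of the far-field operator of a disk of radius `R`. -/
def diskEigenvalue (M : Medium) (R : ℝ) (n : ℤ) (j : Fin 2) : ℂ :=
  (Real.sqrt (8 * Real.pi / M.om) : ℂ) * Complex.I * lamN n j (M.kp * R) (M.ks * R)

/-- The phase factor `e^{-i k z·x̂}`. -/
def phase (k : ℝ) (z : Plane) (θ : S) : ℂ :=
  Complex.exp (-(Complex.I * (k * inner ℝ z (dir θ) : ℝ)))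

/-- The eigenfunction
`(√k_p e^{-i k_p z·x̂} X^{(1)} x̂ + √k_s e^{-i k_s z·x̂} X^{(2)} x̂^⊥) e^{inθ}`
of the far-field operator of the disk of radius `R` centred at `z`. -/
def diskEigenfunction (M : Medium) (R : ℝ) (z : Plane) (n : ℤ) (j : Fin 2) (θ : S) : Vec :=
  fourier n θ •
    ((Real.sqrt M.kp * phase M.kp z θ * eigVec n j (M.kp * R) (M.ks * R) 0) • dirC θ +
      (Real.sqrt M.ks * phase M.ks z θ * eigVec n j (M.kp * R) (M.ks * R) 1) • perpC θ)

theorem continuous_phase (k : ℝ) (z : Plane) : Continuous (phase k z) := by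
  have := continuous_dir
  unfold phase
  fun_prop

theorem continuous_diskEigenfunction (M : Medium) (R : ℝ) (z : Plane) (n : ℤ) (j : Fin 2) :
    Continuous (diskEigenfunction M R z n j) := by
  have h1 := continuous_dirC
  have h2 := continuous_perpC
  have h3 := continuous_phase M.kp z
  have h4 := continuous_phase M.ks z
  unfold diskEigenfunction
  fun_prop

/-- The eigenfunction `diskEigenfunction` as an element of `(L²(𝕊))²`. -/
def diskEigenfunctionL2 (M : Medium) (R : ℝ) (z : Plane) (n : ℤ) (j : Fin 2) : L2Vec :=
  ContinuousMap.toLp 2 MeasureTheory.volume ℂ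
    ⟨diskEigenfunction M R z n j, continuous_diskEigenfunction M R z n j⟩

/-- The function `e^{inθ} e^{-i k z·x̂}` as an element of `L²(𝕊)`. -/
def scalarEigenfunctionL2 (k : ℝ) (z : Plane) (n : ℤ) : L2Scal :=
  ContinuousMap.toLp 2 MeasureTheory.volume ℂ
    ⟨fun θ => fourier n θ * phase k z θ, (map_continuous (fourier n)).mul (continuous_phase k z)⟩

end ElasticDisk

end

/-!
The scattering problem for a disk separates in polar coordinates about its centre `z`, and the
far-field operator becomes a direct sum of `2 × 2` blocks, one for each angular order `n`.

*Cylinder functions.* Schläfli's integrals give the contiguous relations of the Hankel functions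
(`hankel_recurrence`, `hasDerivAt_hankel`). Deforming the contour to the path of steepest descent
(`hankel_zero_eq`) gives their asymptotics at infinity, with bounds that are uniform in the order up
to a factor `C^n n!` (`hankel_bounds`). The asymptotics also give the Wronskian (`im_star_hankel`), by
which the logarithmic derivative of `H_n` has positive imaginary part. A vanishing determinant of
`𝓗_n` would make a product of two such numbers a nonnegative real, which is impossible; hence
`det_cylMatrix_hankel_ne_zero`. In the order, `J_n` decays and `H_n` grows like a factorial, so that
the entries of `Σ_n` decay like `1 / (n!)²` (`fast_sigmaMatrix`).

*Algebra of the blocks.* The numbers `σ_j` are the roots of `σ² + β_n σ + 1`, and this equation says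
that `𝓙_n v` and `𝓗_n v` are parallel for `v = (1, -σ_j)`. So `v` is an eigenvector of `Σ_n`, with the
quotient of `𝓙_n v` and `𝓗_n v` as its eigenvalue (`sigmaMatrix_mulVec_eigVec`). Since `β_n` is purely
imaginary, the roots are distinct and the two eigenvectors are independent (`eigVec_det_ne_zero`).

*Existence.* By the Jacobi–Anger expansion the potentials of a plane wave have explicit Fourier
coefficients on circles about `z`. The potentials of the scattered field are the series
`Σ a_n H_n(k ρ) e^{inθ}` whose coefficients are `-Σ_n` applied to these. Partial derivatives of such a
series are series of the same kind (`hasFDerivAt_waveSum`), and the decay of `Σ_n` makes everything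
converge, which gives the Navier equation, the radiation conditions and the far-field pattern
(`isFarFieldPattern_diskPattern`).

*Uniqueness.* By the Helmholtz decomposition any scattered field has two potentials that solve
Helmholtz equations. Their angular modes about `z` solve the radial Bessel system, so they are
combinations of `H_n` and its conjugate. The radiation condition, stated about the origin, passes to
the modes about `z` after an integration by parts in the angle (`RadiatingScalar.tendsto_mode`) and
excludes the conjugate (`incoming_eq_zero`). The remaining coefficients are determined by the boundary
values, because `𝓗_n` is invertible (`IsScatteredField.exists_mode`, `IsFarFieldPattern.unique`).

*The operator.* Let `D = diag(√k_p, √k_s)`. On the modes `e^{inθ} e^{-ik_p z·x̂} x̂` and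
`e^{inθ} e^{-ik_s z·x̂} x̂^⊥` the far-field operator acts by the block `i √(8π/ω) D Σ_n D⁻¹`
(`farFieldOperator_modeFieldL2`, `two_pi_mul_diskCoef`). The centre `z` enters through the modes only:
the eigenvalues do not depend on it, and the eigenvectors of `Σ_n` give the eigenfunctions, with
the phase factors. The diagonal entries of the block are the eigenvalues of the P-part and the
S-part. Completeness of the trigonometric system and a biorthogonal family turn the eigenfunctions
into a spectral system (`isSpectralSystem_of_biorthogonal`).
-/

namespace ElasticDisk

open MeasureTheory Set Filter Topology

noncomputable section

/-! ### Contiguous relations for the Hankel functions -/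

/-- The exponential part `∫₀^∞ exp (m s - t sinh s) ds` of Schläfli's integral. -/
def expTail (m : ℤ) (t : ℝ) : ℝ := ∫ s in Ioi (0 : ℝ), Real.exp (m * s - t * Real.sinh s)

/-- The oscillating part `∫₀^π exp (i (t sin s - n s)) ds` of Schläfli's integral. -/
def circInt (n : ℤ) (t : ℝ) : ℂ :=
  ∫ s in (0 : ℝ)..Real.pi, Complex.exp (Complex.I * (t * Real.sin s - n * s : ℝ))

theorem sq_div_four_le_sinh {s : ℝ} (hs : 0 ≤ s) : s ^ 2 / 4 ≤ Real.sinh s := by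
  have h1 := Real.quadratic_le_exp_of_nonneg hs
  have h2 : Real.exp (-s) ≤ 1 := Real.exp_le_one_iff.2 (by linarith)
  rw [Real.sinh_eq]
  linarith

/-- Since `t sinh s ≥ t s² / 4`, the factor `exp (-t sinh s)` beats every exponential. This
majorant gives the integrability of all the tails in Schläfli's integral. -/
theorem exp_sub_sinh_le (m : ℝ) {t s : ℝ} (ht : 0 < t) (hs : 0 ≤ s) :
    Real.exp (m * s - t * Real.sinh s) ≤ Real.exp ((m + 1) ^ 2 / t) * Real.exp (-s) := by
  rw [← Real.exp_add]
  apply Real.exp_le_exp.2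
  have h1 := mul_le_mul_of_nonneg_left (sq_div_four_le_sinh hs) ht.le
  have h2 : (m + 1) * s - t * (s ^ 2 / 4) ≤ (m + 1) ^ 2 / t := by
    rw [le_div_iff₀ ht]
    nlinarith [sq_nonneg (m + 1 - t * s / 2)]
  linarith

theorem integrableOn_exp_sub_sinh (m : ℝ) {t : ℝ} (ht : 0 < t) :
    IntegrableOn (fun s => Real.exp (m * s - t * Real.sinh s)) (Ioi 0) := by
  have h := (integrableOn_exp_neg_Ioi 0).const_mul (Real.exp ((m + 1) ^ 2 / t))
  refine Integrable.mono' h (by fun_prop) ?_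
  refine (ae_restrict_mem measurableSet_Ioi).mono fun s hs => ?_
  rw [Real.norm_eq_abs, abs_of_pos (Real.exp_pos _)]
  exact exp_sub_sinh_le m ht (le_of_lt hs)

theorem tendsto_exp_sub_sinh (m : ℝ) {t : ℝ} (ht : 0 < t) :
    Tendsto (fun s => Real.exp (m * s - t * Real.sinh s)) atTop (𝓝 0) := by
  have h : Tendsto (fun s : ℝ => Real.exp ((m + 1) ^ 2 / t) * Real.exp (-s)) atTop (𝓝 0) := by
    simpa using Real.tendsto_exp_neg_atTop_nhds_zero.const_mul (Real.exp ((m + 1) ^ 2 / t))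
  refine squeeze_zero' (Eventually.of_forall fun s => (Real.exp_pos _).le) ?_ h
  filter_upwards [eventually_ge_atTop 0] with s hs using exp_sub_sinh_le m ht hs

theorem sinh_mul_exp (m : ℤ) (t s : ℝ) :
    -Real.sinh s * Real.exp (m * s - t * Real.sinh s) =
      (Real.exp ((m - 1 : ℤ) * s - t * Real.sinh s) -
        Real.exp ((m + 1 : ℤ) * s - t * Real.sinh s)) / 2 := by
  have h1 : ((m - 1 : ℤ) : ℝ) * s - t * Real.sinh s = -s + (m * s - t * Real.sinh s) := by
    push_cast; ring
  have h2 : ((m + 1 : ℤ) : ℝ) * s - t * Real.sinh s = s + (m * s - t * Real.sinh s) := by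
    push_cast; ring
  rw [h1, h2, Real.exp_add, Real.exp_add _ (m * s - t * Real.sinh s), ← sub_mul, Real.sinh_eq]
  ring

theorem hasDerivAt_expTail (m : ℤ) {t : ℝ} (ht : 0 < t) :
    HasDerivAt (expTail m) ((expTail (m - 1) t - expTail (m + 1) t) / 2) t := by
  have key := hasDerivAt_integral_of_dominated_loc_of_deriv_le (𝕜 := ℝ)
    (μ := volume.restrict (Ioi (0 : ℝ))) (s := Ioi (t / 2)) (x₀ := t)
    (F := fun t s => Real.exp (m * s - t * Real.sinh s))
    (F' := fun t s => -Real.sinh s * Real.exp (m * s - t * Real.sinh s))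
    (bound := fun s => (Real.exp ((m - 1 : ℤ) * s - t / 2 * Real.sinh s) +
        Real.exp ((m + 1 : ℤ) * s - t / 2 * Real.sinh s)) / 2)
    (Ioi_mem_nhds (by linarith)) (Eventually.of_forall fun x => by fun_prop)
    (integrableOn_exp_sub_sinh m ht) (by fun_prop) ?_ ?_ ?_
  · refine key.2.congr_deriv ?_
    unfold expTail
    rw [← integral_sub (integrableOn_exp_sub_sinh _ ht) (integrableOn_exp_sub_sinh _ ht),
      ← integral_div]
    exact integral_congr_ae (Eventually.of_forall fun s => sinh_mul_exp m t s)
  · refine (ae_restrict_mem measurableSet_Ioi).mono fun s hs x hx => ?_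
    rw [sinh_mul_exp, Real.norm_eq_abs, abs_div, abs_two]
    have hsh : 0 ≤ Real.sinh s := Real.sinh_nonneg_iff.2 (le_of_lt hs)
    have hx' : t / 2 * Real.sinh s ≤ x * Real.sinh s :=
      mul_le_mul_of_nonneg_right (le_of_lt hx) hsh
    gcongr
    refine (abs_sub _ _).trans ?_
    rw [abs_of_pos (Real.exp_pos _), abs_of_pos (Real.exp_pos _)]
    gcongr
  · exact ((integrableOn_exp_sub_sinh _ (by linarith)).add
      (integrableOn_exp_sub_sinh _ (by linarith))).div_const 2
  · refine Eventually.of_forall fun s x _ => ?_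
    have h1 : HasDerivAt (fun x : ℝ => m * s - x * Real.sinh s) (-Real.sinh s) x := by
      simpa using ((hasDerivAt_id x).mul_const (Real.sinh s)).const_sub ((m : ℝ) * s)
    simpa [mul_comm] using h1.exp

/-- The left-hand side is the integral over `(0, ∞)` of the derivative of `exp (m s - t sinh s)`;
the value `-1` is the boundary term at `s = 0`. -/
theorem expTail_recurrence (m : ℤ) {t : ℝ} (ht : 0 < t) :
    m * expTail m t - t * (expTail (m + 1) t + expTail (m - 1) t) / 2 = -1 := by
  have hd : ∀ s ∈ Ici (0 : ℝ), HasDerivAt (fun s => Real.exp (m * s - t * Real.sinh s))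
      ((m - t * Real.cosh s) * Real.exp (m * s - t * Real.sinh s)) s := by
    intro s _
    have h1 : HasDerivAt (fun s : ℝ => m * s - t * Real.sinh s) (m - t * Real.cosh s) s := by
      simpa using ((hasDerivAt_id s).const_mul (m : ℝ)).fun_sub ((Real.hasDerivAt_sinh s).const_mul t)
    simpa [mul_comm] using h1.exp
  have he : ∀ s : ℝ, (m - t * Real.cosh s) * Real.exp (m * s - t * Real.sinh s) =
      m * Real.exp (m * s - t * Real.sinh s) - t / 2 *
        (Real.exp ((m + 1 : ℤ) * s - t * Real.sinh s) +
        Real.exp ((m - 1 : ℤ) * s - t * Real.sinh s)) := by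
    intro s
    have h1 : ((m - 1 : ℤ) : ℝ) * s - t * Real.sinh s = -s + (m * s - t * Real.sinh s) := by
      push_cast; ring
    have h2 : ((m + 1 : ℤ) : ℝ) * s - t * Real.sinh s = s + (m * s - t * Real.sinh s) := by
      push_cast; ring
    rw [h1, h2, Real.exp_add, Real.exp_add _ (m * s - t * Real.sinh s), Real.cosh_eq]
    ring
  have i0 := integrableOn_exp_sub_sinh m ht
  have i1 := integrableOn_exp_sub_sinh ((m + 1 : ℤ) : ℝ) ht
  have i2 := integrableOn_exp_sub_sinh ((m - 1 : ℤ) : ℝ) ht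
  have i3 : IntegrableOn (fun s => (m - t * Real.cosh s) * Real.exp (m * s - t * Real.sinh s))
      (Ioi 0) := by
    simp_rw [he]
    exact (i0.const_mul _).sub ((i1.add i2).const_mul _)
  have key := integral_Ioi_of_hasDerivAt_of_tendsto' hd i3 (tendsto_exp_sub_sinh m ht)
  simp_rw [he] at key
  have i4 : IntegrableOn (fun s => Real.exp ((m + 1 : ℤ) * s - t * Real.sinh s) +
      Real.exp ((m - 1 : ℤ) * s - t * Real.sinh s)) (Ioi 0) := i1.add i2
  rw [integral_sub (i0.const_mul _) (i4.const_mul _), integral_const_mul,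
    integral_const_mul, integral_add i1 i2] at key
  simp only [mul_zero, Real.sinh_zero, sub_zero, Real.exp_zero, zero_sub] at key
  unfold expTail
  linarith

theorem circInt_shift (n : ℤ) (t s : ℝ) :
    Complex.exp (Complex.I * (t * Real.sin s - (n + 1 : ℤ) * s : ℝ)) =
      (Real.cos s - Complex.I * Real.sin s) *
        Complex.exp (Complex.I * (t * Real.sin s - n * s : ℝ)) ∧
    Complex.exp (Complex.I * (t * Real.sin s - (n - 1 : ℤ) * s : ℝ)) =
      (Real.cos s + Complex.I * Real.sin s) *
        Complex.exp (Complex.I * (t * Real.sin s - n * s : ℝ)) := by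
  have h1 : Complex.exp (-s * Complex.I) = Real.cos s - Complex.I * Real.sin s := by
    rw [Complex.exp_mul_I, Complex.cos_neg, Complex.sin_neg]; push_cast; ring
  have h2 : Complex.exp (s * Complex.I) = Real.cos s + Complex.I * Real.sin s := by
    rw [Complex.exp_mul_I]; push_cast; ring
  rw [← h1, ← h2, ← Complex.exp_add, ← Complex.exp_add]
  constructor <;> (congr 1; push_cast; ring)

theorem intervalIntegrable_circInt (n : ℤ) (t : ℝ) :
    IntervalIntegrable (fun s : ℝ => Complex.exp (Complex.I * (t * Real.sin s - n * s : ℝ)))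
      volume 0 Real.pi :=
  Continuous.intervalIntegrable (by fun_prop) _ _

theorem norm_exp_I_mul (x : ℝ) : ‖Complex.exp (Complex.I * x)‖ = 1 := by
  rw [mul_comm]; exact Complex.norm_exp_ofReal_mul_I x

theorem hasDerivAt_circInt (n : ℤ) (t : ℝ) :
    HasDerivAt (circInt n) ((circInt (n - 1) t - circInt (n + 1) t) / 2) t := by
  have key := intervalIntegral.hasDerivAt_integral_of_dominated_loc_of_deriv_le (𝕜 := ℝ)
    (μ := volume) (a := 0) (b := Real.pi) (s := univ) (x₀ := t)
    (F := fun (t s : ℝ) => Complex.exp (Complex.I * (t * Real.sin s - n * s : ℝ)))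
    (F' := fun (t s : ℝ) => Complex.I * Real.sin s *
      Complex.exp (Complex.I * (t * Real.sin s - n * s : ℝ)))
    (bound := fun s => 1) univ_mem
    (Eventually.of_forall fun x => by fun_prop)
    (intervalIntegrable_circInt n t) (by fun_prop) ?_ (by simp) ?_
  · refine key.2.congr_deriv ?_
    unfold circInt
    rw [← intervalIntegral.integral_sub (intervalIntegrable_circInt _ t)
      (intervalIntegrable_circInt _ t), ← intervalIntegral.integral_div]
    refine intervalIntegral.integral_congr fun s _ => ?_
    simp only [(circInt_shift n t s).1, (circInt_shift n t s).2]
    ring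
  · refine Eventually.of_forall fun s _ x _ => ?_
    rw [norm_mul, norm_exp_I_mul, norm_mul, Complex.norm_I, Complex.norm_real]
    simpa using Real.abs_sin_le_one s
  · refine Eventually.of_forall fun s _ x _ => ?_
    have h1 : HasDerivAt (fun x : ℝ => Complex.I * ((x * Real.sin s - n * s : ℝ) : ℂ))
        (Complex.I * Real.sin s) x := by
      have h0 : HasDerivAt (fun x : ℝ => x * Real.sin s - n * s) (Real.sin s) x := by
        simpa using ((hasDerivAt_id x).mul_const (Real.sin s)).sub_const ((n : ℝ) * s)
      exact h0.ofReal_comp.const_mul _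
    simpa [mul_comm] using h1.cexp

/-- The integrand on the left is the derivative of `-i exp (i (t sin s - n s))`; the right-hand
side is the boundary term. -/
theorem circInt_recurrence (n : ℤ) (t : ℝ) :
    t * (circInt (n + 1) t + circInt (n - 1) t) / 2 - n * circInt n t =
      -Complex.I * ((-1) ^ n - 1) := by
  have hd : ∀ s ∈ uIcc 0 Real.pi,
      HasDerivAt (fun s : ℝ => -Complex.I * Complex.exp (Complex.I * (t * Real.sin s - n * s : ℝ)))
      ((t * Real.cos s - n) * Complex.exp (Complex.I * (t * Real.sin s - n * s : ℝ))) s := by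
    intro s _
    have h0 : HasDerivAt (fun s : ℝ => t * Real.sin s - n * s) (t * Real.cos s - n) s := by
      simpa using ((Real.hasDerivAt_sin s).const_mul t).fun_sub ((hasDerivAt_id s).const_mul (n : ℝ))
    have h1 := ((h0.ofReal_comp.const_mul Complex.I).cexp).const_mul (-Complex.I)
    refine h1.congr_deriv ?_
    push_cast
    linear_combination (-(t * Complex.cos s - n) * Complex.exp (Complex.I *
      (t * Complex.sin s - n * s))) * Complex.I_sq
  have key := intervalIntegral.integral_eq_sub_of_hasDerivAt hd
    (Continuous.intervalIntegrable (by fun_prop) _ _)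
  have he : ∀ s : ℝ, (t * Real.cos s - n) *
      Complex.exp (Complex.I * (t * Real.sin s - n * s : ℝ)) =
      t / 2 * (Complex.exp (Complex.I * (t * Real.sin s - (n + 1 : ℤ) * s : ℝ)) +
        Complex.exp (Complex.I * (t * Real.sin s - (n - 1 : ℤ) * s : ℝ))) -
      n * Complex.exp (Complex.I * (t * Real.sin s - n * s : ℝ)) := by
    intro s
    rw [(circInt_shift n t s).1, (circInt_shift n t s).2]
    ring
  simp_rw [he] at key
  have i0 := intervalIntegrable_circInt n t
  have i1 := intervalIntegrable_circInt (n + 1) t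
  have i2 := intervalIntegrable_circInt (n - 1) t
  rw [intervalIntegral.integral_sub ((i1.add i2).const_mul _) (i0.const_mul _),
    intervalIntegral.integral_const_mul, intervalIntegral.integral_const_mul,
    intervalIntegral.integral_add i1 i2] at key
  have hpi : Complex.exp (Complex.I * ((t * Real.sin Real.pi - n * Real.pi : ℝ) : ℂ)) =
      (-1) ^ n := by
    have : Complex.I * ((t * Real.sin Real.pi - n * Real.pi : ℝ) : ℂ) =
        ((-n : ℤ) : ℂ) * (Real.pi * Complex.I) := by
      rw [Real.sin_pi]; push_cast; ring
    rw [this, Complex.exp_int_mul, Complex.exp_pi_mul_I, zpow_neg, ← inv_zpow]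
    norm_num
  rw [hpi] at key
  simp only [Real.sin_zero, mul_zero, sub_zero, Complex.ofReal_zero, Complex.exp_zero] at key
  unfold circInt
  linear_combination key

/-- Schläfli's integral for the Hankel function. -/
theorem hankel_eq (n : ℤ) {t : ℝ} (ht : 0 < t) :
    hankel n t = (1 / Real.pi : ℂ) * circInt n t -
      (Complex.I / Real.pi) * (expTail n t + (-1) ^ n * expTail (-n) t : ℝ) := by
  have h1 : ∫ s in Ioi (0 : ℝ),
      (Real.exp (n * s) + (-1) ^ n * Real.exp (-(n * s))) * Real.exp (-(t * Real.sinh s)) =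
      expTail n t + (-1) ^ n * expTail (-n) t := by
    unfold expTail
    rw [← integral_const_mul, ← integral_add (integrableOn_exp_sub_sinh _ ht)
      ((integrableOn_exp_sub_sinh _ ht).const_mul _)]
    refine integral_congr_ae (Eventually.of_forall fun s => ?_)
    simp only [sub_eq_add_neg, Real.exp_add]
    push_cast
    ring_nf
  have h2 : circInt n t = ((∫ s in (0 : ℝ)..Real.pi, Real.cos (n * s - t * Real.sin s) : ℝ) : ℂ) +
      Complex.I * (∫ s in (0 : ℝ)..Real.pi, Real.sin (t * Real.sin s - n * s) : ℝ) := by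
    rw [← intervalIntegral.integral_ofReal, ← intervalIntegral.integral_ofReal,
      ← intervalIntegral.integral_const_mul, ← intervalIntegral.integral_add
      (Continuous.intervalIntegrable (by fun_prop) _ _)
      (Continuous.intervalIntegrable (by fun_prop) _ _)]
    refine intervalIntegral.integral_congr fun s _ => ?_
    rw [mul_comm, Complex.exp_mul_I, ← Real.cos_neg (n * s - t * Real.sin s)]
    push_cast
    ring_nf
  unfold hankel cJ cY besselJ besselY
  rw [h1, h2]
  push_cast
  ring

/-- The boundary terms of the two parts of Schläfli's integral cancel. -/
theorem hankel_recurrence (n : ℤ) {t : ℝ} (ht : 0 < t) :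
    t * (hankel (n - 1) t + hankel (n + 1) t) = 2 * n * hankel n t := by
  have h1 := circInt_recurrence n t
  have h2 : ((n * expTail n t - t * (expTail (n + 1) t + expTail (n - 1) t) / 2 : ℝ) : ℂ) = -1 := by
    rw [expTail_recurrence n ht]; norm_num
  have h3 : (((-n : ℤ) * expTail (-n) t -
      t * (expTail (-n + 1) t + expTail (-n - 1) t) / 2 : ℝ) : ℂ) = -1 := by
    rw [expTail_recurrence (-n) ht]; norm_num
  rw [hankel_eq _ ht, hankel_eq _ ht, hankel_eq _ ht]
  have e1 : -(n - 1) = -n + 1 := by ring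
  have e2 : -(n + 1) = -n - 1 := by ring
  have e3 : (-1 : ℝ) ^ (n - 1) = -(-1) ^ n := by
    rw [zpow_sub_one₀ (by norm_num)]; norm_num
  have e4 : (-1 : ℝ) ^ (n + 1) = -(-1) ^ n := by
    rw [zpow_add_one₀ (by norm_num)]; norm_num
  rw [e1, e2, e3, e4]
  push_cast at h1 h2 h3 ⊢
  linear_combination (2 / Real.pi : ℂ) * h1 + (2 * Complex.I / Real.pi) * h2 -
    (2 * Complex.I / Real.pi) * (-1) ^ n * h3

theorem hasDerivAt_hankel (n : ℤ) {t : ℝ} (ht : 0 < t) :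
    HasDerivAt (hankel n) ((hankel (n - 1) t - hankel (n + 1) t) / 2) t := by
  have h1 := (hasDerivAt_circInt n t).const_mul (1 / Real.pi : ℂ)
  have h2 := ((hasDerivAt_expTail n ht).fun_add
    ((hasDerivAt_expTail (-n) ht).const_mul ((-1) ^ n))).ofReal_comp.const_mul
    (Complex.I / Real.pi)
  have h3 := (h1.fun_sub h2).congr_of_eventuallyEq (f₁ := hankel n) (by
    filter_upwards [Ioi_mem_nhds ht] with x hx
    exact hankel_eq n hx)
  refine h3.congr_deriv ?_
  rw [hankel_eq _ ht, hankel_eq _ ht]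
  have e1 : -(n - 1) = -n + 1 := by ring
  have e2 : -(n + 1) = -n - 1 := by ring
  have e3 : (-1 : ℝ) ^ (n - 1) = -(-1) ^ n := by
    rw [zpow_sub_one₀ (by norm_num)]; norm_num
  have e4 : (-1 : ℝ) ^ (n + 1) = -(-1) ^ n := by
    rw [zpow_add_one₀ (by norm_num)]; norm_num
  rw [e1, e2, e3, e4]
  push_cast
  ring

theorem circInt_neg (n : ℤ) (t : ℝ) : circInt (-n) t = (-1) ^ n * circInt n t := by
  unfold circInt
  rw [← intervalIntegral.integral_const_mul]
  have := intervalIntegral.integral_comp_sub_left (a := 0) (b := Real.pi)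
    (fun s : ℝ => Complex.exp (Complex.I * (t * Real.sin s - (-n : ℤ) * s : ℝ))) Real.pi
  rw [sub_self, sub_zero] at this
  rw [← this]
  refine intervalIntegral.integral_congr fun s _ => ?_
  simp only [Real.sin_pi_sub]
  have h : (-1 : ℂ) ^ n = Complex.exp ((n : ℂ) * (Real.pi * Complex.I)) := by
    rw [Complex.exp_int_mul, Complex.exp_pi_mul_I]
  rw [h, ← Complex.exp_add]
  congr 1
  push_cast
  ring

theorem hankel_neg (n : ℤ) {t : ℝ} (ht : 0 < t) : hankel (-n) t = (-1) ^ n * hankel n t := by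
  rw [hankel_eq _ ht, hankel_eq _ ht, circInt_neg, neg_neg]
  have h : (-1 : ℝ) ^ (-n) = (-1) ^ n := by rw [zpow_neg, ← inv_zpow]; norm_num
  have h2 : (-1 : ℂ) ^ n * (-1) ^ n = 1 := by rw [← mul_zpow]; norm_num
  rw [h]
  push_cast
  linear_combination (Complex.I / Real.pi * expTail (-n) t : ℂ) * h2

theorem cJ_eq_re (n : ℤ) (t : ℝ) : cJ n t = ((hankel n t).re : ℂ) := by
  simp [hankel, cJ, cY]

theorem cY_eq_im (n : ℤ) (t : ℝ) : cY n t = ((hankel n t).im : ℂ) := by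
  simp [hankel, cJ, cY]

theorem hasDerivAt_cJ (n : ℤ) {t : ℝ} (ht : 0 < t) :
    HasDerivAt (cJ n) ((cJ (n - 1) t - cJ (n + 1) t) / 2) t := by
  have h := (Complex.reCLM.hasFDerivAt.comp_hasDerivAt t (hasDerivAt_hankel n ht)).ofReal_comp
  rw [show cJ n = fun t => ((hankel n t).re : ℂ) from funext (cJ_eq_re n)]
  refine h.congr_deriv ?_
  rw [cJ_eq_re, cJ_eq_re]
  simp

theorem hasDerivAt_cY (n : ℤ) {t : ℝ} (ht : 0 < t) :
    HasDerivAt (cY n) ((cY (n - 1) t - cY (n + 1) t) / 2) t := by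
  have h := (Complex.imCLM.hasFDerivAt.comp_hasDerivAt t (hasDerivAt_hankel n ht)).ofReal_comp
  rw [show cY n = fun t => ((hankel n t).im : ℂ) from funext (cY_eq_im n)]
  refine h.congr_deriv ?_
  rw [cY_eq_im, cY_eq_im]
  simp

theorem cJ_recurrence (n : ℤ) {t : ℝ} (ht : 0 < t) :
    t * (cJ (n - 1) t + cJ (n + 1) t) = 2 * n * cJ n t := by
  have h := congrArg Complex.re (hankel_recurrence n ht)
  rw [cJ_eq_re, cJ_eq_re, cJ_eq_re]
  rw [show (2 * n : ℂ) = ((2 * n : ℝ) : ℂ) by push_cast; ring, Complex.re_ofReal_mul,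
    Complex.re_ofReal_mul, Complex.add_re] at h
  exact_mod_cast h

theorem cY_recurrence (n : ℤ) {t : ℝ} (ht : 0 < t) :
    t * (cY (n - 1) t + cY (n + 1) t) = 2 * n * cY n t := by
  have h := congrArg Complex.im (hankel_recurrence n ht)
  rw [cY_eq_im, cY_eq_im, cY_eq_im]
  rw [show (2 * n : ℂ) = ((2 * n : ℝ) : ℂ) by push_cast; ring, Complex.im_ofReal_mul,
    Complex.im_ofReal_mul, Complex.add_im] at h
  exact_mod_cast h

theorem cJ_neg (n : ℤ) {t : ℝ} (ht : 0 < t) : cJ (-n) t = (-1) ^ n * cJ n t := by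
  have h := congrArg Complex.re (hankel_neg n ht)
  rw [show (-1 : ℂ) ^ n = (((-1) ^ n : ℝ) : ℂ) by push_cast; rfl, Complex.re_ofReal_mul] at h
  rw [cJ_eq_re, cJ_eq_re, h]
  push_cast
  rfl

/-! ### Behaviour of the Hankel functions at infinity -/

/-- The phase `q = sinh² / cosh` on the path of steepest descent of `exp (i t sin s)` through
`s = π / 2`: there `i sin s = i - q`. -/
def steepPhase (y : ℝ) : ℝ := Real.sinh y ^ 2 / Real.cosh y

/-- The square root `τ` of `steepPhase`, used as a new variable. -/
def steepVar (y : ℝ) : ℝ := Real.sinh y / Real.sqrt (Real.cosh y)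

/-- The derivative of `steepVar`. -/
def steepVarDeriv (y : ℝ) : ℝ :=
  (Real.cosh y ^ 2 + 1) / (2 * (Real.cosh y * Real.sqrt (Real.cosh y)))

theorem steepVar_sq (y : ℝ) : steepVar y ^ 2 = steepPhase y := by
  rw [steepVar, steepPhase, div_pow, Real.sq_sqrt (Real.cosh_pos y).le]

theorem hasDerivAt_steepVar (y : ℝ) : HasDerivAt steepVar (steepVarDeriv y) y := by
  have hc := Real.cosh_pos y
  have hs : 0 < Real.sqrt (Real.cosh y) := Real.sqrt_pos.2 hc
  have h := (Real.hasDerivAt_sinh y).fun_div ((Real.hasDerivAt_cosh y).sqrt hc.ne') hs.ne'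
  refine h.congr_deriv ?_
  unfold steepVarDeriv
  have h2 : Real.sqrt (Real.cosh y) ^ 2 = Real.cosh y := Real.sq_sqrt hc.le
  have h3 := Real.cosh_sq y
  rw [h2]
  field_simp
  rw [h2]
  linear_combination h3

theorem continuous_steepVarDeriv : Continuous steepVarDeriv := by
  unfold steepVarDeriv
  refine Continuous.div (by fun_prop) (by fun_prop) fun y => ?_
  have hc := Real.cosh_pos y
  positivity

theorem continuous_steepPhase : Continuous steepPhase := by
  unfold steepPhase
  exact Continuous.div (by fun_prop) (by fun_prop) fun y => (Real.cosh_pos y).ne'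

theorem sinh_le_steepPhase (y : ℝ) : Real.sinh y ≤ steepPhase y + 1 := by
  have hc := Real.cosh_pos y
  have h1 := Real.one_le_cosh y
  have h3 := Real.cosh_sq y
  have h4 : Real.sinh y ≤ Real.cosh y := (Real.sinh_lt_cosh y).le
  unfold steepPhase
  rw [div_add_one hc.ne', le_div_iff₀ hc]
  nlinarith

theorem steepPhase_nonneg (y : ℝ) : 0 ≤ steepPhase y := by
  have := Real.cosh_pos y
  unfold steepPhase
  positivity

theorem steepVarDeriv_nonneg (y : ℝ) : 0 ≤ steepVarDeriv y := by
  have := Real.cosh_pos y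
  unfold steepVarDeriv
  positivity

theorem steepPhase_le_cosh (y : ℝ) : steepPhase y ≤ Real.cosh y := by
  unfold steepPhase
  rw [div_le_iff₀ (Real.cosh_pos y)]
  nlinarith [Real.cosh_sq y]

theorem steepVarDeriv_le_cosh (y : ℝ) : steepVarDeriv y ≤ Real.cosh y := by
  unfold steepVarDeriv
  have h1 := Real.one_le_cosh y
  have h2 : 1 ≤ Real.sqrt (Real.cosh y) := Real.one_le_sqrt.2 h1
  rw [div_le_iff₀ (by positivity)]
  have h3 : Real.cosh y ^ 2 ≤ Real.cosh y ^ 2 * Real.sqrt (Real.cosh y) :=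
    le_mul_of_one_le_right (by positivity) h2
  nlinarith

theorem cosh_le_exp {y : ℝ} (hy : 0 ≤ y) : Real.cosh y ≤ Real.exp y := by
  rw [Real.cosh_eq]
  have : Real.exp (-y) ≤ Real.exp y := Real.exp_le_exp.2 (by linarith)
  linarith

/-- Comparison of the integrand on the path of steepest descent with the derivative of the new
variable: the error is of second order. -/
theorem abs_sub_steepVarDeriv_le (y : ℝ) :
    |1 / Real.cosh y - steepVarDeriv y| ≤ steepPhase y * steepVarDeriv y ∧
      |1 - steepVarDeriv y| ≤ steepPhase y * steepVarDeriv y ∧ 1 / 2 ≤ steepVarDeriv y := by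
  have h1 := Real.one_le_cosh y
  unfold steepVarDeriv steepPhase
  rw [show Real.sinh y ^ 2 = Real.cosh y ^ 2 - 1 by rw [Real.cosh_sq]; ring]
  obtain ⟨e, he, hd⟩ : ∃ e : ℝ, 0 ≤ e ∧ Real.sqrt (Real.cosh y) = 1 + e :=
    ⟨Real.sqrt (Real.cosh y) - 1, sub_nonneg.2 (Real.one_le_sqrt.2 h1), by ring⟩
  have hc : Real.cosh y = (1 + e) ^ 2 := by
    rw [← hd, Real.sq_sqrt (by linarith)]
  rw [hd, hc]
  have hp : (0 : ℝ) < 1 + e := by linarith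
  have hrhs : (((1 + e) ^ 2) ^ 2 - 1) / (1 + e) ^ 2 *
      ((((1 + e) ^ 2) ^ 2 + 1) / (2 * ((1 + e) ^ 2 * (1 + e)))) =
      ((1 + e) ^ 8 - 1) / (2 * (1 + e) ^ 5) := by
    field_simp
    ring
  rw [hrhs]
  refine ⟨?_, ?_, ?_⟩
  · have : 1 / (1 + e) ^ 2 - (((1 + e) ^ 2) ^ 2 + 1) / (2 * ((1 + e) ^ 2 * (1 + e))) =
        -(((1 + e) ^ 2 * ((1 + e) ^ 4 - 2 * (1 + e) + 1)) / (2 * (1 + e) ^ 5)) := by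
      field_simp
      ring
    rw [this, abs_neg, abs_of_nonneg]
    · gcongr
      rw [← sub_nonneg]
      ring_nf
      positivity
    · apply div_nonneg _ (by positivity)
      apply mul_nonneg (by positivity)
      ring_nf
      positivity
  · have : 1 - (((1 + e) ^ 2) ^ 2 + 1) / (2 * ((1 + e) ^ 2 * (1 + e))) =
        ((1 + e) ^ 2 * (2 * (1 + e) ^ 3 - (1 + e) ^ 4 - 1)) / (2 * (1 + e) ^ 5) := by
      field_simp
      ring
    rw [this, abs_div, abs_of_pos (show 0 < 2 * (1 + e) ^ 5 by positivity)]
    gcongr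
    rw [abs_le]
    constructor
    · rw [neg_le, ← sub_nonneg]
      ring_nf
      positivity
    · rw [← sub_nonneg]
      ring_nf
      positivity
  · rw [div_le_div_iff₀ (by norm_num) (by positivity), ← sub_nonneg]
    ring_nf
    positivity

theorem integrableOn_steep (m : ℤ) {t : ℝ} (ht : 0 < t) {f : ℝ → ℝ} (hf : Continuous f)
    (hb : ∀ y, 0 ≤ y → |f y| ≤ 2 * Real.exp (m * y)) :
    IntegrableOn (fun y => Real.exp (-(t * steepPhase y)) * f y) (Ioi 0) := by
  have h := (integrableOn_exp_sub_sinh m ht).const_mul (2 * Real.exp t)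
  have hq := continuous_steepPhase
  refine Integrable.mono' h (by fun_prop) ?_
  refine (ae_restrict_mem measurableSet_Ioi).mono fun y hy => ?_
  have hy' : (0 : ℝ) ≤ y := le_of_lt hy
  rw [Real.norm_eq_abs, abs_mul, abs_of_pos (Real.exp_pos _)]
  calc Real.exp (-(t * steepPhase y)) * |f y|
      ≤ Real.exp (t + -(t * Real.sinh y)) * (2 * Real.exp (m * y)) := by
        gcongr
        · nlinarith [sinh_le_steepPhase y]
        · exact hb y hy'
    _ = 2 * Real.exp t * Real.exp (m * y - t * Real.sinh y) := by
        rw [sub_eq_add_neg, Real.exp_add, Real.exp_add]; ring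

/-- The substitution `u = steepVar y`, which turns `exp (-t steepPhase y)` into a Gaussian. The
hypothesis `hb` provides the integrability in `y`. -/
theorem integral_steep (g : ℝ → ℝ) (hg : Continuous g) {t : ℝ} (ht : 0 < t) (m : ℤ)
    (hb : ∀ y, 0 ≤ y → |g (steepVar y) * steepVarDeriv y| ≤ 2 * Real.exp (m * y))
    (hi : IntegrableOn (fun u => Real.exp (-(t * u ^ 2)) * g u) (Ioi 0)) :
    ∫ y in Ioi (0 : ℝ), Real.exp (-(t * steepPhase y)) * (g (steepVar y) * steepVarDeriv y) =
      ∫ u in Ioi (0 : ℝ), Real.exp (-(t * u ^ 2)) * g u := by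
  have hc : Continuous steepVar :=
    continuous_iff_continuousAt.2 fun y => (hasDerivAt_steepVar y).continuousAt
  have h0 : steepVar 0 = 0 := by simp [steepVar]
  have hcont : Continuous fun u => Real.exp (-(t * u ^ 2)) * g u := by fun_prop
  have htend : Tendsto steepVar atTop atTop := by
    have h1 : ∀ᶠ y : ℝ in atTop, Real.sqrt (y ^ 2 / 4 - 1) ≤ steepVar y := by
      filter_upwards [eventually_ge_atTop 0] with y hy
      have h2 : 0 ≤ steepVar y := div_nonneg (Real.sinh_nonneg_iff.2 hy) (Real.sqrt_nonneg _)
      rw [← Real.sqrt_sq h2, steepVar_sq]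
      apply Real.sqrt_le_sqrt
      linarith [sinh_le_steepPhase y, sq_div_four_le_sinh hy]
    refine tendsto_atTop_mono' _ h1 ?_
    refine Real.tendsto_sqrt_atTop.comp ?_
    exact tendsto_atTop_add_const_right _ _
      ((tendsto_pow_atTop two_ne_zero).atTop_div_const (by norm_num))
  have hnn : steepVar '' Ici 0 ⊆ Ici 0 := by
    rintro _ ⟨y, hy, rfl⟩
    exact div_nonneg (Real.sinh_nonneg_iff.2 hy) (Real.sqrt_nonneg _)
  have key := integral_comp_mul_deriv_Ioi (f := steepVar) (f' := steepVarDeriv)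
    (g := fun u => Real.exp (-(t * u ^ 2)) * g u) (a := 0) hc.continuousOn htend
    (fun y _ => (hasDerivAt_steepVar y).hasDerivWithinAt) hcont.continuousOn
    (((integrableOn_Ici_iff_integrableOn_Ioi).2 hi).mono_set hnn) ?_
  · rw [h0] at key
    rw [← key]
    refine integral_congr_ae (Eventually.of_forall fun y => ?_)
    simp only [Function.comp_apply, steepVar_sq]
    ring
  · rw [integrableOn_Ici_iff_integrableOn_Ioi]
    have hd := continuous_steepVarDeriv
    refine (integrableOn_steep m ht (f := fun y => g (steepVar y) * steepVarDeriv y)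
      (by fun_prop) hb).congr (Eventually.of_forall fun y => ?_)
    simp only [Function.comp_apply, steepVar_sq]
    ring

theorem abs_steepVarDeriv_le {y : ℝ} (hy : 0 ≤ y) : |steepVarDeriv y| ≤ Real.exp y := by
  rw [abs_of_nonneg (steepVarDeriv_nonneg y)]
  exact (steepVarDeriv_le_cosh y).trans (cosh_le_exp hy)

theorem abs_steepPhase_le {y : ℝ} (hy : 0 ≤ y) : |steepPhase y| ≤ Real.exp y := by
  rw [abs_of_nonneg (steepPhase_nonneg y)]
  exact (steepPhase_le_cosh y).trans (cosh_le_exp hy)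

theorem integral_steepVarDeriv {t : ℝ} (ht : 0 < t) :
    ∫ y in Ioi (0 : ℝ), Real.exp (-(t * steepPhase y)) * steepVarDeriv y =
      Real.sqrt Real.pi / 2 / Real.sqrt t := by
  have h := integral_steep (fun _ => 1) continuous_const ht 1 (fun y hy => by
    rw [one_mul, Int.cast_one, one_mul]
    linarith [abs_steepVarDeriv_le hy, Real.exp_pos y]) (by
    simpa using (integrable_exp_neg_mul_sq ht).integrableOn)
  simp only [one_mul, mul_one] at h
  rw [h]
  have := integral_gaussian_Ioi t
  simp only [neg_mul] at this
  rw [this, Real.sqrt_div Real.pi_pos.le]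
  ring

theorem integral_steepPhase_mul {t : ℝ} (ht : 0 < t) :
    ∫ y in Ioi (0 : ℝ), Real.exp (-(t * steepPhase y)) * (steepPhase y * steepVarDeriv y) ≤
      t ^ (-(3 / 2) : ℝ) := by
  have hi : IntegrableOn (fun u : ℝ => Real.exp (-(t * u ^ 2)) * u ^ 2) (Ioi 0) := by
    have := integrable_rpow_mul_exp_neg_mul_sq ht (s := 2) (by norm_num)
    refine (this.congr (Eventually.of_forall fun u => ?_)).integrableOn
    simp [mul_comm]
  have h := integral_steep (fun u => u ^ 2) (by fun_prop) ht 2 (fun y hy => by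
    rw [steepVar_sq, abs_mul]
    have h1 := mul_le_mul (abs_steepPhase_le hy) (abs_steepVarDeriv_le hy) (abs_nonneg _)
      (Real.exp_pos y).le
    rw [← Real.exp_add] at h1
    rw [show ((2 : ℤ) : ℝ) * y = y + y by push_cast; ring]
    linarith [Real.exp_pos (y + y)]) hi
  simp only [steepVar_sq] at h
  rw [h]
  have h2 := integral_rpow_mul_exp_neg_mul_rpow (p := 2) (q := 2) (b := t) (by norm_num)
    (by norm_num) ht
  have h3 : ∫ u in Ioi (0 : ℝ), Real.exp (-(t * u ^ 2)) * u ^ 2 =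
      ∫ x in Ioi (0 : ℝ), x ^ (2 : ℝ) * Real.exp (-t * x ^ (2 : ℝ)) := by
    refine integral_congr_ae (Eventually.of_forall fun u => ?_)
    simp [mul_comm]
  rw [h3, h2]
  have h4 : Real.Gamma ((2 + 1) / 2) = Real.sqrt Real.pi / 2 := by
    rw [show ((2 : ℝ) + 1) / 2 = 1 / 2 + 1 by norm_num, Real.Gamma_add_one (by norm_num),
      Real.Gamma_one_half_eq]
    ring
  have h5 : Real.sqrt Real.pi ≤ 2 := by
    rw [Real.sqrt_le_left (by norm_num)]
    linarith [Real.pi_le_four]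
  rw [h4, show (-((2 : ℝ) + 1) / 2) = -(3 / 2) by norm_num]
  have h6 : 0 ≤ t ^ (-(3 / 2) : ℝ) := by positivity
  nlinarith

/-- The Laplace integral for `H_0` along the path of steepest descent. -/
def steepInt (t : ℝ) : ℂ :=
  ∫ y in Ioi (0 : ℝ), (Real.exp (-(t * steepPhase y)) : ℂ) * (1 / Real.cosh y - Complex.I)

/-- The path of steepest descent of `exp (i t sin s)` from `π / 2` to `i ∞`. -/
def steepPath (y : ℝ) : ℂ := ((Real.pi / 2 - Real.arctan (Real.sinh y) : ℝ) : ℂ) + Complex.I * y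

theorem sin_steepPath (y : ℝ) : Complex.I * Complex.sin (steepPath y) = Complex.I - steepPhase y := by
  have hc := Real.cosh_pos y
  have hs : Real.sqrt (1 + Real.sinh y ^ 2) = Real.cosh y := by
    rw [add_comm, ← Real.cosh_sq, Real.sqrt_sq hc.le]
  have h1 : Real.sin (Real.pi / 2 - Real.arctan (Real.sinh y)) = 1 / Real.cosh y := by
    rw [Real.sin_pi_div_two_sub, Real.cos_arctan, hs]
  have h2 : Real.cos (Real.pi / 2 - Real.arctan (Real.sinh y)) = Real.sinh y / Real.cosh y := by
    rw [Real.cos_pi_div_two_sub, Real.sin_arctan, hs]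
  have hc' : (Real.cosh y : ℂ) ≠ 0 := by exact_mod_cast hc.ne'
  unfold steepPath
  rw [mul_comm Complex.I (y : ℂ), Complex.sin_add_mul_I, ← Complex.ofReal_sin,
    ← Complex.ofReal_cos, ← Complex.ofReal_cosh, ← Complex.ofReal_sinh, h1, h2, steepPhase]
  push_cast
  push_cast at hc'
  field_simp
  linear_combination (Complex.sinh y ^ 2) * Complex.I_sq

theorem hasDerivAt_steepPath (y : ℝ) :
    HasDerivAt steepPath (-(1 / Real.cosh y - Complex.I)) y := by
  have h1 : HasDerivAt (fun y => Real.pi / 2 - Real.arctan (Real.sinh y))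
      (-(1 / Real.cosh y)) y := by
    have := ((Real.hasDerivAt_sinh y).arctan).const_sub (Real.pi / 2)
    refine this.congr_deriv ?_
    have hc := Real.cosh_pos y
    rw [add_comm, ← Real.cosh_sq]
    field_simp
  have h2 : HasDerivAt (fun y : ℝ => Complex.I * (y : ℂ)) Complex.I y := by
    simpa using (hasDerivAt_id y).ofReal_comp.const_mul Complex.I
  refine (h1.ofReal_comp.fun_add h2).congr_deriv ?_
  push_cast
  ring

theorem integrableOn_steepInt {t : ℝ} (ht : 0 < t) :
    IntegrableOn (fun y => (Real.exp (-(t * steepPhase y)) : ℂ) * (1 / Real.cosh y - Complex.I))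
      (Ioi 0) := by
  have h1 := (integrableOn_steep 0 ht (f := fun _ => 1) continuous_const (by norm_num)).ofReal (𝕜 := ℂ)
  have h2 := (integrableOn_steep 0 ht (f := fun y => 1 / Real.cosh y)
    (continuous_const.div Real.continuous_cosh fun y => (Real.cosh_pos y).ne') (fun y _ => by
      have := Real.one_le_cosh y
      rw [abs_of_pos (by positivity), div_le_iff₀ (by positivity)]
      norm_num
      linarith)).ofReal (𝕜 := ℂ)
  refine (h2.sub (h1.const_mul Complex.I)).congr (Eventually.of_forall fun y => ?_)
  simp
  ring

/-- Deformation of the contour in Schläfli's integral for `H_0` to the path of steepest descent. -/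
theorem hankel_zero_eq {t : ℝ} (ht : 0 < t) :
    hankel 0 t = 2 / Real.pi * (Complex.exp (Complex.I * t) * steepInt t) := by
  obtain ⟨F, hF⟩ : ∃ F : ℂ → ℂ, ∀ z, HasDerivAt F (Complex.exp (Complex.I * (t * Complex.sin z))) z := by
    have hd : Differentiable ℂ fun z : ℂ => Complex.exp (Complex.I * (t * Complex.sin z)) := by
      fun_prop
    obtain ⟨F, hF⟩ := hd.isExactOn_univ
    exact ⟨F, fun z => hF z (mem_univ z)⟩
  -- `F` is a primitive of `exp (i t sin z)`: first the segment from `0` to `π`, folded at `π /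
  -- 2`, then the segment from `0` to `i Y`, and the path of steepest descent from `π / 2`
  have hside1 : circInt 0 t = 2 * (F (Real.pi / 2) - F 0) := by
    have hd : ∀ s ∈ uIcc 0 Real.pi, HasDerivAt (fun s : ℝ => F s)
        (Complex.exp (Complex.I * (t * Real.sin s - (0 : ℤ) * s : ℝ))) s := by
      intro s _
      refine ((hF s).comp_ofReal).congr_deriv ?_
      push_cast
      simp
    have h1 := intervalIntegral.integral_eq_sub_of_hasDerivAt hd
      (intervalIntegrable_circInt 0 t)
    have h2 : ∀ z, HasDerivAt (fun z => F z + F (Real.pi - z)) 0 z := by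
      intro z
      have h3 : HasDerivAt (fun z : ℂ => Real.pi - z) (-1) z := (hasDerivAt_id z).const_sub _
      refine ((hF z).fun_add ((hF _).comp z h3)).congr_deriv ?_
      rw [Complex.sin_pi_sub]
      ring
    have h4 := is_const_of_deriv_eq_zero (fun z => (h2 z).differentiableAt)
      (fun z => (h2 z).deriv) (Real.pi : ℂ) (Real.pi / 2)
    rw [sub_self, show (Real.pi : ℂ) - Real.pi / 2 = Real.pi / 2 by ring] at h4
    unfold circInt
    rw [h1, Complex.ofReal_zero]
    linear_combination h4
  have hside2 : ∀ Y : ℝ, ∫ s in (0 : ℝ)..Y, (Real.exp ((0 : ℤ) * s - t * Real.sinh s) : ℂ) =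
      -Complex.I * (F (Complex.I * Y) - F 0) := by
    intro Y
    have hd : ∀ s ∈ uIcc 0 Y, HasDerivAt (fun s : ℝ => -Complex.I * F (Complex.I * s))
        (Real.exp ((0 : ℤ) * s - t * Real.sinh s) : ℂ) s := by
      intro s _
      have h2 : HasDerivAt (fun y : ℝ => Complex.I * (y : ℂ)) Complex.I s := by
        simpa using (hasDerivAt_id s).ofReal_comp.const_mul Complex.I
      refine (((hF _).comp s h2).const_mul (-Complex.I)).congr_deriv ?_
      rw [mul_comm Complex.I (s : ℂ), Complex.sin_mul_I]
      have : Complex.I * (t * (Complex.sinh s * Complex.I)) =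
        ((-(t * Real.sinh s) : ℝ) : ℂ) := by
        push_cast; linear_combination (t * Complex.sinh s) * Complex.I_sq
      rw [this, ← Complex.ofReal_exp]
      simp only [Int.cast_zero, zero_mul, zero_sub]
      linear_combination (-(Real.exp (-(t * Real.sinh s)) : ℂ)) * Complex.I_sq
    rw [intervalIntegral.integral_eq_sub_of_hasDerivAt hd
      (Continuous.intervalIntegrable (by fun_prop) _ _)]
    simp
    ring
  have hside3 : ∀ Y : ℝ, Complex.exp (Complex.I * t) * ∫ y in (0 : ℝ)..Y,
      (Real.exp (-(t * steepPhase y)) : ℂ) * (1 / Real.cosh y - Complex.I) =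
      F (Real.pi / 2) - F (steepPath Y) := by
    intro Y
    have hq := continuous_steepPhase
    have hcosh : ∀ y : ℝ, (Real.cosh y : ℂ) ≠ 0 := fun y => by
      exact_mod_cast (Real.cosh_pos y).ne'
    have hd : ∀ y ∈ uIcc 0 Y, HasDerivAt (fun y : ℝ => -F (steepPath y))
        (Complex.exp (Complex.I * t) *
          ((Real.exp (-(t * steepPhase y)) : ℂ) * (1 / Real.cosh y - Complex.I))) y := by
      intro y _
      refine ((hF _).comp y (hasDerivAt_steepPath y)).fun_neg.congr_deriv ?_
      rw [mul_left_comm, sin_steepPath, mul_sub, Complex.exp_sub, Complex.ofReal_exp,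
        Complex.ofReal_neg, Complex.exp_neg]
      push_cast
      ring_nf
    rw [← intervalIntegral.integral_const_mul, intervalIntegral.integral_eq_sub_of_hasDerivAt hd
      (Continuous.intervalIntegrable (by fun_prop (disch := exact hcosh _)) _ _)]
    simp [steepPath, neg_add_eq_sub]
  -- the gap between the two upper end points closes, since `exp (i t sin z)` is bounded by `1` in
  -- the half strip `0 ≤ Re z ≤ π / 2`, `0 ≤ Im z`
  have hside4 : Tendsto (fun Y : ℝ => F (steepPath Y) - F (Complex.I * Y)) atTop (𝓝 0) := by
    have hb : ∀ Y : ℝ, 0 ≤ Y → ‖F (steepPath Y) - F (Complex.I * Y)‖ ≤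
        Real.pi / 2 - Real.arctan (Real.sinh Y) := by
      intro Y hY
      have hconv : Convex ℝ (Icc 0 (Real.pi / 2) ×ℂ Ici 0) :=
        Convex.inter (Convex.linear_preimage (convex_Icc (0 : ℝ) (Real.pi / 2)) Complex.reLm)
          (Convex.linear_preimage (convex_Ici (0 : ℝ)) Complex.imLm)
      have hbd : ∀ z ∈ Icc 0 (Real.pi / 2) ×ℂ Ici 0,
          ‖Complex.exp (Complex.I * (t * Complex.sin z))‖ ≤ 1 := by
        intro z hz
        rw [Complex.mem_reProdIm] at hz
        rw [Complex.norm_exp, Real.exp_le_one_iff, Complex.I_mul_re, Complex.im_ofReal_mul]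
        have hsin : (Complex.sin z).im = Real.cos z.re * Real.sinh z.im := by
          conv_lhs => rw [← Complex.re_add_im z]
          rw [Complex.sin_add_mul_I, ← Complex.ofReal_sin,
            ← Complex.ofReal_cos, ← Complex.ofReal_cosh, ← Complex.ofReal_sinh]
          simp [-Complex.ofReal_cos, -Complex.ofReal_sinh, -Complex.ofReal_sin,
            -Complex.ofReal_cosh]
        rw [hsin]
        have h1 : 0 ≤ Real.cos z.re := Real.cos_nonneg_of_mem_Icc
          ⟨by linarith [hz.1.1, Real.pi_pos], hz.1.2⟩
        have h2 : 0 ≤ Real.sinh z.im := Real.sinh_nonneg_iff.2 hz.2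
        have := mul_nonneg ht.le (mul_nonneg h1 h2)
        linarith
      have ha1 : 0 ≤ Real.arctan (Real.sinh Y) :=
        Real.arctan_nonneg.2 (Real.sinh_nonneg_iff.2 hY)
      have ha2 := Real.arctan_lt_pi_div_two (Real.sinh Y)
      have key := hconv.norm_image_sub_le_of_norm_hasDerivWithin_le (f := F)
        (x := Complex.I * Y) (y := steepPath Y)
        (fun z _ => (hF z).hasDerivWithinAt) hbd
        (by rw [Complex.mem_reProdIm]; simp [hY]; positivity)
        (by rw [Complex.mem_reProdIm]; simp [steepPath, hY, ha1, ha2.le,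
              -Complex.ofReal_arctan, -Complex.ofReal_sub])
      refine key.trans (le_of_eq ?_)
      rw [one_mul, steepPath, add_sub_cancel_right, Complex.norm_real, Real.norm_eq_abs,
        abs_of_pos (by linarith)]
    have hlim : Tendsto (fun Y => Real.pi / 2 - Real.arctan (Real.sinh Y)) atTop (𝓝 0) := by
      have hs : Tendsto Real.sinh atTop atTop := by
        have h1 : Tendsto (fun y : ℝ => y ^ 2 / 4) atTop atTop :=
          (tendsto_pow_atTop two_ne_zero).atTop_div_const (by norm_num)
        refine tendsto_atTop_mono' _ ?_ h1
        filter_upwards [eventually_ge_atTop 0] with y hy using sq_div_four_le_sinh hy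
      have := (tendsto_nhds_of_tendsto_nhdsWithin Real.tendsto_arctan_atTop).comp hs
      simpa using this.const_sub (Real.pi / 2)
    refine squeeze_zero_norm' ?_ hlim
    filter_upwards [eventually_ge_atTop 0] with Y hY using hb Y hY
  have hE : IntegrableOn (fun s => (Real.exp ((0 : ℤ) * s - t * Real.sinh s) : ℂ)) (Ioi 0) :=
    Integrable.ofReal (integrableOn_exp_sub_sinh ((0 : ℤ) : ℝ) ht)
  have hA := intervalIntegral_tendsto_integral_Ioi 0 hE tendsto_id
  have hB := intervalIntegral_tendsto_integral_Ioi 0 (integrableOn_steepInt ht) tendsto_id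
  simp only [id_eq] at hA hB
  simp_rw [hside2] at hA
  have hE' : ∫ s in Ioi (0 : ℝ), (Real.exp ((0 : ℤ) * s - t * Real.sinh s) : ℂ) = expTail 0 t :=
    integral_ofReal
  rw [hE'] at hA
  have hB' := hB.const_mul (Complex.exp (Complex.I * t))
  simp_rw [hside3] at hB'
  have hC := ((hA.const_mul Complex.I).add hB').add hside4
  have hconst : (fun Y : ℝ => Complex.I * (-Complex.I * (F (Complex.I * Y) - F 0)) +
      (F (Real.pi / 2) - F (steepPath Y)) + (F (steepPath Y) - F (Complex.I * Y))) =
      fun _ => F (Real.pi / 2) - F 0 := by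
    funext Y
    linear_combination (-(F (Complex.I * Y) - F 0)) * Complex.I_sq
  rw [hconst] at hC
  have hfin := tendsto_nhds_unique hC tendsto_const_nhds
  rw [hankel_eq 0 ht, hside1]
  unfold steepInt
  simp only [neg_zero, zpow_zero, one_mul, Complex.ofReal_add]
  linear_combination (-2 / Real.pi : ℂ) * hfin

theorem norm_inv_cosh_sub_I_le (y : ℝ) : ‖(1 / Real.cosh y - Complex.I : ℂ)‖ ≤ 2 := by
  have h := Real.one_le_cosh y
  refine (norm_sub_le _ _).trans ?_
  rw [Complex.norm_I, ← Complex.ofReal_one, ← Complex.ofReal_div, Complex.norm_real,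
    Real.norm_eq_abs, abs_of_pos (by positivity)]
  have : 1 / Real.cosh y ≤ 1 := by rw [div_le_iff₀ (by positivity)]; linarith
  linarith

theorem integrableOn_steepPhase_mul {t : ℝ} (ht : 0 < t) :
    IntegrableOn (fun y => Real.exp (-(t * steepPhase y)) * (steepPhase y * steepVarDeriv y))
      (Ioi 0) := by
  have h1 := continuous_steepPhase
  have h2 := continuous_steepVarDeriv
  refine integrableOn_steep 2 ht (by fun_prop) fun y hy => ?_
  rw [abs_mul]
  have h1 := mul_le_mul (abs_steepPhase_le hy) (abs_steepVarDeriv_le hy) (abs_nonneg _)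
    (Real.exp_pos y).le
  rw [← Real.exp_add] at h1
  rw [show ((2 : ℤ) : ℝ) * y = y + y by push_cast; ring]
  linarith [Real.exp_pos (y + y)]

/-- Watson's lemma with an explicit error. The amplitude of `steepInt` and `(1 - i) steepVarDeriv`
differ by at most a multiple of `steepPhase * steepVarDeriv`, whose integral gains a factor `1 /
t`. -/
theorem norm_steepInt_sub_le {t : ℝ} (ht : 0 < t) :
    ‖steepInt t - (1 - Complex.I) * (Real.sqrt Real.pi / 2 / Real.sqrt t : ℝ)‖ ≤
      2 * t ^ (-(3 / 2) : ℝ) := by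
  have hd : IntegrableOn (fun y => Real.exp (-(t * steepPhase y)) * steepVarDeriv y) (Ioi 0) :=
    integrableOn_steep 1 ht continuous_steepVarDeriv fun y hy => by
      rw [Int.cast_one, one_mul]
      linarith [abs_steepVarDeriv_le hy, Real.exp_pos y]
  have hd' : IntegrableOn (fun y => (1 - Complex.I) *
      ((Real.exp (-(t * steepPhase y)) * steepVarDeriv y : ℝ) : ℂ)) (Ioi 0) :=
    (Integrable.ofReal hd).const_mul _
  have h1 : (1 - Complex.I) * ((Real.sqrt Real.pi / 2 / Real.sqrt t : ℝ) : ℂ) =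
      ∫ y in Ioi (0 : ℝ), (1 - Complex.I) *
        ((Real.exp (-(t * steepPhase y)) * steepVarDeriv y : ℝ) : ℂ) := by
    rw [integral_const_mul, ← integral_steepVarDeriv ht]
    congr 1
    exact integral_ofReal.symm
  rw [h1, steepInt, ← integral_sub (integrableOn_steepInt ht) hd']
  refine (norm_integral_le_of_norm_le ((integrableOn_steepPhase_mul ht).const_mul 2)
    (Eventually.of_forall fun y => ?_)).trans ?_
  · obtain ⟨ha, hb, -⟩ := abs_sub_steepVarDeriv_le y
    have he : (Real.exp (-(t * steepPhase y)) : ℂ) * (1 / Real.cosh y - Complex.I) -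
        (1 - Complex.I) * ((Real.exp (-(t * steepPhase y)) * steepVarDeriv y : ℝ) : ℂ) =
        (Real.exp (-(t * steepPhase y)) : ℂ) * (((1 / Real.cosh y - steepVarDeriv y : ℝ) : ℂ) -
          Complex.I * ((1 - steepVarDeriv y : ℝ) : ℂ)) := by
      push_cast
      ring
    rw [he, norm_mul, Complex.norm_real, Real.norm_eq_abs, abs_of_pos (Real.exp_pos _),
      mul_left_comm 2]
    gcongr
    refine (norm_sub_le _ _).trans ?_
    rw [norm_mul, Complex.norm_I, one_mul, Complex.norm_real, Complex.norm_real]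
    simp only [Real.norm_eq_abs]
    linarith
  · rw [integral_const_mul]
    linarith [integral_steepPhase_mul ht]

theorem hasDerivAt_steepInt {t : ℝ} (ht : 0 < t) :
    ∃ D : ℂ, HasDerivAt steepInt D t ∧ ‖D‖ ≤ 4 * t ^ (-(3 / 2) : ℝ) := by
  have hq := continuous_steepPhase
  have hcosh : ∀ y : ℝ, (Real.cosh y : ℂ) ≠ 0 := fun y => by
    exact_mod_cast (Real.cosh_pos y).ne'
  have hbase : ∀ x y : ℝ, ‖-(steepPhase y : ℂ) * ((Real.exp (-(x * steepPhase y)) : ℂ) *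
      (1 / Real.cosh y - Complex.I))‖ ≤
      4 * (Real.exp (-(x * steepPhase y)) * (steepPhase y * steepVarDeriv y)) := by
    intro x y
    rw [norm_mul, norm_mul, norm_neg, Complex.norm_real, Complex.norm_real, Real.norm_eq_abs,
      Real.norm_eq_abs, abs_of_pos (Real.exp_pos _), abs_of_nonneg (steepPhase_nonneg y)]
    have h1 := norm_inv_cosh_sub_I_le y
    have h2 := (abs_sub_steepVarDeriv_le y).2.2
    have h3 : ‖(1 / Real.cosh y - Complex.I : ℂ)‖ ≤ 4 * steepVarDeriv y := by linarith
    have h4 : 0 ≤ steepPhase y * Real.exp (-(x * steepPhase y)) :=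
      mul_nonneg (steepPhase_nonneg y) (Real.exp_pos _).le
    have := mul_le_mul_of_nonneg_left h3 h4
    linarith
  have key := hasDerivAt_integral_of_dominated_loc_of_deriv_le (𝕜 := ℝ)
    (μ := volume.restrict (Ioi (0 : ℝ))) (s := Ioi (t / 2)) (x₀ := t)
    (F := fun t y => (Real.exp (-(t * steepPhase y)) : ℂ) * (1 / Real.cosh y - Complex.I))
    (F' := fun t y => -(steepPhase y : ℂ) * ((Real.exp (-(t * steepPhase y)) : ℂ) *
      (1 / Real.cosh y - Complex.I)))
    (bound := fun y => 4 * (Real.exp (-(t / 2 * steepPhase y)) *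
      (steepPhase y * steepVarDeriv y)))
    (Ioi_mem_nhds (by linarith))
    (Eventually.of_forall fun x => (Continuous.aestronglyMeasurable
      (by fun_prop (disch := exact hcosh _))))
    (integrableOn_steepInt ht) (Continuous.aestronglyMeasurable
      (by fun_prop (disch := exact hcosh _))) ?_ ?_ ?_
  · refine ⟨_, key.2, ?_⟩
    refine (norm_integral_le_of_norm_le ((integrableOn_steepPhase_mul ht).const_mul 4)
      (Eventually.of_forall fun y => hbase t y)).trans ?_
    rw [integral_const_mul]
    linarith [integral_steepPhase_mul ht]
  · refine Eventually.of_forall fun y x hx => (hbase x y).trans ?_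
    have h1 := steepPhase_nonneg y
    have h2 := steepVarDeriv_nonneg y
    have h3 : t / 2 ≤ x := le_of_lt hx
    gcongr
  · exact (integrableOn_steepPhase_mul (by linarith)).const_mul 4
  · refine Eventually.of_forall fun y x _ => ?_
    have h1 : HasDerivAt (fun x : ℝ => -(x * steepPhase y)) (-steepPhase y) x := by
      simpa using ((hasDerivAt_id x).mul_const (steepPhase y)).fun_neg
    refine ((h1.exp.ofReal_comp).mul_const _).congr_deriv ?_
    push_cast
    ring

/-- The constant `√(2/π) e^{-iπ/4}` of the asymptotics of `H_0`. -/
def hankelConst : ℂ := (1 - Complex.I) / Real.sqrt Real.pi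

/-- The leading term `√(2/π) e^{-iπ/4} (-i)^n e^{it} / √t` of `H_n`. -/
def hankelLead (n : ℤ) (t : ℝ) : ℂ :=
  hankelConst * (-Complex.I) ^ n * (Complex.exp (Complex.I * t) / Real.sqrt t)

theorem norm_hankelConst : ‖hankelConst‖ ^ 2 = 2 / Real.pi := by
  unfold hankelConst
  rw [norm_div, div_pow, ← Complex.normSq_eq_norm_sq, Complex.norm_real, Real.norm_eq_abs, sq_abs,
    Real.sq_sqrt Real.pi_pos.le]
  congr 1
  simp [Complex.normSq_apply]
  norm_num

theorem norm_neg_I_zpow (n : ℤ) : ‖(-Complex.I) ^ n‖ = 1 := by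
  rw [norm_zpow, norm_neg, Complex.norm_I, one_zpow]

theorem norm_hankelLead (n : ℤ) {t : ℝ} (ht : 0 < t) :
    ‖hankelLead n t‖ = ‖hankelConst‖ / Real.sqrt t := by
  unfold hankelLead
  rw [norm_mul, norm_mul, norm_neg_I_zpow, norm_div, norm_exp_I_mul, Complex.norm_real,
    Real.norm_eq_abs, abs_of_pos (Real.sqrt_pos.2 ht)]
  ring

theorem hankelLead_add_one (n : ℤ) (t : ℝ) :
    hankelLead (n + 1) t = -Complex.I * hankelLead n t := by
  unfold hankelLead
  rw [zpow_add_one₀ (neg_ne_zero.2 Complex.I_ne_zero)]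
  ring

theorem hankelLead_sub_one (n : ℤ) (t : ℝ) :
    hankelLead (n - 1) t = Complex.I * hankelLead n t := by
  have := hankelLead_add_one (n - 1) t
  rw [sub_add_cancel] at this
  rw [this]
  linear_combination (hankelLead (n - 1) t) * Complex.I_sq

theorem norm_hankel_zero_sub_lead {t : ℝ} (ht : 0 < t) :
    ‖hankel 0 t - hankelLead 0 t‖ ≤ 2 * t ^ (-(3 / 2) : ℝ) := by
  have h1 : hankel 0 t - hankelLead 0 t = 2 / Real.pi * (Complex.exp (Complex.I * t) *
      (steepInt t - (1 - Complex.I) * (Real.sqrt Real.pi / 2 / Real.sqrt t : ℝ))) := by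
    have hp : (Real.sqrt Real.pi : ℂ) ≠ 0 := by
      exact_mod_cast (Real.sqrt_pos.2 Real.pi_pos).ne'
    have hp2 : (Real.sqrt Real.pi : ℂ) ^ 2 = Real.pi := by
      exact_mod_cast Real.sq_sqrt Real.pi_pos.le
    have ht' : (Real.sqrt t : ℂ) ≠ 0 := by exact_mod_cast (Real.sqrt_pos.2 ht).ne'
    rw [hankel_zero_eq ht, hankelLead, hankelConst, ← hp2]
    push_cast
    field_simp
  rw [h1, norm_mul, norm_mul, norm_exp_I_mul, one_mul]
  have h2 : ‖(2 / Real.pi : ℂ)‖ ≤ 1 := by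
    rw [norm_div, Complex.norm_real, Real.norm_eq_abs, abs_of_pos Real.pi_pos, Complex.norm_ofNat,
      div_le_one Real.pi_pos]
    exact Real.two_le_pi
  have h3 := norm_steepInt_sub_le ht
  have h4 := norm_nonneg (steepInt t - (1 - Complex.I) * (Real.sqrt Real.pi / 2 / Real.sqrt t : ℝ))
  nlinarith

/-- The bound for `H_1 = -H_0'`: differentiating `exp (i t) * steepInt t` produces `i H_0` and a
term with the derivative of `steepInt`, which is smaller by a factor `1 / t`. -/
theorem norm_hankel_one_sub {t : ℝ} (ht : 0 < t) :
    ‖hankel 1 t + Complex.I * hankel 0 t‖ ≤ 4 * t ^ (-(3 / 2) : ℝ) := by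
  obtain ⟨D, hD, hb⟩ := hasDerivAt_steepInt ht
  have h1 : HasDerivAt (fun t : ℝ => Complex.exp (Complex.I * t))
      (Complex.exp (Complex.I * t) * Complex.I) t := by
    have : HasDerivAt (fun y : ℝ => Complex.I * (y : ℂ)) Complex.I t := by
      simpa using (hasDerivAt_id t).ofReal_comp.const_mul Complex.I
    exact this.cexp
  have h2 := ((h1.fun_mul hD).const_mul (2 / Real.pi : ℂ)).congr_of_eventuallyEq
    (f₁ := hankel 0) (by
      filter_upwards [Ioi_mem_nhds ht] with x hx using hankel_zero_eq hx)
  have h3 := h2.unique (hasDerivAt_hankel 0 ht)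
  have h4 := hankel_neg 1 ht
  rw [zpow_one] at h4
  rw [zero_sub, zero_add, h4] at h3
  have h5 : hankel 1 t + Complex.I * hankel 0 t =
      -(2 / Real.pi * (Complex.exp (Complex.I * t) * D)) := by
    rw [hankel_zero_eq ht]
    linear_combination h3
  rw [h5, norm_neg, norm_mul, norm_mul, norm_exp_I_mul, one_mul]
  have h2 : ‖(2 / Real.pi : ℂ)‖ ≤ 1 := by
    rw [norm_div, Complex.norm_real, Real.norm_eq_abs, abs_of_pos Real.pi_pos, Complex.norm_ofNat,
      div_le_one Real.pi_pos]
    exact Real.two_le_pi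
  have h6 := norm_nonneg D
  nlinarith

theorem norm_hankel_one_sub_lead {t : ℝ} (ht : 0 < t) :
    ‖hankel 1 t - hankelLead 1 t‖ ≤ 6 * t ^ (-(3 / 2) : ℝ) := by
  have h1 : hankel 1 t - hankelLead 1 t = (hankel 1 t + Complex.I * hankel 0 t) -
      Complex.I * (hankel 0 t - hankelLead 0 t) := by
    have := hankelLead_add_one 0 t
    rw [zero_add] at this
    rw [this]
    ring
  rw [h1]
  refine (norm_sub_le _ _).trans ?_
  rw [norm_mul, Complex.norm_I, one_mul]
  linarith [norm_hankel_one_sub ht, norm_hankel_zero_sub_lead ht]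

/-! ### Wronskians and bounds that are uniform in the radius -/

/-- A family of cylinder functions: the contiguous relations hold on the positive half-line. -/
structure IsCylinder (f : ℤ → ℝ → ℂ) : Prop where
  hasDerivAt : ∀ (n : ℤ) {t : ℝ}, 0 < t → HasDerivAt (f n) ((f (n - 1) t - f (n + 1) t) / 2) t
  recurrence : ∀ (n : ℤ) {t : ℝ}, 0 < t → t * (f (n - 1) t + f (n + 1) t) = 2 * n * f n t

theorem isCylinder_hankel : IsCylinder hankel := ⟨hasDerivAt_hankel, hankel_recurrence⟩

theorem isCylinder_cJ : IsCylinder cJ := ⟨hasDerivAt_cJ, cJ_recurrence⟩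

theorem isCylinder_cY : IsCylinder cY := ⟨hasDerivAt_cY, cY_recurrence⟩

theorem IsCylinder.deriv_eq {f : ℤ → ℝ → ℂ} (hf : IsCylinder f) (n : ℤ) {t : ℝ} (ht : 0 < t) :
    t * deriv (f n) t = n * f n t - t * f (n + 1) t := by
  rw [(hf.hasDerivAt n ht).deriv]
  linear_combination (1 / 2 : ℂ) * hf.recurrence n ht

theorem IsCylinder.deriv_eq' {f : ℤ → ℝ → ℂ} (hf : IsCylinder f) (n : ℤ) {t : ℝ} (ht : 0 < t) :
    t * deriv (f n) t = t * f (n - 1) t - n * f n t := by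
  rw [(hf.hasDerivAt n ht).deriv]
  linear_combination (-1 / 2 : ℂ) * hf.recurrence n ht

theorem tendsto_rpow_neg_three_halves_mul :
    Tendsto (fun t : ℝ => Real.sqrt t * t ^ (-(3 / 2) : ℝ)) atTop (𝓝 0) := by
  have h : Tendsto (fun t : ℝ => t ^ (-1 : ℝ)) atTop (𝓝 0) := tendsto_rpow_neg_atTop one_pos
  refine h.congr' ?_
  filter_upwards [eventually_gt_atTop 0] with t ht
  rw [Real.sqrt_eq_rpow, ← Real.rpow_add ht]
  norm_num

theorem tendsto_sqrt_mul_norm_hankel_zero :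
    Tendsto (fun t => Real.sqrt t * ‖hankel 0 t‖) atTop (𝓝 ‖hankelConst‖) := by
  rw [tendsto_iff_norm_sub_tendsto_zero]
  have h := tendsto_rpow_neg_three_halves_mul.const_mul 2
  rw [mul_zero] at h
  refine squeeze_zero' (Eventually.of_forall fun _ => norm_nonneg _) ?_ h
  filter_upwards [eventually_gt_atTop 0] with t ht
  have hs : 0 < Real.sqrt t := Real.sqrt_pos.2 ht
  have h1 : ‖hankelConst‖ = Real.sqrt t * ‖hankelLead 0 t‖ := by
    rw [norm_hankelLead 0 ht]
    field_simp
  rw [h1, ← mul_sub, norm_mul, Real.norm_eq_abs, abs_of_pos hs, mul_left_comm]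
  gcongr
  exact (abs_norm_sub_norm_le _ _).trans (norm_hankel_zero_sub_lead ht)

/-- The product of the left-hand side and `t` has derivative zero, and the asymptotics of `H_0`
and `H_1` give its limit `2 / π` at infinity. -/
theorem im_star_hankel_zero {t : ℝ} (ht : 0 < t) :
    (star (hankel 1 t) * hankel 0 t).im = 2 / (Real.pi * t) := by
  have hder : ∀ t ∈ Ioi (0 : ℝ),
      HasDerivAt (fun t : ℝ => ((t : ℂ) * (star (hankel 1 t) * hankel 0 t)).im) 0 t := by
    intro t ht
    have htr : t ≠ 0 := ne_of_gt ht
    have ht' : (t : ℂ) ≠ 0 := by exact_mod_cast htr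
    have h0 := hasDerivAt_hankel 0 ht
    have h1 := (hasDerivAt_hankel 1 ht).star
    have h2 := ((hasDerivAt_id t).ofReal_comp).fun_mul (h1.fun_mul h0)
    refine (Complex.imCLM.hasFDerivAt.comp_hasDerivAt t h2).congr_deriv ?_
    have e1 := hankel_neg 1 ht
    have e2 := hankel_recurrence 1 ht
    have e3 : hankel 2 t = 2 / t * hankel 1 t - hankel 0 t := by
      field_simp
      norm_num at e2
      linear_combination e2
    rw [zpow_one] at e1
    norm_num at e1 ⊢
    rw [e1, e3]
    simp
    field_simp
    ring
  have hconst : ∀ x ∈ Ioi (0 : ℝ), ∀ y ∈ Ioi (0 : ℝ),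
      ((x : ℂ) * (star (hankel 1 x) * hankel 0 x)).im =
        ((y : ℂ) * (star (hankel 1 y) * hankel 0 y)).im := by
    intro x hx y hy
    have hd : DifferentiableOn ℝ
        (fun t : ℝ => ((t : ℂ) * (star (hankel 1 t) * hankel 0 t)).im) (Ioi 0) :=
      fun t ht => (hder t ht).differentiableAt.differentiableWithinAt
    exact isOpen_Ioi.is_const_of_deriv_eq_zero (convex_Ioi 0).isPreconnected hd
      (fun t ht => (hder t ht).deriv) hx hy
  have hlim : Tendsto (fun t : ℝ => ((t : ℂ) * (star (hankel 1 t) * hankel 0 t)).im) atTop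
      (𝓝 (2 / Real.pi)) := by
    have hz : Tendsto (fun t : ℝ => (4 * (Real.sqrt t * t ^ (-(3 / 2) : ℝ))) *
        (Real.sqrt t * ‖hankel 0 t‖)) atTop (𝓝 0) := by
      simpa using (tendsto_rpow_neg_three_halves_mul.const_mul 4).mul
        tendsto_sqrt_mul_norm_hankel_zero
    have hm := tendsto_sqrt_mul_norm_hankel_zero.pow 2
    rw [norm_hankelConst] at hm
    -- replacing `H_1` by `-i H_0` turns the expression into `t |H_0|²`
    have hdiff : Tendsto (fun t : ℝ => ((t : ℂ) * (star (hankel 1 t) * hankel 0 t)).im -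
        (Real.sqrt t * ‖hankel 0 t‖) ^ 2) atTop (𝓝 0) := by
      refine squeeze_zero_norm' ?_ hz
      filter_upwards [eventually_gt_atTop 0] with t ht
      have hs : Real.sqrt t ^ 2 = t := Real.sq_sqrt ht.le
      have e1 : ((t : ℂ) * (star (hankel 1 t) * hankel 0 t)).im -
          (Real.sqrt t * ‖hankel 0 t‖) ^ 2 =
          t * (star (hankel 1 t + Complex.I * hankel 0 t) * hankel 0 t).im := by
        rw [mul_pow, hs, ← Complex.normSq_eq_norm_sq, Complex.normSq_apply]
        simp
        ring
      rw [e1, norm_mul, Real.norm_eq_abs, abs_of_pos ht]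
      have h3 := norm_hankel_one_sub ht
      calc t * ‖(star (hankel 1 t + Complex.I * hankel 0 t) * hankel 0 t).im‖
          ≤ t * (‖star (hankel 1 t + Complex.I * hankel 0 t)‖ * ‖hankel 0 t‖) := by
            rw [← norm_mul]
            gcongr
            exact Complex.abs_im_le_norm _
        _ ≤ t * (4 * t ^ (-(3 / 2) : ℝ) * ‖hankel 0 t‖) := by
            rw [norm_star]
            gcongr
        _ = _ := by
            nth_rewrite 1 [← hs]
            ring
    simpa using hdiff.add hm
  have hval : ((t : ℂ) * (star (hankel 1 t) * hankel 0 t)).im = 2 / Real.pi := by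
    refine tendsto_nhds_unique (tendsto_const_nhds.congr' ?_) hlim
    filter_upwards [eventually_gt_atTop 0] with x hx using hconst t ht x hx
  rw [Complex.im_ofReal_mul] at hval
  rw [← div_div, eq_div_iff ht.ne', mul_comm, hval]

/-- The Wronskian of `H_n` and its conjugate. By the recurrence it does not depend on the order.
-/
theorem im_star_hankel (n : ℤ) {t : ℝ} (ht : 0 < t) :
    (star (hankel (n + 1) t) * hankel n t).im = 2 / (Real.pi * t) := by
  have hstep : ∀ n : ℤ, (star (hankel (n + 1) t) * hankel n t).im =
      (star (hankel n t) * hankel (n - 1) t).im := by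
    intro n
    have h := hankel_recurrence n ht
    have e : hankel (n + 1) t = ((2 * n / t : ℝ) : ℂ) * hankel n t - hankel (n - 1) t := by
      have ht' : (t : ℂ) ≠ 0 := by exact_mod_cast ht.ne'
      push_cast
      field_simp
      linear_combination h
    rw [e]
    simp only [star_sub, star_mul', sub_mul, Complex.sub_im, RCLike.star_def, Complex.conj_ofReal]
    simp only [mul_assoc, Complex.im_ofReal_mul]
    simp
    ring
  induction n using Int.induction_on with
  | zero => simpa using im_star_hankel_zero ht
  | succ k ih =>
    have := hstep (k + 1)
    rw [add_sub_cancel_right] at this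
    rw [this, ih]
  | pred k ih =>
    have := hstep (-k)
    rw [sub_add_cancel, ← this, ih]

theorem hankel_ne_zero (n : ℤ) {t : ℝ} (ht : 0 < t) : hankel n t ≠ 0 := by
  intro h
  have h1 := im_star_hankel n ht
  rw [h, mul_zero, Complex.zero_im] at h1
  have : 0 < 2 / (Real.pi * t) := by positivity
  linarith

/-- The logarithmic derivative of `H_n` has positive imaginary part: the outgoing wave `H_n`
carries energy to infinity. -/
theorem im_deriv_hankel (n : ℤ) {t : ℝ} (ht : 0 < t) :
    (t * deriv (hankel n) t * star (hankel n t)).im = 2 / Real.pi := by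
  have h := im_star_hankel n ht
  rw [isCylinder_hankel.deriv_eq n ht]
  have e : ((n * hankel n t - t * hankel (n + 1) t) * star (hankel n t)).im =
      t * (star (hankel (n + 1) t) * hankel n t).im := by
    simp
    ring
  rw [e, h]
  field_simp

/-- The Wronskian of the Bessel functions of the first and second kind. -/
theorem wronskian_cJ_cY (n : ℤ) {t : ℝ} (ht : 0 < t) :
    t * (cJ n t * deriv (cY n) t - deriv (cJ n) t * cY n t) = 2 / Real.pi := by
  have h := im_star_hankel n ht
  have h1 := isCylinder_cJ.deriv_eq n ht
  have h2 := isCylinder_cY.deriv_eq n ht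
  have e : ((t * (star (hankel (n + 1) t) * hankel n t).im : ℝ) : ℂ) =
      t * (cJ (n + 1) t * cY n t - cJ n t * cY (n + 1) t) := by
    rw [cJ_eq_re, cJ_eq_re, cY_eq_im, cY_eq_im]
    push_cast [Complex.mul_im, RCLike.star_def, Complex.conj_re, Complex.conj_im]
    ring
  rw [h, show t * (2 / (Real.pi * t)) = 2 / Real.pi by field_simp] at e
  push_cast at e
  linear_combination cJ n t * h2 - cY n t * h1 - e

/-- The weight `C^|n| |n|!`, which controls the growth of `H_n` in the order. -/
def growth (C : ℝ) (n : ℤ) : ℝ := C ^ n.natAbs * (n.natAbs.factorial : ℝ)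

theorem growth_pos {C : ℝ} (hC : 0 < C) (n : ℤ) : 0 < growth C n := by
  unfold growth
  positivity

theorem growth_neg (C : ℝ) (n : ℤ) : growth C (-n) = growth C n := by
  simp [growth]

theorem hankelLead_neg (n : ℤ) (t : ℝ) : hankelLead (-n) t = (-1) ^ n * hankelLead n t := by
  have h : (-Complex.I) ^ (-n) = (-1) ^ n * (-Complex.I) ^ n := by
    rw [zpow_neg, ← inv_zpow, ← mul_zpow]
    congr 1
    rw [inv_neg, Complex.inv_I]
    ring
  unfold hankelLead
  rw [h]
  ring

/-- Induction on the order. The leading terms satisfy `hankelLead (n + 2) = -hankelLead n`, so the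
three term recurrence propagates both bounds, at the cost of a factor `C * (n + 1)` absorbed by
`growth`. -/
theorem hankel_bounds_nat {t₀ : ℝ} (ht₀ : 0 < t₀) : ∃ M C : ℝ, 0 < M ∧ 2 ≤ C ∧
    ∀ (n : ℕ) (t : ℝ), t₀ ≤ t →
      (‖hankel n t‖ ≤ M * growth C n * (Real.sqrt t)⁻¹ ∧
        ‖hankel n t - hankelLead n t‖ ≤ M * growth C n * t ^ (-(3 / 2) : ℝ)) ∧
      (‖hankel (n + 1 : ℕ) t‖ ≤ M * growth C (n + 1 : ℕ) * (Real.sqrt t)⁻¹ ∧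
        ‖hankel (n + 1 : ℕ) t - hankelLead (n + 1 : ℕ) t‖ ≤
          M * growth C (n + 1 : ℕ) * t ^ (-(3 / 2) : ℝ)) := by
  have hr : ∀ t : ℝ, t₀ ≤ t → t ^ (-(3 / 2) : ℝ) = t⁻¹ * (Real.sqrt t)⁻¹ := by
    intro t ht
    have h0 : 0 < t := ht₀.trans_le ht
    rw [Real.sqrt_eq_rpow, ← Real.rpow_neg_one, ← Real.rpow_neg h0.le, ← Real.rpow_add h0]
    norm_num
  -- `M` covers the orders `0` and `1`; `2 / t₀ + 3` makes the weights dominate the recurrence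
  set M := ‖hankelConst‖ + 6 / t₀ + 6 with hM
  have hMpos : 0 < M := by positivity
  have hinv : 0 < t₀⁻¹ := by positivity
  refine ⟨M, 2 / t₀ + 3, hMpos, by rw [div_eq_mul_inv]; linarith, fun n t ht => ?_⟩
  have h0 : 0 < t := ht₀.trans_le ht
  have hs : 0 < (Real.sqrt t)⁻¹ := by positivity
  have hti : t⁻¹ ≤ t₀⁻¹ := inv_anti₀ ht₀ ht
  have hp : 0 < t ^ (-(3 / 2) : ℝ) := by positivity
  have hbase : ∀ (m : ℤ) (e : ℝ), e ≤ 6 →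
      ‖hankel m t - hankelLead m t‖ ≤ e * t ^ (-(3 / 2) : ℝ) →
      ‖hankel m t‖ ≤ M * (Real.sqrt t)⁻¹ ∧
      ‖hankel m t - hankelLead m t‖ ≤ M * t ^ (-(3 / 2) : ℝ) := by
    intro m e he hb
    have hb' : ‖hankel m t - hankelLead m t‖ ≤ 6 * t ^ (-(3 / 2) : ℝ) := by
      refine hb.trans ?_
      gcongr
    constructor
    · have h2 : ‖hankel m t‖ ≤ ‖hankelLead m t‖ + ‖hankel m t - hankelLead m t‖ := by
        have := norm_add_le (hankelLead m t) (hankel m t - hankelLead m t)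
        simpa using this
      rw [norm_hankelLead m h0] at h2
      rw [hr t ht] at hb'
      have h3 : 6 * (t⁻¹ * (Real.sqrt t)⁻¹) ≤ 6 / t₀ * (Real.sqrt t)⁻¹ := by
        rw [← mul_assoc, div_eq_mul_inv]
        gcongr
      calc ‖hankel m t‖ ≤ ‖hankelConst‖ / Real.sqrt t + 6 / t₀ * (Real.sqrt t)⁻¹ := by linarith
        _ = (‖hankelConst‖ + 6 / t₀) * (Real.sqrt t)⁻¹ := by rw [div_eq_mul_inv]; ring
        _ ≤ M * (Real.sqrt t)⁻¹ := by gcongr; linarith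
    · refine hb'.trans ?_
      gcongr
      have : 0 ≤ ‖hankelConst‖ + 6 / t₀ := by positivity
      linarith
  have hg0 : growth (2 / t₀ + 3) (0 : ℕ) = 1 := by simp [growth]
  have hgs : ∀ k : ℕ, growth (2 / t₀ + 3) (k + 1 : ℕ) =
      (2 / t₀ + 3) * (k + 1) * growth (2 / t₀ + 3) k := by
    intro k
    simp only [growth, Int.natAbs_natCast, pow_succ, Nat.factorial_succ]
    push_cast
    ring
  induction n with
  | zero =>
    have b0 := hbase 0 2 (by norm_num) (norm_hankel_zero_sub_lead h0)
    have b1 := hbase 1 6 (by norm_num) (norm_hankel_one_sub_lead h0)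
    have hg1 : 1 ≤ growth (2 / t₀ + 3) (0 + 1 : ℕ) := by
      rw [hgs, hg0, div_eq_mul_inv]
      norm_num
      linarith
    rw [hg0, mul_one]
    refine ⟨b0, b1.1.trans ?_, b1.2.trans ?_⟩
    · gcongr
      exact le_mul_of_one_le_right hMpos.le hg1
    · gcongr
      exact le_mul_of_one_le_right hMpos.le hg1
  | succ k ih =>
    refine ⟨ih.2, ?_⟩
    obtain ⟨⟨a1, a2⟩, b1, b2⟩ := ih
    have ht' : (t : ℂ) ≠ 0 := by exact_mod_cast h0.ne'
    have hrec := hankel_recurrence (k + 1 : ℕ) h0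
    have i1 : (((k + 1 : ℕ) : ℤ) - 1) = k := by push_cast; ring
    have i2 : (((k + 1 : ℕ) : ℤ) + 1) = (k + 1 + 1 : ℕ) := by push_cast; ring
    rw [i1, i2] at hrec
    have e1 : hankel (k + 1 + 1 : ℕ) t =
        ((2 * (k + 1) * t⁻¹ : ℝ) : ℂ) * hankel (k + 1 : ℕ) t - hankel k t := by
      push_cast at hrec ⊢
      field_simp
      linear_combination hrec
    have e2 : hankelLead (k + 1 + 1 : ℕ) t = -hankelLead k t := by
      have h1 := hankelLead_add_one (k + 1 : ℕ) t
      have h2 := hankelLead_sub_one (k + 1 : ℕ) t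
      rw [i2] at h1
      rw [i1] at h2
      rw [h1, h2]
      ring
    set G := growth (2 / t₀ + 3) k with hG
    have hGpos : 0 < G := growth_pos (by positivity) _
    have hn1 : ‖((2 * (k + 1) * t⁻¹ : ℝ) : ℂ)‖ = 2 * (k + 1) * t⁻¹ := by
      rw [Complex.norm_real, Real.norm_eq_abs, abs_of_pos (by positivity)]
    have hk : (0 : ℝ) ≤ k := Nat.cast_nonneg k
    -- the weights dominate the right-hand side of the recurrence
    have hw : ∀ c : ℝ, c ≤ 2 / t₀ + 2 → (k + 1) * c * (M * growth (2 / t₀ + 3) (k + 1 : ℕ)) + M * G ≤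
        M * growth (2 / t₀ + 3) (k + 1 + 1 : ℕ) := by
      intro c hc
      rw [hgs (k + 1), hgs k]
      rw [← hG]
      have h1 : 1 ≤ (2 / t₀ + 3) * ((k : ℝ) + 1) := by
        rw [div_eq_mul_inv]; nlinarith
      have h2 : ((k : ℝ) + 1) * c + 1 ≤ (2 / t₀ + 3) * ((k + 1 : ℕ) + 1) := by
        push_cast
        rw [div_eq_mul_inv] at hc ⊢
        nlinarith
      have h3 : M * G ≤ M * ((2 / t₀ + 3) * ((k : ℝ) + 1) * G) := by
        gcongr
        exact le_mul_of_one_le_left hGpos.le h1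
      have h4 : 0 ≤ M * ((2 / t₀ + 3) * ((k : ℝ) + 1) * G) := by positivity
      nlinarith [mul_le_mul_of_nonneg_right h2 h4]
    constructor
    · rw [e1]
      refine (norm_sub_le _ _).trans ?_
      rw [norm_mul, hn1]
      calc 2 * (k + 1) * t⁻¹ * ‖hankel (k + 1 : ℕ) t‖ + ‖hankel k t‖
          ≤ 2 * (k + 1) * t₀⁻¹ * (M * growth (2 / t₀ + 3) (k + 1 : ℕ) * (Real.sqrt t)⁻¹) +
            M * G * (Real.sqrt t)⁻¹ := by gcongr
        _ = ((k + 1) * (2 / t₀) * (M * growth (2 / t₀ + 3) (k + 1 : ℕ)) + M * G) *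
            (Real.sqrt t)⁻¹ := by rw [div_eq_mul_inv]; ring
        _ ≤ _ := by
          gcongr
          exact hw _ (by linarith)
    · have e3 : hankel (k + 1 + 1 : ℕ) t - hankelLead (k + 1 + 1 : ℕ) t =
          ((2 * (k + 1) * t⁻¹ : ℝ) : ℂ) * hankel (k + 1 : ℕ) t -
            (hankel k t - hankelLead k t) := by
        rw [e1, e2]; ring
      rw [e3]
      refine (norm_sub_le _ _).trans ?_
      rw [norm_mul, hn1]
      calc 2 * (k + 1) * t⁻¹ * ‖hankel (k + 1 : ℕ) t‖ + ‖hankel k t - hankelLead k t‖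
          ≤ 2 * (k + 1) * t⁻¹ * (M * growth (2 / t₀ + 3) (k + 1 : ℕ) * (Real.sqrt t)⁻¹) +
            M * G * t ^ (-(3 / 2) : ℝ) := by gcongr
        _ = ((k + 1) * 2 * (M * growth (2 / t₀ + 3) (k + 1 : ℕ)) + M * G) *
            t ^ (-(3 / 2) : ℝ) := by rw [hr t ht]; ring
        _ ≤ _ := by
          gcongr
          refine hw _ ?_
          rw [div_eq_mul_inv]
          linarith

/-- Bounds for the Hankel functions and for the error of their asymptotics, valid for all orders
at once and for arguments away from zero. -/
theorem hankel_bounds {t₀ : ℝ} (ht₀ : 0 < t₀) : ∃ M C : ℝ, 0 < M ∧ 2 ≤ C ∧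
    ∀ (n : ℤ) (t : ℝ), t₀ ≤ t →
      ‖hankel n t‖ ≤ M * growth C n * (Real.sqrt t)⁻¹ ∧
        ‖hankel n t - hankelLead n t‖ ≤ M * growth C n * t ^ (-(3 / 2) : ℝ) := by
  obtain ⟨M, C, hM, hC, h⟩ := hankel_bounds_nat ht₀
  refine ⟨M, C, hM, hC, fun n t ht => ?_⟩
  have h0 : 0 < t := ht₀.trans_le ht
  rcases Int.eq_nat_or_neg n with ⟨m, rfl | rfl⟩
  · exact (h m t ht).1
  · have h1 : ‖(-1 : ℂ) ^ (m : ℤ)‖ = 1 := by simp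
    rw [hankel_neg _ h0, hankelLead_neg, ← mul_sub, norm_mul, norm_mul, h1, one_mul, one_mul,
      growth_neg]
    exact (h m t ht).1

/-! ### The matrices of the disk: invertibility and spectral decomposition -/

theorem det_cylMatrix (f : ℤ → ℝ → ℂ) (n : ℤ) (a b : ℝ) : (cylMatrix f n a b).det =
    a * deriv (f n) a * (b * deriv (f n) b) - (n : ℂ) ^ 2 * (f n a * f n b) := by
  rw [cylMatrix, Matrix.det_fin_two_of]
  linear_combination (n : ℂ) ^ 2 * f n a * f n b * Complex.I_sq

/-- If the determinant vanished, the product of two numbers with positive imaginary parts (the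
logarithmic derivatives of `H_n`, multiplied by `|H_n|²`) would be a nonnegative real. -/
theorem det_cylMatrix_hankel_ne_zero (n : ℤ) {a b : ℝ} (ha : 0 < a) (hb : 0 < b) :
    (cylMatrix hankel n a b).det ≠ 0 := by
  rw [det_cylMatrix]
  intro h
  have h1 := im_deriv_hankel n ha
  have h2 := im_deriv_hankel n hb
  set z := a * deriv (hankel n) a * star (hankel n a) with hz
  set w := b * deriv (hankel n) b * star (hankel n b) with hw
  have h3 : z * w = (((n : ℝ) ^ 2 * (Complex.normSq (hankel n a) * Complex.normSq (hankel n b)) : ℝ) : ℂ) := by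
    push_cast
    rw [Complex.normSq_eq_conj_mul_self, Complex.normSq_eq_conj_mul_self, hz, hw]
    simp only [RCLike.star_def]
    linear_combination ((starRingEnd ℂ) (hankel n a) * (starRingEnd ℂ) (hankel n b)) * h
  have h4 := congrArg Complex.im h3
  have h5 := congrArg Complex.re h3
  rw [Complex.ofReal_im, Complex.mul_im, h1, h2] at h4
  rw [Complex.ofReal_re, Complex.mul_re, h1, h2] at h5
  have hp : 0 < 2 / Real.pi := by positivity
  have h6 : w.re = -z.re := by
    have : (2 / Real.pi) * (z.re + w.re) = 0 := by linarith
    rcases mul_eq_zero.1 this with h | h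
    · exact absurd h hp.ne'
    · linarith
  have h7 : 0 ≤ (n : ℝ) ^ 2 * (Complex.normSq (hankel n a) * Complex.normSq (hankel n b)) :=
    mul_nonneg (sq_nonneg _) (mul_nonneg (Complex.normSq_nonneg _) (Complex.normSq_nonneg _))
  rw [← h5, h6] at h7
  nlinarith [sq_nonneg z.re]

theorem isUnit_det_cylMatrix_hankel (n : ℤ) {a b : ℝ} (ha : 0 < a) (hb : 0 < b) :
    IsUnit (cylMatrix hankel n a b).det :=
  isUnit_iff_ne_zero.2 (det_cylMatrix_hankel_ne_zero n ha hb)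

/-- `β_n` is purely imaginary, since the bracket in its definition is real. -/
theorem betaN_eq (n : ℤ) {a b : ℝ} (ha : 0 < a) (hb : 0 < b) :
    ∃ r : ℝ, betaN n a b = -Complex.I * r := by
  have hreal : ∃ x : ℝ, ((n : ℂ) ^ 2 * (cJ n b * cY n a - cJ n a * cY n b) +
      a * b * (deriv (cJ n) a * deriv (cY n) b - deriv (cJ n) b * deriv (cY n) a)) = x := by
    rw [(hasDerivAt_cJ n ha).deriv, (hasDerivAt_cJ n hb).deriv, (hasDerivAt_cY n ha).deriv,
      (hasDerivAt_cY n hb).deriv]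
    rw [← Complex.conj_eq_iff_real]
    simp [cJ, cY, map_ofNat (starRingEnd ℂ) 2]
  obtain ⟨x, hx⟩ := hreal
  refine ⟨Real.pi / (2 * n) * x, ?_⟩
  rw [betaN, hx]
  push_cast
  rw [show (Real.pi : ℂ) / (2 * Complex.I * n) = Complex.I⁻¹ * (Real.pi / (2 * n)) by
    rw [div_eq_mul_inv, div_eq_mul_inv]
    simp only [mul_inv]
    ring, Complex.inv_I]
  ring

/-- `σ_1` and `σ_2` are the two roots of `σ² + β_n σ + 1`. They are distinct because `β_n² - 4` is
a negative real. -/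
theorem sigmaN_quadratic (n : ℤ) (j : Fin 2) {a b : ℝ} (ha : 0 < a) (hb : 0 < b) :
    sigmaN n j a b ^ 2 + betaN n a b * sigmaN n j a b + 1 = 0 ∧
      sigmaN n 0 a b ≠ sigmaN n 1 a b := by
  obtain ⟨r, hr⟩ := betaN_eq n ha hb
  have h0 : betaN n a b ^ 2 - 4 ≠ 0 := by
    have : betaN n a b ^ 2 - 4 = ((-(r ^ 2 + 4) : ℝ) : ℂ) := by
      rw [hr]
      push_cast
      linear_combination (r : ℂ) ^ 2 * Complex.I_sq
    rw [this]
    have h : -(r ^ 2 + 4) < 0 := by nlinarith [sq_nonneg r]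
    exact_mod_cast h.ne
  have hs : ((betaN n a b ^ 2 - 4) ^ (1 / 2 : ℂ)) ^ 2 = betaN n a b ^ 2 - 4 := by
    rw [sq, ← Complex.cpow_add _ _ h0]
    norm_num
  have hs0 : (betaN n a b ^ 2 - 4) ^ (1 / 2 : ℂ) ≠ 0 := by
    intro h
    rw [h] at hs
    exact h0 (by rw [← hs]; ring)
  constructor
  · fin_cases j
    · simp only [sigmaN, Fin.zero_eta, Matrix.cons_val_zero]
      linear_combination (1 / 4 : ℂ) * hs
    · simp only [sigmaN, Fin.mk_one, Matrix.cons_val_one, Matrix.cons_val_fin_one]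
      linear_combination (1 / 4 : ℂ) * hs
  · intro h
    simp only [sigmaN, Matrix.cons_val_zero, Matrix.cons_val_one, Matrix.cons_val_fin_one] at h
    apply hs0
    linear_combination h

theorem deriv_hankel_eq (n : ℤ) {t : ℝ} (ht : 0 < t) :
    deriv (hankel n) t = deriv (cJ n) t + Complex.I * deriv (cY n) t := by
  rw [(hasDerivAt_cJ n ht).deriv, (hasDerivAt_cY n ht).deriv, (hasDerivAt_hankel n ht).deriv]
  unfold hankel
  ring

/-- The eigenvalue problem for `Σ_n = 𝓗_n⁻¹ 𝓙_n` in generalized form `𝓙_n v = c 𝓗_n v`. -/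
theorem sigmaMatrix_mulVec_of_eq {n : ℤ} {a b : ℝ} (ha : 0 < a) (hb : 0 < b) {v : Fin 2 → ℂ}
    {c : ℂ} (h : (cylMatrix cJ n a b).mulVec v = c • (cylMatrix hankel n a b).mulVec v) :
    (sigmaMatrix n a b).mulVec v = c • v := by
  rw [sigmaMatrix, ← Matrix.mulVec_mulVec, h, Matrix.mulVec_smul, Matrix.mulVec_mulVec,
    Matrix.nonsing_inv_mul _ (isUnit_det_cylMatrix_hankel n ha hb), Matrix.one_mulVec]

theorem mulVec_two (A B C D x y : ℂ) :
    (!![A, B; C, D]).mulVec ![x, y] = ![A * x + B * y, C * x + D * y] := by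
  ext i
  fin_cases i <;> simp [Matrix.mulVec, dotProduct, Fin.sum_univ_two]

/-- The quadratic equation for `σ` says that `𝓙_n v` and `𝓨_n v` are parallel, hence that `v` is an
eigenvector of `Σ_n`; its coefficients come from the Wronskian of `J_n` and `Y_n`. -/
theorem sigmaMatrix_mulVec_sigmaN {n : ℤ} (hn : n ≠ 0) (j : Fin 2) {a b : ℝ} (ha : 0 < a)
    (hb : 0 < b) : (sigmaMatrix n a b).mulVec ![1, -sigmaN n j a b] =
      lamN n j a b • ![1, -sigmaN n j a b] := by
  apply sigmaMatrix_mulVec_of_eq ha hb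
  have hq := (sigmaN_quadratic n j ha hb).1
  set σ := sigmaN n j a b with hσ
  have hn' : (n : ℂ) ≠ 0 := by exact_mod_cast hn
  have hwa := wronskian_cJ_cY n ha
  have hwb := wronskian_cJ_cY n hb
  have hpi : (Real.pi : ℂ) ≠ 0 := by exact_mod_cast Real.pi_ne_zero
  have hβ : betaN n a b * (2 * Complex.I * n) = Real.pi *
      ((n : ℂ) ^ 2 * (cJ n b * cY n a - cJ n a * cY n b) +
      a * b * (deriv (cJ n) a * deriv (cY n) b - deriv (cJ n) b * deriv (cY n) a)) := by
    have hI := Complex.I_ne_zero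
    rw [betaN]
    field_simp
  set j1 := a * deriv (cJ n) a + Complex.I * n * cJ n b * σ with hj1
  set j2 := Complex.I * n * cJ n a - b * deriv (cJ n) b * σ with hj2
  set h1 := a * deriv (hankel n) a + Complex.I * n * hankel n b * σ with hh1
  set h2 := Complex.I * n * hankel n a - b * deriv (hankel n) b * σ with hh2
  have hvJ : (cylMatrix cJ n a b).mulVec ![1, -σ] = ![j1, j2] := by
    rw [cylMatrix, mulVec_two, hj1, hj2]
    congr 1 <;> [ring; (congr 1; ring)]
  have hvH : (cylMatrix hankel n a b).mulVec ![1, -σ] = ![h1, h2] := by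
    rw [cylMatrix, mulVec_two, hh1, hh2]
    congr 1 <;> [ring; (congr 1; ring)]
  -- `𝓙_n v` and `𝓗_n v` are parallel
  have hdet : j1 * h2 = j2 * h1 := by
    have hpar : Real.pi * (j1 * h2 - j2 * h1) = 0 := by
      rw [hj1, hj2, hh1, hh2, deriv_hankel_eq n ha, deriv_hankel_eq n hb]
      unfold hankel
      have hwa' : Real.pi * (a * (cJ n a * deriv (cY n) a - deriv (cJ n) a * cY n a)) = 2 := by
        rw [hwa]; field_simp
      have hwb' : Real.pi * (b * (cJ n b * deriv (cY n) b - deriv (cJ n) b * cY n b)) = 2 := by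
        rw [hwb]; field_simp
      linear_combination (2 * n : ℂ) * hq + Complex.I * σ * hβ
        + (n : ℂ) * hwa' + n * σ ^ 2 * hwb'
        + (Real.pi * a * n * (deriv (cJ n) a * cY n a - cJ n a * deriv (cY n) a)
          + Real.pi * Complex.I * n ^ 2 * σ * (cJ n b * cY n a - cJ n a * cY n b)
          - Real.pi * n * σ ^ 2 * b * (cJ n b * deriv (cY n) b - deriv (cJ n) b * cY n b)
          - 2 * n * σ * betaN n a b) * Complex.I_sq
    have := (mul_eq_zero.1 hpar).resolve_left hpi
    linear_combination this
  rw [hvJ, hvH]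
  have hlam : lamN n j a b = if h1 ≠ 0 then j1 / h1 else j2 / h2 := by
    rw [lamN, if_neg hn]
  rw [hlam]
  by_cases h0 : h1 = 0
  -- if the first denominator vanishes, the second one does not, because `𝓗_n` is injective
  · have h20 : h2 ≠ 0 := by
      intro h20
      have hz : (cylMatrix hankel n a b).mulVec ![1, -σ] = 0 := by
        rw [hvH, h0, h20]
        ext i
        fin_cases i <;> rfl
      have := Matrix.eq_zero_of_mulVec_eq_zero (det_cylMatrix_hankel_ne_zero n ha hb) hz
      simpa using congrFun this 0
    have hj0 : j1 = 0 := by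
      rw [h0, mul_zero] at hdet
      exact (mul_eq_zero.1 hdet).resolve_right h20
    rw [if_neg (not_not.2 h0), hj0, h0]
    ext i
    fin_cases i
    · simp
    · simp [h20]
  · rw [if_pos h0]
    ext i
    fin_cases i
    · simp [h0]
    · simp only [Fin.mk_one, Matrix.cons_val_one, Matrix.cons_val_fin_one, Pi.smul_apply,
        smul_eq_mul]
      field_simp
      linear_combination -hdet

theorem sigmaMatrix_zero {a b : ℝ} (ha : 0 < a) (hb : 0 < b) (j : Fin 2) :
    (sigmaMatrix 0 a b).mulVec (Pi.single j 1) = lamN 0 j a b • Pi.single j 1 := by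
  apply sigmaMatrix_mulVec_of_eq ha hb
  have h := det_cylMatrix_hankel_ne_zero 0 ha hb
  rw [det_cylMatrix] at h
  have h1 : deriv (hankel 0) a ≠ 0 := by
    intro h0
    apply h
    rw [h0]
    simp
  have h2 : deriv (hankel 0) b ≠ 0 := by
    intro h0
    apply h
    rw [h0]
    simp
  have e0 : (Pi.single 0 1 : Fin 2 → ℂ) = ![1, 0] := by ext i; fin_cases i <;> rfl
  have e1 : (Pi.single 1 1 : Fin 2 → ℂ) = ![0, 1] := by ext i; fin_cases i <;> rfl
  fin_cases j
  · simp only [Fin.zero_eta, e0, lamN, cylMatrix, mulVec_two]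
    ext i
    fin_cases i
    · simp; field_simp
    · simp
  · simp only [Fin.mk_one, e1, lamN, cylMatrix, mulVec_two]
    ext i
    fin_cases i
    · simp
    · simp; field_simp

/-- `eigVec n j` is an eigenvector of `Σ_n` with eigenvalue `lamN n j`. -/
theorem sigmaMatrix_mulVec_eigVec (n : ℤ) (j : Fin 2) {a b : ℝ} (ha : 0 < a) (hb : 0 < b) :
    (sigmaMatrix n a b).mulVec (eigVec n j a b) = lamN n j a b • eigVec n j a b := by
  by_cases hn : n = 0
  · subst hn
    rw [eigVec, if_pos rfl, sigmaMatrix_zero ha hb]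
  · rw [eigVec, if_neg hn, Matrix.mulVec_smul, sigmaMatrix_mulVec_sigmaN hn j ha hb, smul_comm]

/-- The two eigenvectors of `Σ_n` are linearly independent. -/
theorem eigVec_det_ne_zero (n : ℤ) {a b : ℝ} (ha : 0 < a) (hb : 0 < b) :
    eigVec n 0 a b 0 * eigVec n 1 a b 1 - eigVec n 1 a b 0 * eigVec n 0 a b 1 ≠ 0 := by
  by_cases hn : n = 0
  · simp [eigVec, hn]
  · have hs := (sigmaN_quadratic n 0 ha hb).2
    have hpos : ∀ j, ((Real.sqrt (1 + ‖sigmaN n j a b‖ ^ 2) : ℝ) : ℂ) ≠ 0 := fun j => by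
      have : 0 < Real.sqrt (1 + ‖sigmaN n j a b‖ ^ 2) := Real.sqrt_pos.2 (by positivity)
      exact_mod_cast this.ne'
    have h0 := hpos 0
    have h1 := hpos 1
    simp only [eigVec, if_neg hn, Pi.smul_apply, Matrix.cons_val_zero, Matrix.cons_val_one,
      Matrix.cons_val_fin_one, smul_eq_mul]
    intro h
    apply hs
    field_simp at h
    linear_combination h

/-! ### Behaviour in the order: decay of the matrices `Σ_n` -/

theorem norm_cJ_le_one (n : ℤ) (t : ℝ) : ‖cJ n t‖ ≤ 1 := by
  rw [cJ, Complex.norm_real, besselJ, norm_mul]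
  have h := intervalIntegral.norm_integral_le_of_norm_le_const (a := 0) (b := Real.pi) (C := 1)
    (f := fun s => Real.cos (n * s - t * Real.sin s)) fun s _ => Real.abs_cos_le_one _
  rw [sub_zero, abs_of_pos Real.pi_pos, one_mul] at h
  rw [Real.norm_eq_abs, abs_of_pos (by positivity), one_div, inv_mul_le_iff₀ Real.pi_pos, mul_one]
  exact h

/-- Iterating the three-term recurrence downwards shows that `J_n` is at most `t^n / n!`. -/
theorem norm_cJ_le {t : ℝ} (ht : 0 < t) (n : ℕ) :
    ∀ m : ℕ, n ≤ m → ‖cJ m t‖ ≤ t ^ n / (n.factorial : ℝ) := by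
  induction n with
  | zero => intro m _; simpa using norm_cJ_le_one m t
  | succ k ih =>
    intro m hm
    obtain ⟨l, rfl⟩ : ∃ l, m = l + 1 := ⟨m - 1, by omega⟩
    have hrec := cJ_recurrence (l + 1 : ℕ) ht
    have i1 : (((l + 1 : ℕ) : ℤ) - 1) = l := by push_cast; ring
    have i2 : (((l + 1 : ℕ) : ℤ) + 1) = (l + 1 + 1 : ℕ) := by push_cast; ring
    rw [i1, i2] at hrec
    have e : cJ (l + 1 : ℕ) t = ((t / (2 * (l + 1)) : ℝ) : ℂ) * (cJ l t + cJ (l + 1 + 1 : ℕ) t) := by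
      push_cast at hrec ⊢
      have h0 : (l + 1 : ℂ) ≠ 0 := by exact_mod_cast Nat.succ_ne_zero l
      field_simp
      linear_combination -hrec
    have h1 := ih l (by omega)
    have h2 := ih (l + 1 + 1) (by omega)
    rw [e, norm_mul, Complex.norm_real, Real.norm_eq_abs, abs_of_pos (by positivity)]
    have hkl : (k : ℝ) + 1 ≤ l + 1 := by exact_mod_cast hm
    calc t / (2 * (l + 1)) * ‖cJ l t + cJ (l + 1 + 1 : ℕ) t‖
        ≤ t / (2 * (k + 1)) * (t ^ k / (k.factorial : ℝ) + t ^ k / (k.factorial : ℝ)) := by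
          gcongr
          exact (norm_add_le _ _).trans (by gcongr)
      _ = t ^ (k + 1) / ((k + 1).factorial : ℝ) := by
          rw [Nat.factorial_succ]
          push_cast
          field_simp
          ring

theorem norm_cY_le_norm_hankel (n : ℤ) (t : ℝ) : ‖cY n t‖ ≤ ‖hankel n t‖ := by
  rw [cY_eq_im, Complex.norm_real]
  exact Complex.abs_im_le_norm _

/-- If `|H_n|` decreased from some order on, the Wronskian `J_{n+1} Y_n - J_n Y_{n+1}`, which does
not depend on `n`, would tend to zero with `J_n`. -/
theorem exists_norm_hankel_le_succ {t : ℝ} (ht : 0 < t) (N₀ : ℕ) :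
    ∃ n : ℕ, N₀ ≤ n ∧ ‖hankel n t‖ ≤ ‖hankel (n + 1 : ℕ) t‖ := by
  by_contra! hcon
  have hbd : ∀ n : ℕ, N₀ ≤ n → ‖hankel n t‖ ≤ ‖hankel N₀ t‖ := by
    intro n hn
    induction n, hn using Nat.le_induction with
    | base => exact le_rfl
    | succ k hk ih => exact (hcon k hk).le.trans ih
  have hJ : Tendsto (fun n : ℕ => 2 * (t ^ n / (n.factorial : ℝ)) * ‖hankel N₀ t‖) atTop (𝓝 0) := by
    simpa using ((FloorSemiring.tendsto_pow_div_factorial_atTop t).const_mul 2).mul_const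
      ‖hankel N₀ t‖
  have hpos : 0 < 2 / (Real.pi * t) := by positivity
  obtain ⟨n, hn, hlt⟩ := ((eventually_ge_atTop N₀).and (hJ.eventually (gt_mem_nhds hpos))).exists
  have h := im_star_hankel n ht
  have e : (((star (hankel (n + 1) t) * hankel n t).im : ℝ) : ℂ) =
      cJ (n + 1 : ℕ) t * cY n t - cJ n t * cY (n + 1 : ℕ) t := by
    rw [cJ_eq_re, cJ_eq_re, cY_eq_im, cY_eq_im]
    push_cast [Complex.mul_im, RCLike.star_def, Complex.conj_re, Complex.conj_im]
    ring
  rw [h] at e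
  have e2 := congrArg norm e
  rw [Complex.norm_real, Real.norm_eq_abs, abs_of_pos hpos] at e2
  have h1 := norm_cJ_le ht n n le_rfl
  have h2 := norm_cJ_le ht n (n + 1) (by omega)
  have h3 := (norm_cY_le_norm_hankel n t).trans (hbd n hn)
  have h4 := (norm_cY_le_norm_hankel (n + 1 : ℕ) t).trans (hbd (n + 1) (by omega))
  have h5 : ‖cJ (n + 1 : ℕ) t * cY n t - cJ n t * cY (n + 1 : ℕ) t‖ ≤
      t ^ n / (n.factorial : ℝ) * ‖hankel N₀ t‖ + t ^ n / (n.factorial : ℝ) * ‖hankel N₀ t‖ := by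
    refine (norm_sub_le _ _).trans ?_
    rw [norm_mul, norm_mul]
    gcongr
  linarith

theorem hankel_succ_eq {t : ℝ} (ht : 0 < t) (n : ℕ) :
    hankel (n + 1 + 1 : ℕ) t =
      ((2 * (n + 1) / t : ℝ) : ℂ) * hankel (n + 1 : ℕ) t - hankel n t := by
  have hrec := hankel_recurrence (n + 1 : ℕ) ht
  have i1 : (((n + 1 : ℕ) : ℤ) - 1) = n := by push_cast; ring
  have i2 : (((n + 1 : ℕ) : ℤ) + 1) = (n + 1 + 1 : ℕ) := by push_cast; ring
  rw [i1, i2] at hrec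
  have ht' : (t : ℂ) ≠ 0 := by exact_mod_cast ht.ne'
  push_cast at hrec ⊢
  field_simp
  linear_combination hrec

/-- Once `|H_n|` increases somewhere beyond `n = t`, the recurrence forces it to increase from
there on, and at least by the factor `(n + 1) / t`. -/
theorem exists_norm_hankel_growth {t : ℝ} (ht : 0 < t) : ∃ N : ℕ, ∀ n : ℕ, N ≤ n →
    ‖hankel n t‖ ≤ ‖hankel (n + 1 : ℕ) t‖ ∧
      (n + 1) / t * ‖hankel (n + 1 : ℕ) t‖ ≤ ‖hankel (n + 1 + 1 : ℕ) t‖ := by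
  obtain ⟨N, hN, hle⟩ := exists_norm_hankel_le_succ ht (⌈t⌉₊)
  have hstep : ∀ n : ℕ, N ≤ n → ‖hankel n t‖ ≤ ‖hankel (n + 1 : ℕ) t‖ →
      (n + 1) / t * ‖hankel (n + 1 : ℕ) t‖ ≤ ‖hankel (n + 1 + 1 : ℕ) t‖ ∧ 1 ≤ ((n : ℝ) + 1) / t := by
    intro n hn h
    have h1 : t ≤ n := (Nat.le_ceil t).trans (by exact_mod_cast hN.trans hn)
    have h2 : 1 ≤ ((n : ℝ) + 1) / t := by rw [le_div_iff₀ ht]; linarith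
    refine ⟨?_, h2⟩
    have h3 := norm_sub_norm_le (((2 * (n + 1) / t : ℝ) : ℂ) * hankel (n + 1 : ℕ) t) (hankel n t)
    rw [← hankel_succ_eq ht, norm_mul, Complex.norm_real, Real.norm_eq_abs,
      abs_of_pos (by positivity)] at h3
    have h4 : ‖hankel (n + 1 : ℕ) t‖ ≤ ((n : ℝ) + 1) / t * ‖hankel (n + 1 : ℕ) t‖ :=
      le_mul_of_one_le_left (norm_nonneg _) h2
    have h5 : 2 * ((n : ℝ) + 1) / t * ‖hankel (n + 1 : ℕ) t‖ =
        ((n : ℝ) + 1) / t * ‖hankel (n + 1 : ℕ) t‖ +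
        ((n : ℝ) + 1) / t * ‖hankel (n + 1 : ℕ) t‖ := by ring
    linarith
  refine ⟨N, fun n hn => ?_⟩
  have hmono : ‖hankel n t‖ ≤ ‖hankel (n + 1 : ℕ) t‖ := by
    induction n, hn using Nat.le_induction with
    | base => exact hle
    | succ k hk ih =>
      obtain ⟨h1, h2⟩ := hstep k hk ih
      exact (le_mul_of_one_le_left (norm_nonneg _) h2).trans h1
  exact ⟨hmono, (hstep n hn hmono).1⟩

/-- `n H_{n-1}(t) / H_n(t) → t / 2`. -/
theorem tendsto_mul_hankel_div {t : ℝ} (ht : 0 < t) :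
    Tendsto (fun n : ℕ => (n + 2 : ℂ) * hankel (n + 1 : ℕ) t / hankel (n + 1 + 1 : ℕ) t) atTop
      (𝓝 (t / 2)) := by
  obtain ⟨N, hN⟩ := exists_norm_hankel_growth ht
  have hn2 : Tendsto (fun n : ℕ => ((n : ℝ) + 2)⁻¹) atTop (𝓝 0) :=
    tendsto_inv_atTop_zero.comp (tendsto_atTop_add_const_right _ _ tendsto_natCast_atTop_atTop)
  have hn2' : Tendsto (fun n : ℕ => ((n + 2 : ℂ))⁻¹) atTop (𝓝 0) := by
    rw [tendsto_zero_iff_norm_tendsto_zero]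
    refine hn2.congr fun n => ?_
    rw [norm_inv, show (n + 2 : ℂ) = ((n + 2 : ℝ) : ℂ) by push_cast; rfl, Complex.norm_real,
      Real.norm_eq_abs, abs_of_pos (by positivity)]
  have ht' : (t : ℂ) ≠ 0 := by exact_mod_cast ht.ne'
  have hinv : Tendsto (fun n : ℕ => hankel (n + 1 + 1 : ℕ) t / ((n + 2 : ℂ) *
      hankel (n + 1 : ℕ) t)) atTop (𝓝 (2 / t)) := by
    have e : ∀ n : ℕ, hankel (n + 1 + 1 : ℕ) t / ((n + 2 : ℂ) * hankel (n + 1 : ℕ) t) =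
        2 / t - (2 / t) * (n + 2 : ℂ)⁻¹ -
          (n + 2 : ℂ)⁻¹ * (hankel n t / hankel (n + 1 : ℕ) t) := by
      intro n
      have h0 := hankel_ne_zero (n + 1 : ℕ) ht
      have h2 : (n + 2 : ℂ) ≠ 0 := by exact_mod_cast (Nat.succ_ne_zero (n + 1))
      rw [hankel_succ_eq ht]
      push_cast
      push_cast at h0
      field_simp
      ring
    simp_rw [e]
    have h3 : Tendsto (fun n : ℕ => (n + 2 : ℂ)⁻¹ * (hankel n t / hankel (n + 1 : ℕ) t)) atTop
        (𝓝 0) := by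
      refine hn2'.zero_mul_isBoundedUnder_le ?_
      refine isBoundedUnder_of_eventually_le (a := 1) ?_
      filter_upwards [eventually_ge_atTop N] with n hn
      simp only [Function.comp_apply, norm_div]
      exact div_le_one_of_le₀ (hN n hn).1 (norm_nonneg _)
    simpa using (tendsto_const_nhds.sub (hn2'.const_mul (2 / (t : ℂ)))).sub h3
  have h4 := hinv.inv₀ (div_ne_zero two_ne_zero ht')
  rw [inv_div] at h4
  refine h4.congr fun n => ?_
  rw [inv_div]

/-- `|x n|` is bounded by `A^(n+1) / (n!)^p` for some `A`. -/
def FactDecay (p : ℕ) (x : ℕ → ℝ) : Prop :=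
  ∃ A : ℝ, 1 ≤ A ∧ ∀ n, |x n| * (n.factorial : ℝ) ^ p ≤ A ^ (n + 1)

theorem FactDecay.of_eventually {p : ℕ} {x y : ℕ → ℝ} (hy : FactDecay p y)
    (h : ∀ᶠ n in atTop, |x n| ≤ y n) : FactDecay p x := by
  obtain ⟨A, hA, hb⟩ := hy
  obtain ⟨N, hN⟩ := eventually_atTop.1 h
  set S := ∑ n ∈ Finset.range N, |x n| * (n.factorial : ℝ) ^ p with hS
  have hS0 : 0 ≤ S := Finset.sum_nonneg fun n _ => by positivity
  refine ⟨A + S, by linarith, fun n => ?_⟩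
  by_cases hn : N ≤ n
  · calc |x n| * (n.factorial : ℝ) ^ p ≤ |y n| * (n.factorial : ℝ) ^ p :=
          mul_le_mul_of_nonneg_right ((hN n hn).trans (le_abs_self _)) (by positivity)
      _ ≤ A ^ (n + 1) := hb n
      _ ≤ (A + S) ^ (n + 1) := by gcongr; linarith
  · have h1 : |x n| * (n.factorial : ℝ) ^ p ≤ S :=
      Finset.single_le_sum (f := fun n => |x n| * (n.factorial : ℝ) ^ p)
        (fun n _ => by positivity) (Finset.mem_range.2 (not_le.1 hn))
    calc |x n| * (n.factorial : ℝ) ^ p ≤ A + S := by linarith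
      _ ≤ (A + S) ^ (n + 1) := le_self_pow₀ (by linarith) (by omega)

theorem FactDecay.add {p : ℕ} {x y : ℕ → ℝ} (hx : FactDecay p x) (hy : FactDecay p y) :
    FactDecay p fun n => x n + y n := by
  obtain ⟨A, hA, ha⟩ := hx
  obtain ⟨B, hB, hb⟩ := hy
  refine ⟨2 * (A + B), by linarith, fun n => ?_⟩
  have h1 : A ^ (n + 1) ≤ (A + B) ^ (n + 1) := by gcongr; linarith
  have h2 : B ^ (n + 1) ≤ (A + B) ^ (n + 1) := by gcongr; linarith
  have h3 : (2 : ℝ) ≤ 2 ^ (n + 1) := le_self_pow₀ (by norm_num) (by omega)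
  calc |x n + y n| * (n.factorial : ℝ) ^ p
      ≤ (|x n| + |y n|) * (n.factorial : ℝ) ^ p := by gcongr; exact abs_add_le _ _
    _ = |x n| * (n.factorial : ℝ) ^ p + |y n| * (n.factorial : ℝ) ^ p := by ring
    _ ≤ 2 * (A + B) ^ (n + 1) := by linarith [ha n, hb n]
    _ ≤ 2 ^ (n + 1) * (A + B) ^ (n + 1) := by gcongr
    _ = (2 * (A + B)) ^ (n + 1) := by rw [mul_pow]

theorem FactDecay.mul {p q : ℕ} {x y : ℕ → ℝ} (hx : FactDecay p x) (hy : FactDecay q y) :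
    FactDecay (p + q) fun n => x n * y n := by
  obtain ⟨A, hA, ha⟩ := hx
  obtain ⟨B, hB, hb⟩ := hy
  refine ⟨A * B, one_le_mul_of_one_le_of_one_le hA hB, fun n => ?_⟩
  have h := mul_le_mul (ha n) (hb n) (by positivity) (by positivity)
  rw [mul_pow, abs_mul, pow_add]
  calc _ = |x n| * (n.factorial : ℝ) ^ p * (|y n| * (n.factorial : ℝ) ^ q) := by ring
    _ ≤ _ := h

theorem factDecay_const (c : ℝ) : FactDecay 0 fun _ => c := by
  refine ⟨|c| + 1, by linarith [abs_nonneg c], fun n => ?_⟩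
  rw [pow_zero, mul_one]
  have h : 1 ≤ |c| + 1 := by linarith [abs_nonneg c]
  calc |c| ≤ |c| + 1 := by linarith
    _ ≤ (|c| + 1) ^ (n + 1) := le_self_pow₀ h (by omega)

theorem factDecay_natCast : FactDecay 0 fun n => (n : ℝ) := by
  refine ⟨2, one_le_two, fun n => ?_⟩
  rw [pow_zero, mul_one, Nat.abs_cast]
  have : n < 2 ^ n := Nat.lt_two_pow_self
  calc (n : ℝ) ≤ 2 ^ n := by exact_mod_cast this.le
    _ ≤ 2 ^ (n + 1) := pow_le_pow_right₀ one_le_two (by omega)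

theorem factDecay_cJ {t : ℝ} (ht : 0 < t) : FactDecay 1 fun n => ‖cJ n t‖ := by
  refine ⟨t + 1, by linarith, fun n => ?_⟩
  rw [pow_one, abs_norm, ← le_div_iff₀ (by positivity)]
  refine (norm_cJ_le ht n n le_rfl).trans ?_
  gcongr
  calc t ^ n ≤ (t + 1) ^ n := by gcongr; linarith
    _ ≤ (t + 1) ^ (n + 1) := pow_le_pow_right₀ (by linarith) (by omega)

theorem factDecay_cJ_succ {t : ℝ} (ht : 0 < t) : FactDecay 1 fun n => ‖cJ (n + 1 : ℕ) t‖ := by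
  refine ⟨t + 1, by linarith, fun n => ?_⟩
  rw [pow_one, abs_norm, ← le_div_iff₀ (by positivity)]
  refine (norm_cJ_le ht n (n + 1) (by omega)).trans ?_
  gcongr
  calc t ^ n ≤ (t + 1) ^ n := by gcongr; linarith
    _ ≤ (t + 1) ^ (n + 1) := pow_le_pow_right₀ (by linarith) (by omega)

theorem factDecay_inv_hankel {t : ℝ} (ht : 0 < t) : FactDecay 1 fun n => ‖hankel n t‖⁻¹ := by
  obtain ⟨N, hN⟩ := exists_norm_hankel_growth ht
  set c := ‖hankel (N + 1 : ℕ) t‖ with hc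
  have hcpos : 0 < c := norm_pos_iff.2 (hankel_ne_zero _ ht)
  have hlow : ∀ n : ℕ, N + 1 ≤ n →
      c / (N.factorial : ℝ) * ((n - 1).factorial : ℝ) ≤ ‖hankel n t‖ * (t + 1) ^ n := by
    intro n hn
    induction n, hn using Nat.le_induction with
    | base =>
      rw [Nat.add_sub_cancel, div_mul_cancel₀ _ (by positivity)]
      exact le_mul_of_one_le_right (norm_nonneg _) (one_le_pow₀ (by linarith))
    | succ k hk ih =>
      obtain ⟨l, rfl⟩ : ∃ l, k = l + 1 := ⟨k - 1, by omega⟩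
      have h1 := (hN l (by omega)).2
      rw [Nat.add_sub_cancel] at ih ⊢
      rw [Nat.factorial_succ, pow_succ]
      rw [div_mul_eq_mul_div, div_le_iff₀ ht] at h1
      push_cast
      calc c / (N.factorial : ℝ) * (((l : ℝ) + 1) * (l.factorial : ℝ))
          = (l + 1) * (c / (N.factorial : ℝ) * (l.factorial : ℝ)) := by ring
        _ ≤ (l + 1) * (‖hankel (l + 1 : ℕ) t‖ * (t + 1) ^ (l + 1)) := by gcongr
        _ = ((l + 1) * ‖hankel (l + 1 : ℕ) t‖) * (t + 1) ^ (l + 1) := by ring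
        _ ≤ (‖hankel (l + 1 + 1 : ℕ) t‖ * (t + 1)) * (t + 1) ^ (l + 1) := by
            refine mul_le_mul_of_nonneg_right (h1.trans ?_) (by positivity)
            exact mul_le_mul_of_nonneg_left (by linarith) (norm_nonneg _)
        _ = _ := by push_cast; ring
  have hy : FactDecay 1 fun n : ℕ =>
      (n : ℝ) * ((N.factorial : ℝ) / c) * ((t + 1) ^ n / (n.factorial : ℝ)) := by
    have h1 : FactDecay 1 fun n : ℕ => (t + 1) ^ n / (n.factorial : ℝ) := by
      refine ⟨t + 1, by linarith, fun n => ?_⟩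
      rw [pow_one, abs_of_pos (by positivity), div_mul_cancel₀ _ (by positivity)]
      exact pow_le_pow_right₀ (by linarith) (by omega)
    exact (factDecay_natCast.mul (factDecay_const _)).mul h1
  refine hy.of_eventually ?_
  filter_upwards [eventually_ge_atTop (N + 1)] with n hn
  have h1 := hlow n hn
  obtain ⟨l, rfl⟩ : ∃ l, n = l + 1 := ⟨n - 1, by omega⟩
  have hp : 0 < ‖hankel (l + 1 : ℕ) t‖ := norm_pos_iff.2 (hankel_ne_zero _ ht)
  rw [abs_inv, abs_norm, inv_le_comm₀ hp (by positivity)]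
  rw [Nat.add_sub_cancel] at h1
  have e : (((l + 1 : ℕ) : ℝ) * ((N.factorial : ℝ) / c) *
      ((t + 1) ^ (l + 1) / ((l + 1).factorial : ℝ)))⁻¹ =
      c / (N.factorial : ℝ) * (l.factorial : ℝ) / (t + 1) ^ (l + 1) := by
    rw [Nat.factorial_succ]
    push_cast
    field_simp
  rw [e, div_le_iff₀ (by positivity)]
  exact h1

/-- The determinant of `𝓗_n` is asymptotically `-(a² + b²)/2 H_n(a) H_n(b)`: the leading terms
cancel. -/
theorem tendsto_det_div {a b : ℝ} (ha : 0 < a) (hb : 0 < b) :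
    Tendsto (fun n : ℕ => (cylMatrix hankel (n + 1 + 1 : ℕ) a b).det /
      (hankel (n + 1 + 1 : ℕ) a * hankel (n + 1 + 1 : ℕ) b)) atTop
      (𝓝 (-(a ^ 2 + b ^ 2) / 2)) := by
  have hA := tendsto_mul_hankel_div ha
  have hB := tendsto_mul_hankel_div hb
  have hn2 : Tendsto (fun n : ℕ => ((n : ℝ) + 2)⁻¹) atTop (𝓝 0) :=
    tendsto_inv_atTop_zero.comp (tendsto_atTop_add_const_right _ _ tendsto_natCast_atTop_atTop)
  have hn2' : Tendsto (fun n : ℕ => ((n + 2 : ℂ))⁻¹) atTop (𝓝 0) := by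
    rw [tendsto_zero_iff_norm_tendsto_zero]
    refine hn2.congr fun n => ?_
    rw [norm_inv, show (n + 2 : ℂ) = ((n + 2 : ℝ) : ℂ) by push_cast; rfl, Complex.norm_real,
      Real.norm_eq_abs, abs_of_pos (by positivity)]
  have hlim := (((hA.const_mul (a : ℂ)).add (hB.const_mul (b : ℂ))).neg).add
    (((hA.mul hB).const_mul (a * b : ℂ)).mul (hn2'.pow 2))
  have hval : -((a : ℂ) * (a / 2) + b * (b / 2)) + (a * b : ℂ) * (a / 2 * (b / 2)) * 0 ^ 2 =
      -(a ^ 2 + b ^ 2) / 2 := by ring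
  rw [hval] at hlim
  refine hlim.congr fun n => ?_
  have h1 := hankel_ne_zero (n + 1 + 1 : ℕ) ha
  have h2 := hankel_ne_zero (n + 1 + 1 : ℕ) hb
  have h3 : (n + 2 : ℂ) ≠ 0 := by exact_mod_cast (Nat.succ_ne_zero (n + 1))
  have i1 : (((n + 1 + 1 : ℕ) : ℤ) - 1) = (n + 1 : ℕ) := by push_cast; ring
  rw [det_cylMatrix, isCylinder_hankel.deriv_eq' _ ha, isCylinder_hankel.deriv_eq' _ hb, i1]
  have i2 : (((n + 1 + 1 : ℕ) : ℤ) : ℂ) = n + 2 := by push_cast; ring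
  rw [i2]
  field_simp
  ring

theorem norm_mul_deriv_hankel_le {t : ℝ} (ht : 0 < t) :
    ∀ᶠ n : ℕ in atTop, ‖(t : ℂ) * deriv (hankel n) t‖ ≤ (n + t) * ‖hankel n t‖ := by
  obtain ⟨N, hN⟩ := exists_norm_hankel_growth ht
  filter_upwards [eventually_ge_atTop (N + 1)] with n hn
  obtain ⟨l, rfl⟩ : ∃ l, n = l + 1 := ⟨n - 1, by omega⟩
  have i1 : (((l + 1 : ℕ) : ℤ) - 1) = l := by push_cast; ring
  rw [isCylinder_hankel.deriv_eq' _ ht, i1]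
  refine (norm_sub_le _ _).trans ?_
  rw [norm_mul, norm_mul, Complex.norm_real, Real.norm_eq_abs, abs_of_pos ht]
  have h1 := (hN l (by omega)).1
  have h2 : ‖(((l + 1 : ℕ) : ℤ) : ℂ)‖ = (l + 1 : ℕ) := by
    rw [Int.cast_natCast, Complex.norm_natCast]
  rw [h2]
  have := mul_le_mul_of_nonneg_left h1 ht.le
  linarith

/-- Cramer's rule for `Σ_n`, which separates the small determinant from the entries. -/
theorem sigmaMatrix_apply (n : ℤ) {a b : ℝ} (ha : 0 < a) (hb : 0 < b) (i j : Fin 2) :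
    (cylMatrix hankel n a b).det * sigmaMatrix n a b i j =
      ((cylMatrix hankel n a b).adjugate * cylMatrix cJ n a b) i j := by
  have h := det_cylMatrix_hankel_ne_zero n ha hb
  rw [sigmaMatrix, Matrix.inv_def, Ring.inverse_eq_inv', Matrix.smul_mul, Matrix.smul_apply,
    smul_eq_mul, mul_inv_cancel_left₀ h]

/-- The entries of `Σ_n` decay like `1 / (n!)²`: one factorial comes from `𝓙_n`, the other from
`𝓗_n⁻¹`, whose determinant has size `|H_n(a) H_n(b)|`. -/
theorem factDecay_sigmaMatrix {a b : ℝ} (ha : 0 < a) (hb : 0 < b) (i j : Fin 2) :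
    FactDecay 2 fun n => ‖sigmaMatrix n a b i j‖ := by
  -- a common bound for the entries of `𝓙_n`
  set B : ℕ → ℝ := fun n => ((n : ℝ) * ‖cJ n a‖ + a * ‖cJ (n + 1 : ℕ) a‖) +
    ((n : ℝ) * ‖cJ n b‖ + b * ‖cJ (n + 1 : ℕ) b‖) with hB
  have hBd : FactDecay 1 B := by
    have h : ∀ {t : ℝ}, 0 < t →
        FactDecay 1 fun n : ℕ => (n : ℝ) * ‖cJ n t‖ + t * ‖cJ (n + 1 : ℕ) t‖ := fun ht => by
      simpa using (factDecay_natCast.mul (factDecay_cJ ht)).add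
        ((factDecay_const _).mul (factDecay_cJ_succ ht))
    exact (h ha).add (h hb)
  have hBle : ∀ (n : ℕ) (i j : Fin 2), ‖cylMatrix cJ n a b i j‖ ≤ B n := by
    intro n i j
    have h1 : ∀ {t : ℝ}, 0 < t → ‖(t : ℂ) * deriv (cJ n) t‖ ≤
        (n : ℝ) * ‖cJ n t‖ + t * ‖cJ (n + 1 : ℕ) t‖ := by
      intro t ht
      rw [isCylinder_cJ.deriv_eq _ ht]
      refine (norm_sub_le _ _).trans ?_
      rw [norm_mul, norm_mul, Complex.norm_real, Real.norm_eq_abs, abs_of_pos ht, Int.cast_natCast,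
        Complex.norm_natCast]
      push_cast
      exact le_rfl
    have h2 : ∀ t, ‖Complex.I * n * cJ n t‖ = n * ‖cJ n t‖ := fun t => by
      rw [norm_mul, norm_mul, Complex.norm_I, Complex.norm_natCast, one_mul]
    have ha1 := h1 ha
    have hb1 := h1 hb
    have p1 : 0 ≤ (n : ℝ) * ‖cJ n a‖ := by positivity
    have p2 : 0 ≤ (n : ℝ) * ‖cJ n b‖ := by positivity
    have p3 : 0 ≤ a * ‖cJ (n + 1 : ℕ) a‖ := by positivity
    have p4 : 0 ≤ b * ‖cJ (n + 1 : ℕ) b‖ := by positivity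
    fin_cases i <;> fin_cases j <;> simp only [cylMatrix, Fin.zero_eta, Fin.mk_one, Matrix.of_apply,
      Matrix.cons_val_zero, Matrix.cons_val_one, Matrix.cons_val_fin_one, norm_neg, Int.cast_natCast,
      h2, hB] <;> linarith
  -- a common bound for the entries of `𝓗_n⁻¹`
  set c := (a ^ 2 + b ^ 2) / 4 with hc
  have hcpos : 0 < c := by positivity
  set G : ℕ → ℝ := fun n => ((n : ℝ) + (a + b)) / c * (‖hankel n a‖⁻¹ + ‖hankel n b‖⁻¹) with hG
  have hGd : FactDecay 1 G := by
    have h := (((factDecay_natCast.add (factDecay_const (a + b))).mul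
      (factDecay_const c⁻¹))).mul ((factDecay_inv_hankel ha).add (factDecay_inv_hankel hb))
    simpa [hG, div_eq_mul_inv] using h
  have hdet : ∀ᶠ n : ℕ in atTop, c * (‖hankel n a‖ * ‖hankel n b‖) ≤
      ‖(cylMatrix hankel n a b).det‖ := by
    have hlt : c < ‖(-(a ^ 2 + b ^ 2) / 2 : ℂ)‖ := by
      rw [show (-(a ^ 2 + b ^ 2) / 2 : ℂ) = ((-(a ^ 2 + b ^ 2) / 2 : ℝ) : ℂ) by push_cast; rfl,
        Complex.norm_real, Real.norm_eq_abs, neg_div, abs_neg, abs_of_pos (by positivity), hc]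
      have : 0 < a ^ 2 + b ^ 2 := by positivity
      linarith
    have hev := (tendsto_det_div ha hb).norm.eventually (lt_mem_nhds hlt)
    obtain ⟨N, hN⟩ := eventually_atTop.1 hev
    filter_upwards [eventually_ge_atTop (N + 2)] with n hn
    obtain ⟨l, rfl⟩ : ∃ l, n = l + 1 + 1 := ⟨n - 2, by omega⟩
    have h := hN l (by omega)
    rw [norm_div, norm_mul] at h
    have hpa : 0 < ‖hankel (l + 1 + 1 : ℕ) a‖ := norm_pos_iff.2 (hankel_ne_zero _ ha)
    have hpb : 0 < ‖hankel (l + 1 + 1 : ℕ) b‖ := norm_pos_iff.2 (hankel_ne_zero _ hb)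
    rw [lt_div_iff₀ (by positivity)] at h
    exact h.le
  have hy : FactDecay 2 fun n => 2 * (G n * B n) := by
    simpa using (factDecay_const 2).mul (hGd.mul hBd)
  refine hy.of_eventually ?_
  filter_upwards [hdet, norm_mul_deriv_hankel_le ha, norm_mul_deriv_hankel_le hb] with n h1 h2 h3
  have hpa : 0 < ‖hankel n a‖ := norm_pos_iff.2 (hankel_ne_zero _ ha)
  have hpb : 0 < ‖hankel n b‖ := norm_pos_iff.2 (hankel_ne_zero _ hb)
  have hadj : ∀ i j : Fin 2, ‖(cylMatrix hankel n a b).adjugate i j‖ ≤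
      ((n : ℝ) + (a + b)) * (‖hankel n a‖ + ‖hankel n b‖) := by
    intro i j
    have q : ∀ t, ‖Complex.I * n * hankel n t‖ = n * ‖hankel n t‖ := fun t => by
      rw [norm_mul, norm_mul, Complex.norm_I, Complex.norm_natCast, one_mul]
    have p1 : 0 ≤ (n : ℝ) * ‖hankel n a‖ := by positivity
    have p2 : 0 ≤ (n : ℝ) * ‖hankel n b‖ := by positivity
    have p3 : 0 ≤ a * ‖hankel n a‖ := by positivity
    have p4 : 0 ≤ b * ‖hankel n b‖ := by positivity
    have p5 : 0 ≤ a * ‖hankel n b‖ := by positivity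
    have p6 : 0 ≤ b * ‖hankel n a‖ := by positivity
    fin_cases i <;> fin_cases j <;> simp only [cylMatrix, Matrix.adjugate_fin_two_of, Fin.zero_eta,
      Fin.mk_one, Matrix.of_apply,
      Matrix.cons_val_zero, Matrix.cons_val_one, Matrix.cons_val_fin_one, norm_neg, Int.cast_natCast,
      q, neg_neg] <;> linarith
  have hprod : ‖(cylMatrix hankel n a b).det‖ * ‖sigmaMatrix n a b i j‖ ≤
      2 * ((((n : ℝ) + (a + b)) * (‖hankel n a‖ + ‖hankel n b‖)) * B n) := by
    rw [← norm_mul, sigmaMatrix_apply _ ha hb, Matrix.mul_apply, Fin.sum_univ_two]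
    refine (norm_add_le _ _).trans ?_
    rw [norm_mul, norm_mul, two_mul]
    have hB0 : 0 ≤ B n := (norm_nonneg _).trans (hBle n 0 0)
    gcongr
    · exact hadj _ _
    · exact hBle _ _ _
    · exact hadj _ _
    · exact hBle _ _ _
  rw [abs_norm]
  have hpos : 0 < c * (‖hankel n a‖ * ‖hankel n b‖) := by positivity
  have h4 : c * (‖hankel n a‖ * ‖hankel n b‖) * ‖sigmaMatrix n a b i j‖ ≤
      2 * ((((n : ℝ) + (a + b)) * (‖hankel n a‖ + ‖hankel n b‖)) * B n) :=
    (mul_le_mul_of_nonneg_right h1 (norm_nonneg _)).trans hprod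
  rw [mul_comm, ← le_div_iff₀ hpos] at h4
  refine h4.trans (le_of_eq ?_)
  rw [hG]
  field_simp
  ring

theorem cylMatrix_neg {f : ℤ → ℝ → ℂ} (hf : ∀ (n : ℤ) {t : ℝ}, 0 < t → f (-n) t = (-1) ^ n * f n t)
    (n : ℤ) {a b : ℝ} (ha : 0 < a) (hb : 0 < b) :
    cylMatrix f (-n) a b =
      (-1 : ℂ) ^ n • (!![1, 0; 0, -1] * cylMatrix f n a b * !![1, 0; 0, -1]) := by
  have hd : ∀ {t : ℝ}, 0 < t → deriv (f (-n)) t = (-1) ^ n * deriv (f n) t := by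
    intro t ht
    have h : f (-n) =ᶠ[𝓝 t] fun t => (-1) ^ n * f n t := by
      filter_upwards [Ioi_mem_nhds ht] with x hx using hf n hx
    rw [h.deriv_eq, deriv_const_mul_field]
  rw [cylMatrix, cylMatrix, hd ha, hd hb, hf n ha, hf n hb]
  ext i j
  fin_cases i <;> fin_cases j <;> simp <;> ring

/-- Changing the sign of `n` conjugates `Σ_n` with the reflection `diag(1, -1)`. -/
theorem sigmaMatrix_neg (n : ℤ) {a b : ℝ} (ha : 0 < a) (hb : 0 < b) :
    sigmaMatrix (-n) a b = !![1, 0; 0, -1] * sigmaMatrix n a b * !![1, 0; 0, -1] := by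
  have hS : (!![1, 0; 0, -1] : Matrix (Fin 2) (Fin 2) ℂ) * !![1, 0; 0, -1] = 1 := by
    ext i j
    fin_cases i <;> fin_cases j <;> simp [Matrix.mul_apply, Fin.sum_univ_two]
  have hu := isUnit_det_cylMatrix_hankel n ha hb
  have hu' := isUnit_det_cylMatrix_hankel (-n) ha hb
  have hJ : cylMatrix cJ n a b = cylMatrix hankel n a b * sigmaMatrix n a b := by
    rw [sigmaMatrix, ← mul_assoc, Matrix.mul_nonsing_inv _ hu, one_mul]
  rw [sigmaMatrix, cylMatrix_neg (fun n => cJ_neg n) n ha hb, hJ]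
  have h1 : (-1 : ℂ) ^ n • (!![1, 0; 0, -1] * (cylMatrix hankel n a b * sigmaMatrix n a b) *
      !![1, 0; 0, -1]) = cylMatrix hankel (-n) a b *
      (!![1, 0; 0, -1] * sigmaMatrix n a b * !![1, 0; 0, -1]) := by
    rw [cylMatrix_neg (fun n => hankel_neg n) n ha hb, Matrix.smul_mul]
    congr 1
    simp only [mul_assoc]
    rw [← mul_assoc !![1, 0; 0, -1] !![1, 0; 0, -1], hS, one_mul]
  rw [h1, ← mul_assoc, Matrix.nonsing_inv_mul _ hu', one_mul]

theorem norm_sigmaMatrix_neg (n : ℤ) {a b : ℝ} (ha : 0 < a) (hb : 0 < b) (i j : Fin 2) :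
    ‖sigmaMatrix (-n) a b i j‖ = ‖sigmaMatrix n a b i j‖ := by
  rw [sigmaMatrix_neg n ha hb]
  fin_cases i <;> fin_cases j <;> simp [Matrix.mul_apply, Matrix.vecMul, dotProduct, Fin.sum_univ_two]

/-- A family of coefficients for which all series of cylinder functions converge. -/
def Fast (x : ℤ → ℂ) : Prop := ∀ C : ℝ, 1 ≤ C → Summable fun n => ‖x n‖ * growth C n

/-- The decay `1 / (n!)²` of `Σ_n` beats the growth `C^n n!` of the Hankel functions. -/
theorem fast_sigmaMatrix {a b : ℝ} (ha : 0 < a) (hb : 0 < b) (i j : Fin 2) :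
    Fast fun n => sigmaMatrix n a b i j := by
  intro C hC
  obtain ⟨A, hA, hb'⟩ := factDecay_sigmaMatrix ha hb i j
  have hnat : Summable fun n : ℕ => ‖sigmaMatrix n a b i j‖ * growth C n := by
    have hs : Summable fun n : ℕ => A * ((A * C) ^ n / (n.factorial : ℝ)) :=
      (Real.summable_pow_div_factorial (A * C)).mul_left A
    refine Summable.of_nonneg_of_le (fun n => ?_) (fun n => ?_) hs
    · exact mul_nonneg (norm_nonneg _) (growth_pos (by linarith) _).le
    · have h := hb' n
      rw [abs_norm] at h
      rw [growth, Int.natAbs_natCast, ← mul_div_assoc, le_div_iff₀ (by positivity), mul_pow]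
      calc ‖sigmaMatrix n a b i j‖ * (C ^ n * (n.factorial : ℝ)) * (n.factorial : ℝ)
          = ‖sigmaMatrix n a b i j‖ * (n.factorial : ℝ) ^ 2 * C ^ n := by ring
        _ ≤ A ^ (n + 1) * C ^ n := by gcongr
        _ = _ := by ring
  refine Summable.of_nat_of_neg hnat ?_
  refine hnat.congr fun n => ?_
  rw [norm_sigmaMatrix_neg _ ha hb, growth_neg]

/-! ### Polar coordinates -/

/-- A point of the plane as a complex number. -/
def zeta (x : Plane) : ℂ := x 0 + Complex.I * x 1

theorem cosA_coe (x : ℝ) : cosA (x : S) = Real.cos x := Real.Angle.cos_coe x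

theorem sinA_coe (x : ℝ) : sinA (x : S) = Real.sin x := Real.Angle.sin_coe x

theorem cosA_sq_add (θ : S) : (cosA θ : ℂ) ^ 2 + (sinA θ : ℂ) ^ 2 = 1 := by
  exact_mod_cast cosA_sq_add_sinA_sq θ

theorem dir_zero (θ : S) : dir θ 0 = cosA θ := rfl

theorem dir_one (θ : S) : dir θ 1 = sinA θ := rfl

theorem norm_dir (θ : S) : ‖dir θ‖ = 1 := by
  rw [EuclideanSpace.norm_eq]
  simp [Fin.sum_univ_two, dir_zero, dir_one, cosA_sq_add_sinA_sq]

theorem norm_smul_dir {r : ℝ} (hr : 0 ≤ r) (θ : S) : ‖r • dir θ‖ = r := by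
  rw [norm_smul, norm_dir, mul_one, Real.norm_eq_abs, abs_of_nonneg hr]

theorem fourier_one_eq (θ : S) : fourier 1 θ = (cosA θ : ℂ) + Complex.I * sinA θ := by
  induction θ using QuotientAddGroup.induction_on with
  | H x =>
    have h := fourier_coe_apply (T := 2 * Real.pi) (n := 1) (x := x)
    rw [show ((QuotientAddGroup.mk x : S)) = (x : S) from rfl, h, cosA_coe, sinA_coe]
    have : 2 * Real.pi * Complex.I * ((1 : ℤ) : ℂ) * x / ((2 * Real.pi : ℝ) : ℂ) =
        x * Complex.I := by
      have hpi : (Real.pi : ℂ) ≠ 0 := by exact_mod_cast Real.pi_ne_zero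
      push_cast
      field_simp
    rw [this, Complex.exp_mul_I]
    push_cast
    ring

theorem fourier_eq_zpow (n : ℤ) (θ : S) :
    fourier n θ = ((cosA θ : ℂ) + Complex.I * sinA θ) ^ n := by
  rw [← fourier_one_eq, fourier_apply, fourier_apply, one_zsmul, AddCircle.toCircle_zsmul]
  exact Circle.coe_zpow _ _

theorem norm_fourier (n : ℤ) (θ : S) : ‖(fourier n θ : ℂ)‖ = 1 := by
  rw [fourier_apply]
  exact Circle.norm_coe _

theorem zeta_smul_dir (r : ℝ) (θ : S) : zeta (r • dir θ) = r * fourier 1 θ := by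
  rw [fourier_one_eq, zeta]
  simp [dir_zero, dir_one]
  ring

theorem norm_zeta (x : Plane) : ‖zeta x‖ = ‖x‖ := by
  rw [EuclideanSpace.norm_eq, Fin.sum_univ_two, zeta, Complex.norm_eq_sqrt_sq_add_sq]
  simp

theorem zeta_mul_conj (x : Plane) :
    (x 0 + Complex.I * x 1) * (x 0 - Complex.I * x 1) = (‖x‖ : ℂ) ^ 2 := by
  have h : ‖x‖ ^ 2 = x 0 ^ 2 + x 1 ^ 2 := by
    rw [EuclideanSpace.norm_sq_eq, Fin.sum_univ_two]
    simp
  have h2 : (‖x‖ : ℂ) ^ 2 = (x 0 : ℂ) ^ 2 + (x 1 : ℂ) ^ 2 := by exact_mod_cast h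
  rw [h2]
  linear_combination (-(x 1 : ℂ) ^ 2) * Complex.I_sq

/-- Every point of the plane has polar coordinates. -/
theorem exists_eq_smul_dir (x : Plane) : ∃ θ : S, x = ‖x‖ • dir θ := by
  refine ⟨((Complex.arg (zeta x) : ℝ) : S), ?_⟩
  have h1 := Complex.norm_mul_cos_arg (zeta x)
  have h2 := Complex.norm_mul_sin_arg (zeta x)
  have hre : (zeta x).re = x 0 := by simp [zeta]
  have him : (zeta x).im = x 1 := by simp [zeta]
  rw [norm_zeta] at h1 h2
  rw [hre] at h1
  rw [him] at h2
  ext i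
  fin_cases i
  · simp [dir_zero, cosA_coe, h1]
  · simp [dir_one, sinA_coe, h2]

theorem inner_smul_dir_dir (r : ℝ) (θ d : S) : inner ℝ (r • dir θ) (dir d) = r * cosA (θ - d) := by
  have h : cosA (θ - d) = cosA θ * cosA d + sinA θ * sinA d := by
    induction θ using QuotientAddGroup.induction_on with
    | H x =>
      induction d using QuotientAddGroup.induction_on with
      | H y =>
        rw [← QuotientAddGroup.mk_sub]
        exact Real.cos_sub x y
  rw [real_inner_smul_left, h]
  simp [PiLp.inner_apply, Fin.sum_univ_two, dir_zero, dir_one]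
  left
  ring

/-- Bessel's integral over a full period. -/
theorem cJ_eq_integral (n : ℤ) (t : ℝ) :
    2 * Real.pi * cJ n t = ∫ s in (-Real.pi)..Real.pi,
      Complex.exp (Complex.I * (t * Real.sin s - n * s : ℝ)) := by
  have hint : ∀ a b : ℝ, IntervalIntegrable
      (fun s : ℝ => Complex.exp (Complex.I * (t * Real.sin s - n * s : ℝ))) volume a b :=
    fun a b => Continuous.intervalIntegrable (by fun_prop) _ _
  rw [← intervalIntegral.integral_add_adjacent_intervals (hint (-Real.pi) 0) (hint 0 Real.pi)]
  have h1 := intervalIntegral.integral_comp_neg (a := 0) (b := Real.pi)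
    (fun s : ℝ => Complex.exp (Complex.I * (t * Real.sin s - n * s : ℝ)))
  rw [neg_zero] at h1
  rw [← h1, ← intervalIntegral.integral_add
    (Continuous.intervalIntegrable (by fun_prop) _ _) (hint 0 Real.pi)]
  have h2 : cJ n t = (1 / Real.pi : ℂ) *
      ∫ s in (0 : ℝ)..Real.pi, ((Real.cos (n * s - t * Real.sin s) : ℝ) : ℂ) := by
    rw [intervalIntegral.integral_ofReal, cJ, besselJ]
    push_cast
    ring
  have hpi : (Real.pi : ℂ) ≠ 0 := by exact_mod_cast Real.pi_ne_zero
  rw [h2, ← mul_assoc, show 2 * (Real.pi : ℂ) * (1 / Real.pi) = 2 by field_simp,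
    ← intervalIntegral.integral_const_mul]
  refine intervalIntegral.integral_congr fun s _ => ?_
  simp only [Real.sin_neg]
  rw [mul_comm Complex.I, mul_comm Complex.I, Complex.exp_mul_I, Complex.exp_mul_I,
    ← Real.cos_neg (n * s - t * Real.sin s)]
  rw [show t * -Real.sin s - n * -s = -(t * Real.sin s - n * s) by ring,
    show -(n * s - t * Real.sin s) = t * Real.sin s - n * s by ring, Complex.ofReal_neg,
    Complex.cos_neg, Complex.sin_neg]
  push_cast
  ring

theorem summable_norm_cJ {t : ℝ} (ht : 0 < t) : Summable fun n : ℤ => ‖cJ n t‖ := by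
  have hnat : Summable fun n : ℕ => ‖cJ n t‖ :=
    Summable.of_nonneg_of_le (fun n => norm_nonneg _) (fun n => norm_cJ_le ht n n le_rfl)
      (Real.summable_pow_div_factorial t)
  refine Summable.of_nat_of_neg hnat (hnat.congr fun n => ?_)
  rw [cJ_neg _ ht, norm_mul]
  simp

/-- The Jacobi–Anger expansion. -/
theorem hasSum_jacobi_anger {t : ℝ} (ht : 0 < t) (φ : S) :
    HasSum (fun n : ℤ => Complex.I ^ n * cJ n t * fourier n φ)
      (Complex.exp (Complex.I * (t * cosA φ : ℝ))) := by
  have hcont : Continuous fun φ : S => Complex.exp (Complex.I * (t * cosA φ : ℝ)) := by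
    have := continuous_cosA
    fun_prop
  set f : C(S, ℂ) := ⟨fun φ => Complex.exp (Complex.I * (t * cosA φ : ℝ)), hcont⟩ with hf
  have hcoef : ∀ n : ℤ, fourierCoeff f n = Complex.I ^ n * cJ n t := by
    intro n
    rw [fourierCoeff_eq_intervalIntegral f n (-Real.pi - Real.pi / 2)]
    have hpi : (Real.pi : ℂ) ≠ 0 := by exact_mod_cast Real.pi_ne_zero
    have h1 : ∫ x in (-Real.pi - Real.pi / 2)..(-Real.pi - Real.pi / 2 + 2 * Real.pi),
        fourier (-n) (x : S) • f x = Complex.I ^ n * (2 * Real.pi * cJ n t) := by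
      rw [cJ_eq_integral n t, ← intervalIntegral.integral_const_mul]
      have h2 := intervalIntegral.integral_comp_add_right
        (a := -Real.pi - Real.pi / 2) (b := -Real.pi - Real.pi / 2 + 2 * Real.pi)
        (fun s : ℝ => Complex.I ^ n * Complex.exp (Complex.I * (t * Real.sin s - n * s : ℝ)))
        (Real.pi / 2)
      rw [show -Real.pi - Real.pi / 2 + Real.pi / 2 = -Real.pi by ring,
        show -Real.pi - Real.pi / 2 + 2 * Real.pi + Real.pi / 2 = Real.pi by ring] at h2
      rw [← h2]
      refine intervalIntegral.integral_congr fun s _ => ?_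
      simp only [hf, ContinuousMap.coe_mk, cosA_coe, smul_eq_mul]
      have h3 : (fourier (-n) (s : S) : ℂ) = Complex.exp (-(n * s * Complex.I)) := by
        rw [fourier_coe_apply]
        congr 1
        push_cast
        field_simp
      have h4 : Complex.I ^ n = Complex.exp (n * (Real.pi / 2 * Complex.I)) := by
        rw [Complex.exp_int_mul, Complex.exp_pi_div_two_mul_I]
      rw [h3, h4, ← Complex.exp_add, ← Complex.exp_add, Real.sin_add_pi_div_two]
      congr 1
      push_cast
      ring
    rw [h1, Complex.real_smul]
    push_cast
    field_simp
  have hsum : Summable (fourierCoeff f) := by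
    refine Summable.of_norm ?_
    refine (summable_norm_cJ ht).congr fun n => ?_
    rw [hcoef, norm_mul, norm_zpow, Complex.norm_I, one_zpow, one_mul]
  have h := has_pointwise_sum_fourier_series_of_summable hsum φ
  simp_rw [hcoef, smul_eq_mul] at h
  exact h

/-! ### Algebra of rapidly decreasing coefficients -/

theorem growth_add_one_le {C : ℝ} (hC : 1 ≤ C) (n m : ℤ) (h : m.natAbs ≤ n.natAbs + 1) :
    growth C m ≤ C * growth (2 * C) n := by
  unfold growth
  have h1 : C ^ m.natAbs ≤ C ^ (n.natAbs + 1) := pow_le_pow_right₀ hC h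
  have h2 : (m.natAbs.factorial : ℝ) ≤ ((n.natAbs + 1).factorial : ℝ) := by
    exact_mod_cast Nat.factorial_le h
  have h3 : ((n.natAbs + 1 : ℕ) : ℝ) ≤ 2 ^ n.natAbs := by
    exact_mod_cast Nat.lt_two_pow_self
  calc C ^ m.natAbs * (m.natAbs.factorial : ℝ)
      ≤ C ^ (n.natAbs + 1) * ((n.natAbs + 1).factorial : ℝ) := by gcongr
    _ = C * C ^ n.natAbs * (((n.natAbs + 1 : ℕ) : ℝ) * (n.natAbs.factorial : ℝ)) := by
        rw [Nat.factorial_succ]; push_cast; ring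
    _ ≤ C * C ^ n.natAbs * (2 ^ n.natAbs * (n.natAbs.factorial : ℝ)) := by gcongr
    _ = C * ((2 * C) ^ n.natAbs * (n.natAbs.factorial : ℝ)) := by rw [mul_pow]; ring

theorem growth_succ_le {C : ℝ} (hC : 1 ≤ C) (n : ℤ) :
    growth C (n + 1) ≤ C * growth (2 * C) n := growth_add_one_le hC n _ (by omega)

theorem growth_pred_le {C : ℝ} (hC : 1 ≤ C) (n : ℤ) :
    growth C (n - 1) ≤ C * growth (2 * C) n := growth_add_one_le hC n _ (by omega)

theorem natAbs_add_one_mul_growth_le {C : ℝ} (hC : 1 ≤ C) (n : ℤ) :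
    ((n.natAbs : ℝ) + 1) * growth C n ≤ growth (2 * C) n := by
  unfold growth
  have h3 : ((n.natAbs : ℝ) + 1) ≤ 2 ^ n.natAbs := by
    exact_mod_cast Nat.lt_two_pow_self
  rw [mul_pow, ← mul_assoc]
  gcongr

theorem one_le_growth {C : ℝ} (hC : 1 ≤ C) (n : ℤ) : 1 ≤ growth C n :=
  one_le_mul_of_one_le_of_one_le (one_le_pow₀ hC)
    (by exact_mod_cast Nat.one_le_iff_ne_zero.2 (Nat.factorial_ne_zero _))

theorem Fast.of_norm_le {x y : ℤ → ℂ} (hy : Fast y) {c : ℝ} (h : ∀ n, ‖x n‖ ≤ c * ‖y n‖) :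
    Fast x := by
  intro C hC
  refine Summable.of_nonneg_of_le (fun n => ?_) (fun n => ?_) ((hy C hC).mul_left c)
  · exact mul_nonneg (norm_nonneg _) (growth_pos (by linarith) _).le
  · rw [← mul_assoc]
    exact mul_le_mul_of_nonneg_right (h n) (growth_pos (by linarith) _).le

theorem Fast.const_mul {x : ℤ → ℂ} (hx : Fast x) (c : ℂ) : Fast fun n => c * x n :=
  hx.of_norm_le (c := ‖c‖) fun _ => (norm_mul _ _).le

theorem Fast.add {x y : ℤ → ℂ} (hx : Fast x) (hy : Fast y) : Fast fun n => x n + y n := by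
  intro C hC
  refine Summable.of_nonneg_of_le (fun n => ?_) (fun n => ?_) ((hx C hC).add (hy C hC))
  · exact mul_nonneg (norm_nonneg _) (growth_pos (by linarith) _).le
  · rw [← add_mul]
    exact mul_le_mul_of_nonneg_right (norm_add_le _ _) (growth_pos (by linarith) _).le

theorem Fast.sub {x y : ℤ → ℂ} (hx : Fast x) (hy : Fast y) : Fast fun n => x n - y n := by
  simpa [sub_eq_add_neg] using hx.add (hy.const_mul (-1))

theorem Fast.shift_add {x : ℤ → ℂ} (hx : Fast x) : Fast fun n => x (n + 1) := by
  intro C hC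
  have h := ((hx (2 * C) (by linarith)).mul_left C)
  rw [← (Equiv.subRight (1 : ℤ)).summable_iff]
  refine Summable.of_nonneg_of_le (fun n => ?_) (fun n => ?_) h
  · exact mul_nonneg (norm_nonneg _) (growth_pos (by linarith) _).le
  · simp only [Function.comp_apply, Equiv.subRight_apply, sub_add_cancel]
    rw [mul_left_comm]
    exact mul_le_mul_of_nonneg_left (growth_pred_le hC n) (norm_nonneg _)

theorem Fast.shift_sub {x : ℤ → ℂ} (hx : Fast x) : Fast fun n => x (n - 1) := by
  intro C hC
  have h := ((hx (2 * C) (by linarith)).mul_left C)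
  rw [← (Equiv.addRight (1 : ℤ)).summable_iff]
  refine Summable.of_nonneg_of_le (fun n => ?_) (fun n => ?_) h
  · exact mul_nonneg (norm_nonneg _) (growth_pos (by linarith) _).le
  · simp only [Function.comp_apply, Equiv.coe_addRight, add_sub_cancel_right]
    rw [mul_left_comm]
    exact mul_le_mul_of_nonneg_left (growth_succ_le hC n) (norm_nonneg _)

theorem Fast.summable_mul {x y : ℤ → ℂ} (hx : Fast x) {D C : ℝ} (hC : 1 ≤ C)
    (h : ∀ n, ‖y n‖ ≤ D * growth C n) : Summable fun n => x n * y n := by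
  refine Summable.of_norm_bounded (g := fun n => D * (‖x n‖ * growth C n))
    ((hx C hC).mul_left D) fun n => ?_
  rw [norm_mul]
  calc ‖x n‖ * ‖y n‖ ≤ ‖x n‖ * (D * growth C n) := by gcongr; exact h n
    _ = _ := by ring

theorem Fast.summable {x : ℤ → ℂ} (hx : Fast x) : Summable fun n => ‖x n‖ := by
  refine Summable.of_nonneg_of_le (fun n => norm_nonneg _) (fun n => ?_) (hx 1 le_rfl)
  exact le_mul_of_one_le_right (norm_nonneg _) (one_le_growth le_rfl n)

/-- The coefficients of `∂₁ Σ a_n H_n(k r) e^{inθ}`. -/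
def coefX (k : ℝ) (a : ℤ → ℂ) (n : ℤ) : ℂ := k / 2 * (a (n + 1) - a (n - 1))

/-- The coefficients of `∂₂ Σ a_n H_n(k r) e^{inθ}`. -/
def coefY (k : ℝ) (a : ℤ → ℂ) (n : ℤ) : ℂ := Complex.I * k / 2 * (a (n + 1) + a (n - 1))

theorem Fast.coefX {a : ℤ → ℂ} (ha : Fast a) (k : ℝ) : Fast (coefX k a) :=
  (ha.shift_add.sub ha.shift_sub).const_mul _

theorem Fast.coefY {a : ℤ → ℂ} (ha : Fast a) (k : ℝ) : Fast (coefY k a) :=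
  (ha.shift_add.add ha.shift_sub).const_mul _

/-- The Helmholtz equation for the coefficients. -/
theorem coefX_coefX_add (k : ℝ) (a : ℤ → ℂ) (n : ℤ) :
    coefX k (coefX k a) n + coefY k (coefY k a) n = -(k : ℂ) ^ 2 * a n := by
  simp only [coefX, coefY, add_sub_cancel_right, sub_add_cancel]
  linear_combination (k ^ 2 / 4 * (a (n + 1 + 1) + a n + (a n + a (n - 1 - 1))) : ℂ) *
    Complex.I_sq

theorem coefX_coefY (k : ℝ) (a : ℤ → ℂ) : coefX k (coefY k a) = coefY k (coefX k a) := by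
  funext n
  simp only [coefX, coefY, add_sub_cancel_right, sub_add_cancel]
  ring

/-! ### Outgoing cylinder waves -/

/-- The real-linear form `v ↦ v₀ p + v₁ q` on the plane. -/
def gradForm (p q : ℂ) : Plane →L[ℝ] ℂ :=
  (EuclideanSpace.proj 0 : Plane →L[ℝ] ℝ).smulRight p +
    (EuclideanSpace.proj 1 : Plane →L[ℝ] ℝ).smulRight q

theorem gradForm_apply (p q : ℂ) (v : Plane) : gradForm p q v = v 0 * p + v 1 * q := by
  simp [gradForm]

theorem norm_gradForm_le (p q : ℂ) : ‖gradForm p q‖ ≤ ‖p‖ + ‖q‖ := by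
  refine ContinuousLinearMap.opNorm_le_bound _ (by positivity) fun v => ?_
  rw [gradForm_apply]
  refine (norm_add_le _ _).trans ?_
  rw [norm_mul, norm_mul, Complex.norm_real, Complex.norm_real]
  have h0 := PiLp.norm_apply_le v 0
  have h1 := PiLp.norm_apply_le v 1
  nlinarith [norm_nonneg p, norm_nonneg q]

theorem eq_gradForm (L : Plane →L[ℝ] ℂ) :
    L = gradForm (L (EuclideanSpace.single 0 1)) (L (EuclideanSpace.single 1 1)) := by
  ext v
  have hv : v = v 0 • EuclideanSpace.single (0 : Fin 2) (1 : ℝ) +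
      v 1 • EuclideanSpace.single (1 : Fin 2) (1 : ℝ) := by
    ext i
    fin_cases i <;> simp
  conv_lhs => rw [hv]
  rw [map_add, map_smul, map_smul, gradForm_apply, Complex.real_smul, Complex.real_smul]

theorem pd_zero_of_hasFDerivAt {f : Plane → ℂ} {p q : ℂ} {x : Plane}
    (h : HasFDerivAt f (gradForm p q) x) : pd 0 f x = p := by
  rw [pd, h.fderiv, gradForm_apply]
  simp

theorem pd_one_of_hasFDerivAt {f : Plane → ℂ} {p q : ℂ} {x : Plane}
    (h : HasFDerivAt f (gradForm p q) x) : pd 1 f x = q := by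
  rw [pd, h.fderiv, gradForm_apply]
  simp

/-- The outgoing cylinder wave `H_n(k |x|) e^{inθ}`. -/
def cylWave (k : ℝ) (n : ℤ) (x : Plane) : ℂ := hankel n (k * ‖x‖) * (zeta x / ‖x‖) ^ n

theorem zeta_ne_zero {x : Plane} (hx : x ≠ 0) : zeta x ≠ 0 := by
  rw [← norm_ne_zero_iff, norm_zeta, norm_ne_zero_iff]
  exact hx

theorem norm_zeta_div {x : Plane} (hx : x ≠ 0) : ‖zeta x / ‖x‖‖ = 1 := by
  rw [norm_div, norm_zeta, Complex.norm_real, norm_norm, div_self (norm_ne_zero_iff.2 hx)]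

theorem norm_cylWave {x : Plane} (hx : x ≠ 0) (k : ℝ) (n : ℤ) :
    ‖cylWave k n x‖ = ‖hankel n (k * ‖x‖)‖ := by
  rw [cylWave, norm_mul, norm_zpow, norm_zeta_div hx, one_zpow, mul_one]

theorem zeta_smul_dir_div {r : ℝ} (hr : 0 < r) (θ : S) :
    zeta (r • dir θ) / ‖r • dir θ‖ = fourier 1 θ := by
  rw [zeta_smul_dir, norm_smul_dir hr.le, mul_div_cancel_left₀]
  exact_mod_cast hr.ne'

theorem cylWave_smul_dir {r : ℝ} (hr : 0 < r) (k : ℝ) (n : ℤ) (θ : S) :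
    cylWave k n (r • dir θ) = hankel n (k * r) * fourier n θ := by
  rw [cylWave, zeta_smul_dir_div hr, norm_smul_dir hr.le, fourier_eq_zpow n, fourier_one_eq]

theorem hasFDerivAt_norm_plane {x : Plane} (hx : x ≠ 0) :
    HasFDerivAt (fun x : Plane => ‖x‖) ((‖x‖⁻¹ : ℝ) • innerSL ℝ x) x := by
  have h1 := (hasStrictFDerivAt_norm_sq x).hasFDerivAt
  have hn : ‖x‖ ≠ 0 := norm_ne_zero_iff.2 hx
  have h2 := h1.sqrt (by positivity)
  have h3 : (fun y : Plane => Real.sqrt (‖y‖ ^ 2)) = fun y => ‖y‖ := by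
    funext y
    exact Real.sqrt_sq (norm_nonneg y)
  rw [h3, Real.sqrt_sq (norm_nonneg x)] at h2
  refine h2.congr_fderiv ?_
  rw [two_nsmul, ← two_smul ℝ, smul_smul]
  congr 1
  field_simp

theorem hasFDerivAt_zeta (x : Plane) : HasFDerivAt zeta (gradForm 1 Complex.I) x := by
  have h : zeta = gradForm 1 Complex.I := by
    funext y
    rw [gradForm_apply, zeta]
    ring
  rw [h]
  exact (gradForm 1 Complex.I).hasFDerivAt

/-- The partial derivatives of a cylinder wave are combinations of the two neighbouring ones. -/
theorem hasFDerivAt_cylWave {k : ℝ} (hk : 0 < k) (n : ℤ) {x : Plane} (hx : x ≠ 0) :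
    HasFDerivAt (cylWave k n)
      (gradForm (k / 2 * (cylWave k (n - 1) x - cylWave k (n + 1) x))
        (Complex.I * k / 2 * (cylWave k (n - 1) x + cylWave k (n + 1) x))) x := by
  have hr : 0 < ‖x‖ := norm_pos_iff.2 hx
  have hr' : (‖x‖ : ℂ) ≠ 0 := by exact_mod_cast hr.ne'
  have hkr : 0 < k * ‖x‖ := mul_pos hk hr
  have hz := zeta_ne_zero hx
  have hu0 : zeta x / ‖x‖ ≠ 0 := div_ne_zero hz hr'
  have hN := hasFDerivAt_norm_plane hx
  have hNc : HasFDerivAt (fun y : Plane => (‖y‖ : ℂ))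
      (Complex.ofRealCLM.comp ((‖x‖⁻¹ : ℝ) • innerSL ℝ x)) x :=
    Complex.ofRealCLM.hasFDerivAt.comp x hN
  have hinv : HasFDerivAt (fun y : Plane => ((‖y‖ : ℂ))⁻¹)
      (((-((‖x‖ : ℂ) ^ 2)⁻¹) • (1 : ℂ →L[ℝ] ℂ)).comp
        (Complex.ofRealCLM.comp ((‖x‖⁻¹ : ℝ) • innerSL ℝ x))) x :=
    ((hasDerivAt_inv hr').complexToReal_fderiv).comp x hNc
  have hu := (hasFDerivAt_zeta x).mul hinv
  have hzp : HasFDerivAt (fun z : ℂ => z ^ n)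
      ((n * (zeta x / ‖x‖) ^ (n - 1)) • (1 : ℂ →L[ℝ] ℂ)) (zeta x * (‖x‖ : ℂ)⁻¹) := by
    rw [← div_eq_mul_inv]
    exact (hasDerivAt_zpow n _ (Or.inl hu0)).complexToReal_fderiv
  have hup := hzp.comp x hu
  have hH := (hasDerivAt_hankel n hkr).hasFDerivAt.comp x (hN.const_mul k)
  have h := hH.mul hup
  refine (h.congr_of_eventuallyEq (Eventually.of_forall fun y => ?_)).congr_fderiv ?_
  · simp only [cylWave, Function.comp_apply, Pi.mul_apply, div_eq_mul_inv]
  · ext v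
    have hin : inner ℝ x v = x 0 * v 0 + x 1 * v 1 := by
      simp [PiLp.inner_apply, Fin.sum_univ_two]
      ring
    have hrec := hankel_recurrence n hkr
    have hrr := zeta_mul_conj x
    simp only [cylWave, gradForm_apply, add_apply, smul_apply,
      ContinuousLinearMap.comp_apply, Function.comp_apply, ContinuousLinearMap.toSpanSingleton_apply,
      one_apply_eq_self, innerSL_apply_apply, hin, smul_eq_mul, Complex.real_smul,
      Complex.ofRealCLM_apply, Pi.mul_apply, ← div_eq_mul_inv]
    have e1 : (zeta x / ‖x‖) ^ (n + 1) = (zeta x / ‖x‖) ^ (n - 1) * (zeta x / ‖x‖) ^ 2 := by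
      rw [← zpow_natCast, ← zpow_add₀ hu0]
      congr 1
      push_cast
      ring
    have e2 : (zeta x / ‖x‖) ^ n = (zeta x / ‖x‖) ^ (n - 1) * (zeta x / ‖x‖) := by
      rw [← zpow_add_one₀ hu0, sub_add_cancel]
    rw [e1, e2]
    generalize (zeta x / ‖x‖) ^ (n - 1) = Z
    generalize hankel n (k * ‖x‖) = H at *
    generalize hankel (n - 1) (k * ‖x‖) = A at *
    generalize hankel (n + 1) (k * ‖x‖) = B at *
    simp only [zeta]
    generalize (‖x‖ : ℝ) = r at *
    push_cast at hrec ⊢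
    generalize (x 0 : ℂ) = X at *
    generalize (x 1 : ℂ) = Y at *
    field_simp
    generalize (v 0 : ℂ) = V at *
    generalize (v 1 : ℂ) = W at *
    linear_combination (-Z * (-((X + Complex.I * Y) * (X * V + Y * W)) +
      (r : ℂ) ^ 2 * (V + Complex.I * W))) * hrec - k * r * Z * B * (V + Complex.I * W) * hrr -
      2 * k * r * Z * B * (X + Complex.I * Y) * Y * W * Complex.I_sq

/-! ### Series of outgoing cylinder waves -/

theorem exists_norm_cylWave_le {k t₀ : ℝ} (hk : 0 < k) (ht₀ : 0 < t₀) :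
    ∃ D C : ℝ, 0 < D ∧ 2 ≤ C ∧ ∀ (n : ℤ) (x : Plane), t₀ ≤ ‖x‖ →
      ‖cylWave k n x‖ ≤ D * growth C n := by
  obtain ⟨M, C, hM, hC, h⟩ := hankel_bounds (mul_pos hk ht₀)
  refine ⟨M * (Real.sqrt (k * t₀))⁻¹, C, by positivity, hC, fun n x hx => ?_⟩
  have hx0 : x ≠ 0 := norm_pos_iff.1 (ht₀.trans_le hx)
  have hle : k * t₀ ≤ k * ‖x‖ := mul_le_mul_of_nonneg_left hx hk.le
  rw [norm_cylWave hx0]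
  refine (h n _ hle).1.trans ?_
  rw [mul_right_comm]
  have h1 : (Real.sqrt (k * ‖x‖))⁻¹ ≤ (Real.sqrt (k * t₀))⁻¹ :=
    inv_anti₀ (Real.sqrt_pos.2 (mul_pos hk ht₀)) (Real.sqrt_le_sqrt hle)
  have h2 := (growth_pos (C := C) (by linarith) n).le
  exact mul_le_mul_of_nonneg_right (mul_le_mul_of_nonneg_left h1 hM.le) h2

/-- The field `Σ a_n H_n(k ρ) e^{inθ}` in polar coordinates `(ρ, θ)` about `z`. -/
def waveSum (k : ℝ) (z : Plane) (a : ℤ → ℂ) (x : Plane) : ℂ := ∑' n, a n * cylWave k n (x - z)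

theorem Fast.summable_cylWave {a : ℤ → ℂ} (ha : Fast a) {k : ℝ} (hk : 0 < k) {y : Plane}
    (hy : y ≠ 0) : Summable fun n => a n * cylWave k n y := by
  obtain ⟨D, C, -, hC, h⟩ := exists_norm_cylWave_le hk (norm_pos_iff.2 hy)
  exact ha.summable_mul (by linarith) fun n => h n y le_rfl

theorem Fast.tsum_shift {a : ℤ → ℂ} (ha : Fast a) {k : ℝ} (hk : 0 < k) {y : Plane} (hy : y ≠ 0)
    (c s : ℂ) : HasSum
      (fun n => a n * (c * (cylWave k (n - 1) y + s * cylWave k (n + 1) y)))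
      (∑' n, (c * (a (n + 1) + s * a (n - 1))) * cylWave k n y) := by
  have h1 := (ha.shift_add.summable_cylWave hk hy).hasSum
  have h2 := (ha.shift_sub.summable_cylWave hk hy).hasSum
  have h3 : ∑' n, (c * (a (n + 1) + s * a (n - 1))) * cylWave k n y =
      c * (∑' n, a (n + 1) * cylWave k n y) + c * s * ∑' n, a (n - 1) * cylWave k n y := by
    rw [← tsum_mul_left, ← tsum_mul_left, ← Summable.tsum_add (h1.summable.mul_left _)
      (h2.summable.mul_left _)]
    exact tsum_congr fun n => by ring
  rw [h3]
  have h4 : HasSum (fun n => a n * cylWave k (n - 1) y) (∑' n, a (n + 1) * cylWave k n y) := by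
    rw [← (Equiv.addRight (1 : ℤ)).hasSum_iff]
    simpa [Function.comp_def] using h1
  have h5 : HasSum (fun n => a n * cylWave k (n + 1) y) (∑' n, a (n - 1) * cylWave k n y) := by
    rw [← (Equiv.subRight (1 : ℤ)).hasSum_iff]
    simpa [Function.comp_def] using h2
  exact ((h4.mul_left c).add (h5.mul_left (c * s))).congr_fun fun n => by ring

/-- The partial derivatives of a series of cylinder waves are series of the same kind, so that all
differential equations become algebraic identities between coefficients. -/
theorem hasFDerivAt_waveSum {k : ℝ} (hk : 0 < k) {a : ℤ → ℂ} (ha : Fast a) {x z : Plane}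
    (hx : x ≠ z) :
    HasFDerivAt (waveSum k z a)
      (gradForm (waveSum k z (coefX k a) x) (waveSum k z (coefY k a) x)) x := by
  have hd : 0 < ‖x - z‖ := norm_pos_iff.2 (sub_ne_zero.2 hx)
  set s : Set Plane := Metric.ball x (‖x - z‖ / 2) with hs
  have hfar : ∀ y ∈ s, ‖x - z‖ / 2 ≤ ‖y - z‖ := by
    intro y hy
    have h1 : ‖x - z‖ ≤ ‖x - y‖ + ‖y - z‖ := norm_sub_le_norm_sub_add_norm_sub x y z
    have h2 : ‖x - y‖ < ‖x - z‖ / 2 := by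
      rw [← dist_eq_norm, dist_comm]
      exact hy
    linarith
  have hne : ∀ y ∈ s, y - z ≠ 0 := fun y hy =>
    norm_pos_iff.1 (lt_of_lt_of_le (by positivity) (hfar y hy))
  obtain ⟨D, C, hD, hC, hb⟩ := exists_norm_cylWave_le hk (half_pos hd)
  let f' : ℤ → Plane → Plane →L[ℝ] ℂ := fun n y => a n • gradForm
    (k / 2 * (cylWave k (n - 1) (y - z) - cylWave k (n + 1) (y - z)))
    (Complex.I * k / 2 * (cylWave k (n - 1) (y - z) + cylWave k (n + 1) (y - z)))
  have hf : ∀ n, ∀ y ∈ s, HasFDerivAt (fun y => a n * cylWave k n (y - z)) (f' n y) y := by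
    intro n y hy
    have h1 := hasFDerivAt_cylWave hk n (hne y hy)
    have h2 := (h1.comp y ((hasFDerivAt_id y).sub_const z)).const_mul (a n)
    exact h2
  have hf' : ∀ n, ∀ y ∈ s, ‖f' n y‖ ≤ 4 * k * D * C * (‖a n‖ * growth (2 * C) n) := by
    intro n y hy
    have h1 := (hb (n - 1) _ (hfar y hy)).trans
      (mul_le_mul_of_nonneg_left (growth_pred_le (by linarith) n) hD.le)
    have h2 := (hb (n + 1) _ (hfar y hy)).trans
      (mul_le_mul_of_nonneg_left (growth_succ_le (by linarith) n) hD.le)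
    have hk2 : ‖(k / 2 : ℂ)‖ = k / 2 := by
      rw [norm_div, Complex.norm_real, Real.norm_of_nonneg hk.le]; simp
    have hk3 : ‖(Complex.I * k / 2 : ℂ)‖ = k / 2 := by
      rw [mul_div_assoc, norm_mul, Complex.norm_I, one_mul, hk2]
    have h3 : ‖(k / 2 : ℂ) * (cylWave k (n - 1) (y - z) - cylWave k (n + 1) (y - z))‖ ≤
        k / 2 * (2 * (D * (C * growth (2 * C) n))) := by
      rw [norm_mul, hk2]
      refine mul_le_mul_of_nonneg_left ((norm_sub_le _ _).trans ?_) (by positivity)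
      linarith
    have h4 : ‖(Complex.I * k / 2 : ℂ) *
        (cylWave k (n - 1) (y - z) + cylWave k (n + 1) (y - z))‖ ≤
        k / 2 * (2 * (D * (C * growth (2 * C) n))) := by
      rw [norm_mul, hk3]
      refine mul_le_mul_of_nonneg_left ((norm_add_le _ _).trans ?_) (by positivity)
      linarith
    have hg := (growth_pos (C := 2 * C) (by linarith) n).le
    calc ‖f' n y‖ = ‖a n‖ * _ := norm_smul _ _
      _ ≤ ‖a n‖ * (4 * k * D * C * growth (2 * C) n) := by
          refine mul_le_mul_of_nonneg_left ((norm_gradForm_le _ _).trans ((add_le_add h3 h4).trans ?_))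
            (norm_nonneg _)
          have : 0 ≤ k * D * C * growth (2 * C) n := by positivity
          linarith
      _ = _ := by ring
  have hxs : x ∈ s := Metric.mem_ball_self (half_pos hd)
  have hsum : Summable fun n => 4 * k * D * C * (‖a n‖ * growth (2 * C) n) :=
    (ha (2 * C) (by linarith)).mul_left _
  have key := hasFDerivAt_tsum_of_isPreconnected hsum Metric.isOpen_ball
    (convex_ball x _).isPreconnected hf hf' hxs (ha.summable_cylWave hk (hne x hxs)) hxs
  have hsf : Summable fun n => f' n x := Summable.of_norm_bounded hsum fun n => hf' n x hxs
  refine key.congr_fderiv ?_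
  rw [eq_gradForm (∑' n, f' n x)]
  have e : ∀ v : Plane, (∑' n, f' n x) v = ∑' n, f' n x v := fun v =>
    (ContinuousLinearMap.apply ℝ ℂ v).map_tsum hsf
  congr 1
  · rw [e, waveSum]
    have := (ha.tsum_shift hk (hne x hxs) (k / 2) (-1)).tsum_eq
    simp only [coefX, sub_eq_add_neg, f', smul_apply, gradForm_apply] at this ⊢
    simpa using this
  · rw [e, waveSum]
    have := (ha.tsum_shift hk (hne x hxs) (Complex.I * k / 2) 1).tsum_eq
    simp only [coefY, f', smul_apply, gradForm_apply] at this ⊢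
    simpa using this

theorem contDiff_gradForm : ContDiff ℝ ∞ fun p : ℂ × ℂ => gradForm p.1 p.2 := by
  have h1 := (ContinuousLinearMap.smulRightL ℝ Plane ℂ (EuclideanSpace.proj 0)).contDiff (n := ∞)
  have h2 := (ContinuousLinearMap.smulRightL ℝ Plane ℂ (EuclideanSpace.proj 1)).contDiff (n := ∞)
  exact (h1.comp contDiff_fst).add (h2.comp contDiff_snd)

theorem contDiffOn_waveSum {k : ℝ} (hk : 0 < k) (z : Plane) {a : ℤ → ℂ} (ha : Fast a) :
    ContDiffOn ℝ ∞ (waveSum k z a) {z}ᶜ := by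
  -- the derivatives are again series of this kind, so the induction runs over all coefficients
  have main : ∀ (m : ℕ) (a : ℤ → ℂ), Fast a → ContDiffOn ℝ m (waveSum k z a) {z}ᶜ := by
    intro m
    induction m with
    | zero =>
      intro a ha
      exact contDiffOn_zero.2 fun x hx =>
        (hasFDerivAt_waveSum hk ha hx).continuousAt.continuousWithinAt
    | succ m ih =>
      intro a ha
      push_cast
      rw [contDiffOn_succ_iff_fderiv_of_isOpen isOpen_compl_singleton]
      refine ⟨fun x hx => (hasFDerivAt_waveSum hk ha hx).differentiableAt.differentiableWithinAt,
        by simp, ?_⟩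
      have h := (contDiff_gradForm.of_le (m := m) (by exact_mod_cast le_top)).comp_contDiffOn
        ((ih _ (ha.coefX k)).prodMk (ih _ (ha.coefY k)))
      exact h.congr fun x hx => (hasFDerivAt_waveSum hk ha hx).fderiv
  exact contDiffOn_infty.2 fun m => main m a ha

/-! ### The far field of a series of cylinder waves -/

theorem rpow_neg_three_halves {r : ℝ} (hr : 0 < r) :
    r ^ (-(3 / 2) : ℝ) = r⁻¹ * (Real.sqrt r)⁻¹ := by
  rw [Real.sqrt_eq_rpow, ← Real.rpow_neg_one, ← Real.rpow_neg hr.le, ← Real.rpow_add hr]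
  norm_num

theorem fourier_eq_one_zpow (n : ℤ) (θ : S) : (fourier n θ : ℂ) = fourier 1 θ ^ n := by
  rw [fourier_eq_zpow, fourier_one_eq]

theorem norm_exp_I_sub_le (s t : ℝ) :
    ‖Complex.exp (Complex.I * s) - Complex.exp (Complex.I * t)‖ ≤ |s - t| := by
  have h : Complex.exp (Complex.I * s) - Complex.exp (Complex.I * t) =
      Complex.exp (Complex.I * t) * (Complex.exp (Complex.I * (s - t : ℝ)) - 1) := by
    rw [mul_sub, ← Complex.exp_add]
    push_cast
    ring_nf
  rw [h, norm_mul, norm_exp_I_mul, one_mul]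
  exact Real.norm_exp_I_mul_ofReal_sub_one_le

theorem norm_zpow_sub_zpow_le {u v : ℂ} (hu : ‖u‖ = 1) (hv : ‖v‖ = 1) (n : ℤ) :
    ‖u ^ n - v ^ n‖ ≤ n.natAbs * ‖u - v‖ := by
  have main : ∀ m : ℕ, ‖u ^ m - v ^ m‖ ≤ m * ‖u - v‖ := by
    intro m
    induction m with
    | zero => simp
    | succ m ih =>
      have h : u ^ (m + 1) - v ^ (m + 1) = u * (u ^ m - v ^ m) + (u - v) * v ^ m := by ring
      rw [h]
      refine (norm_add_le _ _).trans ?_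
      rw [norm_mul, norm_mul, norm_pow, hu, hv, one_pow]
      push_cast
      linarith
  rcases Int.eq_nat_or_neg n with ⟨m, rfl | rfl⟩
  · simpa using main m
  · have hu0 : u ^ m ≠ 0 := pow_ne_zero _ (norm_ne_zero_iff.1 (by rw [hu]; exact one_ne_zero))
    have hv0 : v ^ m ≠ 0 := pow_ne_zero _ (norm_ne_zero_iff.1 (by rw [hv]; exact one_ne_zero))
    rw [zpow_neg, zpow_neg, zpow_natCast, zpow_natCast, inv_sub_inv hu0 hv0, norm_div, norm_mul,
      norm_pow, norm_pow, hu, hv, norm_sub_rev]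
    simpa using main m

/-- Geometry of the far zone: `x = r x̂` is seen from `z` and from the origin in nearly the same
direction, and `|x - z| = r - z·x̂ + O(1/r)`. -/
theorem far_zone_estimates (z : Plane) {r : ℝ} (hr : 2 * ‖z‖ + 1 ≤ r) (θ : S) :
    r / 2 ≤ ‖r • dir θ - z‖ ∧ |‖r • dir θ - z‖ - r| ≤ ‖z‖ ∧
      |‖r • dir θ - z‖ - (r - inner ℝ z (dir θ))| ≤ 2 * ‖z‖ ^ 2 / r ∧
      ‖zeta (r • dir θ - z) / ‖r • dir θ - z‖ - fourier 1 θ‖ ≤ 4 * ‖z‖ / r := by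
  have hz := norm_nonneg z
  have hr0 : 0 < r := by linarith
  have hx : ‖r • dir θ‖ = r := norm_smul_dir hr0.le θ
  have hrho : ‖r • dir θ - z‖ ^ 2 = r ^ 2 - 2 * r * inner ℝ z (dir θ) + ‖z‖ ^ 2 := by
    rw [norm_sub_sq_real, hx, real_inner_smul_left, real_inner_comm]
    ring
  set ρ := ‖r • dir θ - z‖ with hρ
  set s : ℝ := inner ℝ z (dir θ) with hs
  have hs1 : |s| ≤ ‖z‖ := by
    have := abs_real_inner_le_norm z (dir θ)
    rwa [norm_dir, mul_one] at this
  have h1 : |ρ - r| ≤ ‖z‖ := by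
    have := abs_norm_sub_norm_le (r • dir θ - z) (r • dir θ)
    rw [hx] at this
    refine this.trans ?_
    rw [sub_sub_cancel_left, norm_neg]
  have h2 : r / 2 ≤ ρ := by
    have := (abs_le.1 h1).1
    linarith
  have hρ0 : 0 < ρ := by linarith
  refine ⟨h2, h1, ?_, ?_⟩
  · have hs2 := abs_le.1 hs1
    have h3 : (ρ - (r - s)) * (ρ + (r - s)) = ‖z‖ ^ 2 - s ^ 2 := by
      linear_combination hrho
    have h4 : r / 2 ≤ ρ + (r - s) := by linarith
    have h5 : 0 ≤ ‖z‖ ^ 2 - s ^ 2 := by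
      have := sq_le_sq' hs2.1 hs2.2
      linarith
    have h6 : 0 ≤ ρ - (r - s) := by
      by_contra hneg
      push Not at hneg
      have := mul_neg_of_neg_of_pos hneg (show 0 < ρ + (r - s) by linarith)
      linarith
    rw [abs_of_nonneg h6, le_div_iff₀ hr0]
    have h7 := mul_le_mul_of_nonneg_left h4 h6
    have h8 := sq_nonneg s
    linarith
  · have hzx : zeta (r • dir θ - z) = zeta (r • dir θ) - zeta z := by
      simp only [zeta, PiLp.sub_apply]
      push_cast
      ring
    have hρc : (ρ : ℂ) ≠ 0 := by exact_mod_cast hρ0.ne'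
    have h3 : zeta (r • dir θ - z) / ρ - fourier 1 θ =
        ((r - ρ : ℝ) * fourier 1 θ - zeta z) / ρ := by
      rw [hzx, zeta_smul_dir]
      push_cast
      field_simp
      ring
    rw [h3, norm_div, Complex.norm_real, Real.norm_of_nonneg hρ0.le, div_le_div_iff₀ hρ0 hr0]
    have h4 : ‖((r - ρ : ℝ) : ℂ) * fourier 1 θ - zeta z‖ ≤ 2 * ‖z‖ := by
      refine (norm_sub_le _ _).trans ?_
      rw [norm_mul, norm_fourier, norm_zeta, Complex.norm_real, mul_one, Real.norm_eq_abs,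
        abs_sub_comm]
      linarith
    have h5 := mul_le_mul_of_nonneg_right h4 hr0.le
    have h6 := mul_le_mul_of_nonneg_left h2 (mul_nonneg zero_le_four hz)
    linarith

theorem abs_inv_sqrt_sub_le {r ρ c : ℝ} (hr : 0 < r) (h : r / 2 ≤ ρ) (hc : |ρ - r| ≤ c) :
    |(Real.sqrt ρ)⁻¹ - (Real.sqrt r)⁻¹| ≤ 2 * c * (r⁻¹ * (Real.sqrt r)⁻¹) := by
  have hρ : 0 < ρ := by linarith
  have hsr := Real.sqrt_pos.2 hr
  have hsρ := Real.sqrt_pos.2 hρ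
  have h1 : Real.sqrt r / 2 ≤ Real.sqrt ρ := by
    rw [← Real.sqrt_sq (show (0 : ℝ) ≤ 2 by norm_num), ← Real.sqrt_div hr.le]
    exact Real.sqrt_le_sqrt (by linarith)
  have h2 : |Real.sqrt r - Real.sqrt ρ| * (Real.sqrt r + Real.sqrt ρ) = |ρ - r| := by
    rw [← abs_of_pos (add_pos hsr hsρ), ← abs_mul, abs_sub_comm ρ]
    congr 1
    nlinarith [Real.mul_self_sqrt hr.le, Real.mul_self_sqrt hρ.le]
  have h3 : |Real.sqrt r - Real.sqrt ρ| * Real.sqrt r ≤ c := by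
    refine le_trans ?_ (h2.le.trans hc)
    exact mul_le_mul_of_nonneg_left (by linarith) (abs_nonneg _)
  rw [inv_sub_inv hsρ.ne' hsr.ne', abs_div, abs_of_pos (mul_pos hsρ hsr),
    div_le_iff₀ (mul_pos hsρ hsr)]
  have h4 : |Real.sqrt r - Real.sqrt ρ| ≤ c / Real.sqrt r := by
    rwa [le_div_iff₀ hsr]
  have hc0 : 0 ≤ c := (abs_nonneg _).trans hc
  refine h4.trans ?_
  have h5 : 2 * c * (r⁻¹ * (Real.sqrt r)⁻¹) * (Real.sqrt ρ * Real.sqrt r) =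
      2 * c / r * Real.sqrt ρ := by
    field_simp
  rw [h5]
  refine le_trans (le_of_eq ?_) (mul_le_mul_of_nonneg_left h1 (by positivity))
  nth_rewrite 2 [← Real.mul_self_sqrt hr.le]
  field_simp

/-- The far field of a cylinder wave centred at `z`, measured from the origin. Moving the centre
to the origin produces the phase factor `e^{-ik z·x̂}`; the error is uniform in the direction and
its dependence on the order is controlled by `growth`. -/
theorem exists_norm_cylWave_sub_far_le {k : ℝ} (hk : 0 < k) (z : Plane) :
    ∃ D C : ℝ, 0 < D ∧ 2 ≤ C ∧ ∀ (n : ℤ) (r : ℝ) (θ : S), 2 * ‖z‖ + 1 ≤ r →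
      ‖cylWave k n (r • dir θ - z) - Complex.exp (Complex.I * (k * r : ℝ)) / (Real.sqrt r : ℂ) *
        (hankelConst / (Real.sqrt k : ℂ) * phase k z θ * ((-Complex.I) ^ n * fourier n θ))‖ ≤
      D * growth C n * r ^ (-(3 / 2) : ℝ) := by
  obtain ⟨M, C, hM, hC, hb⟩ := hankel_bounds (mul_pos hk (half_pos (one_pos (α := ℝ))))
  set h0 := ‖hankelConst‖ with hh0
  have hh0' : 0 ≤ h0 := norm_nonneg _
  have hz := norm_nonneg z
  have hsk := Real.sqrt_pos.2 hk
  refine ⟨M * (k / 2) ^ (-(3 / 2) : ℝ) + (h0 * (Real.sqrt k)⁻¹ * 2) * (4 * ‖z‖) +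
    h0 * (Real.sqrt k)⁻¹ * (2 * ‖z‖ + 2 * k * ‖z‖ ^ 2), 2 * C, by positivity, by linarith,
    fun n r θ hr => ?_⟩
  obtain ⟨g1, g2, g3, g4⟩ := far_zone_estimates z hr θ
  have hr0 : 0 < r := by linarith
  set y := r • dir θ - z with hy
  set ρ := ‖y‖ with hρ
  have hρ0 : 0 < ρ := by linarith
  have hy0 : y ≠ 0 := norm_pos_iff.1 hρ0
  set u := zeta y / ρ with hu
  have hu1 : ‖u‖ = 1 := norm_zeta_div hy0
  have hv1 : ‖(fourier 1 θ : ℂ)‖ = 1 := norm_fourier 1 θ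
  set s : ℝ := inner ℝ z (dir θ) with hs
  have hsr := Real.sqrt_pos.2 hr0
  have hsρ := Real.sqrt_pos.2 hρ0
  have hG := one_le_growth (C := C) (by linarith) n
  have hG2 := natAbs_add_one_mul_growth_le (C := C) (by linarith) n
  have hn0 : (0 : ℝ) ≤ n.natAbs := Nat.cast_nonneg _
  have hGG : growth C n ≤ growth (2 * C) n := by nlinarith
  have hnG : (n.natAbs : ℝ) ≤ growth (2 * C) n := by nlinarith
  have h1G := one_le_growth (C := 2 * C) (by linarith) n
  have hI : ‖(-Complex.I) ^ n‖ = 1 := norm_neg_I_zpow n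
  have hph : Complex.exp (Complex.I * (k * r : ℝ)) * phase k z θ =
      Complex.exp (Complex.I * (k * (r - s) : ℝ)) := by
    rw [phase, ← hs, ← Complex.exp_add]
    push_cast
    ring_nf
  rw [rpow_neg_three_halves hr0]
  set E : ℝ := r⁻¹ * (Real.sqrt r)⁻¹ with hE
  have hE0 : 0 < E := by positivity
  -- the error has three sources: the asymptotics of `H_n`, the change of the polar angle, and the
  -- change of the distance in the amplitude and in the phase
  have hsplit : cylWave k n y - Complex.exp (Complex.I * (k * r : ℝ)) / (Real.sqrt r : ℂ) *
      (hankelConst / (Real.sqrt k : ℂ) * phase k z θ * ((-Complex.I) ^ n * fourier n θ)) =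
      (hankel n (k * ρ) - hankelLead n (k * ρ)) * u ^ n +
      hankelLead n (k * ρ) * (u ^ n - (fourier 1 θ) ^ n) +
      hankelConst * (Real.sqrt k : ℂ)⁻¹ * (-Complex.I) ^ n * (fourier 1 θ) ^ n *
        (Complex.exp (Complex.I * (k * ρ : ℝ)) * (((Real.sqrt ρ)⁻¹ - (Real.sqrt r)⁻¹ : ℝ) : ℂ) +
          (Complex.exp (Complex.I * (k * ρ : ℝ)) - Complex.exp (Complex.I * (k * (r - s) : ℝ))) *
            ((Real.sqrt r)⁻¹ : ℝ)) := by
    rw [cylWave, ← hρ, ← hu, ← hph, hankelLead, Real.sqrt_mul hk.le, fourier_eq_one_zpow n]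
    push_cast
    field_simp
    ring
  rw [hsplit]
  have b1 : ‖(hankel n (k * ρ) - hankelLead n (k * ρ)) * u ^ n‖ ≤
      M * (k / 2) ^ (-(3 / 2) : ℝ) * growth (2 * C) n * E := by
    rw [norm_mul, norm_zpow, hu1, one_zpow, mul_one]
    refine (hb n _ (mul_le_mul_of_nonneg_left (by linarith) hk.le)).2.trans ?_
    have h1 : (k * ρ) ^ (-(3 / 2) : ℝ) ≤ (k / 2) ^ (-(3 / 2) : ℝ) * E := by
      rw [hE, ← rpow_neg_three_halves hr0, ← Real.mul_rpow (by positivity) hr0.le]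
      exact Real.rpow_le_rpow_of_nonpos (by positivity) (by nlinarith) (by norm_num)
    calc M * growth C n * (k * ρ) ^ (-(3 / 2) : ℝ)
        ≤ M * growth (2 * C) n * ((k / 2) ^ (-(3 / 2) : ℝ) * E) := by
          refine mul_le_mul (mul_le_mul_of_nonneg_left hGG hM.le) h1 (by positivity) (by positivity)
      _ = _ := by ring
  have b2 : ‖hankelLead n (k * ρ) * (u ^ n - (fourier 1 θ) ^ n)‖ ≤
      (h0 * (Real.sqrt k)⁻¹ * 2) * (4 * ‖z‖) * growth (2 * C) n * E := by
    rw [norm_mul, norm_hankelLead _ (mul_pos hk hρ0), ← hh0, Real.sqrt_mul hk.le]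
    have h1 : Real.sqrt r / 2 ≤ Real.sqrt ρ := by
      rw [← Real.sqrt_sq (show (0 : ℝ) ≤ 2 by norm_num), ← Real.sqrt_div hr0.le]
      exact Real.sqrt_le_sqrt (by linarith)
    have h2 : h0 / (Real.sqrt k * Real.sqrt ρ) ≤ h0 * (Real.sqrt k)⁻¹ * 2 * (Real.sqrt r)⁻¹ := by
      rw [div_eq_mul_inv, mul_inv, mul_assoc, mul_assoc]
      refine mul_le_mul_of_nonneg_left (mul_le_mul_of_nonneg_left ?_ (by positivity)) hh0'
      refine (inv_anti₀ (by positivity) h1).trans (le_of_eq ?_)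
      rw [inv_div, div_eq_mul_inv]
    have h3 : ‖u ^ n - (fourier 1 θ) ^ n‖ ≤ growth (2 * C) n * (4 * ‖z‖ * r⁻¹) := by
      refine (norm_zpow_sub_zpow_le hu1 hv1 n).trans ?_
      exact mul_le_mul hnG g4 (norm_nonneg _) (by linarith)
    calc _ ≤ (h0 * (Real.sqrt k)⁻¹ * 2 * (Real.sqrt r)⁻¹) *
          (growth (2 * C) n * (4 * ‖z‖ * r⁻¹)) :=
          mul_le_mul h2 h3 (norm_nonneg _) (by positivity)
      _ = _ := by rw [hE]; ring
  have b3 : ‖hankelConst * (Real.sqrt k : ℂ)⁻¹ * (-Complex.I) ^ n * (fourier 1 θ) ^ n *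
        (Complex.exp (Complex.I * (k * ρ : ℝ)) * (((Real.sqrt ρ)⁻¹ - (Real.sqrt r)⁻¹ : ℝ) : ℂ) +
          (Complex.exp (Complex.I * (k * ρ : ℝ)) - Complex.exp (Complex.I * (k * (r - s) : ℝ))) *
            ((Real.sqrt r)⁻¹ : ℝ))‖ ≤
      h0 * (Real.sqrt k)⁻¹ * (2 * ‖z‖ + 2 * k * ‖z‖ ^ 2) * growth (2 * C) n * E := by
    rw [norm_mul, norm_mul, norm_mul, norm_mul, hI, norm_zpow, hv1, one_zpow, norm_inv,
      Complex.norm_real, Real.norm_of_nonneg hsk.le, mul_one, mul_one, ← hh0]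
    have h1 : ‖Complex.exp (Complex.I * (k * ρ : ℝ)) *
        (((Real.sqrt ρ)⁻¹ - (Real.sqrt r)⁻¹ : ℝ) : ℂ)‖ ≤ 2 * ‖z‖ * E := by
      rw [norm_mul, norm_exp_I_mul, one_mul, Complex.norm_real]
      exact abs_inv_sqrt_sub_le hr0 g1 g2
    have h2 : ‖(Complex.exp (Complex.I * (k * ρ : ℝ)) -
        Complex.exp (Complex.I * (k * (r - s) : ℝ))) * ((Real.sqrt r)⁻¹ : ℝ)‖ ≤
        2 * k * ‖z‖ ^ 2 * E := by
      rw [norm_mul, Complex.norm_real, Real.norm_of_nonneg (by positivity)]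
      have h3 := norm_exp_I_sub_le (k * ρ) (k * (r - s))
      rw [← mul_sub, abs_mul, abs_of_pos hk] at h3
      calc _ ≤ k * (2 * ‖z‖ ^ 2 / r) * (Real.sqrt r)⁻¹ :=
            mul_le_mul_of_nonneg_right (h3.trans (mul_le_mul_of_nonneg_left g3 hk.le))
              (by positivity)
        _ = _ := by rw [hE]; ring
    calc _ ≤ h0 * (Real.sqrt k)⁻¹ * (2 * ‖z‖ * E + 2 * k * ‖z‖ ^ 2 * E) :=
          mul_le_mul_of_nonneg_left ((norm_add_le _ _).trans (add_le_add h1 h2)) (by positivity)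
      _ = h0 * (Real.sqrt k)⁻¹ * (2 * ‖z‖ + 2 * k * ‖z‖ ^ 2) * 1 * E := by ring
      _ ≤ _ := by gcongr
  refine (norm_add₃_le).trans ((add_le_add (add_le_add b1 b2) b3).trans (le_of_eq ?_))
  ring

/-- The amplitude `√(2/(πk)) e^{-iπ/4} e^{-ik z·x̂} Σ a_n (-i)^n e^{inθ}` of the far field of
`waveSum k z a`. -/
def ffAmp (k : ℝ) (z : Plane) (a : ℤ → ℂ) (θ : S) : ℂ :=
  hankelConst / (Real.sqrt k : ℂ) * phase k z θ * ∑' n, a n * ((-Complex.I) ^ n * fourier n θ)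

theorem Fast.summable_fourier {a : ℤ → ℂ} (ha : Fast a) (θ : S) :
    Summable fun n => a n * ((-Complex.I) ^ n * fourier n θ) := by
  refine Summable.of_norm_bounded ha.summable fun n => ?_
  rw [norm_mul, norm_mul, norm_neg_I_zpow, norm_fourier, mul_one, mul_one]

theorem exists_norm_waveSum_sub_far_le {k : ℝ} (hk : 0 < k) (z : Plane) {a : ℤ → ℂ}
    (ha : Fast a) : ∃ K : ℝ, 0 < K ∧ ∀ (r : ℝ) (θ : S), 2 * ‖z‖ + 1 ≤ r →
      ‖waveSum k z a (r • dir θ) -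
        Complex.exp (Complex.I * (k * r : ℝ)) / (Real.sqrt r : ℂ) * ffAmp k z a θ‖ ≤
      K * r ^ (-(3 / 2) : ℝ) := by
  obtain ⟨D, C, hD, hC, hb⟩ := exists_norm_cylWave_sub_far_le hk z
  have hs := ha C (by linarith)
  have hs0 : 0 ≤ ∑' n, ‖a n‖ * growth C n := tsum_nonneg fun n =>
    mul_nonneg (norm_nonneg _) (growth_pos (by linarith) _).le
  refine ⟨D * (∑' n, ‖a n‖ * growth C n) + 1, by positivity, fun r θ hr => ?_⟩
  have hz := norm_nonneg z
  have hr0 : 0 < r := by linarith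
  have hy : r • dir θ - z ≠ 0 := norm_pos_iff.1
    (lt_of_lt_of_le (half_pos hr0) (far_zone_estimates z hr θ).1)
  have h1 := ha.summable_cylWave hk hy
  set e := Complex.exp (Complex.I * (k * r : ℝ)) / (Real.sqrt r : ℂ) *
    (hankelConst / (Real.sqrt k : ℂ) * phase k z θ) with he
  have h2 := (ha.summable_fourier θ).mul_left e
  have h3 : waveSum k z a (r • dir θ) -
      Complex.exp (Complex.I * (k * r : ℝ)) / (Real.sqrt r : ℂ) * ffAmp k z a θ =
      ∑' n, (a n * cylWave k n (r • dir θ - z) -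
        e * (a n * ((-Complex.I) ^ n * fourier n θ))) := by
    rw [h1.tsum_sub h2, tsum_mul_left, waveSum, ffAmp, he]
    ring
  rw [h3]
  have hrp : 0 < r ^ (-(3 / 2) : ℝ) := Real.rpow_pos_of_pos hr0 _
  have hs' := hs.mul_left (D * r ^ (-(3 / 2) : ℝ))
  refine (tsum_of_norm_bounded hs'.hasSum fun n => ?_).trans ?_
  · have h4 : a n * cylWave k n (r • dir θ - z) - e * (a n * ((-Complex.I) ^ n * fourier n θ)) =
        a n * (cylWave k n (r • dir θ - z) -
          Complex.exp (Complex.I * (k * r : ℝ)) / (Real.sqrt r : ℂ) *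
          (hankelConst / (Real.sqrt k : ℂ) * phase k z θ * ((-Complex.I) ^ n * fourier n θ))) := by
      rw [he]
      ring
    rw [h4, norm_mul]
    refine (mul_le_mul_of_nonneg_left (hb n r θ hr) (norm_nonneg _)).trans (le_of_eq ?_)
    ring
  · rw [tsum_mul_left]
    nlinarith

theorem Fast.tsum_fourier_shift {a : ℤ → ℂ} (ha : Fast a) (θ : S) :
    HasSum (fun n => a (n + 1) * ((-Complex.I) ^ n * fourier n θ))
        (Complex.I * (cosA θ - Complex.I * sinA θ) *
          ∑' n, a n * ((-Complex.I) ^ n * fourier n θ)) ∧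
      HasSum (fun n => a (n - 1) * ((-Complex.I) ^ n * fourier n θ))
        (-Complex.I * (cosA θ + Complex.I * sinA θ) *
          ∑' n, a n * ((-Complex.I) ^ n * fourier n θ)) := by
  have h := (ha.summable_fourier θ).hasSum
  have hcs := cosA_sq_add θ
  have h1 : (cosA θ + Complex.I * sinA θ : ℂ) * (cosA θ - Complex.I * sinA θ) = 1 := by
    linear_combination hcs - (sinA θ : ℂ) ^ 2 * Complex.I_sq
  have hu : (cosA θ + Complex.I * sinA θ : ℂ) ≠ 0 := left_ne_zero_of_mul_eq_one h1
  have hI : (-Complex.I) ≠ 0 := neg_ne_zero.2 Complex.I_ne_zero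
  constructor
  · rw [← (Equiv.subRight (1 : ℤ)).hasSum_iff]
    refine (h.mul_left _).congr_fun fun n => ?_
    simp only [Function.comp_apply, Equiv.subRight_apply, sub_add_cancel, fourier_eq_zpow,
      zpow_sub_one₀ hu, zpow_sub_one₀ hI]
    rw [inv_eq_of_mul_eq_one_right h1, inv_neg, Complex.inv_I]
    ring
  · rw [← (Equiv.addRight (1 : ℤ)).hasSum_iff]
    refine (h.mul_left _).congr_fun fun n => ?_
    simp only [Function.comp_apply, Equiv.coe_addRight, add_sub_cancel_right, fourier_eq_zpow,
      zpow_add_one₀ hu, zpow_add_one₀ hI]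
    ring

theorem ffAmp_coefX {k : ℝ} {z : Plane} {a : ℤ → ℂ} (ha : Fast a) (θ : S) :
    ffAmp k z (coefX k a) θ = Complex.I * k * cosA θ * ffAmp k z a θ := by
  obtain ⟨h1, h2⟩ := ha.tsum_fourier_shift θ
  have h := (((h1.sub h2).mul_left (k / 2 : ℂ)).congr_fun
    (g := fun n => coefX k a n * ((-Complex.I) ^ n * fourier n θ))
    fun n => by rw [coefX]; ring).tsum_eq
  rw [ffAmp, h, ffAmp]
  ring

theorem ffAmp_coefY {k : ℝ} {z : Plane} {a : ℤ → ℂ} (ha : Fast a) (θ : S) :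
    ffAmp k z (coefY k a) θ = Complex.I * k * sinA θ * ffAmp k z a θ := by
  obtain ⟨h1, h2⟩ := ha.tsum_fourier_shift θ
  have h := (((h1.add h2).mul_left (Complex.I * k / 2 : ℂ)).congr_fun
    (g := fun n => coefY k a n * ((-Complex.I) ^ n * fourier n θ))
    fun n => by rw [coefY]; ring).tsum_eq
  rw [ffAmp, h, ffAmp]
  linear_combination (-Complex.I * k * (hankelConst / (Real.sqrt k : ℂ) * phase k z θ *
    ∑' n, a n * ((-Complex.I) ^ n * fourier n θ)) * sinA θ) * Complex.I_sq

/-! ### Partial derivatives -/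

theorem two_le_infty : (2 : WithTop ℕ∞) ≤ ∞ := by
  exact WithTop.coe_le_coe.2 (le_top : (2 : ℕ∞) ≤ ⊤)

theorem fderiv_apply_eq_pd (f : Plane → ℂ) (x v : Plane) :
    fderiv ℝ f x v = v 0 * pd 0 f x + v 1 * pd 1 f x := by
  conv_lhs => rw [eq_gradForm (fderiv ℝ f x)]
  exact gradForm_apply _ _ _

theorem pd_congr {f g : Plane → ℂ} {x : Plane} (h : f =ᶠ[𝓝 x] g) (j : Fin 2) :
    pd j f x = pd j g x := by
  rw [pd, pd, h.fderiv_eq]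

theorem pd_congr_on {f g : Plane → ℂ} {U : Set Plane} (hU : IsOpen U) (h : EqOn f g U) {x : Plane}
    (hx : x ∈ U) (j : Fin 2) : pd j f x = pd j g x :=
  pd_congr (h.eventuallyEq_of_mem (hU.mem_nhds hx)) j

theorem pd_const_mul {f : Plane → ℂ} {x : Plane} (hf : DifferentiableAt ℝ f x) (c : ℂ)
    (j : Fin 2) : pd j (fun y => c * f y) x = c * pd j f x := by
  rw [pd, fderiv_const_mul hf, smul_apply, smul_eq_mul, pd]

theorem pd_add {f g : Plane → ℂ} {x : Plane} (hf : DifferentiableAt ℝ f x)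
    (hg : DifferentiableAt ℝ g x) (j : Fin 2) :
    pd j (fun y => f y + g y) x = pd j f x + pd j g x := by
  rw [pd, fderiv_fun_add hf hg, add_apply, pd, pd]

theorem pd_sub {f g : Plane → ℂ} {x : Plane} (hf : DifferentiableAt ℝ f x)
    (hg : DifferentiableAt ℝ g x) (j : Fin 2) :
    pd j (fun y => f y - g y) x = pd j f x - pd j g x := by
  rw [pd, fderiv_fun_sub hf hg, sub_apply, pd, pd]

theorem contDiffOn_pd {f : Plane → ℂ} {U : Set Plane} (hU : IsOpen U) (hf : ContDiffOn ℝ ∞ f U)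
    (j : Fin 2) : ContDiffOn ℝ ∞ (pd j f) U :=
  (hf.fderiv_of_isOpen hU (m := ∞) (by simp)).clm_apply contDiffOn_const

theorem differentiableAt_of_contDiffOn {E : Type*} [NormedAddCommGroup E] [NormedSpace ℝ E]
    {f : Plane → E} {U : Set Plane} (hU : IsOpen U)
    (hf : ContDiffOn ℝ ∞ f U) {x : Plane} (hx : x ∈ U) : DifferentiableAt ℝ f x :=
  (hf.contDiffAt (hU.mem_nhds hx)).differentiableAt (by simp)

theorem pd_pd_eq {f : Plane → ℂ} {x : Plane} (hf : ContDiffAt ℝ 2 f x) (i j : Fin 2) :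
    pd i (pd j f) x = fderiv ℝ (fderiv ℝ f) x (EuclideanSpace.single i 1)
      (EuclideanSpace.single j 1) := by
  have h : DifferentiableAt ℝ (fderiv ℝ f) x :=
    (hf.fderiv_right (m := 1) (by norm_num)).differentiableAt (by simp)
  have h2 := (h.hasFDerivAt.clm_apply (hasFDerivAt_const (EuclideanSpace.single j (1 : ℝ)) x)).fderiv
  rw [pd]
  unfold pd
  rw [h2]
  simp

theorem pd_comm {f : Plane → ℂ} {x : Plane} (hf : ContDiffAt ℝ 2 f x) (i j : Fin 2) :
    pd i (pd j f) x = pd j (pd i f) x := by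
  rw [pd_pd_eq hf, pd_pd_eq hf]
  exact hf.isSymmSndFDerivAt (by simp) _ _

theorem laplacian_eq_pd {f : Plane → ℂ} {x : Plane} (hf : ContDiffAt ℝ 2 f x) :
    (Δ f) x = pd 0 (pd 0 f) x + pd 1 (pd 1 f) x := by
  rw [InnerProductSpace.laplacian_eq_iteratedFDeriv_orthonormalBasis f
    (EuclideanSpace.basisFun (Fin 2) ℝ)]
  simp only [Fin.sum_univ_two, EuclideanSpace.basisFun_apply, iteratedFDeriv_two_apply]
  rw [pd_pd_eq hf, pd_pd_eq hf]
  rfl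

theorem laplacian_vec_apply {u : Plane → Vec} {x : Plane} (hu : ContDiffAt ℝ 2 u x) (j : Fin 2) :
    (Δ u) x j = pd 0 (pd 0 fun y => u y j) x + pd 1 (pd 1 fun y => u y j) x := by
  have h := hu.laplacian_CLM_comp_left
    (l := (EuclideanSpace.proj j : Vec →L[ℂ] ℂ).restrictScalars ℝ)
  have h2 : ContDiffAt ℝ 2 (fun y => u y j) x :=
    ((EuclideanSpace.proj j : Vec →L[ℂ] ℂ).restrictScalars ℝ).contDiff.contDiffAt.comp x hu
  rw [← laplacian_eq_pd h2]
  exact h.symm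

/-! ### Elastic fields made of cylinder waves -/

theorem waveSum_add {k : ℝ} (hk : 0 < k) {z x : Plane} (hx : x ≠ z) {a b : ℤ → ℂ} (ha : Fast a)
    (hb : Fast b) :
    waveSum k z (fun n => a n + b n) x = waveSum k z a x + waveSum k z b x := by
  have hy := sub_ne_zero.2 hx
  rw [waveSum, waveSum, waveSum,
    ← (ha.summable_cylWave hk hy).tsum_add (hb.summable_cylWave hk hy)]
  exact tsum_congr fun n => by ring

theorem waveSum_const_mul (k : ℝ) (z x : Plane) (a : ℤ → ℂ) (c : ℂ) :
    waveSum k z (fun n => c * a n) x = c * waveSum k z a x := by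
  rw [waveSum, waveSum, ← tsum_mul_left]
  exact tsum_congr fun n => by ring

theorem pd_zero_waveSum {k : ℝ} (hk : 0 < k) {a : ℤ → ℂ} (ha : Fast a) {x z : Plane} (hx : x ≠ z) :
    pd 0 (waveSum k z a) x = waveSum k z (coefX k a) x :=
  pd_zero_of_hasFDerivAt (hasFDerivAt_waveSum hk ha hx)

theorem pd_one_waveSum {k : ℝ} (hk : 0 < k) {a : ℤ → ℂ} (ha : Fast a) {x z : Plane} (hx : x ≠ z) :
    pd 1 (waveSum k z a) x = waveSum k z (coefY k a) x :=
  pd_one_of_hasFDerivAt (hasFDerivAt_waveSum hk ha hx)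

/-- The Helmholtz equation `Δ φ + k² φ = 0` for `waveSum`, in terms of the coefficients. -/
theorem waveSum_helmholtz {k : ℝ} (hk : 0 < k) {a : ℤ → ℂ} (ha : Fast a) {x z : Plane}
    (hx : x ≠ z) :
    waveSum k z (coefX k (coefX k a)) x + waveSum k z (coefY k (coefY k a)) x =
      -(k : ℂ) ^ 2 * waveSum k z a x := by
  rw [← waveSum_add hk hx ((ha.coefX k).coefX k) ((ha.coefY k).coefY k), ← waveSum_const_mul]
  congr 1
  funext n
  exact coefX_coefX_add k a n

/-- The field `grad φ + curl ψ` with potentials `φ = waveSum kp z a` and `ψ = waveSum ks z b`. -/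
def elasticSum (kp ks : ℝ) (z : Plane) (a b : ℤ → ℂ) (x : Plane) : Vec :=
  WithLp.toLp 2 ![waveSum kp z (coefX kp a) x - waveSum ks z (coefY ks b) x,
    waveSum kp z (coefY kp a) x + waveSum ks z (coefX ks b) x]

theorem elasticSum_zero (kp ks : ℝ) (z : Plane) (a b : ℤ → ℂ) (x : Plane) :
    elasticSum kp ks z a b x 0 = waveSum kp z (coefX kp a) x - waveSum ks z (coefY ks b) x := rfl

theorem elasticSum_one (kp ks : ℝ) (z : Plane) (a b : ℤ → ℂ) (x : Plane) :
    elasticSum kp ks z a b x 1 = waveSum kp z (coefY kp a) x + waveSum ks z (coefX ks b) x := rfl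

section

variable {kp ks : ℝ} (hp : 0 < kp) (hs : 0 < ks) (z : Plane) {a b : ℤ → ℂ} (ha : Fast a)
  (hb : Fast b)

include hp hs ha hb

theorem contDiffOn_elasticSum : ContDiffOn ℝ ∞ (elasticSum kp ks z a b) {z}ᶜ := by
  refine contDiffOn_piLp' 2 fun j => ?_
  fin_cases j
  · exact (contDiffOn_waveSum hp z (ha.coefX _)).sub (contDiffOn_waveSum hs z (hb.coefY _))
  · exact (contDiffOn_waveSum hp z (ha.coefY _)).add (contDiffOn_waveSum hs z (hb.coefX _))

theorem divg_elasticSum {x : Plane} (hx : x ≠ z) :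
    divg (elasticSum kp ks z a b) x = -(kp : ℂ) ^ 2 * waveSum kp z a x := by
  have d : ∀ {k : ℝ} {c : ℤ → ℂ}, 0 < k → Fast c → DifferentiableAt ℝ (waveSum k z c) x :=
    fun hk hc => (hasFDerivAt_waveSum hk hc hx).differentiableAt
  simp only [divg, elasticSum_zero, elasticSum_one]
  rw [pd_sub (d hp (ha.coefX _)) (d hs (hb.coefY _)), pd_add (d hp (ha.coefY _)) (d hs (hb.coefX _)),
    pd_zero_waveSum hp (ha.coefX _) hx, pd_zero_waveSum hs (hb.coefY _) hx,
    pd_one_waveSum hp (ha.coefY _) hx, pd_one_waveSum hs (hb.coefX _) hx, coefX_coefY,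
    ← waveSum_helmholtz hp ha hx]
  ring

theorem scurl_elasticSum {x : Plane} (hx : x ≠ z) :
    scurl (elasticSum kp ks z a b) x = (ks : ℂ) ^ 2 * waveSum ks z b x := by
  have d : ∀ {k : ℝ} {c : ℤ → ℂ}, 0 < k → Fast c → DifferentiableAt ℝ (waveSum k z c) x :=
    fun hk hc => (hasFDerivAt_waveSum hk hc hx).differentiableAt
  simp only [scurl, elasticSum_zero, elasticSum_one]
  rw [pd_sub (d hp (ha.coefX _)) (d hs (hb.coefY _)), pd_add (d hp (ha.coefY _)) (d hs (hb.coefX _)),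
    pd_one_waveSum hp (ha.coefX _) hx, pd_one_waveSum hs (hb.coefY _) hx,
    pd_zero_waveSum hp (ha.coefY _) hx, pd_zero_waveSum hs (hb.coefX _) hx, coefX_coefY]
  linear_combination -waveSum_helmholtz hs hb hx

theorem grad_divg_elasticSum {x : Plane} (hx : x ≠ z) :
    grad (divg (elasticSum kp ks z a b)) x = (-(kp : ℂ) ^ 2) •
      WithLp.toLp 2 ![waveSum kp z (coefX kp a) x, waveSum kp z (coefY kp a) x] := by
  have h : EqOn (divg (elasticSum kp ks z a b)) (fun y => -(kp : ℂ) ^ 2 * waveSum kp z a y) {z}ᶜ :=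
    fun y hy => divg_elasticSum hp hs z ha hb hy
  have d := (hasFDerivAt_waveSum hp ha hx).differentiableAt
  have e := fun j => (pd_congr_on isOpen_compl_singleton h hx j).trans (pd_const_mul d _ j)
  ext j
  fin_cases j
  · simpa [grad, pd_zero_waveSum hp ha hx] using e 0
  · simpa [grad, pd_one_waveSum hp ha hx] using e 1

theorem vcurl_scurl_elasticSum {x : Plane} (hx : x ≠ z) :
    vcurl (scurl (elasticSum kp ks z a b)) x = ((ks : ℂ) ^ 2) •
      WithLp.toLp 2 ![-waveSum ks z (coefY ks b) x, waveSum ks z (coefX ks b) x] := by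
  have h : EqOn (scurl (elasticSum kp ks z a b)) (fun y => (ks : ℂ) ^ 2 * waveSum ks z b y) {z}ᶜ :=
    fun y hy => scurl_elasticSum hp hs z ha hb hy
  have d := (hasFDerivAt_waveSum hs hb hx).differentiableAt
  have e := fun j => (pd_congr_on isOpen_compl_singleton h hx j).trans (pd_const_mul d _ j)
  ext j
  fin_cases j
  · simpa [vcurl, pd_one_waveSum hs hb hx] using e 1
  · simpa [vcurl, pd_zero_waveSum hs hb hx] using e 0

theorem laplacian_elasticSum {x : Plane} (hx : x ≠ z) :
    (Δ (elasticSum kp ks z a b)) x = (-(kp : ℂ) ^ 2) •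
      WithLp.toLp 2 ![waveSum kp z (coefX kp a) x, waveSum kp z (coefY kp a) x] +
      (-(ks : ℂ) ^ 2) •
      WithLp.toLp 2 ![-waveSum ks z (coefY ks b) x, waveSum ks z (coefX ks b) x] := by
  have hU : IsOpen ({z}ᶜ : Set Plane) := isOpen_compl_singleton
  have hc := ((contDiffOn_elasticSum hp hs z ha hb).contDiffAt (hU.mem_nhds hx)).of_le
    (m := 2) two_le_infty
  have d : ∀ {k : ℝ} {c : ℤ → ℂ} {y : Plane}, 0 < k → Fast c → y ≠ z →
      DifferentiableAt ℝ (waveSum k z c) y :=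
    fun hk hc hy => (hasFDerivAt_waveSum hk hc hy).differentiableAt
  ext j
  rw [laplacian_vec_apply hc]
  fin_cases j
  · simp only [Fin.zero_eta, elasticSum_zero]
    have e0 : EqOn (pd 0 fun y => waveSum kp z (coefX kp a) y - waveSum ks z (coefY ks b) y)
        (fun y => waveSum kp z (coefX kp (coefX kp a)) y - waveSum ks z (coefX ks (coefY ks b)) y)
        {z}ᶜ := fun y hy => by
      rw [pd_sub (d hp (ha.coefX _) hy) (d hs (hb.coefY _) hy), pd_zero_waveSum hp (ha.coefX _) hy,
        pd_zero_waveSum hs (hb.coefY _) hy]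
    have e1 : EqOn (pd 1 fun y => waveSum kp z (coefX kp a) y - waveSum ks z (coefY ks b) y)
        (fun y => waveSum kp z (coefY kp (coefX kp a)) y - waveSum ks z (coefY ks (coefY ks b)) y)
        {z}ᶜ := fun y hy => by
      rw [pd_sub (d hp (ha.coefX _) hy) (d hs (hb.coefY _) hy), pd_one_waveSum hp (ha.coefX _) hy,
        pd_one_waveSum hs (hb.coefY _) hy]
    rw [pd_congr_on hU e0 hx, pd_congr_on hU e1 hx,
      pd_sub (d hp ((ha.coefX _).coefX _) hx) (d hs ((hb.coefY _).coefX _) hx),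
      pd_sub (d hp ((ha.coefX _).coefY _) hx) (d hs ((hb.coefY _).coefY _) hx),
      pd_zero_waveSum hp ((ha.coefX _).coefX _) hx, pd_zero_waveSum hs ((hb.coefY _).coefX _) hx,
      pd_one_waveSum hp ((ha.coefX _).coefY _) hx, pd_one_waveSum hs ((hb.coefY _).coefY _) hx]
    simp
    linear_combination waveSum_helmholtz hp (ha.coefX kp) hx - waveSum_helmholtz hs (hb.coefY ks) hx
  · simp only [Fin.mk_one, elasticSum_one]
    have e0 : EqOn (pd 0 fun y => waveSum kp z (coefY kp a) y + waveSum ks z (coefX ks b) y)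
        (fun y => waveSum kp z (coefX kp (coefY kp a)) y + waveSum ks z (coefX ks (coefX ks b)) y)
        {z}ᶜ := fun y hy => by
      rw [pd_add (d hp (ha.coefY _) hy) (d hs (hb.coefX _) hy), pd_zero_waveSum hp (ha.coefY _) hy,
        pd_zero_waveSum hs (hb.coefX _) hy]
    have e1 : EqOn (pd 1 fun y => waveSum kp z (coefY kp a) y + waveSum ks z (coefX ks b) y)
        (fun y => waveSum kp z (coefY kp (coefY kp a)) y + waveSum ks z (coefY ks (coefX ks b)) y)
        {z}ᶜ := fun y hy => by
      rw [pd_add (d hp (ha.coefY _) hy) (d hs (hb.coefX _) hy), pd_one_waveSum hp (ha.coefY _) hy,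
        pd_one_waveSum hs (hb.coefX _) hy]
    rw [pd_congr_on hU e0 hx, pd_congr_on hU e1 hx,
      pd_add (d hp ((ha.coefY _).coefX _) hx) (d hs ((hb.coefX _).coefX _) hx),
      pd_add (d hp ((ha.coefY _).coefY _) hx) (d hs ((hb.coefX _).coefY _) hx),
      pd_zero_waveSum hp ((ha.coefY _).coefX _) hx, pd_zero_waveSum hs ((hb.coefX _).coefX _) hx,
      pd_one_waveSum hp ((ha.coefY _).coefY _) hx, pd_one_waveSum hs ((hb.coefX _).coefY _) hx]
    simp
    linear_combination waveSum_helmholtz hp (ha.coefY kp) hx + waveSum_helmholtz hs (hb.coefX ks) hx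

end

/-! ### Radiation condition and far field of the elastic fields -/

/-- The amplitudes of the partial derivatives are `i k x̂₁` and `i k x̂₂` times the amplitude of
the series itself, so the leading terms of the radiation condition cancel. -/
theorem exists_norm_waveSum_radiation_le {k : ℝ} (hk : 0 < k) (z : Plane) {c : ℤ → ℂ}
    (hc : Fast c) : ∃ K : ℝ, 0 < K ∧ ∀ (r : ℝ) (θ : S), 2 * ‖z‖ + 1 ≤ r →
      ‖gradForm (waveSum k z (coefX k c) (r • dir θ)) (waveSum k z (coefY k c) (r • dir θ)) (dir θ) -
        Complex.I * k * waveSum k z c (r • dir θ)‖ ≤ K * r ^ (-(3 / 2) : ℝ) := by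
  obtain ⟨K0, hK0, h0⟩ := exists_norm_waveSum_sub_far_le hk z hc
  obtain ⟨K1, hK1, h1⟩ := exists_norm_waveSum_sub_far_le hk z (hc.coefX k)
  obtain ⟨K2, hK2, h2⟩ := exists_norm_waveSum_sub_far_le hk z (hc.coefY k)
  refine ⟨K1 + K2 + k * K0, by positivity, fun r θ hr => ?_⟩
  have h0 := h0 r θ hr
  have h1 := h1 r θ hr
  have h2 := h2 r θ hr
  rw [ffAmp_coefX hc] at h1
  rw [ffAmp_coefY hc] at h2
  rw [gradForm_apply, dir_zero, dir_one]
  set e := Complex.exp (Complex.I * (k * r : ℝ)) / (Real.sqrt r : ℂ)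
  have hsplit : (cosA θ : ℂ) * waveSum k z (coefX k c) (r • dir θ) +
      sinA θ * waveSum k z (coefY k c) (r • dir θ) - Complex.I * k * waveSum k z c (r • dir θ) =
      cosA θ * (waveSum k z (coefX k c) (r • dir θ) -
        e * (Complex.I * k * cosA θ * ffAmp k z c θ)) +
      sinA θ * (waveSum k z (coefY k c) (r • dir θ) -
        e * (Complex.I * k * sinA θ * ffAmp k z c θ)) +
      -(Complex.I * k) * (waveSum k z c (r • dir θ) - e * ffAmp k z c θ) := by
    linear_combination (e * Complex.I * k * ffAmp k z c θ) * cosA_sq_add θ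
  rw [hsplit]
  have hcs := cosA_sq_add_sinA_sq θ
  have hcos : ‖(cosA θ : ℂ)‖ ≤ 1 := by
    rw [Complex.norm_real, Real.norm_eq_abs, abs_le_one_iff_mul_self_le_one]
    nlinarith
  have hsin : ‖(sinA θ : ℂ)‖ ≤ 1 := by
    rw [Complex.norm_real, Real.norm_eq_abs, abs_le_one_iff_mul_self_le_one]
    nlinarith
  have hIk : ‖-(Complex.I * k : ℂ)‖ = k := by
    rw [norm_neg, norm_mul, Complex.norm_I, one_mul, Complex.norm_real, Real.norm_of_nonneg hk.le]
  refine norm_add₃_le.trans ?_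
  rw [norm_mul, norm_mul, norm_mul, hIk]
  have t1 := (mul_le_of_le_one_left (norm_nonneg _) hcos).trans h1
  have t2 := (mul_le_of_le_one_left (norm_nonneg _) hsin).trans h2
  have t3 := mul_le_mul_of_nonneg_left h0 hk.le
  linarith

theorem norm_toLp_le (p q : ℂ) : ‖(WithLp.toLp 2 ![p, q] : Vec)‖ ≤ ‖p‖ + ‖q‖ := by
  rw [EuclideanSpace.norm_eq]
  refine Real.sqrt_le_iff.2 ⟨by positivity, ?_⟩
  simp only [Fin.sum_univ_two, Matrix.cons_val_zero, Matrix.cons_val_one]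
  nlinarith [norm_nonneg p, norm_nonneg q]

theorem norm_vec_le (v : Vec) : ‖v‖ ≤ ‖v 0‖ + ‖v 1‖ := by
  have h : v = WithLp.toLp 2 ![v 0, v 1] := by
    ext i
    fin_cases i <;> rfl
  conv_lhs => rw [h]
  exact norm_toLp_le _ _

theorem fderiv_vec_apply {v : Plane → Vec} {x : Plane} (hv : DifferentiableAt ℝ v x) (h : Plane)
    (j : Fin 2) : fderiv ℝ v x h j = fderiv ℝ (fun y => v y j) x h := by
  have := (((EuclideanSpace.proj j : Vec →L[ℂ] ℂ).restrictScalars ℝ).hasFDerivAt.comp x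
    hv.hasFDerivAt).fderiv
  exact (congrArg (fun L => L h) this).symm

theorem radiating_of_waveSum {k : ℝ} (hk : 0 < k) (z : Plane) {c₀ c₁ : ℤ → ℂ} (h₀ : Fast c₀)
    (h₁ : Fast c₁) {v : Plane → Vec}
    (hv : ∀ x, x ≠ z → v x = WithLp.toLp 2 ![waveSum k z c₀ x, waveSum k z c₁ x]) :
    Radiating k v := by
  obtain ⟨K0, hK0, hb0⟩ := exists_norm_waveSum_radiation_le hk z h₀
  obtain ⟨K1, hK1, hb1⟩ := exists_norm_waveSum_radiation_le hk z h₁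
  have hO : (fun x : Plane => fderiv ℝ v x (‖x‖⁻¹ • x) - (Complex.I * k) • v x)
      =O[Bornology.cobounded Plane] fun x : Plane => ‖x‖ ^ (-(3 / 2) : ℝ) := by
    refine Asymptotics.IsBigO.of_bound (K0 + K1) ?_
    filter_upwards [tendsto_norm_cobounded_atTop.eventually_ge_atTop (2 * ‖z‖ + 1)] with x hx
    have hz := norm_nonneg z
    obtain ⟨θ, hθ⟩ := exists_eq_smul_dir x
    have hx0 : 0 < ‖x‖ := by linarith
    have hdir : ‖x‖⁻¹ • x = dir θ := by
      nth_rewrite 2 [hθ]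
      rw [smul_smul, inv_mul_cancel₀ hx0.ne', one_smul]
    have hxz : x ≠ z := by
      rintro rfl
      linarith
    have hnear : v =ᶠ[𝓝 x] fun y => WithLp.toLp 2 ![waveSum k z c₀ y, waveSum k z c₁ y] :=
      Filter.eventuallyEq_of_mem (isOpen_compl_singleton.mem_nhds hxz) fun y hy => hv y hy
    have hd0 := hasFDerivAt_waveSum hk h₀ hxz
    have hd1 := hasFDerivAt_waveSum hk h₁ hxz
    have hdv : DifferentiableAt ℝ v x := by
      refine DifferentiableAt.congr_of_eventuallyEq ?_ hnear
      refine (contDiffAt_piLp' 2 (n := 1) fun j => ?_).differentiableAt one_ne_zero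
      have hm := isOpen_compl_singleton.mem_nhds hxz
      fin_cases j
      · exact ((contDiffOn_waveSum hk z h₀).contDiffAt hm).of_le (by simp)
      · exact ((contDiffOn_waveSum hk z h₁).contDiffAt hm).of_le (by simp)
    have e0 : (fderiv ℝ v x (dir θ) - (Complex.I * k) • v x) 0 =
        gradForm (waveSum k z (coefX k c₀) x) (waveSum k z (coefY k c₀) x) (dir θ) -
          Complex.I * k * waveSum k z c₀ x := by
      have h1 : (fun y => v y 0) =ᶠ[𝓝 x] waveSum k z c₀ := hnear.mono fun y hy =>
        congrArg (fun w : Vec => w 0) hy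
      rw [PiLp.sub_apply, fderiv_vec_apply hdv, h1.fderiv_eq, hd0.fderiv, hv x hxz]
      rfl
    have e1 : (fderiv ℝ v x (dir θ) - (Complex.I * k) • v x) 1 =
        gradForm (waveSum k z (coefX k c₁) x) (waveSum k z (coefY k c₁) x) (dir θ) -
          Complex.I * k * waveSum k z c₁ x := by
      have h1 : (fun y => v y 1) =ᶠ[𝓝 x] waveSum k z c₁ := hnear.mono fun y hy =>
        congrArg (fun w : Vec => w 1) hy
      rw [PiLp.sub_apply, fderiv_vec_apply hdv, h1.fderiv_eq, hd1.fderiv, hv x hxz]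
      rfl
    have b0 := hb0 ‖x‖ θ hx
    have b1 := hb1 ‖x‖ θ hx
    rw [← hθ] at b0 b1
    rw [hdir, Real.norm_of_nonneg (by positivity : (0 : ℝ) ≤ ‖x‖ ^ (-(3 / 2) : ℝ))]
    refine (norm_vec_le _).trans ?_
    rw [e0, e1, add_mul]
    exact add_le_add b0 b1
  refine hO.trans_isLittleO ?_
  have hlit : (fun r : ℝ => r ^ (-(3 / 2) : ℝ)) =o[atTop] fun r : ℝ => r ^ (-(1 / 2) : ℝ) := by
    rw [Asymptotics.isLittleO_iff_tendsto' ((eventually_gt_atTop 0).mono fun r hr h0 =>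
      absurd h0 (Real.rpow_pos_of_pos hr _).ne')]
    refine (tendsto_rpow_neg_atTop (one_pos (α := ℝ))).congr' ?_
    filter_upwards [eventually_gt_atTop 0] with r hr
    rw [← Real.rpow_sub hr]
    norm_num
  exact hlit.comp_tendsto tendsto_norm_cobounded_atTop

theorem hasFarField_of_waveSum {k : ℝ} (hk : 0 < k) (z : Plane) {c₀ c₁ : ℤ → ℂ} (h₀ : Fast c₀)
    (h₁ : Fast c₁) {v : Plane → Vec}
    (hv : ∀ x, x ≠ z → v x = WithLp.toLp 2 ![waveSum k z c₀ x, waveSum k z c₁ x])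
    {e : S → Vec} {A : S → ℂ} (he₀ : ∀ θ, ffAmp k z c₀ θ = A θ * e θ 0)
    (he₁ : ∀ θ, ffAmp k z c₁ θ = A θ * e θ 1) : HasFarField k e v A := by
  obtain ⟨K0, hK0, hb0⟩ := exists_norm_waveSum_sub_far_le hk z h₀
  obtain ⟨K1, hK1, hb1⟩ := exists_norm_waveSum_sub_far_le hk z h₁
  refine Asymptotics.IsBigO.of_bound (K0 + K1) ?_
  have hev : ∀ᶠ q : ℝ × S in atTop ×ˢ (⊤ : Filter S), 2 * ‖z‖ + 1 ≤ q.1 :=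
    tendsto_fst.eventually (eventually_ge_atTop _)
  filter_upwards [hev] with ⟨r, θ⟩ hr
  simp only at hr ⊢
  have hz := norm_nonneg z
  have hr0 : 0 < r := by linarith
  have hxz : r • dir θ ≠ z := by
    intro h
    have := norm_smul_dir hr0.le θ
    rw [h] at this
    linarith
  rw [Real.norm_of_nonneg (by positivity : (0 : ℝ) ≤ r ^ (-(3 / 2) : ℝ)), add_mul]
  refine (norm_vec_le _).trans (add_le_add ?_ ?_)
  · have h := hb0 r θ hr
    rw [he₀, ← mul_assoc] at h
    rw [PiLp.sub_apply, hv _ hxz]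
    exact h
  · have h := hb1 r θ hr
    rw [he₁, ← mul_assoc] at h
    rw [PiLp.sub_apply, hv _ hxz]
    exact h

theorem Medium.kp_pos (M : Medium) : 0 < M.kp := div_pos M.om_pos (Real.sqrt_pos.2 M.lam_pos)

theorem Medium.ks_pos (M : Medium) : 0 < M.ks := div_pos M.om_pos (Real.sqrt_pos.2 M.mu_pos)

theorem Medium.kp_sq (M : Medium) : (M.lam + 2 * M.mu) * M.kp ^ 2 = M.om ^ 2 := by
  have := M.lam_pos
  rw [Medium.kp, div_pow, Real.sq_sqrt this.le]
  field_simp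

theorem Medium.ks_sq (M : Medium) : M.mu * M.ks ^ 2 = M.om ^ 2 := by
  have := M.mu_pos
  rw [Medium.ks, div_pow, Real.sq_sqrt this.le]
  field_simp

section

variable (M : Medium) (z : Plane) {a b : ℤ → ℂ} (ha : Fast a) (hb : Fast b)

include ha hb

theorem pPart_elasticSum {x : Plane} (hx : x ≠ z) :
    pPart M (elasticSum M.kp M.ks z a b) x =
      WithLp.toLp 2 ![waveSum M.kp z (coefX M.kp a) x, waveSum M.kp z (coefY M.kp a) x] := by
  have hk : (M.kp : ℂ) ≠ 0 := by exact_mod_cast M.kp_pos.ne'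
  rw [pPart, grad_divg_elasticSum M.kp_pos M.ks_pos z ha hb hx, smul_smul]
  have : -(1 / (M.kp : ℂ) ^ 2) * -(M.kp : ℂ) ^ 2 = 1 := by field_simp
  rw [this, one_smul]

theorem sPart_elasticSum {x : Plane} (hx : x ≠ z) :
    sPart M (elasticSum M.kp M.ks z a b) x =
      WithLp.toLp 2 ![waveSum M.ks z (fun n => -1 * coefY M.ks b n) x,
        waveSum M.ks z (coefX M.ks b) x] := by
  have hk : (M.ks : ℂ) ≠ 0 := by exact_mod_cast M.ks_pos.ne'
  rw [sPart, vcurl_scurl_elasticSum M.kp_pos M.ks_pos z ha hb hx, smul_smul, waveSum_const_mul]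
  have : 1 / (M.ks : ℂ) ^ 2 * (M.ks : ℂ) ^ 2 = 1 := by field_simp
  rw [this, one_smul, neg_one_mul]

theorem navier_elasticSum {x : Plane} (hx : x ≠ z) :
    (M.mu : ℂ) • (Δ (elasticSum M.kp M.ks z a b)) x +
      ((M.lam + M.mu : ℝ) : ℂ) • grad (divg (elasticSum M.kp M.ks z a b)) x
      + (M.om : ℂ) ^ 2 • elasticSum M.kp M.ks z a b x = 0 := by
  have h1 : ((M.lam : ℂ) + 2 * M.mu) * (M.kp : ℂ) ^ 2 = (M.om : ℂ) ^ 2 := by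
    exact_mod_cast M.kp_sq
  have h2 : (M.mu : ℂ) * (M.ks : ℂ) ^ 2 = (M.om : ℂ) ^ 2 := by exact_mod_cast M.ks_sq
  rw [laplacian_elasticSum M.kp_pos M.ks_pos z ha hb hx,
    grad_divg_elasticSum M.kp_pos M.ks_pos z ha hb hx]
  ext j
  fin_cases j
  · simp [elasticSum_zero]
    linear_combination -(waveSum M.kp z (coefX M.kp a) x) * h1 +
      (waveSum M.ks z (coefY M.ks b) x) * h2
  · simp [elasticSum_one]
    linear_combination -(waveSum M.kp z (coefY M.kp a) x) * h1 -
      (waveSum M.ks z (coefX M.ks b) x) * h2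

theorem radiating_pPart_elasticSum : Radiating M.kp (pPart M (elasticSum M.kp M.ks z a b)) :=
  radiating_of_waveSum M.kp_pos z (ha.coefX _) (ha.coefY _) fun _ hx => pPart_elasticSum M z ha hb hx

theorem radiating_sPart_elasticSum : Radiating M.ks (sPart M (elasticSum M.kp M.ks z a b)) :=
  radiating_of_waveSum M.ks_pos z ((hb.coefY _).const_mul _) (hb.coefX _)
    fun _ hx => sPart_elasticSum M z ha hb hx

theorem hasFarField_pPart_elasticSum :
    HasFarField M.kp dirC (pPart M (elasticSum M.kp M.ks z a b))
      (fun θ => Complex.I * M.kp * ffAmp M.kp z a θ) :=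
  hasFarField_of_waveSum M.kp_pos z (ha.coefX _) (ha.coefY _)
    (fun _ hx => pPart_elasticSum M z ha hb hx)
    (fun θ => by rw [ffAmp_coefX ha]; simp [dirC]; ring)
    (fun θ => by rw [ffAmp_coefY ha]; simp [dirC]; ring)

theorem hasFarField_sPart_elasticSum :
    HasFarField M.ks perpC (sPart M (elasticSum M.kp M.ks z a b))
      (fun θ => Complex.I * M.ks * ffAmp M.ks z b θ) :=
  hasFarField_of_waveSum M.ks_pos z ((hb.coefY _).const_mul _) (hb.coefX _)
    (fun _ hx => sPart_elasticSum M z ha hb hx)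
    (fun θ => by
      have h := ffAmp_coefY (k := M.ks) (z := z) hb θ
      rw [ffAmp] at h ⊢
      rw [show (fun n => -1 * coefY M.ks b n * ((-Complex.I) ^ n * fourier n θ)) =
        fun n => -1 * (coefY M.ks b n * ((-Complex.I) ^ n * fourier n θ)) from
          funext fun n => by ring, tsum_mul_left]
      simp only [perpC, Matrix.cons_val_zero]
      linear_combination -h)
    (fun θ => by rw [ffAmp_coefX hb]; simp [perpC]; ring)

end

/-! ### The field scattered by a disk -/

/-- The rows of the boundary matrix are the radial and the angular component. Their combination
`u_r + i u_θ = e^{-iθ} (u₁ + i u₂)` involves the cylinder functions of order `n + 1` only. -/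
theorem IsCylinder.cylMatrix_mulVec_add {f : ℤ → ℝ → ℂ} (hf : IsCylinder f) (n : ℤ) {s t : ℝ}
    (hs : 0 < s) (ht : 0 < t) (x y : ℂ) :
    (cylMatrix f n s t).mulVec ![x, y] 0 + Complex.I * (cylMatrix f n s t).mulVec ![x, y] 1 =
      -(s * f (n + 1) s * x) - Complex.I * (t * f (n + 1) t * y) := by
  rw [cylMatrix, mulVec_two, Matrix.cons_val_zero, Matrix.cons_val_one, Matrix.cons_val_fin_one]
  linear_combination x * hf.deriv_eq n hs + Complex.I * y * hf.deriv_eq n ht +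
    (n * f n s * x) * Complex.I_sq

/-- The combination `u_r - i u_θ = e^{iθ} (u₁ - i u₂)` of the rows involves the cylinder functions
of order `n - 1` only. -/
theorem IsCylinder.cylMatrix_mulVec_sub {f : ℤ → ℝ → ℂ} (hf : IsCylinder f) (n : ℤ) {s t : ℝ}
    (hs : 0 < s) (ht : 0 < t) (x y : ℂ) :
    (cylMatrix f n s t).mulVec ![x, y] 0 - Complex.I * (cylMatrix f n s t).mulVec ![x, y] 1 =
      s * f (n - 1) s * x - Complex.I * (t * f (n - 1) t * y) := by
  rw [cylMatrix, mulVec_two, Matrix.cons_val_zero, Matrix.cons_val_one, Matrix.cons_val_fin_one]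
  linear_combination x * hf.deriv_eq' n hs - Complex.I * y * hf.deriv_eq' n ht -
    (n * f n s * x) * Complex.I_sq

theorem waveSum_coefX_add {k : ℝ} (hk : 0 < k) {z x : Plane} (hx : x ≠ z) {a : ℤ → ℂ}
    (ha : Fast a) : waveSum k z (coefX k a) x + Complex.I * waveSum k z (coefY k a) x =
      ∑' n, -k * a (n - 1) * cylWave k n (x - z) := by
  rw [← waveSum_const_mul, ← waveSum_add hk hx (ha.coefX k) ((ha.coefY k).const_mul _), waveSum]
  refine tsum_congr fun n => ?_
  rw [coefX, coefY]
  linear_combination (k / 2 * (a (n + 1) + a (n - 1)) * cylWave k n (x - z)) * Complex.I_sq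

theorem waveSum_coefX_sub {k : ℝ} (hk : 0 < k) {z x : Plane} (hx : x ≠ z) {a : ℤ → ℂ}
    (ha : Fast a) : waveSum k z (coefX k a) x - Complex.I * waveSum k z (coefY k a) x =
      ∑' n, k * a (n + 1) * cylWave k n (x - z) := by
  rw [sub_eq_add_neg, ← neg_mul, ← waveSum_const_mul,
    ← waveSum_add hk hx (ha.coefX k) ((ha.coefY k).const_mul _), waveSum]
  refine tsum_congr fun n => ?_
  rw [coefX, coefY]
  linear_combination (-k / 2 * (a (n + 1) + a (n - 1)) * cylWave k n (x - z)) * Complex.I_sq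

/-- The coefficients about `z` of a potential of the plane wave of amplitude `c` and direction
`d`, namely of `c e^{ikx·d} / (ik) = Σ inc_n J_n(kρ) e^{inθ}`. -/
def incCoef (k : ℝ) (z : Plane) (d : S) (c : ℂ) (n : ℤ) : ℂ :=
  c * Complex.exp (Complex.I * (k * inner ℝ z (dir d) : ℝ)) * Complex.I ^ n * fourier (-n) d /
    (Complex.I * k)

/-- The coefficients of the potentials of the scattered field: `-Σ_n` applied to those of the
incident plane wave. -/
def scatCoef (M : Medium) (R : ℝ) (z : Plane) (d : S) (cp cs : ℂ) (i : Fin 2) (n : ℤ) : ℂ :=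
  -(sigmaMatrix n (M.kp * R) (M.ks * R) i 0 * incCoef M.kp z d cp n +
    sigmaMatrix n (M.kp * R) (M.ks * R) i 1 * incCoef M.ks z d cs n)

theorem norm_incCoef {k : ℝ} (hk : 0 < k) (z : Plane) (d : S) (c : ℂ) (n : ℤ) :
    ‖incCoef k z d c n‖ = ‖c‖ / k := by
  rw [incCoef, norm_div, norm_mul, norm_mul, norm_mul, norm_mul, norm_exp_I_mul, norm_fourier,
    norm_zpow, Complex.norm_I, one_zpow, Complex.norm_real, Real.norm_of_nonneg hk.le]
  simp

theorem fast_scatCoef (M : Medium) {R : ℝ} (hR : 0 < R) (z : Plane) (d : S) (cp cs : ℂ)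
    (i : Fin 2) : Fast (scatCoef M R z d cp cs i) := by
  have hp := M.kp_pos
  have hs := M.ks_pos
  have hsig := fun j => fast_sigmaMatrix (mul_pos hp hR) (mul_pos hs hR) i j
  have h0 : Fast fun n => sigmaMatrix n (M.kp * R) (M.ks * R) i 0 * incCoef M.kp z d cp n :=
    (hsig 0).of_norm_le (c := ‖cp‖ / M.kp) fun n => by rw [norm_mul, norm_incCoef hp, mul_comm]
  have h1 : Fast fun n => sigmaMatrix n (M.kp * R) (M.ks * R) i 1 * incCoef M.ks z d cs n :=
    (hsig 1).of_norm_le (c := ‖cs‖ / M.ks) fun n => by rw [norm_mul, norm_incCoef hs, mul_comm]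
  have h := (h0.add h1).const_mul (-1)
  simp only [neg_one_mul] at h
  exact h

/-- The coefficients are chosen so that the boundary values cancel mode by mode. -/
theorem cylMatrix_scatCoef (M : Medium) {R : ℝ} (hR : 0 < R) (z : Plane) (d : S) (cp cs : ℂ)
    (n : ℤ) :
    (cylMatrix hankel n (M.kp * R) (M.ks * R)).mulVec
        ![scatCoef M R z d cp cs 0 n, scatCoef M R z d cp cs 1 n] =
      -(cylMatrix cJ n (M.kp * R) (M.ks * R)).mulVec
        ![incCoef M.kp z d cp n, incCoef M.ks z d cs n] := by
  have h := isUnit_det_cylMatrix_hankel n (mul_pos M.kp_pos hR) (mul_pos M.ks_pos hR)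
  have e : ![scatCoef M R z d cp cs 0 n, scatCoef M R z d cp cs 1 n] =
      -(sigmaMatrix n (M.kp * R) (M.ks * R)).mulVec
        ![incCoef M.kp z d cp n, incCoef M.ks z d cs n] := by
    ext i
    fin_cases i <;>
      simp [scatCoef, -neg_add_rev]
  rw [e, Matrix.mulVec_neg, Matrix.mulVec_mulVec, sigmaMatrix, Matrix.mul_nonsing_inv_cancel_left _ _ h]

theorem fourier_sub_angle (n : ℤ) (θ d : S) :
    (fourier n (θ - d) : ℂ) = fourier n θ * fourier (-n) d := by
  rw [fourier_apply, fourier_apply, fourier_apply, zsmul_sub, sub_eq_add_neg,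
    AddCircle.toCircle_add, neg_zsmul]
  exact Circle.coe_mul _ _

/-- The Jacobi–Anger expansion of a plane wave about the point `z`. -/
theorem hasSum_planeWave {k R : ℝ} (hk : 0 < k) (hR : 0 < R) (z : Plane) (d θ : S) (c : ℂ) :
    HasSum (fun n : ℤ => Complex.I * k * incCoef k z d c n * cJ n (k * R) * fourier n θ)
      (c * Complex.exp (Complex.I * (k * inner ℝ (z + R • dir θ) (dir d) : ℝ))) := by
  have hk' : (k : ℂ) ≠ 0 := by exact_mod_cast hk.ne'
  have h := (hasSum_jacobi_anger (mul_pos hk hR) (θ - d)).mul_left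
    (c * Complex.exp (Complex.I * (k * inner ℝ z (dir d) : ℝ)))
  have e : c * Complex.exp (Complex.I * (k * inner ℝ (z + R • dir θ) (dir d) : ℝ)) =
      c * Complex.exp (Complex.I * (k * inner ℝ z (dir d) : ℝ)) *
        Complex.exp (Complex.I * (k * R * cosA (θ - d) : ℝ)) := by
    rw [inner_add_left, inner_smul_dir_dir, mul_assoc c, ← Complex.exp_add]
    push_cast
    ring_nf
  rw [e]
  refine h.congr_fun fun n => ?_
  rw [incCoef, fourier_sub_angle]
  field_simp

theorem incCoef_sub_one {k : ℝ} (z : Plane) (d : S) (c : ℂ) (n : ℤ) :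
    -incCoef k z d c (n - 1) = Complex.I * fourier 1 d * incCoef k z d c n := by
  have h1 : (fourier (-(n - 1)) d : ℂ) = fourier 1 d * fourier (-n) d := by
    rw [← fourier_add]
    congr 2
    ring
  rw [incCoef, incCoef, h1, zpow_sub_one₀ Complex.I_ne_zero, Complex.inv_I]
  ring

theorem incCoef_add_one {k : ℝ} (z : Plane) (d : S) (c : ℂ) (n : ℤ) :
    incCoef k z d c (n + 1) = Complex.I * fourier (-1) d * incCoef k z d c n := by
  have h1 : (fourier (-(n + 1)) d : ℂ) = fourier (-1) d * fourier (-n) d := by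
    rw [← fourier_add]
    congr 2
    ring
  rw [incCoef, incCoef, h1, zpow_add_one₀ Complex.I_ne_zero]
  ring

theorem fourier_neg_one_eq (θ : S) : (fourier (-1) θ : ℂ) = cosA θ - Complex.I * sinA θ := by
  have h : (cosA θ + Complex.I * sinA θ : ℂ) * (cosA θ - Complex.I * sinA θ) = 1 := by
    linear_combination cosA_sq_add θ - (sinA θ : ℂ) ^ 2 * Complex.I_sq
  rw [fourier_eq_zpow, zpow_neg_one]
  exact inv_eq_of_mul_eq_one_right h

/-- The rigid boundary condition. The combinations `u₁ ± i u₂` of the incident and the scattered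
field are expanded in `e^{inθ}`, and every mode vanishes by `cylMatrix_scatCoef`. -/
theorem elasticSum_scatCoef_boundary (M : Medium) {R : ℝ} (hR : 0 < R) (z : Plane) (d : S)
    (cp cs : ℂ) (θ : S) :
    planeWave M d cp cs (z + R • dir θ) +
      elasticSum M.kp M.ks z (scatCoef M R z d cp cs 0) (scatCoef M R z d cp cs 1)
        (z + R • dir θ) = 0 := by
  have hp := M.kp_pos
  have hs := M.ks_pos
  have hpR := mul_pos hp hR
  have hsR := mul_pos hs hR
  have hRc : (R : ℂ) ≠ 0 := by exact_mod_cast hR.ne'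
  have hIp : (Complex.I * M.kp : ℂ) ≠ 0 :=
    mul_ne_zero Complex.I_ne_zero (by exact_mod_cast hp.ne')
  set a := scatCoef M R z d cp cs 0 with ha_def
  set b := scatCoef M R z d cp cs 1 with hb_def
  have ha : Fast a := fast_scatCoef M hR z d cp cs 0
  have hb : Fast b := fast_scatCoef M hR z d cp cs 1
  set x := z + R • dir θ with hx_def
  have hxz : x - z = R • dir θ := by rw [hx_def, add_sub_cancel_left]
  have hy0 : R • dir θ ≠ 0 := by
    rw [← norm_pos_iff, norm_smul_dir hR.le]
    exact hR
  have hx : x ≠ z := sub_ne_zero.1 (by rwa [hxz])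
  set α := incCoef M.kp z d cp with hα
  set β := incCoef M.ks z d cs with hβ
  have hP := hasSum_planeWave hp hR z d θ cp
  have hS := hasSum_planeWave hs hR z d θ cs
  rw [← hx_def, ← hα] at hP
  rw [← hx_def, ← hβ] at hS
  set Ep := cp * Complex.exp (Complex.I * (M.kp * inner ℝ x (dir d) : ℝ)) with hEp
  set Es := cs * Complex.exp (Complex.I * (M.ks * inner ℝ x (dir d) : ℝ)) with hEs
  have hmode : ∀ m, (cylMatrix hankel m (M.kp * R) (M.ks * R)).mulVec ![a m, b m] =
      -(cylMatrix cJ m (M.kp * R) (M.ks * R)).mulVec ![α m, β m] :=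
    cylMatrix_scatCoef M hR z d cp cs
  -- the combination `u₁ + i u₂`
  have hplus : planeWave M d cp cs x 0 + Complex.I * planeWave M d cp cs x 1 +
      (elasticSum M.kp M.ks z a b x 0 + Complex.I * elasticSum M.kp M.ks z a b x 1) = 0 := by
    have e1 : planeWave M d cp cs x 0 + Complex.I * planeWave M d cp cs x 1 =
        fourier 1 d * Ep + Complex.I * fourier 1 d * Es := by
      simp only [planeWave, ← hEp, ← hEs, PiLp.add_apply, PiLp.smul_apply, smul_eq_mul, dirC, perpC,
        Matrix.cons_val_zero, Matrix.cons_val_one, Matrix.cons_val_fin_one, fourier_one_eq]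
      linear_combination (-Es * sinA d) * Complex.I_sq
    have e2 : elasticSum M.kp M.ks z a b x 0 + Complex.I * elasticSum M.kp M.ks z a b x 1 =
        (∑' n, -M.kp * a (n - 1) * cylWave M.kp n (x - z)) +
          Complex.I * ∑' n, -M.ks * b (n - 1) * cylWave M.ks n (x - z) := by
      rw [← waveSum_coefX_add hp hx ha, ← waveSum_coefX_add hs hx hb, elasticSum_zero,
        elasticSum_one]
      linear_combination (-waveSum M.ks z (coefY M.ks b) x) * Complex.I_sq
    have s1 := ((ha.shift_sub.const_mul (-M.kp)).summable_cylWave hp hy0).hasSum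
    have s2 := (((hb.shift_sub.const_mul (-M.ks)).summable_cylWave hs hy0).hasSum).mul_left
      Complex.I
    rw [e1, e2, hxz]
    have h := ((hP.mul_left (fourier 1 d)).add (hS.mul_left (Complex.I * fourier 1 d))).add
      (s1.add s2)
    refine h.unique (hasSum_zero.congr_fun fun n => ?_)
    rw [cylWave_smul_dir hR, cylWave_smul_dir hR]
    have r1 := isCylinder_hankel.cylMatrix_mulVec_add (n - 1) hpR hsR (a (n - 1)) (b (n - 1))
    have r2 := isCylinder_cJ.cylMatrix_mulVec_add (n - 1) hpR hsR (α (n - 1)) (β (n - 1))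
    rw [hmode, Pi.neg_apply, Pi.neg_apply, sub_add_cancel] at r1
    rw [sub_add_cancel] at r2
    have r3 := incCoef_sub_one (k := M.kp) z d cp n
    have r4 := incCoef_sub_one (k := M.ks) z d cs n
    rw [← hα] at r3
    rw [← hβ] at r4
    push_cast at r1 r2
    refine mul_left_cancel₀ hRc ?_
    linear_combination (-fourier n θ : ℂ) * r1 - (fourier n θ : ℂ) * r2 +
      (-R * M.kp * cJ n (M.kp * R) * fourier n θ) * r3 -
      Complex.I * (R * M.ks * cJ n (M.ks * R) * fourier n θ) * r4
  -- the combination `u₁ - i u₂`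
  have hminus : planeWave M d cp cs x 0 - Complex.I * planeWave M d cp cs x 1 +
      (elasticSum M.kp M.ks z a b x 0 - Complex.I * elasticSum M.kp M.ks z a b x 1) = 0 := by
    have e1 : planeWave M d cp cs x 0 - Complex.I * planeWave M d cp cs x 1 =
        fourier (-1) d * Ep - Complex.I * fourier (-1) d * Es := by
      simp only [planeWave, ← hEp, ← hEs, PiLp.add_apply, PiLp.smul_apply, smul_eq_mul, dirC, perpC,
        Matrix.cons_val_zero, Matrix.cons_val_one, Matrix.cons_val_fin_one, fourier_neg_one_eq]
      linear_combination (-Es * sinA d) * Complex.I_sq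
    have e2 : elasticSum M.kp M.ks z a b x 0 - Complex.I * elasticSum M.kp M.ks z a b x 1 =
        (∑' n, M.kp * a (n + 1) * cylWave M.kp n (x - z)) +
          -Complex.I * ∑' n, M.ks * b (n + 1) * cylWave M.ks n (x - z) := by
      rw [← waveSum_coefX_sub hp hx ha, ← waveSum_coefX_sub hs hx hb, elasticSum_zero,
        elasticSum_one]
      linear_combination (-waveSum M.ks z (coefY M.ks b) x) * Complex.I_sq
    have s1 := ((ha.shift_add.const_mul M.kp).summable_cylWave hp hy0).hasSum
    have s2 := (((hb.shift_add.const_mul M.ks).summable_cylWave hs hy0).hasSum).mul_left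
      (-Complex.I)
    rw [e1, e2, hxz]
    have h := ((hP.mul_left (fourier (-1) d)).sub (hS.mul_left (Complex.I * fourier (-1) d))).add
      (s1.add s2)
    refine h.unique (hasSum_zero.congr_fun fun n => ?_)
    rw [cylWave_smul_dir hR, cylWave_smul_dir hR]
    have r1 := isCylinder_hankel.cylMatrix_mulVec_sub (n + 1) hpR hsR (a (n + 1)) (b (n + 1))
    have r2 := isCylinder_cJ.cylMatrix_mulVec_sub (n + 1) hpR hsR (α (n + 1)) (β (n + 1))
    rw [hmode, Pi.neg_apply, Pi.neg_apply, add_sub_cancel_right] at r1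
    rw [add_sub_cancel_right] at r2
    have r3 := incCoef_add_one (k := M.kp) z d cp n
    have r4 := incCoef_add_one (k := M.ks) z d cs n
    rw [← hα] at r3
    rw [← hβ] at r4
    push_cast at r1 r2
    refine mul_left_cancel₀ hRc ?_
    linear_combination (-fourier n θ : ℂ) * r1 - (fourier n θ : ℂ) * r2 -
      (R * M.kp * cJ n (M.kp * R) * fourier n θ) * r3 +
      Complex.I * (R * M.ks * cJ n (M.ks * R) * fourier n θ) * r4
  ext j
  fin_cases j
  · simp only [Fin.zero_eta, PiLp.add_apply, PiLp.zero_apply]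
    linear_combination (1 / 2 : ℂ) * hplus + (1 / 2 : ℂ) * hminus
  · simp only [Fin.mk_one, PiLp.add_apply, PiLp.zero_apply]
    linear_combination (-Complex.I / 2 : ℂ) * hplus + (Complex.I / 2 : ℂ) * hminus +
      (planeWave M d cp cs x 1 + elasticSum M.kp M.ks z a b x 1) * Complex.I_sq

/-- The pair of far-field patterns of a disk. -/
def diskPattern (M : Medium) (R : ℝ) (z : Plane) (d : S) (cp cs : ℂ) : (S → ℂ) × (S → ℂ) :=
  (fun θ => Complex.I * M.kp * ffAmp M.kp z (scatCoef M R z d cp cs 0) θ,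
    fun θ => Complex.I * M.ks * ffAmp M.ks z (scatCoef M R z d cp cs 1) θ)

/-- Existence of the scattered field of a disk and of its far-field pattern. -/
theorem isFarFieldPattern_diskPattern (M : Medium) {R : ℝ} (hR : 0 < R) (z : Plane) (d : S)
    (cp cs : ℂ) :
    IsFarFieldPattern M (Metric.ball z R) d cp cs (diskPattern M R z d cp cs) := by
  have ha := fast_scatCoef M hR z d cp cs 0
  have hb := fast_scatCoef M hR z d cp cs 1
  have hsub : (Metric.ball z R)ᶜ ⊆ {z}ᶜ :=
    compl_subset_compl.2 (singleton_subset_iff.2 (Metric.mem_ball_self hR))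
  have hsub' : (closure (Metric.ball z R))ᶜ ⊆ {z}ᶜ :=
    (compl_subset_compl.2 subset_closure).trans hsub
  have hsm := contDiffOn_elasticSum M.kp_pos M.ks_pos z ha hb
  refine ⟨elasticSum M.kp M.ks z (scatCoef M R z d cp cs 0) (scatCoef M R z d cp cs 1),
    ⟨hsm.mono hsub', (hsm.mono hsub).continuousOn,
      fun x hx => navier_elasticSum M z ha hb (hsub' hx), fun x hx => ?_,
      radiating_pPart_elasticSum M z ha hb, radiating_sPart_elasticSum M z ha hb⟩,
    hasFarField_pPart_elasticSum M z ha hb, hasFarField_sPart_elasticSum M z ha hb⟩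
  rw [frontier_ball z hR.ne', Metric.mem_sphere, dist_eq_norm] at hx
  obtain ⟨θ, hθ⟩ := exists_eq_smul_dir (x - z)
  rw [hx] at hθ
  have := elasticSum_scatCoef_boundary M hR z d cp cs θ
  rwa [← hθ, add_sub_cancel] at this

/-! ### Angular modes of a function outside a disk -/

/-- The point with polar coordinates `(ρ, θ)` about `z`. -/
def polar (z : Plane) (ρ θ : ℝ) : Plane := z + ρ • dir (θ : S)

/-- The unit vector `(-sin θ, cos θ)` in the plane. -/
def perp (θ : S) : Plane := WithLp.toLp 2 ![-sinA θ, cosA θ]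

/-- The complement of the closed disk of radius `R` about `z`. -/
def exterior (z : Plane) (R : ℝ) : Set Plane := {x | R < ‖x - z‖}

theorem isOpen_exterior (z : Plane) (R : ℝ) : IsOpen (exterior z R) :=
  isOpen_lt continuous_const (by fun_prop)

theorem polar_mem_exterior (z : Plane) {R ρ : ℝ} (hR : 0 < R) (hρ : R < ρ) (θ : ℝ) :
    polar z ρ θ ∈ exterior z R := by
  rw [exterior, mem_ofPred_eq, polar, add_sub_cancel_left, norm_smul_dir (hR.trans hρ).le]
  exact hρ

theorem continuous_polar (z : Plane) : Continuous fun q : ℝ × ℝ => polar z q.1 q.2 := by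
  have h : Continuous fun θ : ℝ => dir (θ : S) := continuous_dir.comp (AddCircle.continuous_mk' _)
  unfold polar
  exact continuous_const.add (continuous_fst.smul (h.comp continuous_snd))

theorem hasDerivAt_dir (θ : ℝ) : HasDerivAt (fun θ : ℝ => dir (θ : S)) (perp (θ : S)) θ := by
  have e : (fun θ : ℝ => dir (θ : S)) = fun θ : ℝ =>
      Real.cos θ • EuclideanSpace.single (0 : Fin 2) (1 : ℝ) +
        Real.sin θ • EuclideanSpace.single (1 : Fin 2) (1 : ℝ) := by
    funext θ
    ext i
    fin_cases i <;> simp [dir, cosA_coe, sinA_coe]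
  rw [e]
  refine (((Real.hasDerivAt_cos θ).smul_const _).add
    ((Real.hasDerivAt_sin θ).smul_const _)).congr_deriv ?_
  ext i
  fin_cases i <;> simp [perp, cosA_coe, sinA_coe]

theorem hasDerivAt_polar_radial (z : Plane) (ρ θ : ℝ) :
    HasDerivAt (fun ρ => polar z ρ θ) (dir (θ : S)) ρ := by
  simpa [polar] using ((hasDerivAt_id ρ).smul_const (dir (θ : S))).const_add z

theorem hasDerivAt_polar_angular (z : Plane) (ρ θ : ℝ) :
    HasDerivAt (fun θ => polar z ρ θ) (ρ • perp (θ : S)) θ :=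
  ((hasDerivAt_dir θ).const_smul ρ).const_add z

theorem fourier_deriv (n : ℤ) (θ : ℝ) :
    HasDerivAt (fun θ : ℝ => (fourier n (θ : S) : ℂ)) (Complex.I * n * fourier n (θ : S)) θ := by
  refine (hasDerivAt_fourier (2 * Real.pi) n θ).congr_deriv ?_
  have : (Real.pi : ℂ) ≠ 0 := by exact_mod_cast Real.pi_ne_zero
  push_cast
  field_simp

theorem continuous_fourier_coe (n : ℤ) : Continuous fun θ : ℝ => (fourier n (θ : S) : ℂ) :=
  continuous_iff_continuousAt.2 fun θ => (fourier_deriv n θ).continuousAt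

/-- The `n`-th angular Fourier mode of `f` on the circle of radius `ρ` about `z` (up to the factor
`2π`). -/
def mode (z : Plane) (n : ℤ) (f : Plane → ℂ) (ρ : ℝ) : ℂ :=
  ∫ θ in (0 : ℝ)..2 * Real.pi, fourier (-n) (θ : S) * f (polar z ρ θ)

section

variable {z : Plane} {R : ℝ} {f : Plane → ℂ}

theorem continuous_polar_angular (z : Plane) (ρ : ℝ) : Continuous fun θ : ℝ => polar z ρ θ :=
  (continuous_polar z).comp (Continuous.prodMk continuous_const continuous_id)

theorem continuous_comp_polar {E : Type*} [TopologicalSpace E] {g : Plane → E} (hR : 0 < R)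
    (hg : ContinuousOn g (exterior z R)) {ρ : ℝ} (hρ : R < ρ) :
    Continuous fun θ : ℝ => g (polar z ρ θ) :=
  hg.comp_continuous (continuous_polar_angular z ρ) fun θ => polar_mem_exterior z hR hρ θ

theorem continuousOn_fderiv (hf : ContDiffOn ℝ ∞ f (exterior z R)) :
    ContinuousOn (fderiv ℝ f) (exterior z R) :=
  hf.continuousOn_fderiv_of_isOpen (isOpen_exterior z R) (by simp)

theorem hasDerivAt_comp_polar_radial (hR : 0 < R) (hf : ContDiffOn ℝ ∞ f (exterior z R)) {ρ : ℝ}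
    (hρ : R < ρ) (θ : ℝ) :
    HasDerivAt (fun ρ => f (polar z ρ θ)) (fderiv ℝ f (polar z ρ θ) (dir (θ : S))) ρ :=
  (differentiableAt_of_contDiffOn (isOpen_exterior z R) hf
    (polar_mem_exterior z hR hρ θ)).hasFDerivAt.comp_hasDerivAt ρ (hasDerivAt_polar_radial z ρ θ)

theorem hasDerivAt_comp_polar_angular (hR : 0 < R) (hf : ContDiffOn ℝ ∞ f (exterior z R)) {ρ : ℝ}
    (hρ : R < ρ) (θ : ℝ) :
    HasDerivAt (fun θ => f (polar z ρ θ)) (fderiv ℝ f (polar z ρ θ) (ρ • perp (θ : S))) θ :=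
  (differentiableAt_of_contDiffOn (isOpen_exterior z R) hf
    (polar_mem_exterior z hR hρ θ)).hasFDerivAt.comp_hasDerivAt θ (hasDerivAt_polar_angular z ρ θ)

theorem continuous_perp : Continuous perp := by
  refine (PiLp.continuous_toLp 2 _).comp (continuous_pi fun i => ?_)
  fin_cases i
  · exact continuous_sinA.neg
  · exact continuous_cosA

theorem continuous_radial_deriv (hR : 0 < R) (hf : ContDiffOn ℝ ∞ f (exterior z R)) {ρ : ℝ}
    (hρ : R < ρ) : Continuous fun θ : ℝ => fderiv ℝ f (polar z ρ θ) (dir (θ : S)) :=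
  (continuous_comp_polar hR (continuousOn_fderiv hf) hρ).clm_apply
    (continuous_dir.comp (AddCircle.continuous_mk' _))

theorem continuous_angular_deriv (hR : 0 < R) (hf : ContDiffOn ℝ ∞ f (exterior z R)) {ρ : ℝ}
    (hρ : R < ρ) : Continuous fun θ : ℝ => fderiv ℝ f (polar z ρ θ) (ρ • perp (θ : S)) :=
  (continuous_comp_polar hR (continuousOn_fderiv hf) hρ).clm_apply
    ((continuous_perp.comp (AddCircle.continuous_mk' _)).const_smul ρ)

theorem hasDerivAt_mode (hR : 0 < R) (hf : ContDiffOn ℝ ∞ f (exterior z R)) (n : ℤ) {ρ : ℝ}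
    (hρ : R < ρ) : HasDerivAt (mode z n f)
      (∫ θ in (0 : ℝ)..2 * Real.pi,
        fourier (-n) (θ : S) * fderiv ℝ f (polar z ρ θ) (dir (θ : S))) ρ := by
  obtain ⟨r₁, hr₁, hr₁'⟩ := exists_between hρ
  set K : Set ℝ := Icc r₁ (ρ + 1) with hK
  have hKsub : ∀ s ∈ K, R < s := fun s hs => hr₁.trans_le hs.1
  have hKn : K ∈ 𝓝 ρ := Icc_mem_nhds hr₁' (by linarith)
  have hcont : ContinuousOn (fun q : ℝ × ℝ => fderiv ℝ f (polar z q.1 q.2))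
      (K ×ˢ Icc 0 (2 * Real.pi)) :=
    (continuousOn_fderiv hf).comp (continuous_polar z).continuousOn
      fun q hq => polar_mem_exterior z hR (hKsub _ hq.1) _
  obtain ⟨B, hB⟩ := (isCompact_Icc.prod isCompact_Icc).exists_bound_of_continuousOn hcont
  refine (intervalIntegral.hasDerivAt_integral_of_dominated_loc_of_deriv_le (bound := fun _ => B)
    (F := fun ρ (θ : ℝ) => fourier (-n) (θ : S) * f (polar z ρ θ))
    (F' := fun ρ (θ : ℝ) => fourier (-n) (θ : S) * fderiv ℝ f (polar z ρ θ) (dir (θ : S)))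
    hKn ?_ ?_ ?_ ?_ ?_ ?_).2
  · filter_upwards [hKn] with s hs
    exact ((continuous_fourier_coe _).mul
      (continuous_comp_polar hR hf.continuousOn (hKsub s hs))).aestronglyMeasurable
  · exact ((continuous_fourier_coe _).mul
      (continuous_comp_polar hR hf.continuousOn hρ)).intervalIntegrable _ _
  · exact ((continuous_fourier_coe _).mul (continuous_radial_deriv hR hf hρ)).aestronglyMeasurable
  · refine Eventually.of_forall fun θ hθ s hs => ?_
    rw [uIoc_of_le Real.two_pi_pos.le] at hθ
    rw [norm_mul, norm_fourier, one_mul]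
    refine (ContinuousLinearMap.le_opNorm _ _).trans ?_
    rw [norm_dir, mul_one]
    exact hB (s, θ) ⟨hs, hθ.1.le, hθ.2⟩
  · exact intervalIntegrable_const
  · refine Eventually.of_forall fun θ hθ s hs => ?_
    exact (hasDerivAt_comp_polar_radial hR hf (hKsub s hs) θ).const_mul _

theorem polar_two_pi (z : Plane) (ρ : ℝ) : polar z ρ (2 * Real.pi) = polar z ρ 0 := by
  rw [polar, polar]
  congr 3
  simp

/-- Integration by parts in the angle. -/
theorem integral_mul_angular_deriv (hR : 0 < R) (hf : ContDiffOn ℝ ∞ f (exterior z R)) {ρ : ℝ}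
    (hρ : R < ρ) {m m' : ℝ → ℂ} (hm : ∀ θ, HasDerivAt m (m' θ) θ) (hm' : Continuous m')
    (hper : m (2 * Real.pi) = m 0) :
    ∫ θ in (0 : ℝ)..2 * Real.pi, m θ * fderiv ℝ f (polar z ρ θ) (ρ • perp (θ : S)) =
      -∫ θ in (0 : ℝ)..2 * Real.pi, m' θ * f (polar z ρ θ) := by
  rw [intervalIntegral.integral_mul_deriv_eq_deriv_mul (fun θ _ => hm θ)
    (fun θ _ => hasDerivAt_comp_polar_angular hR hf hρ θ) (hm'.intervalIntegrable _ _)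
    ((continuous_angular_deriv hR hf hρ).intervalIntegrable _ _), polar_two_pi, hper, sub_self,
    zero_sub]

theorem mode_angular (hR : 0 < R) (hf : ContDiffOn ℝ ∞ f (exterior z R)) {ρ : ℝ}
    (hρ : R < ρ) (n : ℤ) :
    ∫ θ in (0 : ℝ)..2 * Real.pi,
        fourier (-n) (θ : S) * fderiv ℝ f (polar z ρ θ) (ρ • perp (θ : S)) =
      Complex.I * n * mode z n f ρ := by
  rw [integral_mul_angular_deriv hR hf hρ (fun θ => fourier_deriv (-n) θ)
    (continuous_const.mul (continuous_fourier_coe _)), mode, ← intervalIntegral.integral_neg,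
    ← intervalIntegral.integral_const_mul]
  · refine intervalIntegral.integral_congr fun θ _ => ?_
    push_cast
    ring
  · congr 1
    simp

/-- The operator `∂₁ + i ∂₂` raises the order of a mode by one. -/
theorem mode_dPlus (hR : 0 < R) (hf : ContDiffOn ℝ ∞ f (exterior z R)) {ρ : ℝ}
    (hρ : R < ρ) (n : ℤ) :
    HasDerivAt (mode z n f)
      (mode z (n + 1) (fun x => pd 0 f x + Complex.I * pd 1 f x) ρ + n / ρ * mode z n f ρ) ρ := by
  have hρ0 : (ρ : ℂ) ≠ 0 := by exact_mod_cast (hR.trans hρ).ne'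
  refine (hasDerivAt_mode hR hf n hρ).congr_deriv ?_
  have h1 : (n : ℂ) / ρ * mode z n f ρ = ∫ θ in (0 : ℝ)..2 * Real.pi, -Complex.I / ρ *
      (fourier (-n) (θ : S) * fderiv ℝ f (polar z ρ θ) (ρ • perp (θ : S))) := by
    rw [intervalIntegral.integral_const_mul, mode_angular hR hf hρ]
    linear_combination (n / ρ * mode z n f ρ) * Complex.I_sq
  have hpd : ∀ j, Continuous fun θ : ℝ => pd j f (polar z ρ θ) := fun j =>
    continuous_comp_polar hR (contDiffOn_pd (isOpen_exterior z R) hf j).continuousOn hρ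
  rw [h1, mode, ← intervalIntegral.integral_add]
  · refine intervalIntegral.integral_congr fun θ _ => ?_
    have h2 : (fourier (-(n + 1)) (θ : S) : ℂ) =
        fourier (-n) (θ : S) * (cosA θ - Complex.I * sinA θ) := by
      rw [neg_add, fourier_add, fourier_neg_one_eq]
    simp only [fderiv_apply_eq_pd, PiLp.smul_apply, dir_zero, dir_one, perp, h2, smul_eq_mul,
      Matrix.cons_val_zero, Matrix.cons_val_one, Matrix.cons_val_fin_one]
    push_cast
    field_simp
    linear_combination (sinA θ * pd 1 f (polar z ρ θ)) * Complex.I_sq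
  · exact ((continuous_fourier_coe _).mul
      ((hpd 0).add (continuous_const.mul (hpd 1)))).intervalIntegrable _ _
  · exact (continuous_const.mul ((continuous_fourier_coe _).mul
      (continuous_angular_deriv hR hf hρ))).intervalIntegrable _ _

/-- The operator `∂₁ - i ∂₂` lowers the order of a mode by one. -/
theorem mode_dMinus (hR : 0 < R) (hf : ContDiffOn ℝ ∞ f (exterior z R)) {ρ : ℝ}
    (hρ : R < ρ) (n : ℤ) :
    HasDerivAt (mode z n f)
      (mode z (n - 1) (fun x => pd 0 f x - Complex.I * pd 1 f x) ρ - n / ρ * mode z n f ρ) ρ := by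
  have hρ0 : (ρ : ℂ) ≠ 0 := by exact_mod_cast (hR.trans hρ).ne'
  refine (hasDerivAt_mode hR hf n hρ).congr_deriv ?_
  have h1 : (n : ℂ) / ρ * mode z n f ρ = ∫ θ in (0 : ℝ)..2 * Real.pi, -Complex.I / ρ *
      (fourier (-n) (θ : S) * fderiv ℝ f (polar z ρ θ) (ρ • perp (θ : S))) := by
    rw [intervalIntegral.integral_const_mul, mode_angular hR hf hρ]
    linear_combination (n / ρ * mode z n f ρ) * Complex.I_sq
  have hpd : ∀ j, Continuous fun θ : ℝ => pd j f (polar z ρ θ) := fun j =>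
    continuous_comp_polar hR (contDiffOn_pd (isOpen_exterior z R) hf j).continuousOn hρ
  rw [h1, mode, ← intervalIntegral.integral_sub]
  · refine intervalIntegral.integral_congr fun θ _ => ?_
    have h2 : (fourier (-(n - 1)) (θ : S) : ℂ) =
        fourier (-n) (θ : S) * (cosA θ + Complex.I * sinA θ) := by
      rw [neg_sub, sub_eq_neg_add, fourier_add, fourier_one_eq]
    simp only [fderiv_apply_eq_pd, PiLp.smul_apply, dir_zero, dir_one, perp, h2, smul_eq_mul,
      Matrix.cons_val_zero, Matrix.cons_val_one, Matrix.cons_val_fin_one]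
    push_cast
    field_simp
    linear_combination (sinA θ * pd 1 f (polar z ρ θ)) * Complex.I_sq
  · exact ((continuous_fourier_coe _).mul
      ((hpd 0).sub (continuous_const.mul (hpd 1)))).intervalIntegrable _ _
  · exact (continuous_const.mul ((continuous_fourier_coe _).mul
      (continuous_angular_deriv hR hf hρ))).intervalIntegrable _ _

end

/-! ### The radiation condition for angular modes -/

theorem isCylinder_star_hankel : IsCylinder fun n t => star (hankel n t) where
  hasDerivAt n t ht := by
    refine (hasDerivAt_hankel n ht).star.congr_deriv ?_
    simp
  recurrence n t ht := by
    have h := congrArg star (hankel_recurrence n ht)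
    simpa using h

/-- The Wronskian of a solution of the radial system with a cylinder function is constant. -/
theorem IsCylinder.wronskian_const {F : ℤ → ℝ → ℂ} (hF : IsCylinder F) {k R : ℝ} (hk : 0 < k)
    (hR : 0 < R) {n : ℤ} {f g : ℝ → ℂ}
    (hf : ∀ ρ, R < ρ → HasDerivAt f (g ρ + n / ρ * f ρ) ρ)
    (hg : ∀ ρ, R < ρ → HasDerivAt g (-(k : ℂ) ^ 2 * f ρ - (n + 1) / ρ * g ρ) ρ) :
    ∃ c : ℂ, ∀ ρ, R < ρ →
      ρ * (f ρ * (-k * F (n + 1) (k * ρ)) - g ρ * F n (k * ρ)) = c := by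
  have hder : ∀ ρ ∈ Ioi R, HasDerivAt
      (fun ρ : ℝ => (ρ : ℂ) * (f ρ * (-k * F (n + 1) (k * ρ)) - g ρ * F n (k * ρ))) 0 ρ := by
    intro ρ hρ
    have hρ0 : 0 < ρ := hR.trans hρ
    have hρc : (ρ : ℂ) ≠ 0 := by exact_mod_cast hρ0.ne'
    have ht := mul_pos hk hρ0
    have hid : HasDerivAt (fun ρ : ℝ => k * ρ) k ρ := by
      simpa using (hasDerivAt_id ρ).const_mul k
    have h1 := (hF.hasDerivAt n ht).scomp ρ hid
    have h2 := ((hF.hasDerivAt (n + 1) ht).scomp ρ hid).const_mul (-k : ℂ)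
    have h3 := (hasDerivAt_id ρ).ofReal_comp.fun_mul
      (((hf ρ hρ).fun_mul h2).fun_sub ((hg ρ hρ).fun_mul h1))
    refine h3.congr_deriv ?_
    have r1 := hF.recurrence n ht
    have r2 := hF.recurrence (n + 1) ht
    rw [add_sub_cancel_right] at r2
    push_cast at r1 r2
    simp only [Function.comp_apply, id, add_sub_cancel_right, Complex.real_smul,
      Complex.ofReal_one]
    field_simp
    linear_combination (k * f ρ : ℂ) * r2 - g ρ * r1
  obtain ⟨c, hc⟩ : ∃ c : ℂ, ∀ ρ ∈ Ioi R,
      (ρ : ℂ) * (f ρ * (-k * F (n + 1) (k * ρ)) - g ρ * F n (k * ρ)) = c := by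
    refine ⟨_, fun ρ hρ => isOpen_Ioi.is_const_of_deriv_eq_zero (convex_Ioi R).isPreconnected
      (fun x hx => (hder x hx).differentiableAt.differentiableWithinAt)
      (fun x hx => (hder x hx).deriv) hρ (show R + 1 ∈ Ioi R by simp)⟩
  exact ⟨c, hc⟩

/-- A solution of the radial system is a combination of the outgoing `H_n` and the incoming `conj
H_n`: its Wronskians with these two are constant, and Cramer's rule recovers the solution. -/
theorem exists_hankel_combination {k R : ℝ} (hk : 0 < k)
    (hR : 0 < R) {n : ℤ} {f g : ℝ → ℂ}
    (hf : ∀ ρ, R < ρ → HasDerivAt f (g ρ + n / ρ * f ρ) ρ)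
    (hg : ∀ ρ, R < ρ → HasDerivAt g (-(k : ℂ) ^ 2 * f ρ - (n + 1) / ρ * g ρ) ρ) :
    ∃ a b : ℂ, ∀ ρ, R < ρ →
      f ρ = a * hankel n (k * ρ) + b * star (hankel n (k * ρ)) ∧
      g ρ = a * (-k * hankel (n + 1) (k * ρ)) + b * (-k * star (hankel (n + 1) (k * ρ))) := by
  obtain ⟨c₁, h₁⟩ := isCylinder_hankel.wronskian_const hk hR hf hg
  obtain ⟨c₂, h₂⟩ := isCylinder_star_hankel.wronskian_const hk hR hf hg
  have hpi : (Real.pi : ℂ) ≠ 0 := by exact_mod_cast Real.pi_ne_zero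
  refine ⟨-(Real.pi / (4 * Complex.I) * c₂), Real.pi / (4 * Complex.I) * c₁, fun ρ hρ => ?_⟩
  have hρ0 : 0 < ρ := hR.trans hρ
  have hρc : (ρ : ℂ) ≠ 0 := by exact_mod_cast hρ0.ne'
  have hkc : (k : ℂ) ≠ 0 := by exact_mod_cast hk.ne'
  have e1 := h₁ ρ hρ
  have e2 := h₂ ρ hρ
  have hw := im_star_hankel n (mul_pos hk hρ0)
  set p := hankel n (k * ρ)
  set q := hankel (n + 1) (k * ρ)
  have hw2 : star q * p - q * star p = 4 * Complex.I / (Real.pi * (k * ρ)) := by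
    have h3 := Complex.sub_conj (star q * p)
    rw [hw] at h3
    simp only [map_mul, starRingEnd_apply, star_star] at h3
    rw [h3]
    push_cast
    ring
  have hI := Complex.I_ne_zero
  constructor
  · have : f ρ * (4 * Complex.I / Real.pi) = c₁ * star p - c₂ * p := by
      rw [← e1, ← e2]
      have h4 : 4 * Complex.I / (Real.pi : ℂ) = ρ * k * (star q * p - q * star p) := by
        rw [hw2]; field_simp
      rw [h4]
      ring
    field_simp at this ⊢
    linear_combination this
  · have : g ρ * (4 * Complex.I / Real.pi) = c₁ * (-k * star q) - c₂ * (-k * q) := by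
      rw [← e1, ← e2]
      have h4 : 4 * Complex.I / (Real.pi : ℂ) = ρ * k * (star q * p - q * star p) := by
        rw [hw2]; field_simp
      rw [h4]
      ring
    field_simp at this ⊢
    linear_combination this

theorem tendsto_sqrt_mul_norm_hankel (n : ℤ) :
    Tendsto (fun t => Real.sqrt t * ‖hankel n t‖) atTop (𝓝 ‖hankelConst‖) := by
  obtain ⟨M, C, hM, hC, hb⟩ := hankel_bounds one_pos
  rw [tendsto_iff_norm_sub_tendsto_zero]
  have h := tendsto_rpow_neg_three_halves_mul.const_mul (M * growth C n)
  rw [mul_zero] at h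
  refine squeeze_zero' (Eventually.of_forall fun _ => norm_nonneg _) ?_ h
  filter_upwards [eventually_ge_atTop 1] with t ht
  have ht0 : 0 < t := one_pos.trans_le ht
  have hst := Real.sqrt_pos.2 ht0
  have h1 : ‖hankelConst‖ = Real.sqrt t * ‖hankelLead n t‖ := by
    rw [norm_hankelLead n ht0]
    field_simp
  rw [h1, ← mul_sub, norm_mul, Real.norm_of_nonneg hst.le]
  calc _ ≤ Real.sqrt t * (M * growth C n * t ^ (-(3 / 2) : ℝ)) :=
        mul_le_mul_of_nonneg_left
          ((abs_norm_sub_norm_le _ _).trans (hb n t ht).2) hst.le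
    _ = _ := by ring

/-- The outgoing cylinder functions satisfy the radiation condition. -/
theorem tendsto_sqrt_mul_norm_hankel_radiation (n : ℤ) :
    Tendsto (fun t => Real.sqrt t *
      ‖(hankel (n - 1) t - hankel (n + 1) t) / 2 - Complex.I * hankel n t‖) atTop (𝓝 0) := by
  obtain ⟨M, C, hM, hC, hb⟩ := hankel_bounds one_pos
  have h := tendsto_rpow_neg_three_halves_mul.const_mul
    (M * growth C (n - 1) + M * growth C (n + 1) + M * growth C n)
  rw [mul_zero] at h
  refine squeeze_zero' (Eventually.of_forall fun _ => by positivity) ?_ h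
  filter_upwards [eventually_ge_atTop 1] with t ht
  have ht0 : 0 < t := one_pos.trans_le ht
  have hst := Real.sqrt_pos.2 ht0
  have e : (hankel (n - 1) t - hankel (n + 1) t) / 2 - Complex.I * hankel n t =
      (1 / 2 : ℂ) * (hankel (n - 1) t - hankelLead (n - 1) t) +
        (-1 / 2 : ℂ) * (hankel (n + 1) t - hankelLead (n + 1) t) +
        -Complex.I * (hankel n t - hankelLead n t) := by
    rw [hankelLead_add_one, hankelLead_sub_one]
    ring
  rw [e]
  have b1 := (hb (n - 1) t ht).2
  have b2 := (hb (n + 1) t ht).2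
  have b3 := (hb n t ht).2
  have h1 : ‖(1 / 2 : ℂ) * (hankel (n - 1) t - hankelLead (n - 1) t) +
        (-1 / 2 : ℂ) * (hankel (n + 1) t - hankelLead (n + 1) t) +
        -Complex.I * (hankel n t - hankelLead n t)‖ ≤
      M * growth C (n - 1) * t ^ (-(3 / 2) : ℝ) + M * growth C (n + 1) * t ^ (-(3 / 2) : ℝ) +
        M * growth C n * t ^ (-(3 / 2) : ℝ) := by
    refine norm_add₃_le.trans (add_le_add (add_le_add ?_ ?_) ?_)
    · rw [norm_mul]
      refine (mul_le_of_le_one_left (norm_nonneg _) ?_).trans b1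
      norm_num
    · rw [norm_mul]
      refine (mul_le_of_le_one_left (norm_nonneg _) ?_).trans b2
      norm_num
    · rw [norm_mul]
      refine (mul_le_of_le_one_left (norm_nonneg _) ?_).trans b3
      simp
  calc _ ≤ Real.sqrt t * _ := mul_le_mul_of_nonneg_left h1 hst.le
    _ = _ := by ring

/-- A combination of the outgoing `H_n` and the incoming `conj H_n` that satisfies the radiation
condition has no incoming part. -/
theorem incoming_eq_zero {k R : ℝ} (hk : 0 < k) (hR : 0 < R) {n : ℤ} {a b : ℂ} {g : ℝ → ℂ}
    (hg : ∀ ρ, R < ρ → g ρ = a * hankel n (k * ρ) + b * star (hankel n (k * ρ)))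
    (hrad : Tendsto (fun ρ => Real.sqrt ρ * ‖deriv g ρ - Complex.I * k * g ρ‖) atTop (𝓝 0)) :
    b = 0 := by
  have hkt : Tendsto (fun ρ : ℝ => k * ρ) atTop atTop := tendsto_id.const_mul_atTop hk
  have t1 := (tendsto_sqrt_mul_norm_hankel n).comp hkt
  have t2 := (tendsto_sqrt_mul_norm_hankel_radiation n).comp hkt
  have hupper : Tendsto (fun ρ => Real.sqrt k * (Real.sqrt ρ * ‖deriv g ρ - Complex.I * k * g ρ‖) +
      (‖a‖ * k + ‖b‖ * k) * (Real.sqrt (k * ρ) * ‖(hankel (n - 1) (k * ρ) -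
        hankel (n + 1) (k * ρ)) / 2 - Complex.I * hankel n (k * ρ)‖)) atTop (𝓝 0) := by
    simpa using (hrad.const_mul (Real.sqrt k)).add (t2.const_mul (‖a‖ * k + ‖b‖ * k))
  have hlow : Tendsto (fun ρ => ‖b‖ * k * 2 * (Real.sqrt (k * ρ) * ‖hankel n (k * ρ)‖)) atTop
      (𝓝 (‖b‖ * k * 2 * ‖hankelConst‖)) := t1.const_mul _
  have hle := le_of_tendsto_of_tendsto hlow hupper ?_
  · by_contra hb
    have h1 : 0 < ‖b‖ := norm_pos_iff.2 hb
    have h2 : 0 < ‖hankelConst‖ := by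
      have h3 := norm_hankelConst
      by_contra h4
      have h5 : ‖hankelConst‖ = 0 := le_antisymm (not_lt.1 h4) (norm_nonneg _)
      rw [h5] at h3
      have : 0 < 2 / Real.pi := by positivity
      rw [← h3] at this
      norm_num at this
    have : 0 < ‖b‖ * k * 2 * ‖hankelConst‖ := by positivity
    linarith
  · filter_upwards [eventually_gt_atTop R] with ρ hρ
    have hρ0 : 0 < ρ := hR.trans hρ
    have ht := mul_pos hk hρ0
    have hid : HasDerivAt (fun ρ : ℝ => k * ρ) k ρ := by
      simpa using (hasDerivAt_id ρ).const_mul k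
    have d1 := (isCylinder_hankel.hasDerivAt n ht).scomp ρ hid
    have d2 := (isCylinder_star_hankel.hasDerivAt n ht).scomp ρ hid
    have d3 : HasDerivAt g _ ρ := ((d1.const_mul a).add (d2.const_mul b)).congr_of_eventuallyEq
      (Filter.eventuallyEq_of_mem (Ioi_mem_nhds hρ) fun s hs => hg s hs)
    set ε := (hankel (n - 1) (k * ρ) - hankel (n + 1) (k * ρ)) / 2 - Complex.I * hankel n (k * ρ)
      with hε
    -- `conj H_n` satisfies the radiation condition with the opposite sign, which leaves `2 i k b
    -- conj H_n`
    have e : b * k * (2 * Complex.I) * star (hankel n (k * ρ)) =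
        -(deriv g ρ - Complex.I * k * g ρ) + a * k * ε + b * k * star ε := by
      rw [d3.deriv, hg ρ hρ, hε]
      simp only [Complex.real_smul, star_sub, star_div₀, star_mul', star_ofNat, RCLike.star_def,
        Complex.conj_I]
      ring
    have hn := congrArg norm e
    have hkn : ‖(k : ℂ)‖ = k := by rw [Complex.norm_real, Real.norm_of_nonneg hk.le]
    rw [norm_mul, norm_mul, norm_mul, norm_mul, norm_star, Complex.norm_I, hkn] at hn
    have hn2 : ‖-(deriv g ρ - Complex.I * k * g ρ) + a * k * ε + b * k * star ε‖ ≤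
        ‖deriv g ρ - Complex.I * k * g ρ‖ + ‖a‖ * k * ‖ε‖ + ‖b‖ * k * ‖ε‖ := by
      refine norm_add₃_le.trans (le_of_eq ?_)
      rw [norm_neg, norm_mul, norm_mul, norm_mul, norm_mul, norm_star, hkn]
    have hn3 : ‖b‖ * k * 2 * ‖hankel n (k * ρ)‖ ≤
        ‖deriv g ρ - Complex.I * k * g ρ‖ + ‖a‖ * k * ‖ε‖ + ‖b‖ * k * ‖ε‖ := by
      refine le_trans (le_of_eq ?_) (hn.le.trans hn2)
      simp
    have h4 := mul_le_mul_of_nonneg_left hn3 (Real.sqrt_nonneg (k * ρ))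
    have h5 : Real.sqrt (k * ρ) = Real.sqrt k * Real.sqrt ρ := Real.sqrt_mul hk.le _
    calc _ = Real.sqrt (k * ρ) * (‖b‖ * k * 2 * ‖hankel n (k * ρ)‖) := by ring
      _ ≤ _ := h4
      _ = _ := by rw [mul_add, mul_add]; nth_rewrite 1 [h5]; ring

/-- The Sommerfeld radiation condition (about the origin) for a scalar function. -/
def RadiatingScalar (k : ℝ) (G : Plane → ℂ) : Prop :=
  (fun x : Plane => fderiv ℝ G x (‖x‖⁻¹ • x) - Complex.I * k * G x)
    =o[Bornology.cobounded Plane] fun x : Plane => ‖x‖ ^ (-(1 / 2) : ℝ)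

theorem RadiatingScalar.eventually {k : ℝ} {G : Plane → ℂ} (h : RadiatingScalar k G) {ε : ℝ}
    (hε : 0 < ε) : ∃ r₀ : ℝ, ∀ x : Plane, r₀ ≤ ‖x‖ →
      ‖fderiv ℝ G x (‖x‖⁻¹ • x) - Complex.I * k * G x‖ ≤ ε * ‖x‖ ^ (-(1 / 2) : ℝ) := by
  have h1 := h.bound hε
  rw [← comap_norm_atTop, eventually_comap] at h1
  obtain ⟨r₀, h2⟩ := eventually_atTop.1 h1
  refine ⟨r₀, fun x hx => ?_⟩
  have := h2 ‖x‖ hx x rfl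
  rwa [Real.norm_of_nonneg (Real.rpow_nonneg (norm_nonneg x) _)] at this

section

variable {z : Plane} {R k : ℝ} {G : Plane → ℂ}

theorem mem_exterior_of_lt {x : Plane} (hx : R + ‖z‖ < ‖x‖) : x ∈ exterior z R := by
  have := norm_sub_norm_le x z
  rw [exterior, mem_ofPred_eq]
  linarith

/-- A radiating function grows at most linearly: integrate the radiation condition along rays. -/
theorem RadiatingScalar.growth_le (h : RadiatingScalar k G)
    (hG : ContDiffOn ℝ ∞ G (exterior z R)) :
    ∃ C r₀ : ℝ, 0 < C ∧ ∀ x : Plane, r₀ ≤ ‖x‖ → ‖G x‖ ≤ C * ‖x‖ := by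
  obtain ⟨r₁, h₁⟩ := h.eventually one_pos
  set r₀ := max (max r₁ 1) (R + ‖z‖ + 1) with hr₀
  have hr1 : 1 ≤ r₀ := (le_max_right _ _).trans (le_max_left _ _)
  have hr0 : r₁ ≤ r₀ := (le_max_left _ _).trans (le_max_left _ _)
  have hrR : R + ‖z‖ + 1 ≤ r₀ := le_max_right _ _
  have hmem : ∀ x : Plane, r₀ ≤ ‖x‖ → x ∈ exterior z R := fun x hx =>
    mem_exterior_of_lt (by linarith)
  obtain ⟨B, hB⟩ := (isCompact_sphere (0 : Plane) r₀).exists_bound_of_continuousOn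
    (f := G) (hG.continuousOn.mono fun x hx => hmem x (by
      rw [mem_sphere_zero_iff_norm] at hx
      exact hx.ge))
  refine ⟨|B| + 1, r₀, by positivity, fun x hx => ?_⟩
  obtain ⟨θ, hθ⟩ := exists_eq_smul_dir x
  have hn : ∀ r ∈ Ici r₀, ‖r • dir θ‖ = r := fun r hr => norm_smul_dir (by
    have : r₀ ≤ r := hr
    linarith) θ
  -- the function `e^{-ikr} G(r x̂)` has a derivative of norm at most `1`
  have hder : ∀ r ∈ Ici r₀, HasDerivAt
      (fun r : ℝ => Complex.exp (Complex.I * (-(k * r) : ℝ)) * G (r • dir θ))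
      (Complex.exp (Complex.I * (-(k * r) : ℝ)) *
        (fderiv ℝ G (r • dir θ) (dir θ) - Complex.I * k * G (r • dir θ))) r := by
    intro r hr
    have hr' : r₀ ≤ ‖r • dir θ‖ := by rw [hn r hr]; exact hr
    have d1 : HasDerivAt (fun r : ℝ => r • dir θ) (dir θ) r := by
      simpa using (hasDerivAt_id r).smul_const (dir θ)
    have d2 := (differentiableAt_of_contDiffOn (isOpen_exterior z R) hG
      (hmem _ hr')).hasFDerivAt.comp_hasDerivAt r d1
    have d3 : HasDerivAt (fun r : ℝ => Complex.exp (Complex.I * (-(k * r) : ℝ)))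
        (Complex.exp (Complex.I * (-(k * r) : ℝ)) * (Complex.I * (-(k * 1) : ℝ))) r :=
      (((((hasDerivAt_id r).const_mul k).fun_neg).ofReal_comp).const_mul Complex.I).cexp
    refine (d3.fun_mul d2).congr_deriv ?_
    simp only [Function.comp_apply]
    push_cast
    ring
  have hbd : ∀ r ∈ Ici r₀, ‖Complex.exp (Complex.I * (-(k * r) : ℝ)) *
        (fderiv ℝ G (r • dir θ) (dir θ) - Complex.I * k * G (r • dir θ))‖ ≤ 1 := by
    intro r hr
    have hr' : r₀ ≤ r := hr
    have h2 := h₁ (r • dir θ) (by rw [hn r hr]; linarith)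
    rw [hn r hr, smul_smul, inv_mul_cancel₀ (by linarith), one_smul, one_mul] at h2
    rw [norm_mul, norm_exp_I_mul, one_mul]
    exact h2.trans (Real.rpow_le_one_of_one_le_of_nonpos (by linarith) (by norm_num))
  have hmv := (convex_Ici r₀).norm_image_sub_le_of_norm_hasDerivWithin_le
    (fun r hr => (hder r hr).hasDerivWithinAt) hbd (mem_Ici.2 le_rfl) (mem_Ici.2 hx)
  rw [← hθ] at hmv
  have hb := hB (r₀ • dir θ) (by
    rw [mem_sphere_zero_iff_norm]
    exact hn r₀ (mem_Ici.2 le_rfl))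
  have h3 := norm_sub_norm_le (Complex.exp (Complex.I * (-(k * ‖x‖) : ℝ)) * G x)
    (Complex.exp (Complex.I * (-(k * r₀) : ℝ)) * G (r₀ • dir θ))
  rw [norm_mul, norm_mul, norm_exp_I_mul, norm_exp_I_mul, one_mul, one_mul] at h3
  rw [Real.norm_of_nonneg (by linarith), one_mul] at hmv
  have h4 := le_abs_self B
  have h5 : |B| ≤ |B| * ‖x‖ := le_mul_of_one_le_right (abs_nonneg _) (by linarith)
  linarith

theorem vec_decomp (z : Plane) (θ : S) :
    z = (inner ℝ z (dir θ) : ℝ) • dir θ + (inner ℝ z (perp θ) : ℝ) • perp θ := by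
  have h := cosA_sq_add_sinA_sq θ
  ext i
  fin_cases i
  · simp [PiLp.inner_apply, Fin.sum_univ_two, dir, perp]
    linear_combination -(z 0) * h
  · simp [PiLp.inner_apply, Fin.sum_univ_two, dir, perp]
    linear_combination -(z 1) * h

theorem norm_perp (θ : S) : ‖perp θ‖ = 1 := by
  rw [EuclideanSpace.norm_eq]
  simp [perp, Fin.sum_univ_two, add_comm, cosA_sq_add_sinA_sq]

theorem hasDerivAt_inner_dir (z : Plane) (θ : ℝ) :
    HasDerivAt (fun θ : ℝ => (inner ℝ z (dir (θ : S)) : ℝ)) (inner ℝ z (perp (θ : S))) θ :=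
  (innerSL ℝ z).hasFDerivAt.comp_hasDerivAt θ (hasDerivAt_dir θ)

theorem hasDerivAt_inner_perp (z : Plane) (θ : ℝ) :
    HasDerivAt (fun θ : ℝ => (inner ℝ z (perp (θ : S)) : ℝ)) (-inner ℝ z (dir (θ : S))) θ := by
  have e : (fun θ : ℝ => (inner ℝ z (perp (θ : S)) : ℝ)) = fun θ : ℝ =>
      -Real.sin θ * z 0 + Real.cos θ * z 1 := by
    funext θ
    simp [PiLp.inner_apply, Fin.sum_univ_two, perp, cosA_coe, sinA_coe]
  rw [e]
  refine (((Real.hasDerivAt_sin θ).fun_neg.mul_const (z 0)).fun_add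
    ((Real.hasDerivAt_cos θ).mul_const (z 1))).congr_deriv ?_
  simp [PiLp.inner_apply, Fin.sum_univ_two, dir, cosA_coe, sinA_coe]
  ring

/-- The radiation condition about the origin carries over to the angular modes about `z`. The
radial derivative about `z` is the one about the origin up to a small multiple of the angular
derivative about `z`, which is integrated by parts. -/
theorem RadiatingScalar.tendsto_mode (h : RadiatingScalar k G) (hk : 0 < k) (hR : 0 < R)
    (hG : ContDiffOn ℝ ∞ G (exterior z R)) (n : ℤ) :
    Tendsto (fun ρ => Real.sqrt ρ * ‖deriv (mode z n G) ρ - Complex.I * k * mode z n G ρ‖) atTop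
      (𝓝 0) := by
  obtain ⟨C, r₀, hC, hgrow⟩ := h.growth_le hG
  set N : ℝ := (n.natAbs : ℝ) with hN
  have hN0 : 0 ≤ N := Nat.cast_nonneg _
  set Z := ‖z‖ with hZ
  have hZ0 : 0 ≤ Z := norm_nonneg z
  set K : ℝ := k * (4 * Z ^ 2) * (C * (3 / 2)) + (2 * N + 8) * Z * (C * (3 / 2)) with hK
  have hK0 : 0 ≤ K := by positivity
  have key : ∀ ε > 0, ∀ᶠ ρ in atTop,
      ‖deriv (mode z n G) ρ - Complex.I * k * mode z n G ρ‖ ≤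
        (6 * ε * (Real.sqrt ρ)⁻¹ + K * ρ⁻¹) * (2 * Real.pi) := by
    intro ε hε
    obtain ⟨r₁, hr₁⟩ := h.eventually hε
    filter_upwards [eventually_gt_atTop R, eventually_ge_atTop (2 * Z + 1),
      eventually_ge_atTop (2 * r₀), eventually_ge_atTop (2 * r₁)] with ρ hρR hρz hρ0 hρ1
    have hρ : 0 < ρ := hR.trans hρR
    have hsρ := Real.sqrt_pos.2 hρ
    -- the coefficient of the angular derivative
    let s : ℝ → ℝ := fun θ => inner ℝ z (dir (θ : S))
    let t : ℝ → ℝ := fun θ => inner ℝ z (perp (θ : S))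
    have hs_le : ∀ θ, |s θ| ≤ Z := fun θ => by
      have := abs_real_inner_le_norm z (dir (θ : S))
      rwa [norm_dir, mul_one] at this
    have ht_le : ∀ θ, |t θ| ≤ Z := fun θ => by
      have := abs_real_inner_le_norm z (perp (θ : S))
      rwa [norm_perp, mul_one] at this
    have hs_pos : ∀ θ, ρ / 2 ≤ ρ + s θ := fun θ => by
      have := (abs_le.1 (hs_le θ)).1
      linarith
    have hs_pos' : ∀ θ, 0 < ρ + s θ := fun θ => (half_pos hρ).trans_le (hs_pos θ)
    let v : ℝ → ℝ := fun θ => t θ / (ρ * (ρ + s θ))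
    let v' : ℝ → ℝ := fun θ =>
      (-s θ * (ρ * (ρ + s θ)) - t θ * (ρ * t θ)) / (ρ * (ρ + s θ)) ^ 2
    have hv : ∀ θ, HasDerivAt v (v' θ) θ := fun θ =>
      (hasDerivAt_inner_perp z θ).fun_div (((hasDerivAt_inner_dir z θ).const_add ρ).const_mul ρ)
        (mul_pos hρ (hs_pos' θ)).ne'
    let m : ℝ → ℂ := fun θ => fourier (-n) (θ : S) * (v θ : ℂ)
    let m' : ℝ → ℂ := fun θ => Complex.I * ((-n : ℤ) : ℂ) * fourier (-n) (θ : S) * (v θ : ℂ) +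
      fourier (-n) (θ : S) * (v' θ : ℂ)
    have hm : ∀ θ, HasDerivAt m (m' θ) θ := fun θ =>
      (fourier_deriv (-n) θ).fun_mul (hv θ).ofReal_comp
    have hsc : Continuous s := continuous_iff_continuousAt.2 fun θ =>
      (hasDerivAt_inner_dir z θ).continuousAt
    have htc : Continuous t := continuous_iff_continuousAt.2 fun θ =>
      (hasDerivAt_inner_perp z θ).continuousAt
    have hvc : Continuous v := continuous_iff_continuousAt.2 fun θ => (hv θ).continuousAt
    have hvc' : Continuous v' := by
      refine Continuous.div (by fun_prop) (by fun_prop) fun θ => ?_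
      exact pow_ne_zero _ (mul_pos hρ (hs_pos' θ)).ne'
    have hfc := continuous_fourier_coe (-n)
    have hmc' : Continuous m' := by
      have h1 : Continuous fun θ => (v θ : ℂ) := Complex.continuous_ofReal.comp hvc
      have h2 : Continuous fun θ => (v' θ : ℂ) := Complex.continuous_ofReal.comp hvc'
      exact ((continuous_const.mul hfc).mul h1).add (hfc.mul h2)
    have hcoe : ((2 * Real.pi : ℝ) : S) = ((0 : ℝ) : S) := by simp
    have hper : m (2 * Real.pi) = m 0 := by
      simp only [m, v, s, t, hcoe]
    have hparts := integral_mul_angular_deriv hR hG hρR hm hmc' hper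
    -- the integrand after the integration by parts
    have hGc := continuous_comp_polar hR hG.continuousOn hρR
    have hint : deriv (mode z n G) ρ - Complex.I * k * mode z n G ρ =
        ∫ θ in (0 : ℝ)..2 * Real.pi, (fourier (-n) (θ : S) *
          (fderiv ℝ G (polar z ρ θ) (dir (θ : S)) - Complex.I * k * G (polar z ρ θ)) +
          (m θ * fderiv ℝ G (polar z ρ θ) (ρ • perp (θ : S)) + m' θ * G (polar z ρ θ))) := by
      have i1 : IntervalIntegrable (fun θ : ℝ => fourier (-n) (θ : S) *
          fderiv ℝ G (polar z ρ θ) (dir (θ : S))) volume 0 (2 * Real.pi) :=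
        (hfc.mul (continuous_radial_deriv hR hG hρR)).intervalIntegrable _ _
      have i2 : IntervalIntegrable (fun θ : ℝ => Complex.I * k * (fourier (-n) (θ : S) *
          G (polar z ρ θ))) volume 0 (2 * Real.pi) :=
        (continuous_const.mul (hfc.mul hGc)).intervalIntegrable _ _
      have hmcont : Continuous m := continuous_iff_continuousAt.2 fun θ => (hm θ).continuousAt
      have i3 : IntervalIntegrable (fun θ : ℝ => m θ *
          fderiv ℝ G (polar z ρ θ) (ρ • perp (θ : S))) volume 0 (2 * Real.pi) :=
        (hmcont.mul (continuous_angular_deriv hR hG hρR)).intervalIntegrable _ _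
      have i4 : IntervalIntegrable (fun θ : ℝ => m' θ * G (polar z ρ θ)) volume 0
          (2 * Real.pi) := (hmc'.mul hGc).intervalIntegrable _ _
      have e1 : (∫ θ in (0 : ℝ)..2 * Real.pi, (fourier (-n) (θ : S) *
          (fderiv ℝ G (polar z ρ θ) (dir (θ : S)) - Complex.I * k * G (polar z ρ θ)) +
          (m θ * fderiv ℝ G (polar z ρ θ) (ρ • perp (θ : S)) + m' θ * G (polar z ρ θ)))) =
          ∫ θ in (0 : ℝ)..2 * Real.pi, ((fourier (-n) (θ : S) *
            fderiv ℝ G (polar z ρ θ) (dir (θ : S)) -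
            Complex.I * k * (fourier (-n) (θ : S) * G (polar z ρ θ))) +
          (m θ * fderiv ℝ G (polar z ρ θ) (ρ • perp (θ : S)) + m' θ * G (polar z ρ θ))) := by
        refine intervalIntegral.integral_congr fun θ _ => ?_
        ring
      rw [e1, intervalIntegral.integral_add (i1.sub i2) (i3.add i4),
        intervalIntegral.integral_sub i1 i2, intervalIntegral.integral_add i3 i4, hparts,
        neg_add_cancel, add_zero, (hasDerivAt_mode hR hG n hρR).deriv,
        intervalIntegral.integral_const_mul, mode]
    rw [hint]
    refine (intervalIntegral.norm_integral_le_of_norm_le_const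
      (C := 6 * ε * (Real.sqrt ρ)⁻¹ + K * ρ⁻¹) fun θ _ => ?_).trans (le_of_eq ?_)
    swap
    · rw [sub_zero, abs_of_pos Real.two_pi_pos]
    obtain ⟨g1, g2, g3, -⟩ := far_zone_estimates (-z) (r := ρ) (by rw [norm_neg]; exact hρz) (θ : S)
    have hy : ρ • dir (θ : S) - -z = polar z ρ θ := by rw [polar]; abel
    rw [hy, inner_neg_left, sub_neg_eq_add, norm_neg] at g3
    rw [hy] at g1 g2
    rw [norm_neg] at g2
    set y := polar z ρ θ with hy_def
    set r := ‖y‖ with hr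
    have hr_pos : 0 < r := (half_pos hρ).trans_le g1
    have hr_up : r ≤ 3 / 2 * ρ := by
      have := (abs_le.1 g2).2
      linarith
    have hS := hs_pos θ
    have hS' := hs_pos' θ
    have hSc : ((ρ + s θ : ℝ) : ℂ) ≠ 0 := by exact_mod_cast hS'.ne'
    have hρc : (ρ : ℂ) ≠ 0 := by exact_mod_cast hρ.ne'
    have hrc : (r : ℂ) ≠ 0 := by exact_mod_cast hr_pos.ne'
    set L := fderiv ℝ G y with hL
    have hLy : L (‖y‖⁻¹ • y) =
        (r : ℂ)⁻¹ * ((ρ + s θ : ℝ) * L (dir (θ : S)) + (t θ : ℝ) * L (perp (θ : S))) := by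
      have : y = (ρ + s θ) • dir (θ : S) + t θ • perp (θ : S) := by
        rw [hy_def, polar]
        conv_lhs => rw [vec_decomp z (θ : S)]
        rw [add_smul]
        abel
      rw [map_smul]
      nth_rewrite 2 [this]
      rw [map_add, map_smul, map_smul]
      simp only [Complex.real_smul]
      push_cast
      rfl
    have hident : fourier (-n) (θ : S) * (L (dir (θ : S)) - Complex.I * k * G y) +
        (m θ * L (ρ • perp (θ : S)) + m' θ * G y) =
        fourier (-n) (θ : S) * ((r / (ρ + s θ) : ℝ) : ℂ) *
          (L (‖y‖⁻¹ • y) - Complex.I * k * G y) +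
        fourier (-n) (θ : S) * (Complex.I * k) * ((r / (ρ + s θ) - 1 : ℝ) : ℂ) * G y +
        m' θ * G y := by
      rw [hLy, map_smul]
      simp only [m, v, Complex.real_smul]
      push_cast at hSc ⊢
      field_simp
      ring
    rw [hident]
    have hGy : ‖G y‖ ≤ C * (3 / 2 * ρ) :=
      (hgrow y (by linarith)).trans (mul_le_mul_of_nonneg_left hr_up hC.le)
    have hrad := hr₁ y (by linarith)
    have hr_half : r ^ (-(1 / 2) : ℝ) ≤ 2 * (Real.sqrt ρ)⁻¹ := by
      rw [Real.rpow_neg hr_pos.le, ← Real.sqrt_eq_rpow]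
      have h1 : Real.sqrt ρ / 2 ≤ Real.sqrt r := by
        rw [← Real.sqrt_sq (show (0 : ℝ) ≤ 2 by norm_num), ← Real.sqrt_div hρ.le]
        exact Real.sqrt_le_sqrt (by linarith)
      refine (inv_anti₀ (by positivity) h1).trans (le_of_eq ?_)
      rw [inv_div, div_eq_mul_inv]
    have hc3 : r / (ρ + s θ) ≤ 3 := by
      rw [div_le_iff₀ hS']
      linarith
    have hc0 : 0 ≤ r / (ρ + s θ) := by positivity
    have hc1 : |r / (ρ + s θ) - 1| ≤ 4 * Z ^ 2 * (ρ⁻¹ * ρ⁻¹) := by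
      rw [div_sub_one hS'.ne', abs_div, abs_of_pos hS', div_le_iff₀ hS']
      refine g3.trans ?_
      have h1 : 4 * Z ^ 2 * (ρ⁻¹ * ρ⁻¹) * (ρ / 2) = 2 * Z ^ 2 / ρ := by field_simp; ring
      rw [← h1]
      exact mul_le_mul_of_nonneg_left hS (by positivity)
    have hv1 : |v θ| ≤ 2 * Z * (ρ⁻¹ * ρ⁻¹) := by
      simp only [v]
      rw [abs_div, abs_of_pos (mul_pos hρ hS'), div_le_iff₀ (mul_pos hρ hS')]
      refine (ht_le θ).trans ?_
      have h1 : 2 * Z * (ρ⁻¹ * ρ⁻¹) * (ρ * (ρ / 2)) = Z := by field_simp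
      exact h1.ge.trans (mul_le_mul_of_nonneg_left
        (mul_le_mul_of_nonneg_left hS hρ.le) (by positivity))
    have hv2 : |v' θ| ≤ 8 * Z * (ρ⁻¹ * ρ⁻¹) := by
      simp only [v']
      have hden : 0 < (ρ * (ρ + s θ)) ^ 2 := pow_pos (mul_pos hρ hS') 2
      rw [abs_div, abs_of_pos hden, div_le_iff₀ hden]
      have h1 : |-s θ * (ρ * (ρ + s θ)) - t θ * (ρ * t θ)| ≤ 2 * Z * (ρ * (ρ + s θ)) := by
        refine (abs_sub _ _).trans ?_
        rw [abs_mul (-s θ), abs_mul (t θ), abs_mul ρ (t θ), abs_neg, abs_of_pos (mul_pos hρ hS'),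
          abs_of_pos hρ]
        have h2 := mul_le_mul_of_nonneg_right (hs_le θ) (mul_pos hρ hS').le
        have h3 : |t θ| * (ρ * |t θ|) ≤ Z * (ρ * (ρ + s θ)) :=
          mul_le_mul (ht_le θ) (mul_le_mul_of_nonneg_left ((ht_le θ).trans (by linarith)) hρ.le)
            (by positivity) hZ0
        linarith
      refine h1.trans ?_
      have h4 : 2 * Z * (ρ * (ρ + s θ)) = 4 * Z * (ρ⁻¹ * (ρ⁻¹ * ρ⁻¹)) *
          ((ρ * (ρ + s θ)) * (ρ * (ρ * (ρ / 2)))) := by field_simp; ring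
      have h5 : 8 * Z * (ρ⁻¹ * ρ⁻¹) * (ρ * (ρ + s θ)) ^ 2 = 8 * Z * (ρ⁻¹ * (ρ⁻¹ * ρ⁻¹)) *
          ((ρ * (ρ + s θ)) * (ρ * (ρ * (ρ + s θ)))) := by field_simp
      rw [h4, h5]
      refine mul_le_mul ?_ ?_ (by positivity) (by positivity)
      · refine mul_le_mul_of_nonneg_right ?_ (by positivity)
        linarith
      · refine mul_le_mul_of_nonneg_left ?_ (by positivity)
        exact mul_le_mul_of_nonneg_left (mul_le_mul_of_nonneg_left hS hρ.le) hρ.le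
    have hm1 : ‖m' θ‖ ≤ (2 * N + 8) * Z * (ρ⁻¹ * ρ⁻¹) := by
      simp only [m']
      refine (norm_add_le _ _).trans ?_
      rw [norm_mul, norm_mul, norm_mul, norm_mul, norm_fourier, Complex.norm_I, Complex.norm_real,
        Complex.norm_real, Complex.norm_intCast, Real.norm_eq_abs, Real.norm_eq_abs]
      have hn : |((-n : ℤ) : ℝ)| = N := by
        rw [hN]
        push_cast
        rw [abs_neg, Nat.cast_natAbs, Int.cast_abs]
      rw [hn]
      have := mul_le_mul_of_nonneg_left hv1 hN0
      linarith
    refine norm_add₃_le.trans ?_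
    rw [norm_mul, norm_mul, norm_mul, norm_mul, norm_mul, norm_mul, norm_mul, norm_fourier,
      Complex.norm_I, Complex.norm_real, Complex.norm_real, Complex.norm_real,
      Real.norm_of_nonneg hc0, Real.norm_of_nonneg hk.le, Real.norm_eq_abs, one_mul, one_mul, one_mul]
    have f1 : r / (ρ + s θ) * ‖L (‖y‖⁻¹ • y) - Complex.I * k * G y‖ ≤
        6 * ε * (Real.sqrt ρ)⁻¹ := by
      calc _ ≤ 3 * (ε * (2 * (Real.sqrt ρ)⁻¹)) := mul_le_mul hc3
            (hrad.trans (mul_le_mul_of_nonneg_left hr_half hε.le)) (norm_nonneg _) (by norm_num)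
        _ = _ := by ring
    have f2 : k * |r / (ρ + s θ) - 1| * ‖G y‖ ≤ k * (4 * Z ^ 2) * (C * (3 / 2)) * ρ⁻¹ := by
      calc _ ≤ k * (4 * Z ^ 2 * (ρ⁻¹ * ρ⁻¹)) * (C * (3 / 2 * ρ)) :=
            mul_le_mul (mul_le_mul_of_nonneg_left hc1 hk.le) hGy (norm_nonneg _) (by positivity)
        _ = _ := by field_simp
    have f3 : ‖m' θ‖ * ‖G y‖ ≤ (2 * N + 8) * Z * (C * (3 / 2)) * ρ⁻¹ := by
      calc _ ≤ (2 * N + 8) * Z * (ρ⁻¹ * ρ⁻¹) * (C * (3 / 2 * ρ)) :=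
            mul_le_mul hm1 hGy (norm_nonneg _) (by positivity)
        _ = _ := by field_simp
    rw [hK]
    linarith
  -- conclude by letting first `ρ → ∞` and then `ε → 0`
  rw [Metric.tendsto_nhds]
  intro δ hδ
  have hε : 0 < δ / (24 * Real.pi) := by positivity
  have hsmall : ∀ᶠ ρ : ℝ in atTop, K * (2 * Real.pi) * (Real.sqrt ρ)⁻¹ < δ / 2 := by
    have h1 : Tendsto (fun ρ : ℝ => K * (2 * Real.pi) * (Real.sqrt ρ)⁻¹) atTop (𝓝 0) := by
      simpa using (tendsto_inv_atTop_zero.comp Real.tendsto_sqrt_atTop).const_mul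
        (K * (2 * Real.pi))
    exact h1.eventually (gt_mem_nhds (half_pos hδ))
  filter_upwards [key _ hε, hsmall, eventually_gt_atTop 0] with ρ h1 h2 hρ
  have hsρ := Real.sqrt_pos.2 hρ
  rw [dist_zero_right, Real.norm_of_nonneg (by positivity)]
  have h3 := mul_le_mul_of_nonneg_left h1 hsρ.le
  have h4 : Real.sqrt ρ * ((6 * (δ / (24 * Real.pi)) * (Real.sqrt ρ)⁻¹ + K * ρ⁻¹) * (2 * Real.pi)) =
      δ / 2 + K * (2 * Real.pi) * (Real.sqrt ρ)⁻¹ := by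
    have h5 : ρ⁻¹ = (Real.sqrt ρ)⁻¹ * (Real.sqrt ρ)⁻¹ := by
      rw [← mul_inv, Real.mul_self_sqrt hρ.le]
    rw [h5]
    have hpi := Real.pi_pos
    field_simp
    ring
  linarith

end

/-! ### Uniqueness of the scattered field -/

section

variable {z : Plane} {R : ℝ}

theorem mode_congr {f g : Plane → ℂ} (hR : 0 < R) (h : EqOn f g (exterior z R)) (n : ℤ) {ρ : ℝ}
    (hρ : R < ρ) : mode z n f ρ = mode z n g ρ := by
  refine intervalIntegral.integral_congr fun θ _ => ?_
  simp only [h (polar_mem_exterior z hR hρ θ)]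

theorem mode_const_mul (c : ℂ) (f : Plane → ℂ) (n : ℤ) (ρ : ℝ) :
    mode z n (fun x => c * f x) ρ = c * mode z n f ρ := by
  rw [mode, mode, ← intervalIntegral.integral_const_mul]
  refine intervalIntegral.integral_congr fun θ _ => ?_
  ring

theorem mode_add {f g : Plane → ℂ} (hR : 0 < R) (hf : ContinuousOn f (exterior z R))
    (hg : ContinuousOn g (exterior z R)) (n : ℤ) {ρ : ℝ} (hρ : R < ρ) :
    mode z n (fun x => f x + g x) ρ = mode z n f ρ + mode z n g ρ := by
  have i1 : IntervalIntegrable (fun θ : ℝ => fourier (-n) (θ : S) * f (polar z ρ θ)) volume 0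
      (2 * Real.pi) :=
    ((continuous_fourier_coe _).mul (continuous_comp_polar hR hf hρ)).intervalIntegrable _ _
  have i2 : IntervalIntegrable (fun θ : ℝ => fourier (-n) (θ : S) * g (polar z ρ θ)) volume 0
      (2 * Real.pi) :=
    ((continuous_fourier_coe _).mul (continuous_comp_polar hR hg hρ)).intervalIntegrable _ _
  rw [mode, mode, mode, ← intervalIntegral.integral_add i1 i2]
  refine intervalIntegral.integral_congr fun θ _ => ?_
  ring

/-- An outgoing solution of the Helmholtz equation has the modes `a H_n`. -/
theorem exists_outgoing_mode {k : ℝ} (hk : 0 < k) (hR : 0 < R) {φ : Plane → ℂ}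
    (hφ : ContDiffOn ℝ ∞ φ (exterior z R))
    (hH : ∀ x ∈ exterior z R, pd 0 (pd 0 φ) x + pd 1 (pd 1 φ) x = -(k : ℂ) ^ 2 * φ x)
    (hrad : RadiatingScalar k fun x => pd 0 φ x + Complex.I * pd 1 φ x) (n : ℤ) :
    ∃ a : ℂ, ∀ ρ, R < ρ → mode z n φ ρ = a * hankel n (k * ρ) ∧
      mode z (n + 1) (fun x => pd 0 φ x + Complex.I * pd 1 φ x) ρ =
        -k * a * hankel (n + 1) (k * ρ) ∧
      mode z (n - 1) (fun x => pd 0 φ x - Complex.I * pd 1 φ x) ρ =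
        k * a * hankel (n - 1) (k * ρ) := by
  have hU := isOpen_exterior z R
  have hp0 := contDiffOn_pd hU hφ 0
  have hp1 := contDiffOn_pd hU hφ 1
  have hD : ContDiffOn ℝ ∞ (fun x => pd 0 φ x + Complex.I * pd 1 φ x) (exterior z R) :=
    hp0.add (contDiffOn_const.mul hp1)
  have hDD : EqOn (fun x => pd 0 (fun x => pd 0 φ x + Complex.I * pd 1 φ x) x -
      Complex.I * pd 1 (fun x => pd 0 φ x + Complex.I * pd 1 φ x) x)
      (fun x => -(k : ℂ) ^ 2 * φ x) (exterior z R) := by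
    intro x hx
    have d0 := differentiableAt_of_contDiffOn hU hp0 hx
    have d1 := differentiableAt_of_contDiffOn hU hp1 hx
    have hc := pd_comm ((hφ.contDiffAt (hU.mem_nhds hx)).of_le two_le_infty) 0 1
    simp only
    rw [← hH x hx, pd_add d0 (d1.const_mul _), pd_add d0 (d1.const_mul _), pd_const_mul d1,
      pd_const_mul d1, hc]
    linear_combination (-pd 1 (pd 1 φ) x) * Complex.I_sq
  have hf : ∀ ρ, R < ρ → HasDerivAt (mode z n φ)
      (mode z (n + 1) (fun x => pd 0 φ x + Complex.I * pd 1 φ x) ρ + n / ρ * mode z n φ ρ) ρ :=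
    fun ρ hρ => mode_dPlus hR hφ hρ n
  have hg : ∀ ρ, R < ρ → HasDerivAt (mode z (n + 1) (fun x => pd 0 φ x + Complex.I * pd 1 φ x))
      (-(k : ℂ) ^ 2 * mode z n φ ρ - (n + 1) / ρ *
        mode z (n + 1) (fun x => pd 0 φ x + Complex.I * pd 1 φ x) ρ) ρ := by
    intro ρ hρ
    refine (mode_dMinus hR hD hρ (n + 1)).congr_deriv ?_
    rw [add_sub_cancel_right, mode_congr hR hDD n hρ, mode_const_mul]
    push_cast
    ring
  obtain ⟨a, b, hab⟩ := exists_hankel_combination hk hR hf hg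
  have hkc : (k : ℂ) ≠ 0 := by exact_mod_cast hk.ne'
  -- the radiation condition is used for `(∂₁ + i ∂₂) φ`, a combination of components of the
  -- field, and hence for the modes of order `n + 1`
  have hb : b = 0 := by
    have h0 := incoming_eq_zero (n := n + 1) (a := -k * a) (b := -k * b) hk hR
      (fun ρ hρ => by rw [(hab ρ hρ).2]; ring) (hrad.tendsto_mode hk hR hD (n + 1))
    simpa [hkc] using h0
  subst hb
  refine ⟨a, fun ρ hρ => ?_⟩
  have hρ0 : 0 < ρ := hR.trans hρ
  have hρc : (ρ : ℂ) ≠ 0 := by exact_mod_cast hρ0.ne'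
  obtain ⟨h1, h2⟩ := hab ρ hρ
  rw [zero_mul, add_zero] at h1 h2
  refine ⟨h1, by rw [h2]; ring, ?_⟩
  have h3 := (mode_dMinus hR hφ hρ n).unique (hf ρ hρ)
  rw [h1, h2] at h3
  have hrec := hankel_recurrence n (mul_pos hk hρ0)
  push_cast at hrec
  refine mul_left_cancel₀ hρc ?_
  field_simp at h3
  linear_combination h3 - a * hrec

theorem continuousOn_mode {f : Plane → ℂ} (hR : 0 < R)
    (hf : ContinuousOn f (Metric.ball z R)ᶜ) (n : ℤ) : ContinuousOn (mode z n f) (Ici R) := by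
  have hmem : ∀ q : ℝ × ℝ, polar z (max q.1 R) q.2 ∈ (Metric.ball z R)ᶜ := by
    intro q
    have h0 : (0 : ℝ) ≤ max q.1 R := hR.le.trans (le_max_right _ _)
    rw [mem_compl_iff, Metric.mem_ball, dist_eq_norm, polar, add_sub_cancel_left,
      norm_smul_dir h0, not_lt]
    exact le_max_right _ _
  have hc : Continuous fun q : ℝ × ℝ => f (polar z (max q.1 R) q.2) :=
    hf.comp_continuous ((continuous_polar z).comp
      ((continuous_fst.max continuous_const).prodMk continuous_snd)) hmem
  have h1 : Continuous fun ρ : ℝ => ∫ θ in (0 : ℝ)..2 * Real.pi,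
      fourier (-n) (θ : S) * f (polar z (max ρ R) θ) :=
    intervalIntegral.continuous_parametric_intervalIntegral_of_continuous'
      (f := fun (ρ θ : ℝ) => (fourier (-n) (θ : S) : ℂ) * f (polar z (max ρ R) θ))
      (((continuous_fourier_coe (-n)).comp continuous_snd).mul hc) _ _
  refine h1.continuousOn.congr fun ρ hρ => ?_
  simp only [mode, max_eq_left (mem_Ici.1 hρ)]

/-- A continuous function on the exterior of a disk is determined by its modes. -/
theorem eqOn_of_mode_eq {f g : Plane → ℂ} (hR : 0 < R) (hf : ContinuousOn f (exterior z R))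
    (hg : ContinuousOn g (exterior z R))
    (h : ∀ (n : ℤ) (ρ : ℝ), R < ρ → mode z n f ρ = mode z n g ρ) : EqOn f g (exterior z R) := by
  intro x hx
  obtain ⟨θ, hθ⟩ := exists_eq_smul_dir (x - z)
  set ρ := ‖x - z‖ with hρ_def
  have hρ : R < ρ := hx
  have hxe : x = z + ρ • dir θ := by rw [← hθ, add_sub_cancel]
  have hmem : ∀ η : S, z + ρ • dir η ∈ exterior z R := fun η => by
    rw [exterior, mem_ofPred_eq, add_sub_cancel_left, norm_smul_dir (hR.trans hρ).le]
    exact hρ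
  have hc : Continuous fun η : S => z + ρ • dir η := by
    have := continuous_dir
    fun_prop
  let F : C(S, ℂ) := ⟨fun η => f (z + ρ • dir η) - g (z + ρ • dir η),
    (hf.comp_continuous hc hmem).sub (hg.comp_continuous hc hmem)⟩
  have hF : fourierCoeff (F : S → ℂ) = 0 := by
    funext n
    have i1 : IntervalIntegrable (fun θ : ℝ => fourier (-n) (θ : S) * f (polar z ρ θ)) volume 0
        (2 * Real.pi) :=
      ((continuous_fourier_coe _).mul (continuous_comp_polar hR hf hρ)).intervalIntegrable _ _
    have i2 : IntervalIntegrable (fun θ : ℝ => fourier (-n) (θ : S) * g (polar z ρ θ)) volume 0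
        (2 * Real.pi) :=
      ((continuous_fourier_coe _).mul (continuous_comp_polar hR hg hρ)).intervalIntegrable _ _
    have h0 := h n ρ hρ
    rw [mode, mode, ← sub_eq_zero, ← intervalIntegral.integral_sub i1 i2] at h0
    rw [fourierCoeff_eq_intervalIntegral _ _ 0, zero_add, Pi.zero_apply]
    refine smul_eq_zero_of_right _ (Eq.trans ?_ h0)
    refine intervalIntegral.integral_congr fun θ _ => ?_
    simp only [F, ContinuousMap.coe_mk, smul_eq_mul, polar]
    ring
  have hs := has_pointwise_sum_fourier_series_of_summable (f := F) (by rw [hF]; exact summable_zero) θ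
  simp only [hF, Pi.zero_apply, zero_smul] at hs
  have h1 : F θ = 0 := hs.unique hasSum_zero
  rw [hxe]
  exact sub_eq_zero.1 h1

/-- Linear combinations of the components of a radiating field are radiating. -/
theorem Radiating.scalar {k : ℝ} {v : Plane → Vec} (hv : Radiating k v)
    (hd : ContDiffOn ℝ ∞ v (exterior z R)) (α β : ℂ) {G : Plane → ℂ}
    (hG : EqOn G (fun x => α * v x 0 + β * v x 1) (exterior z R)) : RadiatingScalar k G := by
  have hU := isOpen_exterior z R
  refine Asymptotics.IsBigO.trans_isLittleO ?_ hv
  refine Asymptotics.IsBigO.of_bound (‖α‖ + ‖β‖) ?_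
  filter_upwards [tendsto_norm_cobounded_atTop.eventually_gt_atTop (R + ‖z‖)] with x hx
  have hxU := mem_exterior_of_lt hx
  have hdv := differentiableAt_of_contDiffOn hU hd hxU
  have hj : ∀ j, DifferentiableAt ℝ (fun y => v y j) x := fun j =>
    (((EuclideanSpace.proj j : Vec →L[ℂ] ℂ).restrictScalars ℝ).hasFDerivAt.comp x
      hdv.hasFDerivAt).differentiableAt
  have hnear : G =ᶠ[𝓝 x] fun x => α * v x 0 + β * v x 1 :=
    hG.eventuallyEq_of_mem (hU.mem_nhds hxU)
  set h := ‖x‖⁻¹ • x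
  have e : fderiv ℝ G x h - Complex.I * k * G x =
      α * (fderiv ℝ v x h - (Complex.I * k) • v x) 0 +
        β * (fderiv ℝ v x h - (Complex.I * k) • v x) 1 := by
    rw [hnear.fderiv_eq, hG hxU, fderiv_fun_add ((hj 0).const_mul α) ((hj 1).const_mul β),
      fderiv_const_mul (hj 0), fderiv_const_mul (hj 1), PiLp.sub_apply, PiLp.sub_apply,
      fderiv_vec_apply hdv, fderiv_vec_apply hdv]
    simp only [add_apply, smul_apply, smul_eq_mul, PiLp.smul_apply]
    ring
  rw [e]
  refine (norm_add_le _ _).trans ?_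
  rw [norm_mul, norm_mul, add_mul]
  exact add_le_add (mul_le_mul_of_nonneg_left (PiLp.norm_apply_le _ 0) (norm_nonneg _))
    (mul_le_mul_of_nonneg_left (PiLp.norm_apply_le _ 1) (norm_nonneg _))

end

/-- The compressional potential `-k_p⁻² div u`. -/
def potP (M : Medium) (u : Plane → Vec) (x : Plane) : ℂ := -(1 / (M.kp : ℂ) ^ 2) * divg u x

/-- The shear potential `k_s⁻² curl u`. -/
def potS (M : Medium) (u : Plane → Vec) (x : Plane) : ℂ := 1 / (M.ks : ℂ) ^ 2 * scurl u x

theorem compl_closure_ball (z : Plane) {R : ℝ} (hR : 0 < R) :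
    (closure (Metric.ball z R))ᶜ = exterior z R := by
  rw [closure_ball z hR.ne']
  ext x
  rw [mem_compl_iff, Metric.mem_closedBall, dist_eq_norm, not_le]
  rfl

section

variable {M : Medium} {z : Plane} {R : ℝ} (hR : 0 < R) {ui us : Plane → Vec}
  (h : IsScatteredField M (Metric.ball z R) ui us)

include hR h

theorem IsScatteredField.contDiffOn : ContDiffOn ℝ ∞ us (exterior z R) := by
  rw [← compl_closure_ball z hR]
  exact h.smooth

theorem IsScatteredField.contDiffOn_apply (j : Fin 2) :
    ContDiffOn ℝ ∞ (fun x => us x j) (exterior z R) :=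
  contDiffOn_piLp_apply 2 |>.comp (h.contDiffOn hR) (mapsTo_univ _ _)

theorem IsScatteredField.contDiffOn_divg : ContDiffOn ℝ ∞ (divg us) (exterior z R) :=
  (contDiffOn_pd (isOpen_exterior z R) (h.contDiffOn_apply hR 0) 0).add
    (contDiffOn_pd (isOpen_exterior z R) (h.contDiffOn_apply hR 1) 1)

theorem IsScatteredField.contDiffOn_scurl : ContDiffOn ℝ ∞ (scurl us) (exterior z R) :=
  (contDiffOn_pd (isOpen_exterior z R) (h.contDiffOn_apply hR 0) 1).sub
    (contDiffOn_pd (isOpen_exterior z R) (h.contDiffOn_apply hR 1) 0)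

theorem IsScatteredField.contDiffOn_potP : ContDiffOn ℝ ∞ (potP M us) (exterior z R) :=
  contDiffOn_const.mul (h.contDiffOn_divg hR)

theorem IsScatteredField.contDiffOn_potS : ContDiffOn ℝ ∞ (potS M us) (exterior z R) :=
  contDiffOn_const.mul (h.contDiffOn_scurl hR)

theorem IsScatteredField.pPart_eq {x : Plane} (hx : x ∈ exterior z R) :
    pPart M us x = grad (potP M us) x := by
  have d := differentiableAt_of_contDiffOn (isOpen_exterior z R) (h.contDiffOn_divg hR) hx
  have e : ∀ j, -(1 / (M.kp : ℂ) ^ 2) * pd j (divg us) x = pd j (potP M us) x := fun j =>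
    (pd_const_mul d _ j).symm
  ext j
  fin_cases j
  · exact e 0
  · exact e 1

theorem IsScatteredField.sPart_eq {x : Plane} (hx : x ∈ exterior z R) :
    sPart M us x = vcurl (potS M us) x := by
  have d := differentiableAt_of_contDiffOn (isOpen_exterior z R) (h.contDiffOn_scurl hR) hx
  have e : ∀ j, 1 / (M.ks : ℂ) ^ 2 * pd j (scurl us) x = pd j (potS M us) x := fun j =>
    (pd_const_mul d _ j).symm
  ext j
  fin_cases j
  · refine Eq.trans ?_ (congrArg Neg.neg (e 1))
    exact mul_neg _ _
  · exact e 0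

/-- The Helmholtz decomposition, a consequence of `Δ = grad div - curl curl`. -/
theorem IsScatteredField.decomposition {x : Plane} (hx : x ∈ exterior z R) :
    us x = pPart M us x + sPart M us x := by
  have hU := isOpen_exterior z R
  have hnav := h.navier x (by rw [compl_closure_ball z hR]; exact hx)
  have c2 := ((h.contDiffOn hR).contDiffAt (hU.mem_nhds hx)).of_le two_le_infty
  have hcj := fun j => ((h.contDiffOn_apply hR j).contDiffAt (hU.mem_nhds hx)).of_le two_le_infty
  have d : ∀ i j, DifferentiableAt ℝ (pd i fun y => us y j) x := fun i j =>
    differentiableAt_of_contDiffOn hU (contDiffOn_pd hU (h.contDiffOn_apply hR j) i) hx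
  have hk : (M.kp : ℂ) ≠ 0 := by exact_mod_cast M.kp_pos.ne'
  have hk' : (M.ks : ℂ) ≠ 0 := by exact_mod_cast M.ks_pos.ne'
  have hom : (M.om : ℂ) ≠ 0 := by exact_mod_cast M.om_pos.ne'
  have e1 : ((M.lam : ℂ) + 2 * M.mu) * (M.kp : ℂ) ^ 2 = (M.om : ℂ) ^ 2 := by
    exact_mod_cast M.kp_sq
  have e2 : (M.mu : ℂ) * (M.ks : ℂ) ^ 2 = (M.om : ℂ) ^ 2 := by exact_mod_cast M.ks_sq
  have hlap0 : (Δ us) x 0 = pd 0 (divg us) x + pd 1 (scurl us) x := by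
    rw [laplacian_vec_apply c2]
    unfold divg scurl
    rw [pd_add (d 0 0) (d 1 1), pd_sub (d 1 0) (d 0 1), pd_comm (hcj 1) 1 0]
    ring
  have hlap1 : (Δ us) x 1 = pd 1 (divg us) x - pd 0 (scurl us) x := by
    rw [laplacian_vec_apply c2]
    unfold divg scurl
    rw [pd_add (d 0 0) (d 1 1), pd_sub (d 1 0) (d 0 1), pd_comm (hcj 0) 1 0]
    ring
  have i1 : (M.om : ℂ) ^ 2 * (1 / (M.kp : ℂ) ^ 2) = M.lam + 2 * M.mu := by
    rw [← e1]; field_simp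
  have i2 : (M.om : ℂ) ^ 2 * (1 / (M.ks : ℂ) ^ 2) = M.mu := by
    rw [← e2]; field_simp
  ext j
  refine mul_left_cancel₀ (pow_ne_zero 2 hom) ?_
  have hj := congrArg (fun w : Vec => w j) hnav
  fin_cases j
  · simp [grad, hlap0] at hj
    change (M.om : ℂ) ^ 2 * us x 0 = M.om ^ 2 * (-(1 / (M.kp : ℂ) ^ 2) * pd 0 (divg us) x +
      1 / (M.ks : ℂ) ^ 2 * -pd 1 (scurl us) x)
    linear_combination hj + pd 0 (divg us) x * i1 + pd 1 (scurl us) x * i2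
  · simp [grad, hlap1] at hj
    change (M.om : ℂ) ^ 2 * us x 1 = M.om ^ 2 * (-(1 / (M.kp : ℂ) ^ 2) * pd 1 (divg us) x +
      1 / (M.ks : ℂ) ^ 2 * pd 0 (scurl us) x)
    linear_combination hj + pd 1 (divg us) x * i1 - pd 0 (scurl us) x * i2

theorem IsScatteredField.apply_zero {x : Plane} (hx : x ∈ exterior z R) :
    us x 0 = pd 0 (potP M us) x - pd 1 (potS M us) x := by
  rw [h.decomposition hR hx, h.pPart_eq hR hx, h.sPart_eq hR hx, sub_eq_add_neg]
  rfl

theorem IsScatteredField.apply_one {x : Plane} (hx : x ∈ exterior z R) :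
    us x 1 = pd 1 (potP M us) x + pd 0 (potS M us) x := by
  rw [h.decomposition hR hx, h.pPart_eq hR hx, h.sPart_eq hR hx]
  rfl

/-- The potentials of a scattered field solve the Helmholtz equations. -/
theorem IsScatteredField.helmholtz {x : Plane} (hx : x ∈ exterior z R) :
    pd 0 (pd 0 (potP M us)) x + pd 1 (pd 1 (potP M us)) x = -(M.kp : ℂ) ^ 2 * potP M us x ∧
    pd 0 (pd 0 (potS M us)) x + pd 1 (pd 1 (potS M us)) x = -(M.ks : ℂ) ^ 2 * potS M us x := by
  have hU := isOpen_exterior z R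
  have hk : (M.kp : ℂ) ≠ 0 := by exact_mod_cast M.kp_pos.ne'
  have hk' : (M.ks : ℂ) ≠ 0 := by exact_mod_cast M.ks_pos.ne'
  have dP : ∀ i, DifferentiableAt ℝ (pd i (potP M us)) x := fun i =>
    differentiableAt_of_contDiffOn hU (contDiffOn_pd hU (h.contDiffOn_potP hR) i) hx
  have dS : ∀ i, DifferentiableAt ℝ (pd i (potS M us)) x := fun i =>
    differentiableAt_of_contDiffOn hU (contDiffOn_pd hU (h.contDiffOn_potS hR) i) hx
  have cP := pd_comm (((h.contDiffOn_potP hR).contDiffAt (hU.mem_nhds hx)).of_le two_le_infty) 0 1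
  have cS := pd_comm (((h.contDiffOn_potS hR).contDiffAt (hU.mem_nhds hx)).of_le two_le_infty) 0 1
  have e0 : ∀ i, pd i (fun y => us y 0) x =
      pd i (pd 0 (potP M us)) x - pd i (pd 1 (potS M us)) x := fun i => by
    rw [pd_congr_on hU (fun y hy => h.apply_zero hR hy) hx, pd_sub (dP 0) (dS 1)]
  have e1 : ∀ i, pd i (fun y => us y 1) x =
      pd i (pd 1 (potP M us)) x + pd i (pd 0 (potS M us)) x := fun i => by
    rw [pd_congr_on hU (fun y hy => h.apply_one hR hy) hx, pd_add (dP 1) (dS 0)]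
  constructor
  · have : -(M.kp : ℂ) ^ 2 * potP M us x = divg us x := by rw [potP]; field_simp
    rw [this, divg, e0, e1, cS]
    ring
  · have : -(M.ks : ℂ) ^ 2 * potS M us x = -scurl us x := by rw [potS]; field_simp
    rw [this, scurl, e0, e1, cP]
    ring

/-- Every scattered field of a disk is, mode by mode, made of outgoing cylinder waves, and the two
coefficients of order `n` are determined by the boundary values through `𝓗_n`. -/
theorem IsScatteredField.exists_mode (n : ℤ) : ∃ a b : ℂ,
    (∀ ρ, R < ρ → mode z n (potP M us) ρ = a * hankel n (M.kp * ρ) ∧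
      mode z n (potS M us) ρ = b * hankel n (M.ks * ρ)) ∧
    (cylMatrix hankel n (M.kp * R) (M.ks * R)).mulVec ![a, b] 0 +
      Complex.I * (cylMatrix hankel n (M.kp * R) (M.ks * R)).mulVec ![a, b] 1 =
      R * mode z (n + 1) (fun x => us x 0 + Complex.I * us x 1) R ∧
    (cylMatrix hankel n (M.kp * R) (M.ks * R)).mulVec ![a, b] 0 -
      Complex.I * (cylMatrix hankel n (M.kp * R) (M.ks * R)).mulVec ![a, b] 1 =
      R * mode z (n - 1) (fun x => us x 0 - Complex.I * us x 1) R := by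
  have hU := isOpen_exterior z R
  have hp := M.kp_pos
  have hs := M.ks_pos
  have hpR := mul_pos hp hR
  have hsR := mul_pos hs hR
  have cP := h.contDiffOn_potP hR
  have cS := h.contDiffOn_potS hR
  have smoothP : ContDiffOn ℝ ∞ (pPart M us) (exterior z R) := by
    refine (contDiffOn_piLp' 2 fun j => ?_).congr fun x hx => h.pPart_eq hR hx
    fin_cases j
    · exact contDiffOn_pd hU cP 0
    · exact contDiffOn_pd hU cP 1
  have smoothS : ContDiffOn ℝ ∞ (sPart M us) (exterior z R) := by
    refine (contDiffOn_piLp' 2 fun j => ?_).congr fun x hx => h.sPart_eq hR hx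
    fin_cases j
    · exact (contDiffOn_pd hU cS 1).neg
    · exact contDiffOn_pd hU cS 0
  have radP : RadiatingScalar M.kp fun x => pd 0 (potP M us) x + Complex.I * pd 1 (potP M us) x :=
    h.radiating_p.scalar smoothP 1 Complex.I fun x hx => by
      simp only [h.pPart_eq hR hx, grad, Matrix.cons_val_zero, Matrix.cons_val_one,
        Matrix.cons_val_fin_one, one_mul]
  have radS : RadiatingScalar M.ks fun x => pd 0 (potS M us) x + Complex.I * pd 1 (potS M us) x :=
    h.radiating_s.scalar smoothS (-Complex.I) 1 fun x hx => by
      simp only [h.sPart_eq hR hx, vcurl, Matrix.cons_val_zero, Matrix.cons_val_one,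
        Matrix.cons_val_fin_one, one_mul]
      ring
  obtain ⟨a, ha⟩ := exists_outgoing_mode hp hR cP (fun x hx => (h.helmholtz hR hx).1) radP n
  obtain ⟨b, hb⟩ := exists_outgoing_mode hs hR cS (fun x hx => (h.helmholtz hR hx).2) radS n
  have hcont : ∀ j, ContinuousOn (fun x => us x j) (Metric.ball z R)ᶜ := fun j =>
    (EuclideanSpace.proj j : Vec →L[ℂ] ℂ).continuous.comp_continuousOn h.cont
  -- the modes of the boundary values are limits of modes in the exterior
  have hlim : ∀ {f g : ℝ → ℂ}, ContinuousOn f (Ici R) → ContinuousAt g R →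
      (∀ ρ, R < ρ → f ρ = g ρ) → f R = g R := by
    intro f g hf hg hfg
    have t1 : Tendsto f (𝓝[>] R) (𝓝 (f R)) :=
      ((hf R self_mem_Ici).mono_left (nhdsWithin_mono _ Ioi_subset_Ici_self))
    have t2 : Tendsto g (𝓝[>] R) (𝓝 (g R)) := hg.tendsto.mono_left nhdsWithin_le_nhds
    refine tendsto_nhds_unique t1 (t2.congr' ?_)
    filter_upwards [self_mem_nhdsWithin] with ρ hρ
    exact (hfg ρ hρ).symm
  have hHc : ∀ (m : ℤ) {k : ℝ}, 0 < k → ContinuousAt (fun ρ : ℝ => hankel m (k * ρ)) R :=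
    fun m k hk => ContinuousAt.comp (f := fun ρ : ℝ => k * ρ) (g := hankel m)
      (hasDerivAt_hankel m (mul_pos hk hR)).continuousAt (by fun_prop)
  refine ⟨a, b, fun ρ hρ => ⟨(ha ρ hρ).1, (hb ρ hρ).1⟩, ?_, ?_⟩
  · rw [isCylinder_hankel.cylMatrix_mulVec_add n hpR hsR]
    have hc : ContinuousOn (fun x => us x 0 + Complex.I * us x 1) (Metric.ball z R)ᶜ :=
      (hcont 0).add (continuousOn_const.mul (hcont 1))
    have hval := hlim (continuousOn_mode hR hc
      (n + 1)) (g := fun ρ => -M.kp * a * hankel (n + 1) (M.kp * ρ) +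
        Complex.I * (-M.ks * b * hankel (n + 1) (M.ks * ρ)))
      ((continuousAt_const.mul (hHc _ hp)).add
        (continuousAt_const.mul (continuousAt_const.mul (hHc _ hs)))) fun ρ hρ => by
      rw [← (ha ρ hρ).2.1, ← (hb ρ hρ).2.1, ← mode_const_mul, ← mode_add hR
        ((contDiffOn_pd hU cP 0).add (contDiffOn_const.mul (contDiffOn_pd hU cP 1))).continuousOn
        (contDiffOn_const.mul ((contDiffOn_pd hU cS 0).add
          (contDiffOn_const.mul (contDiffOn_pd hU cS 1)))).continuousOn _ hρ]
      refine mode_congr hR (fun x hx => ?_) _ hρ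
      simp only [h.apply_zero hR hx, h.apply_one hR hx]
      linear_combination (-pd 1 (potS M us) x) * Complex.I_sq
    rw [hval]
    push_cast
    ring
  · rw [isCylinder_hankel.cylMatrix_mulVec_sub n hpR hsR]
    have hc : ContinuousOn (fun x => us x 0 - Complex.I * us x 1) (Metric.ball z R)ᶜ :=
      (hcont 0).sub (continuousOn_const.mul (hcont 1))
    have hval := hlim (continuousOn_mode hR hc
      (n - 1)) (g := fun ρ => M.kp * a * hankel (n - 1) (M.kp * ρ) +
        -Complex.I * (M.ks * b * hankel (n - 1) (M.ks * ρ)))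
      ((continuousAt_const.mul (hHc _ hp)).add
        (continuousAt_const.mul (continuousAt_const.mul (hHc _ hs)))) fun ρ hρ => by
      rw [← (ha ρ hρ).2.2, ← (hb ρ hρ).2.2, ← mode_const_mul, ← mode_add hR
        ((contDiffOn_pd hU cP 0).sub (contDiffOn_const.mul (contDiffOn_pd hU cP 1))).continuousOn
        (contDiffOn_const.mul ((contDiffOn_pd hU cS 0).sub
          (contDiffOn_const.mul (contDiffOn_pd hU cS 1)))).continuousOn _ hρ]
      refine mode_congr hR (fun x hx => ?_) _ hρ
      simp only [h.apply_zero hR hx, h.apply_one hR hx]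
      linear_combination (-pd 1 (potS M us) x) * Complex.I_sq
    rw [hval]
    push_cast
    ring

/-- Uniqueness of the scattered field of a disk, stated for the two potentials: both fields have
the same boundary values, and `𝓗_n` is injective. -/
theorem IsScatteredField.pot_unique {us' : Plane → Vec}
    (h' : IsScatteredField M (Metric.ball z R) ui us') :
    EqOn (potP M us) (potP M us') (exterior z R) ∧
      EqOn (potS M us) (potS M us') (exterior z R) := by
  have hpR := mul_pos M.kp_pos hR
  have hsR := mul_pos M.ks_pos hR
  have hsphere : ∀ θ : ℝ, us (polar z R θ) = us' (polar z R θ) := by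
    intro θ
    have hmem : polar z R θ ∈ frontier (Metric.ball z R) := by
      rw [frontier_ball z hR.ne', Metric.mem_sphere, dist_eq_norm, polar, add_sub_cancel_left,
        norm_smul_dir hR.le]
    exact add_left_cancel ((h.rigid _ hmem).trans (h'.rigid _ hmem).symm)
  have hmodes : ∀ n ρ, R < ρ → mode z n (potP M us) ρ = mode z n (potP M us') ρ ∧
      mode z n (potS M us) ρ = mode z n (potS M us') ρ := by
    intro n ρ hρ
    obtain ⟨a, b, h1, h2, h3⟩ := h.exists_mode hR n
    obtain ⟨a', b', h1', h2', h3'⟩ := h'.exists_mode hR n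
    have e1 : mode z (n + 1) (fun x => us x 0 + Complex.I * us x 1) R =
        mode z (n + 1) (fun x => us' x 0 + Complex.I * us' x 1) R := by
      refine intervalIntegral.integral_congr fun θ _ => ?_
      simp only [hsphere θ]
    have e2 : mode z (n - 1) (fun x => us x 0 - Complex.I * us x 1) R =
        mode z (n - 1) (fun x => us' x 0 - Complex.I * us' x 1) R := by
      refine intervalIntegral.integral_congr fun θ _ => ?_
      simp only [hsphere θ]
    rw [e1, ← h2'] at h2
    rw [e2, ← h3'] at h3
    have hv : (cylMatrix hankel n (M.kp * R) (M.ks * R)).mulVec ![a, b] =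
        (cylMatrix hankel n (M.kp * R) (M.ks * R)).mulVec ![a', b'] := by
      ext i
      fin_cases i
      · simp only [Fin.zero_eta]
        linear_combination (1 / 2 : ℂ) * h2 + (1 / 2 : ℂ) * h3
      · simp only [Fin.mk_one]
        refine mul_left_cancel₀ Complex.I_ne_zero ?_
        linear_combination (1 / 2 : ℂ) * h2 - (1 / 2 : ℂ) * h3
    have hinj := Matrix.mulVec_injective_of_isUnit ((Matrix.isUnit_iff_isUnit_det _).2
      (isUnit_det_cylMatrix_hankel n hpR hsR)) hv
    have ea : a = a' := by simpa using congrFun hinj 0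
    have eb : b = b' := by simpa using congrFun hinj 1
    rw [(h1 ρ hρ).1, (h1 ρ hρ).2, (h1' ρ hρ).1, (h1' ρ hρ).2, ea, eb]
    exact ⟨rfl, rfl⟩
  exact ⟨eqOn_of_mode_eq hR (h.contDiffOn_potP hR).continuousOn
      (h'.contDiffOn_potP hR).continuousOn fun n ρ hρ => (hmodes n ρ hρ).1,
    eqOn_of_mode_eq hR (h.contDiffOn_potS hR).continuousOn
      (h'.contDiffOn_potS hR).continuousOn fun n ρ hρ => (hmodes n ρ hρ).2⟩

end

/-- The amplitude is the limit of `√r e^{-ikr} v(r x̂)`, hence determined by the field. -/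
theorem HasFarField.unique {k : ℝ} {e : S → Vec} (he : ∀ θ, ‖e θ‖ = 1) {v v' : Plane → Vec}
    {z : Plane} {R : ℝ} (hv : EqOn v v' (exterior z R)) {A A' : S → ℂ} (h : HasFarField k e v A)
    (h' : HasFarField k e v' A') : A = A' := by
  funext θ
  have ht : Tendsto (fun r : ℝ => (r, θ)) atTop (atTop ×ˢ (⊤ : Filter S)) :=
    tendsto_id.prodMk tendsto_top
  have h1 := (h'.comp_tendsto ht).sub (h.comp_tendsto ht)
  obtain ⟨C, hC⟩ := h1.bound
  have hlim : Tendsto (fun r : ℝ => C * r⁻¹) atTop (𝓝 0) := by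
    simpa using tendsto_inv_atTop_zero.const_mul C
  have hle : ‖A θ - A' θ‖ ≤ 0 := by
    refine ge_of_tendsto hlim ?_
    filter_upwards [hC, eventually_gt_atTop 0, eventually_gt_atTop (R + ‖z‖)] with r hr hr0 hrR
    have hsr := Real.sqrt_pos.2 hr0
    have hmem : r • dir θ ∈ exterior z R :=
      mem_exterior_of_lt (by rw [norm_smul_dir hr0.le]; exact hrR)
    simp only [Function.comp_apply, ← hv hmem] at hr
    rw [sub_sub_sub_cancel_left, ← sub_smul, ← mul_sub, norm_smul, he, mul_one, norm_mul, norm_div,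
      norm_exp_I_mul, Complex.norm_real, Real.norm_of_nonneg hsr.le,
      Real.norm_of_nonneg (Real.rpow_nonneg hr0.le _), rpow_neg_three_halves hr0] at hr
    have h2 := mul_le_mul_of_nonneg_left hr hsr.le
    have h3 : Real.sqrt r * (1 / Real.sqrt r * ‖A θ - A' θ‖) = ‖A θ - A' θ‖ := by field_simp
    have h4 : Real.sqrt r * (C * (r⁻¹ * (Real.sqrt r)⁻¹)) = C * r⁻¹ := by field_simp
    rwa [h3, h4] at h2
  exact sub_eq_zero.1 (norm_le_zero_iff.1 hle)

theorem IsFarFieldPattern.unique {M : Medium} {z : Plane} {R : ℝ} (hR : 0 < R) {d : S} {cp cs : ℂ}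
    {a a' : (S → ℂ) × (S → ℂ)} (h : IsFarFieldPattern M (Metric.ball z R) d cp cs a)
    (h' : IsFarFieldPattern M (Metric.ball z R) d cp cs a') : a = a' := by
  obtain ⟨us, hs, hp1, hs1⟩ := h
  obtain ⟨us', hs', hp2, hs2⟩ := h'
  obtain ⟨eP, eS⟩ := hs.pot_unique hR hs'
  have hU := isOpen_exterior z R
  have e1 : EqOn (pPart M us) (pPart M us') (exterior z R) := fun x hx => by
    rw [hs.pPart_eq hR hx, hs'.pPart_eq hR hx, grad, grad, pd_congr_on hU eP hx,
      pd_congr_on hU eP hx]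
  have e2 : EqOn (sPart M us) (sPart M us') (exterior z R) := fun x hx => by
    rw [hs.sPart_eq hR hx, hs'.sPart_eq hR hx, vcurl, vcurl, pd_congr_on hU eS hx,
      pd_congr_on hU eS hx]
  exact Prod.ext (hp1.unique norm_dirC e1 hp2) (hs1.unique norm_perpC e2 hs2)

/-- By uniqueness, the pattern selected by `farFieldParts` is the explicit one. -/
theorem farFieldParts_ball (M : Medium) {R : ℝ} (hR : 0 < R) (z : Plane) (d : S) (cp cs : ℂ) :
    farFieldParts M (Metric.ball z R) d cp cs = diskPattern M R z d cp cs :=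
  (Classical.epsilon_spec (p := IsFarFieldPattern M (Metric.ball z R) d cp cs)
    ⟨_, isFarFieldPattern_diskPattern M hR z d cp cs⟩).unique hR
    (isFarFieldPattern_diskPattern M hR z d cp cs)

/-! ### Fourier modes of compressional and shear fields on the circle -/

/-- The wave numbers `k_p` (`q = 0`) and `k_s` (`q = 1`). -/
def Medium.wave (M : Medium) : Fin 2 → ℝ := ![M.kp, M.ks]

/-- The polarisations `x̂` (`q = 0`) and `x̂^⊥` (`q = 1`). -/
def frame : Fin 2 → S → Vec := ![dirC, perpC]

/-- The projections `P_p` (`q = 0`) and `P_s` (`q = 1`). -/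
def proj : Fin 2 → L2Vec →L[ℂ] L2Scal := ![projP, projS]

theorem Medium.wave_pos (M : Medium) (q : Fin 2) : 0 < M.wave q := by
  fin_cases q
  · exact M.kp_pos
  · exact M.ks_pos

theorem continuous_frame (q : Fin 2) : Continuous (frame q) := by
  fin_cases q
  · exact continuous_dirC
  · exact continuous_perpC

theorem norm_frame (q : Fin 2) (θ : S) : ‖frame q θ‖ = 1 := by
  fin_cases q
  · exact norm_dirC θ
  · exact norm_perpC θ

theorem inner_frame_eq_dotC (q : Fin 2) (θ : S) (v : Vec) :
    inner ℂ (frame q θ) v = dotC v (frame q θ) := by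
  refine (dotC_eq_inner _ _ fun i => ?_).symm
  fin_cases q <;> fin_cases i <;> simp [frame, dirC, perpC]

theorem inner_frame_frame (q q' : Fin 2) (θ : S) :
    inner ℂ (frame q θ) (frame q' θ) = if q = q' then 1 else 0 := by
  rw [inner_frame_eq_dotC]
  have h := cosA_sq_add θ
  fin_cases q <;> fin_cases q' <;> simp [frame, dirC, perpC, dotC]
  · linear_combination h
  · ring
  · ring
  · linear_combination h

theorem eq_zero_of_inner_frame {θ : S} {v : Vec} (h : ∀ q, inner ℂ (frame q θ) v = 0) : v = 0 := by
  have h0 := h 0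
  have h1 := h 1
  rw [inner_frame_eq_dotC] at h0 h1
  simp only [frame, dirC, perpC, dotC, Matrix.cons_val_zero, Matrix.cons_val_one,
    Matrix.cons_val_fin_one] at h0 h1
  have hc := cosA_sq_add θ
  ext i
  fin_cases i
  · simp only [Fin.zero_eta, PiLp.zero_apply]
    linear_combination cosA θ * h0 - sinA θ * h1 - v 0 * hc
  · simp only [Fin.mk_one, PiLp.zero_apply]
    linear_combination sinA θ * h0 + cosA θ * h1 - v 1 * hc

theorem coeFn_proj (q : Fin 2) (g : L2Vec) :
    proj q g =ᵐ[volume] fun θ => inner ℂ (frame q θ) (g θ) := by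
  simp only [inner_frame_eq_dotC]
  fin_cases q
  · exact (memLp_dotC dirC continuous_dirC (fun θ i => by fin_cases i <;> simp [dirC])
      norm_dirC g).coeFn_toLp
  · exact (memLp_dotC perpC continuous_perpC (fun θ i => by fin_cases i <;> simp [perpC])
      norm_perpC g).coeFn_toLp

theorem coeFn_scalarEigenfunctionL2 (k : ℝ) (z : Plane) (n : ℤ) :
    scalarEigenfunctionL2 k z n =ᵐ[volume] fun θ => fourier n θ * phase k z θ :=
  ContinuousMap.coeFn_toLp _ _

theorem conj_phase (k : ℝ) (z : Plane) (θ : S) : (starRingEnd ℂ) (phase k z θ) =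
    Complex.exp (Complex.I * (k * inner ℝ z (dir θ) : ℝ)) := by
  rw [phase, ← Complex.exp_conj]
  simp

theorem conj_phase_mul_phase (k : ℝ) (z : Plane) (θ : S) :
    (starRingEnd ℂ) (phase k z θ) * phase k z θ = 1 := by
  rw [conj_phase, phase, ← Complex.exp_add]
  simp

/-- The field `e^{inθ} e^{-ik_q z·x̂}` times the polarisation `q`. -/
def modeField (M : Medium) (z : Plane) (q : Fin 2) (n : ℤ) : C(S, Vec) :=
  ⟨fun θ => (fourier n θ * phase (M.wave q) z θ) • frame q θ,
    ((map_continuous (fourier n)).mul (continuous_phase _ z)).smul (continuous_frame q)⟩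

theorem modeField_apply (M : Medium) (z : Plane) (q : Fin 2) (n : ℤ) (θ : S) :
    modeField M z q n θ = (fourier n θ * phase (M.wave q) z θ) • frame q θ := rfl

theorem norm_modeField_apply (M : Medium) (z : Plane) (q : Fin 2) (n : ℤ) (θ : S) :
    ‖modeField M z q n θ‖ = 1 := by
  rw [modeField_apply, norm_smul, norm_mul, norm_fourier, norm_frame, phase, Complex.norm_exp]
  simp

theorem inner_modeField (M : Medium) (z : Plane) (q : Fin 2) (n : ℤ) (d : S) (v : Vec) :
    inner ℂ (modeField M z q n d) v =
      fourier (-n) d * Complex.exp (Complex.I * (M.wave q * inner ℝ z (dir d) : ℝ)) *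
        dotC v (frame q d) := by
  rw [modeField_apply, inner_smul_left, map_mul, ← fourier_neg, conj_phase, inner_frame_eq_dotC]

/-- `modeField` as an element of `(L²(𝕊))²`. -/
def modeFieldL2 (M : Medium) (z : Plane) (q : Fin 2) (n : ℤ) : L2Vec :=
  ContinuousMap.toLp 2 volume ℂ (modeField M z q n)

theorem coeFn_modeFieldL2 (M : Medium) (z : Plane) (q : Fin 2) (n : ℤ) :
    modeFieldL2 M z q n =ᵐ[volume] modeField M z q n := ContinuousMap.coeFn_toLp _ _

theorem inner_modeFieldL2 (M : Medium) (z : Plane) (q : Fin 2) (n : ℤ) (g : L2Vec) :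
    inner ℂ (modeFieldL2 M z q n) g = ∫ d, inner ℂ (modeField M z q n d) (g d) := by
  rw [L2.inner_def]
  refine integral_congr_ae ?_
  filter_upwards [coeFn_modeFieldL2 M z q n] with d hd
  rw [hd]

theorem integral_fourier_neg_mul (n m : ℤ) :
    ∫ θ : S, (fourier (-n) θ * fourier m θ : ℂ) = if n = m then (2 * Real.pi : ℂ) else 0 := by
  have h := congrFun (fourierCoeff_fourier (T := 2 * Real.pi) m) n
  rw [fourierCoeff, AddCircle.integral_haarAddCircle] at h
  simp only [smul_eq_mul] at h
  have hpi : (2 * Real.pi : ℂ) ≠ 0 := by exact_mod_cast Real.two_pi_pos.ne'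
  have h2 : ∫ θ : S, (fourier (-n) θ * fourier m θ : ℂ) =
      (2 * Real.pi : ℂ) * ((Pi.single m 1 : ℤ → ℂ) n) := by
    rw [← h, Complex.real_smul]
    push_cast
    field_simp
  rw [h2, Pi.single_apply]
  split_ifs <;> simp

theorem inner_modeFieldL2_modeFieldL2 (M : Medium) (z : Plane) (q q' : Fin 2) (n n' : ℤ) :
    inner ℂ (modeFieldL2 M z q n) (modeFieldL2 M z q' n') =
      if q = q' ∧ n = n' then (2 * Real.pi : ℂ) else 0 := by
  have h : inner ℂ (modeFieldL2 M z q n) (modeFieldL2 M z q' n') =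
      ∫ θ : S, (if q = q' then 1 else 0) * (fourier (-n) θ * fourier n' θ : ℂ) := by
    rw [inner_modeFieldL2]
    refine integral_congr_ae ?_
    filter_upwards [coeFn_modeFieldL2 M z q' n'] with θ hθ
    rw [hθ, modeField_apply, modeField_apply, inner_smul_left, inner_smul_right, inner_frame_frame]
    split_ifs with hq
    · subst hq
      rw [map_mul, fourier_neg]
      linear_combination ((starRingEnd ℂ) (fourier n θ) * fourier n' θ : ℂ) *
        conj_phase_mul_phase (M.wave q) z θ
    · ring
  rw [h, integral_const_mul, integral_fourier_neg_mul]
  split_ifs <;> simp_all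

theorem norm_modeFieldL2 (M : Medium) (z : Plane) (q : Fin 2) (n : ℤ) :
    ‖modeFieldL2 M z q n‖ = Real.sqrt (2 * Real.pi) := by
  have h := inner_self_eq_norm_sq_to_K (𝕜 := ℂ) (modeFieldL2 M z q n)
  rw [inner_modeFieldL2_modeFieldL2, if_pos ⟨rfl, rfl⟩] at h
  refine ((Real.sqrt_eq_iff_eq_sq Real.two_pi_pos.le (norm_nonneg _)).2 ?_).symm
  refine Complex.ofReal_injective ?_
  push_cast
  exact h

/-- The adjoint of the projection on the polarisation `q`, evaluated on the scalar modes. -/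
theorem inner_scalarEigenfunctionL2_proj (M : Medium) (z : Plane) (q : Fin 2) (n : ℤ) (g : L2Vec) :
    inner ℂ (scalarEigenfunctionL2 (M.wave q) z n) (proj q g) =
      inner ℂ (modeFieldL2 M z q n) g := by
  rw [inner_modeFieldL2, L2.inner_def]
  refine integral_congr_ae ?_
  filter_upwards [coeFn_proj q g, coeFn_scalarEigenfunctionL2 (M.wave q) z n] with θ h1 h2
  rw [h1, h2, modeField_apply, inner_smul_left, RCLike.inner_apply]
  ring

theorem adjoint_proj_scalarEigenfunctionL2 (M : Medium) (z : Plane) (q : Fin 2) (n : ℤ) :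
    ContinuousLinearMap.adjoint (proj q) (scalarEigenfunctionL2 (M.wave q) z n) =
      modeFieldL2 M z q n := by
  refine ext_inner_right ℂ fun g => ?_
  rw [ContinuousLinearMap.adjoint_inner_left, inner_scalarEigenfunctionL2_proj]

/-- Completeness of `e^{inθ} e^{-ik z·x̂}`: multiplying by a continuous function of modulus one
reduces it to the completeness of the trigonometric system. -/
theorem eq_zero_of_inner_scalarEigenfunctionL2 (k : ℝ) (z : Plane) {f : L2Scal}
    (h : ∀ n, inner ℂ (scalarEigenfunctionL2 k z n) f = 0) : f = 0 := by
  have hc : Continuous fun θ => (starRingEnd ℂ) (phase k z θ) :=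
    Complex.continuous_conj.comp (continuous_phase k z)
  have hn : ∀ θ, ‖(starRingEnd ℂ) (phase k z θ)‖ = 1 := fun θ => by
    rw [conj_phase, norm_exp_I_mul]
  have hmem : MemLp (fun θ => (starRingEnd ℂ) (phase k z θ) * f θ) 2 volume := by
    refine MemLp.of_le (Lp.memLp f) (hc.aestronglyMeasurable.mul (Lp.aestronglyMeasurable f))
      (Eventually.of_forall fun θ => ?_)
    rw [norm_mul, hn, one_mul]
  have hspan : (Submodule.span ℂ (range fun n : ℤ =>
      (ContinuousMap.toLp 2 volume ℂ (fourier n : C(S, ℂ)) : L2Scal))).topologicalClosure = ⊤ := by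
    convert! (ContinuousMap.toLp_denseRange ℂ (volume : Measure S) ℂ
      (p := 2) (by simp)).topologicalClosure_map_submodule span_fourier_closure_eq_top
    rw [Submodule.map_span, ← range_comp']
    rfl
  have h0 : hmem.toLp _ = 0 := by
    rw [Submodule.topologicalClosure_eq_top_iff] at hspan
    rw [← Submodule.mem_bot ℂ, ← hspan, Submodule.mem_orthogonal]
    intro u hu
    induction hu using Submodule.span_induction with
    | mem x hx =>
      obtain ⟨n, rfl⟩ := hx
      rw [← h n, L2.inner_def, L2.inner_def]
      refine integral_congr_ae ?_
      filter_upwards [hmem.coeFn_toLp, coeFn_scalarEigenfunctionL2 k z n,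
        ContinuousMap.coeFn_toLp (p := 2) (𝕜 := ℂ) volume (fourier n : C(S, ℂ))] with θ h1 h2 h3
      rw [h1, h3, h2, RCLike.inner_apply, RCLike.inner_apply, map_mul]
      ring
    | zero => exact inner_zero_left _
    | add x y _ _ hx hy => rw [inner_add_left, hx, hy, add_zero]
    | smul c x _ hx => rw [inner_smul_left, hx, mul_zero]
  refine (Lp.eq_zero_iff_ae_eq_zero).2 ?_
  filter_upwards [hmem.coeFn_toLp, (Lp.eq_zero_iff_ae_eq_zero).1 h0] with θ h1 h2
  rw [h1] at h2
  have h3 : (starRingEnd ℂ) (phase k z θ) ≠ 0 := norm_pos_iff.1 (by rw [hn]; exact one_pos)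
  exact (mul_eq_zero.1 h2).resolve_left h3

/-- Completeness of the vector modes. -/
theorem eq_zero_of_inner_modeFieldL2 (M : Medium) (z : Plane) {g : L2Vec}
    (h : ∀ q n, inner ℂ (modeFieldL2 M z q n) g = 0) : g = 0 := by
  have h0 : ∀ q, proj q g = 0 := fun q =>
    eq_zero_of_inner_scalarEigenfunctionL2 (M.wave q) z fun n => by
      rw [inner_scalarEigenfunctionL2_proj, h]
  refine (Lp.eq_zero_iff_ae_eq_zero).2 ?_
  filter_upwards [coeFn_proj 0 g, coeFn_proj 1 g, (Lp.eq_zero_iff_ae_eq_zero).1 (h0 0),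
    (Lp.eq_zero_iff_ae_eq_zero).1 (h0 1)] with θ a0 a1 b0 b1
  refine eq_zero_of_inner_frame (θ := θ) fun q => ?_
  fin_cases q
  · exact a0.symm.trans b0
  · exact a1.symm.trans b1

theorem inner_scalarEigenfunctionL2 (M : Medium) (z : Plane) (q : Fin 2) (n m : ℤ) :
    inner ℂ (scalarEigenfunctionL2 (M.wave q) z n) (scalarEigenfunctionL2 (M.wave q) z m) =
      if n = m then (2 * Real.pi : ℂ) else 0 := by
  rw [← integral_fourier_neg_mul, scalarEigenfunctionL2, scalarEigenfunctionL2,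
    ContinuousMap.inner_toLp]
  refine integral_congr_ae (Eventually.of_forall fun θ => ?_)
  simp only [ContinuousMap.coe_mk, map_mul, fourier_neg]
  linear_combination ((starRingEnd ℂ) (fourier n θ) * fourier m θ : ℂ) *
    conj_phase_mul_phase (M.wave q) z θ

theorem proj_modeFieldL2 (M : Medium) (z : Plane) (q q' : Fin 2) (n : ℤ) :
    proj q (modeFieldL2 M z q' n) =
      if q = q' then scalarEigenfunctionL2 (M.wave q) z n else 0 := by
  refine sub_eq_zero.1 (eq_zero_of_inner_scalarEigenfunctionL2 (M.wave q) z fun m => ?_)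
  rw [inner_sub_right, inner_scalarEigenfunctionL2_proj, inner_modeFieldL2_modeFieldL2]
  by_cases hq : q = q'
  · simp [hq, inner_scalarEigenfunctionL2]
  · simp [hq]

/-! ### The far-field operator of a disk -/

/-- The coefficients of the far-field operator of a disk in the modes `modeFieldL2`: it maps
`modeFieldL2 M z q n` to `2π` times the sum over `q'` of `diskCoef M R q' q n` times
`modeFieldL2 M z q' n`. -/
def diskCoef (M : Medium) (R : ℝ) (q' q : Fin 2) (n : ℤ) : ℂ :=
  (Real.sqrt (8 * Real.pi / M.om) : ℂ) * Complex.I / (2 * Real.pi) *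
    ((Real.sqrt (M.wave q') : ℂ) / (Real.sqrt (M.wave q) : ℂ)) *
    sigmaMatrix n (M.kp * R) (M.ks * R) q' q

theorem summable_norm_diskCoef (M : Medium) {R : ℝ} (hR : 0 < R) (q' q : Fin 2) :
    Summable fun n => ‖diskCoef M R q' q n‖ :=
  ((fast_sigmaMatrix (mul_pos M.kp_pos hR) (mul_pos M.ks_pos hR) q' q).const_mul _).summable

/-- The constant relating the amplitude of the far field of `H_n` to the eigenvalues. -/
theorem diskCoef_const (M : Medium) (q' q : Fin 2) :
    Complex.exp (-(Complex.I * Real.pi / 4)) * (Real.sqrt (M.wave q / M.om) : ℂ) *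
        (-hankelConst * (Real.sqrt (M.wave q') : ℂ) / M.wave q) =
      (Real.sqrt (8 * Real.pi / M.om) : ℂ) * Complex.I / (2 * Real.pi) *
        ((Real.sqrt (M.wave q') : ℂ) / (Real.sqrt (M.wave q) : ℂ)) := by
  have hexp : Complex.exp (-(Complex.I * Real.pi / 4)) =
      (Real.sqrt 2 : ℂ) / 2 * (1 - Complex.I) := by
    have e : -(Complex.I * Real.pi / 4) = ((-(Real.pi / 4) : ℝ) : ℂ) * Complex.I := by
      push_cast; ring
    rw [e, Complex.exp_mul_I, ← Complex.ofReal_cos, ← Complex.ofReal_sin, Real.cos_neg,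
      Real.sin_neg, Real.cos_pi_div_four, Real.sin_pi_div_four]
    push_cast
    ring
  have h8 : Real.sqrt (8 * Real.pi / M.om) =
      2 * Real.sqrt 2 * Real.sqrt Real.pi / Real.sqrt M.om := by
    rw [Real.sqrt_div (by positivity), Real.sqrt_mul (by norm_num),
      show (8 : ℝ) = 2 ^ 2 * 2 by norm_num, Real.sqrt_mul (by norm_num),
      Real.sqrt_sq (by norm_num)]
  have hw := M.wave_pos q
  have hom := M.om_pos
  have hpi := Real.pi_pos
  have s1 : (Real.sqrt (M.wave q) : ℂ) ≠ 0 := by exact_mod_cast (Real.sqrt_pos.2 hw).ne'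
  have s2 : (Real.sqrt M.om : ℂ) ≠ 0 := by exact_mod_cast (Real.sqrt_pos.2 hom).ne'
  have s3 : (Real.sqrt Real.pi : ℂ) ≠ 0 := by exact_mod_cast (Real.sqrt_pos.2 hpi).ne'
  have w2 : (M.wave q : ℂ) = (Real.sqrt (M.wave q) : ℂ) ^ 2 := by
    exact_mod_cast (Real.sq_sqrt hw.le).symm
  have p2 : (Real.pi : ℂ) = (Real.sqrt Real.pi : ℂ) ^ 2 := by
    exact_mod_cast (Real.sq_sqrt hpi.le).symm
  rw [hexp, h8, Real.sqrt_div hw.le, hankelConst, w2, p2]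
  push_cast
  field_simp
  linear_combination (-(Real.sqrt (M.wave q') : ℂ)) * Complex.I_sq

/-- The amplitude of the component `q'` of the far field, as a series of modes. -/
theorem hasSum_ffAmp_scatCoef (M : Medium) {R : ℝ} (hR : 0 < R) (z : Plane) (d : S) (cp cs : ℂ)
    (q' : Fin 2) (θ : S) :
    HasSum (fun n => (-hankelConst * (Real.sqrt (M.wave q') : ℂ) *
        ∑ q, sigmaMatrix n (M.kp * R) (M.ks * R) q' q * (![cp, cs] q / M.wave q *
          (fourier (-n) d * Complex.exp (Complex.I * (M.wave q * inner ℝ z (dir d) : ℝ))))) *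
        (fourier n θ * phase (M.wave q') z θ))
      (Complex.I * M.wave q' * ffAmp (M.wave q') z (scatCoef M R z d cp cs q') θ) := by
  have h := ((fast_scatCoef M hR z d cp cs q').summable_fourier θ).hasSum.mul_left
    (Complex.I * M.wave q' * (hankelConst / (Real.sqrt (M.wave q') : ℂ) *
      phase (M.wave q') z θ))
  have hw := M.wave_pos q'
  have s1 : (Real.sqrt (M.wave q') : ℂ) ≠ 0 := by exact_mod_cast (Real.sqrt_pos.2 hw).ne'
  have w2 : (M.wave q' : ℂ) = (Real.sqrt (M.wave q') : ℂ) ^ 2 := by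
    exact_mod_cast (Real.sq_sqrt hw.le).symm
  have hkp : (M.kp : ℂ) ≠ 0 := by exact_mod_cast M.kp_pos.ne'
  have hks : (M.ks : ℂ) ≠ 0 := by exact_mod_cast M.ks_pos.ne'
  rw [ffAmp, ← mul_assoc]
  refine h.congr_fun fun n => ?_
  have hI : (Complex.I : ℂ) ^ n * (-Complex.I) ^ n = 1 := by
    rw [← mul_zpow, mul_neg, Complex.I_mul_I, neg_neg, one_zpow]
  have e : Complex.I * (M.wave q' : ℂ) * (hankelConst / (Real.sqrt (M.wave q') : ℂ) *
      phase (M.wave q') z θ) = Complex.I * ((Real.sqrt (M.wave q') : ℂ) * (hankelConst *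
      phase (M.wave q') z θ)) := by
    nth_rewrite 1 [w2]
    field_simp
  rw [e, scatCoef, incCoef, incCoef, Fin.sum_univ_two]
  simp only [Medium.wave, Matrix.cons_val_zero, Matrix.cons_val_one, Matrix.cons_val_fin_one]
  field_simp
  rw [mul_assoc _ (Complex.I ^ n), hI, mul_one]

/-- The far-field pattern of a disk as a series of modes. The phase factors of `z` belong to the
modes in the direction of observation and in the direction of incidence; the coefficients do not
involve `z`. -/
theorem hasSum_farField_ball (M : Medium) {R : ℝ} (hR : 0 < R) (z : Plane) (d : S) (cp cs : ℂ)
    (θ : S) :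
    HasSum (fun n => ∑ q', (-hankelConst * (Real.sqrt (M.wave q') : ℂ) *
        ∑ q, sigmaMatrix n (M.kp * R) (M.ks * R) q' q * (![cp, cs] q / M.wave q *
          (fourier (-n) d * Complex.exp (Complex.I * (M.wave q * inner ℝ z (dir d) : ℝ))))) •
        modeField M z q' n θ)
      (farField M (Metric.ball z R) d cp cs θ) := by
  have h := fun q' => (hasSum_ffAmp_scatCoef M hR z d cp cs q' θ).smul_const (frame q' θ)
  rw [farField, farFieldParts_ball M hR]
  refine ((h 0).add (h 1)).congr_fun fun n => ?_
  rw [Fin.sum_univ_two, modeField_apply, modeField_apply, smul_smul, smul_smul]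

/-- The far-field integral as a series of modes. -/
theorem hasSum_farFieldIntegral_ball (M : Medium) {R : ℝ} (hR : 0 < R) (z : Plane) (g : L2Vec)
    (θ : S) :
    HasSum (fun n => ∑ q', ∑ q, (diskCoef M R q' q n * inner ℂ (modeFieldL2 M z q n) g) •
      modeField M z q' n θ) (farFieldIntegral M (Metric.ball z R) g θ) := by
  have hg : Integrable (fun d => g d) (volume : Measure S) :=
    (Lp.memLp g).integrable (by norm_num)
  set F : ℤ → S → Vec := fun n d => ∑ q', ∑ q,
    (diskCoef M R q' q n * inner ℂ (modeField M z q n d) (g d)) • modeField M z q' n θ with hF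
  have hI : ∀ q n, Integrable (fun d => inner ℂ (modeField M z q n d) (g d)) volume := by
    intro q n
    refine Integrable.mono' hg.norm
      ((modeField M z q n).continuous.aestronglyMeasurable.inner hg.aestronglyMeasurable)
      (Eventually.of_forall fun d => ?_)
    refine (norm_inner_le_norm _ _).trans ?_
    rw [norm_modeField_apply, one_mul]
  have hterm : ∀ q' q n, Integrable (fun d =>
      (diskCoef M R q' q n * inner ℂ (modeField M z q n d) (g d)) • modeField M z q' n θ) volume :=
    fun q' q n => ((hI q n).const_mul _).smul_const _
  have hFi : ∀ n, Integrable (F n) volume := fun n =>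
    integrable_finsetSum _ fun q' _ => integrable_finsetSum _ fun q _ => hterm q' q n
  have hint : ∀ n, ∫ d, F n d = ∑ q', ∑ q,
      (diskCoef M R q' q n * inner ℂ (modeFieldL2 M z q n) g) • modeField M z q' n θ := by
    intro n
    rw [hF, integral_finsetSum _ fun q' _ => integrable_finsetSum _ fun q _ => hterm q' q n]
    refine Finset.sum_congr rfl fun q' _ => ?_
    rw [integral_finsetSum _ fun q _ => hterm q' q n]
    refine Finset.sum_congr rfl fun q _ => ?_
    rw [integral_smul_const, integral_const_mul, inner_modeFieldL2]
  have hle : ∀ n d, ‖F n d‖ ≤ (∑ q', ∑ q, ‖diskCoef M R q' q n‖) * ‖g d‖ := by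
    intro n d
    rw [Finset.sum_mul]
    refine norm_sum_le_of_le _ fun q' _ => ?_
    rw [Finset.sum_mul]
    refine norm_sum_le_of_le _ fun q _ => ?_
    rw [norm_smul, norm_modeField_apply, mul_one, norm_mul]
    refine mul_le_mul_of_nonneg_left ((norm_inner_le_norm _ _).trans ?_) (norm_nonneg _)
    rw [norm_modeField_apply, one_mul]
  have hsum : Summable fun n => ∑ q', ∑ q, ‖diskCoef M R q' q n‖ :=
    summable_sum fun q' _ => summable_sum fun q _ => summable_norm_diskCoef M hR q' q
  have hFs : Summable fun n => ∫ d, ‖F n d‖ := by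
    refine Summable.of_nonneg_of_le (fun n => integral_nonneg fun d => norm_nonneg _) (fun n => ?_)
      (hsum.mul_right (∫ d, ‖g d‖))
    rw [← integral_const_mul]
    exact integral_mono (hFi n).norm (hg.norm.const_mul _) (hle n)
  have h := hasSum_integral_of_summable_integral_norm hFi hFs
  simp only [hint] at h
  refine (?_ : farFieldIntegral M (Metric.ball z R) g θ = _) ▸ h
  rw [farFieldIntegral, ← integral_smul]
  refine integral_congr_ae (Eventually.of_forall fun d => HasSum.tsum_eq ?_ |>.symm)
  have h0 := (hasSum_farField_ball M hR z d 1 0 θ).const_smul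
    ((Real.sqrt (M.kp / M.om) : ℂ) * dotC (g d) (dirC d))
  have h1 := (hasSum_farField_ball M hR z d 0 1 θ).const_smul
    ((Real.sqrt (M.ks / M.om) : ℂ) * dotC (g d) (perpC d))
  have h2 := (h0.add h1).const_smul (Complex.exp (-(Complex.I * Real.pi / 4)))
  refine h2.congr_fun fun n => ?_
  simp only [hF, inner_modeField, diskCoef, ← diskCoef_const]
  simp only [Fin.sum_univ_two, Matrix.cons_val_zero, Matrix.cons_val_one,
    Matrix.cons_val_fin_one, Medium.wave, frame]
  module

/-- The far-field operator of a disk as a series of operators of rank one. -/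
def diskOperator (M : Medium) (R : ℝ) (z : Plane) : L2Vec →L[ℂ] L2Vec :=
  ∑' n, ∑ q', ∑ q, diskCoef M R q' q n •
    InnerProductSpace.rankOne ℂ (modeFieldL2 M z q' n) (modeFieldL2 M z q n)

theorem hasSum_diskOperator (M : Medium) {R : ℝ} (hR : 0 < R) (z : Plane) (g : L2Vec) :
    HasSum (fun n => ∑ q', ∑ q, (diskCoef M R q' q n * inner ℂ (modeFieldL2 M z q n) g) •
      modeFieldL2 M z q' n) (diskOperator M R z g) := by
  have hs : Summable fun n => ∑ q', ∑ q, diskCoef M R q' q n •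
      InnerProductSpace.rankOne ℂ (modeFieldL2 M z q' n) (modeFieldL2 M z q n) := by
    refine summable_sum fun q' _ => summable_sum fun q _ => ?_
    refine Summable.of_norm_bounded ((summable_norm_diskCoef M hR q' q).mul_right
      (Real.sqrt (2 * Real.pi) * Real.sqrt (2 * Real.pi))) fun n => ?_
    rw [norm_smul, InnerProductSpace.norm_rankOne, norm_modeFieldL2, norm_modeFieldL2]
  have h := hs.hasSum.mapL (ContinuousLinearMap.apply ℂ L2Vec g)
  refine h.congr_fun fun n => ?_
  simp only [map_sum, map_smul, ContinuousLinearMap.apply_apply, InnerProductSpace.rankOne_apply,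
    smul_smul]

/-- The series converges uniformly on the circle, so that its sum in `(L²(𝕊))²` agrees with the
pointwise sum, which is the far-field integral. -/
theorem isFarFieldOperator_diskOperator (M : Medium) {R : ℝ} (hR : 0 < R) (z : Plane) :
    IsFarFieldOperator M (Metric.ball z R) (diskOperator M R z) := by
  intro g
  have hs : Summable fun n => ∑ q', ∑ q,
      (diskCoef M R q' q n * inner ℂ (modeFieldL2 M z q n) g) • modeField M z q' n := by
    refine summable_sum fun q' _ => summable_sum fun q _ => ?_
    refine Summable.of_norm_bounded ((summable_norm_diskCoef M hR q' q).mul_right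
      (Real.sqrt (2 * Real.pi) * ‖g‖)) fun n => ?_
    rw [norm_smul, norm_mul, mul_assoc]
    refine mul_le_mul_of_nonneg_left ?_ (norm_nonneg _)
    have h1 : ‖modeField M z q' n‖ ≤ 1 :=
      (ContinuousMap.norm_le _ zero_le_one).2 fun θ => (norm_modeField_apply M z q' n θ).le
    have h2 := norm_inner_le_norm (𝕜 := ℂ) (modeFieldL2 M z q n) g
    rw [norm_modeFieldL2] at h2
    calc _ ≤ (Real.sqrt (2 * Real.pi) * ‖g‖) * 1 :=
          mul_le_mul h2 h1 (norm_nonneg _) ((norm_nonneg _).trans h2)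
      _ = _ := mul_one _
  have h1 := hs.hasSum.mapL (ContinuousMap.toLp 2 (volume : Measure S) ℂ)
  have h2 : diskOperator M R z g = ContinuousMap.toLp 2 (volume : Measure S) ℂ
      (∑' n, ∑ q', ∑ q, (diskCoef M R q' q n * inner ℂ (modeFieldL2 M z q n) g) •
        modeField M z q' n) := by
    refine (hasSum_diskOperator M hR z g).unique (h1.congr_fun fun n => ?_)
    simp only [map_sum, map_smul, modeFieldL2]
  rw [h2]
  filter_upwards [ContinuousMap.coeFn_toLp (p := 2) (𝕜 := ℂ) (volume : Measure S)
    (∑' n, ∑ q', ∑ q, (diskCoef M R q' q n * inner ℂ (modeFieldL2 M z q n) g) •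
        modeField M z q' n)] with θ hθ
  rw [hθ]
  have h3 := ContinuousMap.hasSum_apply hs.hasSum θ
  refine h3.unique ((hasSum_farFieldIntegral_ball M hR z g θ).congr_fun fun n => ?_)
  simp only [ContinuousMap.sum_apply, ContinuousMap.smul_apply]

theorem isFarFieldOperator_farFieldOperator (M : Medium) {R : ℝ} (hR : 0 < R) (z : Plane) :
    IsFarFieldOperator M (Metric.ball z R) (farFieldOperator M (Metric.ball z R)) :=
  Classical.epsilon_spec (p := IsFarFieldOperator M (Metric.ball z R))
    ⟨_, isFarFieldOperator_diskOperator M hR z⟩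

theorem farFieldOperator_ball (M : Medium) {R : ℝ} (hR : 0 < R) (z : Plane) :
    farFieldOperator M (Metric.ball z R) = diskOperator M R z := by
  ext1 g
  exact Lp.ext ((isFarFieldOperator_farFieldOperator M hR z g).trans
    (isFarFieldOperator_diskOperator M hR z g).symm)

/-- The far-field operator of a disk in the basis of modes. -/
theorem farFieldOperator_modeFieldL2 (M : Medium) {R : ℝ} (hR : 0 < R) (z : Plane) (q : Fin 2)
    (n : ℤ) : farFieldOperator M (Metric.ball z R) (modeFieldL2 M z q n) =
      ∑ q', (2 * Real.pi * diskCoef M R q' q n) • modeFieldL2 M z q' n := by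
  rw [farFieldOperator_ball M hR]
  refine (hasSum_diskOperator M hR z _).unique ?_
  convert hasSum_ite_eq n (∑ q', (2 * Real.pi * diskCoef M R q' q n : ℂ) • modeFieldL2 M z q' n)
    using 2 with m
  simp only [inner_modeFieldL2_modeFieldL2]
  split_ifs with h
  · subst h
    refine Finset.sum_congr rfl fun q' _ => ?_
    rw [Finset.sum_eq_single q (fun p _ hp => by simp [hp]) (by simp)]
    simp [mul_comm]
  · simp [h]

/-! ### Spectral systems -/

/-- Eigenvectors with dense span and a total biorthogonal family form a spectral system: the
biorthogonal vectors are eigenvectors of the adjoint, and one of them does not annihilate a given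
eigenvector. -/
theorem isSpectralSystem_of_biorthogonal {ι E : Type*} [NormedAddCommGroup E]
    [InnerProductSpace ℂ E] {T : E →L[ℂ] E} {ev : ι → ℂ} {v w : ι → E}
    (hT : ∀ i, T (v i) = ev i • v i)
    (hv : (Submodule.span ℂ (range v)).topologicalClosure = ⊤)
    (hw : ∀ x, (∀ i, inner ℂ (w i) x = 0) → x = 0) (hne : ∀ i, inner ℂ (w i) (v i) ≠ 0)
    (horth : ∀ i j, i ≠ j → inner ℂ (w i) (v j) = 0) : IsSpectralSystem T ev v where
  eigenvector i := by
    refine ⟨Module.End.mem_eigenspace_iff.2 (hT i), fun h => hne i ?_⟩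
    rw [h, inner_zero_right]
  independent := by
    refine linearIndependent_iff'.2 fun s g hg i hi => ?_
    have h := congrArg (fun x => inner ℂ (w i) x) hg
    simp only [inner_sum, inner_smul_right, inner_zero_right] at h
    rw [Finset.sum_eq_single i (fun j _ hj => by rw [horth i j hj.symm, mul_zero])
      (fun hi' => absurd hi hi')] at h
    exact (mul_eq_zero.1 h).resolve_right (hne i)
  dense_span := hv
  eigenvalue c hc := by
    obtain ⟨x, hx, hx0⟩ := hc.exists_hasEigenvector
    have hTx : T x = c • x := Module.End.mem_eigenspace_iff.1 hx
    -- `⟨w i, T x⟩ = ev i ⟨w i, x⟩` holds on the vectors `v j`, hence everywhere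
    have hadj : ∀ i, (innerSL ℂ (w i)) ∘L T = ev i • innerSL ℂ (w i) := by
      intro i
      refine ContinuousLinearMap.ext_on
        (Submodule.dense_iff_topologicalClosure_eq_top.2 hv) ?_
      rintro _ ⟨j, rfl⟩
      simp only [ContinuousLinearMap.comp_apply, innerSL_apply_apply, hT, inner_smul_right,
        smul_apply, smul_eq_mul]
      by_cases hij : i = j
      · rw [hij]
      · rw [horth i j hij, mul_zero, mul_zero]
    have hex : ∃ i, inner ℂ (w i) x ≠ 0 := by
      by_contra! h
      exact hx0 (hw x h)
    obtain ⟨i, hi⟩ := hex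
    refine ⟨i, ?_⟩
    have h := congrArg (fun f : E →L[ℂ] ℂ => f x) (hadj i)
    simp only [ContinuousLinearMap.comp_apply, innerSL_apply_apply, hTx, inner_smul_right,
      smul_apply, smul_eq_mul] at h
    exact (mul_right_cancel₀ hi h).symm

theorem topologicalClosure_eq_top_of_total {ι E : Type*} [NormedAddCommGroup E]
    [InnerProductSpace ℂ E] [CompleteSpace E] {v : ι → E} {K : Submodule ℂ E} (hK : ∀ i, v i ∈ K)
    (h : ∀ x, (∀ i, inner ℂ (v i) x = 0) → x = 0) : K.topologicalClosure = ⊤ := by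
  rw [Submodule.topologicalClosure_eq_top_iff, Submodule.eq_bot_iff]
  exact fun x hx => h x fun i => (Submodule.mem_orthogonal _ _).1 hx _ (hK i)

/-- In the modes of order `n`, the far-field operator is `i √(8π/ω)` times `D Σ_n D⁻¹` with `D =
diag(√k_p, √k_s)`. -/
theorem two_pi_mul_diskCoef (M : Medium) (R : ℝ) (q' q : Fin 2) (n : ℤ) :
    2 * Real.pi * diskCoef M R q' q n = (Real.sqrt (8 * Real.pi / M.om) : ℂ) * Complex.I *
      ((Real.sqrt (M.wave q') : ℂ) / (Real.sqrt (M.wave q) : ℂ)) *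
        sigmaMatrix n (M.kp * R) (M.ks * R) q' q := by
  have hpi : (Real.pi : ℂ) ≠ 0 := by exact_mod_cast Real.pi_ne_zero
  rw [diskCoef]
  field_simp

theorem sqrt_wave_ne_zero (M : Medium) (q : Fin 2) : (Real.sqrt (M.wave q) : ℂ) ≠ 0 := by
  exact_mod_cast (Real.sqrt_pos.2 (M.wave_pos q)).ne'

/-- In the modes of order `n`, the eigenfunctions are `D v` with `D = diag(√k_p, √k_s)` and `v` an
eigenvector of `Σ_n`. -/
theorem diskEigenfunctionL2_eq (M : Medium) (R : ℝ) (z : Plane) (n : ℤ) (j : Fin 2) :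
    diskEigenfunctionL2 M R z n j = ∑ q, ((Real.sqrt (M.wave q) : ℂ) *
      eigVec n j (M.kp * R) (M.ks * R) q) • modeFieldL2 M z q n := by
  have h : (⟨diskEigenfunction M R z n j, continuous_diskEigenfunction M R z n j⟩ : C(S, Vec)) =
      ∑ q, ((Real.sqrt (M.wave q) : ℂ) * eigVec n j (M.kp * R) (M.ks * R) q) •
        modeField M z q n := by
    ext1 θ
    rw [ContinuousMap.coe_mk, ContinuousMap.sum_apply, Fin.sum_univ_two, ContinuousMap.smul_apply,
      ContinuousMap.smul_apply, modeField_apply, modeField_apply]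
    simp only [diskEigenfunction, Medium.wave, frame, Matrix.cons_val_zero, Matrix.cons_val_one,
      Matrix.cons_val_fin_one]
    module
  rw [diskEigenfunctionL2, h, map_sum]
  simp only [map_smul, modeFieldL2]

theorem farFieldOperator_diskEigenfunctionL2 (M : Medium) {R : ℝ} (hR : 0 < R) (z : Plane) (n : ℤ)
    (j : Fin 2) :
    farFieldOperator M (Metric.ball z R) (diskEigenfunctionL2 M R z n j) =
      diskEigenvalue M R n j • diskEigenfunctionL2 M R z n j := by
  have h := sigmaMatrix_mulVec_eigVec n j (mul_pos M.kp_pos hR) (mul_pos M.ks_pos hR)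
  have hq : ∀ q', sigmaMatrix n (M.kp * R) (M.ks * R) q' 0 * eigVec n j (M.kp * R) (M.ks * R) 0 +
      sigmaMatrix n (M.kp * R) (M.ks * R) q' 1 * eigVec n j (M.kp * R) (M.ks * R) 1 =
      lamN n j (M.kp * R) (M.ks * R) * eigVec n j (M.kp * R) (M.ks * R) q' := fun q' => by
    have := congrFun h q'
    rwa [Matrix.mulVec, dotProduct, Fin.sum_univ_two] at this
  have s0 := sqrt_wave_ne_zero M 0
  have s1 := sqrt_wave_ne_zero M 1
  rw [diskEigenfunctionL2_eq, map_sum, Finset.smul_sum]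
  simp only [map_smul, farFieldOperator_modeFieldL2 M hR, two_pi_mul_diskCoef, Finset.smul_sum]
  rw [Finset.sum_comm]
  refine Finset.sum_congr rfl fun q' _ => ?_
  rw [Fin.sum_univ_two, smul_smul, smul_smul, smul_smul, ← add_smul, diskEigenvalue]
  congr 1
  have e := hq q'
  generalize M.kp * R = a at e ⊢
  generalize M.ks * R = b at e ⊢
  field_simp
  linear_combination (Real.sqrt (8 * Real.pi / M.om) * Real.sqrt (M.wave q') : ℂ) * e

/-- The family biorthogonal, up to factors, to the eigenfunctions of the disk. -/
def diskDual (M : Medium) (R : ℝ) (z : Plane) (n : ℤ) (j : Fin 2) : L2Vec :=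
  ![(starRingEnd ℂ) ((Real.sqrt (M.wave 1) : ℂ) * eigVec n 1 (M.kp * R) (M.ks * R) 1) •
      modeFieldL2 M z 0 n -
    (starRingEnd ℂ) ((Real.sqrt (M.wave 0) : ℂ) * eigVec n 1 (M.kp * R) (M.ks * R) 0) •
      modeFieldL2 M z 1 n,
    (starRingEnd ℂ) ((Real.sqrt (M.wave 0) : ℂ) * eigVec n 0 (M.kp * R) (M.ks * R) 0) •
      modeFieldL2 M z 1 n -
    (starRingEnd ℂ) ((Real.sqrt (M.wave 1) : ℂ) * eigVec n 0 (M.kp * R) (M.ks * R) 1) •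
      modeFieldL2 M z 0 n] j

theorem wave_det_ne_zero (M : Medium) {R : ℝ} (hR : 0 < R) (n : ℤ) :
    (Real.sqrt (M.wave 0) : ℂ) * eigVec n 0 (M.kp * R) (M.ks * R) 0 *
        ((Real.sqrt (M.wave 1) : ℂ) * eigVec n 1 (M.kp * R) (M.ks * R) 1) -
      (Real.sqrt (M.wave 0) : ℂ) * eigVec n 1 (M.kp * R) (M.ks * R) 0 *
        ((Real.sqrt (M.wave 1) : ℂ) * eigVec n 0 (M.kp * R) (M.ks * R) 1) ≠ 0 := by
  have h := mul_ne_zero (mul_ne_zero (sqrt_wave_ne_zero M 0) (sqrt_wave_ne_zero M 1))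
    (eigVec_det_ne_zero n (mul_pos M.kp_pos hR) (mul_pos M.ks_pos hR))
  convert h using 1
  ring

/-- For each `n` the two eigenfunctions span the same plane as the two modes of order `n`, so they
inherit completeness, and `diskDual` is, up to factors, the dual basis of that plane. -/
theorem isSpectralSystem_farFieldOperator (M : Medium) {R : ℝ} (hR : 0 < R) (z : Plane) :
    IsSpectralSystem (farFieldOperator M (Metric.ball z R))
      (fun q : ℤ × Fin 2 => diskEigenvalue M R q.1 q.2)
      (fun q : ℤ × Fin 2 => diskEigenfunctionL2 M R z q.1 q.2) := by
  have hpi : (2 * Real.pi : ℂ) ≠ 0 := by exact_mod_cast Real.two_pi_pos.ne'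
  refine isSpectralSystem_of_biorthogonal (w := fun q : ℤ × Fin 2 => diskDual M R z q.1 q.2)
    (fun q => farFieldOperator_diskEigenfunctionL2 M hR z q.1 q.2) ?_ ?_ ?_ ?_
  · refine topologicalClosure_eq_top_of_total
      (v := fun q : Fin 2 × ℤ => modeFieldL2 M z q.1 q.2) ?_
      fun x hx => eq_zero_of_inner_modeFieldL2 M z fun q n => hx (q, n)
    rintro ⟨q, n⟩
    have hmem : ∀ j, diskEigenfunctionL2 M R z n j ∈ Submodule.span ℂ
        (range fun q : ℤ × Fin 2 => diskEigenfunctionL2 M R z q.1 q.2) := fun j =>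
      Submodule.subset_span ⟨(n, j), rfl⟩
    refine ((Submodule.smul_mem_iff _ (wave_det_ne_zero M hR n)).1 ?_)
    fin_cases q
    · convert Submodule.sub_mem _
        (Submodule.smul_mem _ ((Real.sqrt (M.wave 1) : ℂ) * eigVec n 1 (M.kp * R) (M.ks * R) 1)
          (hmem 0))
        (Submodule.smul_mem _ ((Real.sqrt (M.wave 1) : ℂ) * eigVec n 0 (M.kp * R) (M.ks * R) 1)
          (hmem 1)) using 1
      rw [diskEigenfunctionL2_eq, diskEigenfunctionL2_eq, Fin.sum_univ_two, Fin.sum_univ_two]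
      simp only [Fin.zero_eta]
      module
    · convert Submodule.sub_mem _
        (Submodule.smul_mem _ ((Real.sqrt (M.wave 0) : ℂ) * eigVec n 0 (M.kp * R) (M.ks * R) 0)
          (hmem 1))
        (Submodule.smul_mem _ ((Real.sqrt (M.wave 0) : ℂ) * eigVec n 1 (M.kp * R) (M.ks * R) 0)
          (hmem 0)) using 1
      rw [diskEigenfunctionL2_eq, diskEigenfunctionL2_eq, Fin.sum_univ_two, Fin.sum_univ_two]
      simp only [Fin.mk_one]
      module
  · intro x hx
    have key : ∀ n, inner ℂ (modeFieldL2 M z 0 n) x = 0 ∧ inner ℂ (modeFieldL2 M z 1 n) x = 0 := by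
      intro n
      have h0 := hx (n, 0)
      have h1 := hx (n, 1)
      simp only [diskDual, Matrix.cons_val_zero, Matrix.cons_val_one, Matrix.cons_val_fin_one,
        inner_sub_left, inner_smul_left, Complex.conj_conj] at h0 h1
      have hd := wave_det_ne_zero M hR n
      constructor
      · refine (mul_eq_zero.1 ?_).resolve_left hd
        linear_combination (Real.sqrt (M.wave 0) : ℂ) * eigVec n 0 (M.kp * R) (M.ks * R) 0 * h0 +
          (Real.sqrt (M.wave 0) : ℂ) * eigVec n 1 (M.kp * R) (M.ks * R) 0 * h1
      · refine (mul_eq_zero.1 ?_).resolve_left hd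
        linear_combination (Real.sqrt (M.wave 1) : ℂ) * eigVec n 0 (M.kp * R) (M.ks * R) 1 * h0 +
          (Real.sqrt (M.wave 1) : ℂ) * eigVec n 1 (M.kp * R) (M.ks * R) 1 * h1
    refine eq_zero_of_inner_modeFieldL2 M z fun q n => ?_
    fin_cases q
    · exact (key n).1
    · exact (key n).2
  · rintro ⟨n, j⟩
    have hd := mul_ne_zero hpi (wave_det_ne_zero M hR n)
    simp only [diskEigenfunctionL2_eq, Fin.sum_univ_two]
    fin_cases j <;>
    simp only [Fin.zero_eta, Fin.mk_one, diskDual, Matrix.cons_val_zero, Matrix.cons_val_one,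
      Matrix.cons_val_fin_one, inner_sub_left, inner_smul_left, inner_add_right, inner_smul_right,
      inner_modeFieldL2_modeFieldL2, Complex.conj_conj, zero_ne_one, one_ne_zero, true_and,
      false_and, if_true, if_false] <;>
    · convert hd using 1
      ring
  · rintro ⟨n, j⟩ ⟨m, l⟩ hne
    simp only [diskEigenfunctionL2_eq, Fin.sum_univ_two]
    by_cases hnm : n = m
    · subst hnm
      have hjl : j ≠ l := fun h => hne (by rw [h])
      fin_cases j <;> fin_cases l <;>
      simp only [Fin.zero_eta, Fin.mk_one, diskDual, Matrix.cons_val_zero, Matrix.cons_val_one,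
        Matrix.cons_val_fin_one, inner_sub_left, inner_smul_left, inner_add_right,
        inner_smul_right, inner_modeFieldL2_modeFieldL2, Complex.conj_conj, zero_ne_one,
        one_ne_zero, true_and, false_and, if_true, if_false]
      · exact absurd rfl hjl
      · ring
      · ring
      · exact absurd rfl hjl
    · fin_cases j <;>
      simp [diskDual, inner_modeFieldL2_modeFieldL2, hnm]

/-- The spectral systems of the P-part (`q = 0`) and the S-part (`q = 1`). -/
theorem isSpectralSystem_part (M : Medium) {R : ℝ} (hR : 0 < R) (z : Plane) (q : Fin 2) :
    IsSpectralSystem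
      (proj q ∘L farFieldOperator M (Metric.ball z R) ∘L ContinuousLinearMap.adjoint (proj q))
      (fun n : ℤ => (Real.sqrt (8 * Real.pi / M.om) : ℂ) * Complex.I *
        sigmaMatrix n (M.kp * R) (M.ks * R) q q)
      (fun n : ℤ => scalarEigenfunctionL2 (M.wave q) z n) := by
  have hpi : (2 * Real.pi : ℂ) ≠ 0 := by exact_mod_cast Real.two_pi_pos.ne'
  have hw : ∀ f : L2Scal, (∀ n, inner ℂ (scalarEigenfunctionL2 (M.wave q) z n) f = 0) → f = 0 :=
    fun f => eq_zero_of_inner_scalarEigenfunctionL2 _ z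
  refine isSpectralSystem_of_biorthogonal (w := fun n => scalarEigenfunctionL2 (M.wave q) z n)
    (fun n => ?_) (topologicalClosure_eq_top_of_total
      (fun n => Submodule.subset_span ⟨n, rfl⟩) hw) hw (fun n => ?_) fun n m hnm => ?_
  · have hs := sqrt_wave_ne_zero M q
    rw [ContinuousLinearMap.comp_apply, ContinuousLinearMap.comp_apply,
      adjoint_proj_scalarEigenfunctionL2, farFieldOperator_modeFieldL2 M hR, map_sum]
    simp only [map_smul, proj_modeFieldL2]
    rw [Finset.sum_eq_single q (fun q' _ h => by rw [if_neg h.symm, smul_zero]) (by simp),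
      if_pos rfl, two_pi_mul_diskCoef, div_self hs, mul_one]
  · rw [inner_scalarEigenfunctionL2, if_pos rfl]
    exact hpi
  · rw [inner_scalarEigenfunctionL2, if_neg hnm]

/-- The eigenvalues do not depend on the centre of the disk. -/
theorem hasEigenvalue_farFieldOperator_iff (M : Medium) {R : ℝ} (hR : 0 < R) (z : Plane) (c : ℂ) :
    Module.End.HasEigenvalue (farFieldOperator M (Metric.ball z R) : L2Vec →ₗ[ℂ] L2Vec) c ↔
      ∃ q : ℤ × Fin 2, diskEigenvalue M R q.1 q.2 = c := by
  refine ⟨(isSpectralSystem_farFieldOperator M hR z).eigenvalue c, ?_⟩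
  rintro ⟨q, rfl⟩
  exact Module.End.hasEigenvalue_of_hasEigenvector
    ((isSpectralSystem_farFieldOperator M hR z).eigenvector q)

end

end ElasticDisk

theorem mainTheorem11 (M : ElasticDisk.Medium) (R : ℝ) (hR : 0 < R) (z : ElasticDisk.Plane) :
    -- the far-field patterns and the far-field operator of the disk are well defined
    (∀ (d : ElasticDisk.S) (cp cs : ℂ),
      ∃! a, ElasticDisk.IsFarFieldPattern M (Metric.ball z R) d cp cs a) ∧
    ElasticDisk.IsFarFieldOperator M (Metric.ball z R)
      (ElasticDisk.farFieldOperator M (Metric.ball z R)) ∧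
    -- the disks centred at `z` and at the origin have the same eigenvalues
    (∀ c : ℂ,
      Module.End.HasEigenvalue
          (ElasticDisk.farFieldOperator M (Metric.ball z R) :
            ElasticDisk.L2Vec →ₗ[ℂ] ElasticDisk.L2Vec) c ↔
        Module.End.HasEigenvalue
          (ElasticDisk.farFieldOperator M (Metric.ball 0 R) :
            ElasticDisk.L2Vec →ₗ[ℂ] ElasticDisk.L2Vec) c) ∧
    -- the spectral system of the far-field operator
    ElasticDisk.IsSpectralSystem (ElasticDisk.farFieldOperator M (Metric.ball z R))
      (fun q : ℤ × Fin 2 => ElasticDisk.diskEigenvalue M R q.1 q.2)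
      (fun q : ℤ × Fin 2 => ElasticDisk.diskEigenfunctionL2 M R z q.1 q.2) ∧
    -- the spectral systems of its P-part and its S-part
    (∀ n : ℤ, IsUnit (ElasticDisk.cylMatrix ElasticDisk.hankel n (M.kp * R) (M.ks * R)).det) ∧
    ElasticDisk.IsSpectralSystem (ElasticDisk.farFieldOperatorP M (Metric.ball z R))
      (fun n : ℤ => (Real.sqrt (8 * Real.pi / M.om) : ℂ) * Complex.I *
        ElasticDisk.sigmaMatrix n (M.kp * R) (M.ks * R) 0 0)
      (fun n : ℤ => ElasticDisk.scalarEigenfunctionL2 M.kp z n) ∧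
    ElasticDisk.IsSpectralSystem (ElasticDisk.farFieldOperatorS M (Metric.ball z R))
      (fun n : ℤ => (Real.sqrt (8 * Real.pi / M.om) : ℂ) * Complex.I *
        ElasticDisk.sigmaMatrix n (M.kp * R) (M.ks * R) 1 1)
      (fun n : ℤ => ElasticDisk.scalarEigenfunctionL2 M.ks z n) := by
  refine ⟨fun d cp cs => ⟨_, ElasticDisk.isFarFieldPattern_diskPattern M hR z d cp cs,
      fun a ha => ha.unique hR (ElasticDisk.isFarFieldPattern_diskPattern M hR z d cp cs)⟩,
    ElasticDisk.isFarFieldOperator_farFieldOperator M hR z, fun c => ?_,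
    ElasticDisk.isSpectralSystem_farFieldOperator M hR z,
    fun n => ElasticDisk.isUnit_det_cylMatrix_hankel n (mul_pos M.kp_pos hR) (mul_pos M.ks_pos hR),
    ElasticDisk.isSpectralSystem_part M hR z 0, ElasticDisk.isSpectralSystem_part M hR z 1⟩
  rw [ElasticDisk.hasEigenvalue_farFieldOperator_iff M hR,
    ElasticDisk.hasEigenvalue_farFieldOperator_iff M hR]
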